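/- **Notation.** Logarithms are binary, $H(p)=-p\log p-(1-p)\log(1-p)$ (with $0\log 0=0$; a quotient $0/0$ is read as $0$), $[K]=\{1,\dots,K\}$, and $J_w(n)$ is the set of vectors in $\{0,1\}^n$ with exactly $\lfloor wn\rfloor$ ones; $x\le s$ is meant coordinatewise. For $0\le w_x\le w_s\le 1$, an $(n,t,K_W,K_a,w_s,w_x)$ *constant-weight concatenated WOM code* is a surjection $D_W:J_{w_x}(n)^t\times[K_a]\to[K_W]$ such that for all $m\in[K_W]$ and $s\in J_{w_s}(n)^t$ there is $(x,m_a)\in D_W^{-1}(m)$ with $x\le s$. (The $t$ blocks, the indices and the messages may be labelled by any sets of the right size.) Its rate is $R_W=\frac1{nt}\log (K_W/K_a)$, and $C_W=w_sH(w_x/w_s)$. Running times are numbers of steps of a random access machine that acts on natural numbers by addition, cut-off subtraction, halving, indirect load and store, conditionals and loops, each at unit cost. Every program below is a single program for all parameters; it is given the integer parameters of the code as part of its input. **Hash construction.** Let $0<\epsilon\le\frac12$, $0<\delta\le\frac12$, $c>20$, $0\le w_x\le w_s\le1$, and put $$n=\Big\lceil\tfrac c\epsilon\log\tfrac1\epsilon\Big\rceil,\quad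 k=\max\{0,\lfloor n(C_W-\tfrac{2\epsilon}3)\rfloor\},\quad t_1=\lfloor(1/\epsilon)^{c/12}-1\rfloor,\quad t_2=\lceil2^{4n/\delta}\rceil,\quad t=t_1t_2,\quad N=nt.$$ Represent $\mathbb F_{2^n}$ as $\mathbb F_2[X]/(f)$, where $f$ is the irreducible polynomial of degree $n$ whose coefficients, read as a binary number, are least, and elements are given by their $n$ coefficients. For $a,b\in\mathbb F_{2^n}$ let $H_{a,b}(x)\in\{0,1\}^k$ consist of the first $k$ bits of $ax+b$. Messages are matrices $m=(m_{i,j})$ with $m_{i,j}\in\{0,1\}^k$, $(i,j)\in[t_1]\times[t_2]$, so $K_W=2^{kt}$; indices are tuples $((a_j,b_j))_{j\in[t_2]}$ of pairs in $\mathbb F_{2^n}^2$, so $K_a=2^{2nt_2}$. The decoder $D_W$ maps $(x,(a_j,b_j)_j)$ to $m_{i,j}=H_{a_j,b_j}(x_{i,j})$. The encoder receives $m$ and a state $s\in J_{w_s}(n)^{t_1\times t_2}$ and finds pairs $(a_j,b_j)$ and vectors $x_{i,j}\in J_{w_x}(n)$ with $x_{i,j}\le s_{i,j}$ and $H_{a_j,b_j}(x_{i,j})=m_{i,j}$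 for all $i,j$. **Rank-modulation construction.** A permutation $\pi$ of a multiset on a set of cells assigns to each cell $j$ a rank $\pi^{-1}(j)$; $\mathfrak S_{q,z}$ is the set of those in which each of the ranks $1,\dots,q$ occurs $z$ times. The cost is $\alpha(\sigma\to\pi)=\max_j(\sigma^{-1}(j)-\pi^{-1}(j))$. For $\mathcal C\subseteq\mathfrak S_{q,z}$, a surjection $D_R:\mathcal C\to[K_R]$ is a $(q,z,K_R,r)$ *RM rewriting code* if for all $m\in[K_R]$, $\sigma\in\mathcal C$ there is $\pi\in D_R^{-1}(m)$ with $\alpha(\sigma\to\pi)\le r$; its rate is $R_R=\frac1{qz}\log K_R$, and $C_R=(r+1)H(\frac1{r+1})$. Let $1\le r<q$, let $D_W$ be the hash code with $w_s=\frac{r+1}q$, $w_x=\frac1q$, and parameters $\epsilon,\delta,c$ such that $q\mid n$; put $z_W=n/q$. Let $a$ be the least integer such that $|\mathfrak S_{r+1,a}|\ge K_a$, let $z=tz_W+(q-r-1)a$, let $K_M$ be the number of permutations of the multiset $\{(q-r)^{z_W},\dots,q^{z_W}\}$, and let $K_R=K_M^{\,t}K_W^{\,q-r-1}$. The codebook $\mathcal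 C$ consists of the concatenations $(\pi_{a,1},\dots,\pi_{a,q-r-1},\pi_b,\pi_{x,1},\dots,\pi_{x,t})$ with $\pi_{a,i}\in\mathfrak S_{r+1,a}$, $\pi_{x,l}\in\mathfrak S_{q,z_W}$ and $\pi_b$ a permutation of $\{(r+2)^{(q-r-1)a},\dots,q^{(q-r-1)a}\}$. The decoder $D_R$ outputs, for $i=1,\dots,q-r-1$, the value of $D_W$ at the characteristic vectors of rank $i$ in $\pi_{x,1},\dots,\pi_{x,t}$ and at the index whose bits are the $2nt_2$ lowest binary digits of the lexicographic index (counted from $0$) of $\pi_{a,i}$ in $\mathfrak S_{r+1,a}$; and for each $l\in[t]$ the lexicographic index, among the permutations of $\{(q-r)^{z_W},\dots,q^{z_W}\}$, of the arrangement of the ranks $q-r,\dots,q$ in $\pi_{x,l}$. The encoder $E_R$ receives a message and a state $\sigma\in\mathcal C$. For $i=1,\dots,q-r-1$ it applies the WOM encoder to the $i$-th message part and to the state which marks the cells of the blocks $x,1,\dots,x,t$ that have rank at most $i+r$ in $\sigma$ and have not been assigned one of the ranks $1,\dots,i-1$ of $\pi$; it gives rank $i$ to the cells so selected and stores the index in $\pi_{a,i}$.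 It stores the remaining message parts in the ranks $q-r,\dots,q$ of the blocks and sets $\pi_b=\sigma_b$. **Theorem.** 1. For all parameters as above, $D_W$ is an $(n,t,K_W,K_a,w_s,w_x)$ constant-weight concatenated WOM code. 2. The family is capacity achieving: if $\epsilon\le\frac1{20}$, then $C_W-\epsilon<R_W\le\frac1N\log K_W\le C_W$; and for fixed $\delta,c,w_s,w_x$, $R_W\to C_W$ as $\epsilon\to0$. 3. The family is efficient: a program carries out the encoding, for all parameters, messages and states, in time less than $N^{1+\delta}$, and a program computes $D_W$ in time at most $N^{1+A\delta\epsilon}$, where $A$ is an absolute constant. 4. For all parameters as above, $D_R$ is a $(q,z,K_R,r)$ RM rewriting code. There are an absolute constant $B$, a program that carries out the encoding $E_R$ (its output $\pi\in\mathcal C$ satisfies $D_R(\pi)=m$ and $\alpha(\sigma\to\pi)\le r$) and a program that computes $D_R$, both in time at most $(qz)^B$. For every $r\ge1$ and $\eta>0$ there is $Q$ such that for every $q\ge Q$ there is $\epsilon_0>0$ such that $C_R-\eta<R_R\le C_R$ for all members of the family with these $q,r$ and with $\epsilon<\epsilon_0$. In particular, for every $r\ge1$ and every $\delta\in(0,\frac12]$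 there is an infinite sequence of members with cost $r$ and this $\delta$ whose rates tend to $C_R$. So these codes contain an explicit efficient capacity-achieving family of RM rewriting codes. -/

import Mathlib

open Filter Topology

/-! ## A random access machine with a step count

A structured random access machine with the elementary operations addition, cut-off subtraction and
halving on natural numbers, indirect loads and stores, a conditional and a loop. Every operation and
every test costs one step. There is no multiplication, so that registers grow by at most one bit in
each step; polynomial time on this machine is polynomial time on a Turing machine. -/

namespace RAM

/-- Programs. The natural numbers `d a b` are names of registers. -/
inductive Prog : Type
  | const (d v : ℕ) : Prog
  | add (d a b : ℕ) : Prog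
  | sub (d a b : ℕ) : Prog
  | half (d a : ℕ) : Prog
  | load (d a : ℕ) : Prog
  | store (a b : ℕ) : Prog
  | seq (p q : Prog) : Prog
  | ifNZ (a : ℕ) (p q : Prog) : Prog
  | whileNZ (a : ℕ) (p : Prog) : Prog

/-- A machine state: the contents of the registers and of the memory. -/
structure State where
  reg : ℕ → ℕ
  mem : ℕ → ℕ

/-- Write `v` into register `d`. -/
def State.setReg (σ : State) (d v : ℕ) : State := ⟨Function.update σ.reg d v, σ.mem⟩

/-- Write `v` into the memory cell with address `d`. -/
def State.setMem (σ : State) (d v : ℕ) : State := ⟨σ.reg, Function.update σ.mem d v⟩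

/-- `Exec p σ τ T`: started in state `σ`, the program `p` halts in state `τ` after exactly `T`
steps. -/
inductive Exec : Prog → State → State → ℕ → Prop
  | const (σ : State) (d v : ℕ) : Exec (.const d v) σ (σ.setReg d v) 1
  | add (σ : State) (d a b : ℕ) : Exec (.add d a b) σ (σ.setReg d (σ.reg a + σ.reg b)) 1
  | sub (σ : State) (d a b : ℕ) : Exec (.sub d a b) σ (σ.setReg d (σ.reg a - σ.reg b)) 1
  | half (σ : State) (d a : ℕ) : Exec (.half d a) σ (σ.setReg d (σ.reg a / 2)) 1
  | load (σ : State) (d a : ℕ) : Exec (.load d a) σ (σ.setReg d (σ.mem (σ.reg a))) 1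
  | store (σ : State) (a b : ℕ) : Exec (.store a b) σ (σ.setMem (σ.reg a) (σ.reg b)) 1
  | seq {p q : Prog} {σ τ ρ : State} {S T : ℕ} :
      Exec p σ τ S → Exec q τ ρ T → Exec (.seq p q) σ ρ (S + T)
  | ifTrue {a : ℕ} {p q : Prog} {σ τ : State} {T : ℕ} :
      σ.reg a ≠ 0 → Exec p σ τ T → Exec (.ifNZ a p q) σ τ (T + 1)
  | ifFalse {a : ℕ} {p q : Prog} {σ τ : State} {T : ℕ} :
      σ.reg a = 0 → Exec q σ τ T → Exec (.ifNZ a p q) σ τ (T + 1)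
  | whileEnd {a : ℕ} {p : Prog} {σ : State} :
      σ.reg a = 0 → Exec (.whileNZ a p) σ σ 1
  | whileStep {a : ℕ} {p : Prog} {σ τ ρ : State} {S T : ℕ} :
      σ.reg a ≠ 0 → Exec p σ τ S → Exec (.whileNZ a p) τ ρ T →
      Exec (.whileNZ a p) σ ρ (S + T + 1)

/-- The initial state: the input in the memory cells `0, 1, 2, …`, and `0` everywhere else. -/
def initState (inp : List ℕ) : State := ⟨fun _ => 0, fun i => inp.getD i 0⟩

/-- On input `inp` the program `P` halts after exactly `T` steps, with the list `out` in the memory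
cells `0, …, out.length - 1`. -/
def Computes (P : Prog) (inp out : List ℕ) (T : ℕ) : Prop :=
  ∃ τ : State, Exec P (initState inp) τ T ∧
    ∀ i, i < out.length → τ.mem i = out.getD i 0

end RAM

namespace RankMod

/-! ## Constant-weight concatenated WOM codes -/

/-- The Hamming weight of a binary vector. -/
def weight {n : ℕ} (x : Fin n → Bool) : ℕ := (Finset.univ.filter fun i => x i = true).card

/-- `J w n`: the binary vectors of length `n` and weight `⌊w n⌋`. The order `x ≤ s` on binary vectors
is the coordinatewise one. -/
def J (w : ℝ) (n : ℕ) : Set (Fin n → Bool) := {x | weight x = ⌊w * n⌋₊}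

/-- The binary entropy function, in bits. -/
noncomputable def entropy (p : ℝ) : ℝ := Real.binEntropy p / Real.log 2

/-- The capacity `w_s H(w_x / w_s)`. -/
noncomputable def womCapacity (ws wx : ℝ) : ℝ := ws * entropy (wx / ws)

/-- `D` is an `(n, t, K_W, K_a, w_s, w_x)` constant-weight concatenated WOM code. The `t` blocks are
labelled by `ι`, the `K_a` indices by `A` and the `K_W` messages by `M`. -/
structure IsConcatWOMCode {ι A M : Type} (n t KW Ka : ℕ) (ws wx : ℝ)
    (D : (ι → J wx n) × A → M) : Prop where
  n_pos : 0 < n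
  t_pos : 0 < t
  KW_pos : 0 < KW
  Ka_pos : 0 < Ka
  ws_mem : ws ∈ Set.Icc (0 : ℝ) 1
  wx_mem : wx ∈ Set.Icc (0 : ℝ) ws
  card_blocks : Nat.card ι = t
  card_index : Nat.card A = Ka
  card_message : Nat.card M = KW
  surjective : Function.Surjective D
  writable : ∀ (m : M) (s : ι → J ws n), ∃ (x : ι → J wx n) (a : A),
    D (x, a) = m ∧ ∀ i, (x i : Fin n → Bool) ≤ (s i : Fin n → Bool)

/-- The rate `(1 / (n t)) log₂ (K_W / K_a)`. -/
noncomputable def concatRate (n t KW Ka : ℕ) : ℝ :=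
  Real.logb 2 ((KW : ℝ) / (Ka : ℝ)) / ((n : ℝ) * (t : ℝ))

/-! ## The hash functions

`𝔽_{2^n}` is represented as `𝔽₂[X] / (f)`, where `f` is the irreducible polynomial of degree `n` whose
coefficient vector, read as a binary number, is the least possible; an element is the vector of the
`n` coefficients of its representative of degree less than `n`. -/

/-- The polynomial over `𝔽₂` whose `i`-th coefficient is the `i`-th binary digit of `m`. -/
noncomputable def natPoly (m : ℕ) : Polynomial (ZMod 2) :=
  ∑ i ∈ Finset.range m.size, if m.testBit i = true then Polynomial.X ^ i else 0

/-- The polynomial over `𝔽₂` whose vector of coefficients is `x`. -/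
noncomputable def bitPoly {n : ℕ} (x : Fin n → Bool) : Polynomial (ZMod 2) :=
  ∑ i : Fin n, if x i = true then Polynomial.X ^ (i : ℕ) else 0

/-- The least irreducible polynomial of degree `n` over `𝔽₂`. -/
noncomputable def modulus (n : ℕ) : Polynomial (ZMod 2) :=
  natPoly (sInf {m : ℕ | Irreducible (natPoly m) ∧ (natPoly m).natDegree = n})

/-- The names `(a, b)` of the `2 ^ (2 n)` hash functions. -/
abbrev Key (n : ℕ) : Type := (Fin n → Bool) × (Fin n → Bool)

/-- The hash function `x ↦ (a x + b)_[k]`: the first `k` bits of the element `a x + b` of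
`𝔽_{2^n}`. -/
noncomputable def hashFn (n k : ℕ) (key : Key n) (x : Fin n → Bool) : Fin k → Bool :=
  fun i => decide
    (((bitPoly key.1 * bitPoly x + bitPoly key.2) %ₘ modulus n).coeff (i : ℕ) = 1)

/-- The decoder: the message part `(i, j)` is the hash, with the `j`-th key, of block `(i, j)`. -/
noncomputable def hashDecode {n k t₁ t₂ : ℕ} (x : Fin t₁ × Fin t₂ → Fin n → Bool)
    (key : Fin t₂ → Key n) : Fin t₁ × Fin t₂ → Fin k → Bool :=
  fun b => hashFn n k (key b.2) (x b)

/-- What the brute force search of the encoder finds for the message `m` and the state `s`. -/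
def IsHashEncoding {n k t₁ t₂ : ℕ} (wx : ℝ) (m : Fin t₁ × Fin t₂ → Fin k → Bool)
    (s x : Fin t₁ × Fin t₂ → Fin n → Bool) (key : Fin t₂ → Key n) : Prop :=
  ∀ (j : Fin t₂) (i : Fin t₁),
    x (i, j) ≤ s (i, j) ∧ x (i, j) ∈ J wx n ∧ hashFn n k (key j) (x (i, j)) = m (i, j)

/-! ## The hash construction -/

/-- The parameters `ε, δ, c, w_s, w_x` of the hash construction. -/
structure HashParams where
  eps : ℝ
  del : ℝ
  c : ℝ
  ws : ℝ
  wx : ℝ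

namespace HashParams

/-- The range of the parameters. -/
structure Valid (p : HashParams) : Prop where
  eps_pos : 0 < p.eps
  eps_le : p.eps ≤ 1 / 2
  del_pos : 0 < p.del
  del_le : p.del ≤ 1 / 2
  c_gt : 20 < p.c
  ws_mem : p.ws ∈ Set.Icc (0 : ℝ) 1
  wx_mem : p.wx ∈ Set.Icc (0 : ℝ) p.ws

/-- The length `n = ⌈(c/ε) log₂ (1/ε)⌉` of a block. -/
noncomputable def n (p : HashParams) : ℕ := ⌈p.c / p.eps * Real.logb 2 (1 / p.eps)⌉₊

/-- The number `k = max (0, ⌊n (C_W - 2ε/3)⌋)` of message bits in a block. -/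
noncomputable def k (p : HashParams) : ℕ :=
  ⌊(p.n : ℝ) * (womCapacity p.ws p.wx - 2 * p.eps / 3)⌋₊

/-- The number `t₁ = ⌊(1/ε)^(c/12) - 1⌋` of blocks that share a key. -/
noncomputable def t₁ (p : HashParams) : ℕ := ⌊(1 / p.eps) ^ (p.c / 12) - 1⌋₊

/-- The number `t₂ = ⌈2^(4n/δ)⌉` of keys. -/
noncomputable def t₂ (p : HashParams) : ℕ := ⌈(2 : ℝ) ^ (4 * (p.n : ℝ) / p.del)⌉₊

/-- The number `t = t₁ t₂` of blocks. -/
noncomputable def t (p : HashParams) : ℕ := p.t₁ * p.t₂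

/-- The block length `N = n t` of the code. -/
noncomputable def N (p : HashParams) : ℕ := p.n * p.t

/-- The number `K_W = K_b^t` of messages, where `K_b = 2^k`. -/
noncomputable def KW (p : HashParams) : ℕ := (2 ^ p.k) ^ p.t

/-- The number `(2^(2n))^t₂` of indices. -/
noncomputable def Ka (p : HashParams) : ℕ := (2 ^ (2 * p.n)) ^ p.t₂

/-- Positions `(i, j)` of blocks in the `t₁ × t₂` matrix. -/
abbrev Blocks (p : HashParams) : Type := Fin p.t₁ × Fin p.t₂

/-- Messages: `t₁ × t₂` matrices with entries of `k` bits. -/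
abbrev Message (p : HashParams) : Type := p.Blocks → Fin p.k → Bool

/-- Indices: one key for each of the `t₂` columns. -/
abbrev Index (p : HashParams) : Type := Fin p.t₂ → Key p.n

/-- The capacity `C_W`. -/
noncomputable def capacity (p : HashParams) : ℝ := womCapacity p.ws p.wx

/-- The decoding function `D_W`. -/
noncomputable def decode (p : HashParams) : (p.Blocks → J p.wx p.n) × p.Index → p.Message :=
  fun y => hashDecode (fun b => (y.1 b : Fin p.n → Bool)) y.2

/-- The rate `(1/N) log₂ (K_W / K_a)` of the code. -/
noncomputable def rate (p : HashParams) : ℝ := concatRate p.n p.t p.KW p.Ka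

end HashParams

/-! ## Inputs and outputs of the WOM programs, as lists of natural numbers -/

/-- Concatenation of finitely many lists. -/
def flat {m : ℕ} (f : Fin m → List ℕ) : List ℕ := (List.ofFn f).flatten

/-- A binary vector as a list of zeros and ones. -/
def bits {m : ℕ} (x : Fin m → Bool) : List ℕ := List.ofFn fun i => (x i).toNat

/-- The entries of a `t₁ × t₂` matrix of lists, column after column. -/
def columns {t₁ t₂ : ℕ} (f : Fin t₁ × Fin t₂ → List ℕ) : List ℕ :=
  flat fun j : Fin t₂ => flat fun i : Fin t₁ => f (i, j)

namespace HashParams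

/-- The integer parameters of a code: the head of every input. -/
noncomputable def header (p : HashParams) : List ℕ :=
  [p.n, p.k, p.t₁, p.t₂, ⌊p.wx * p.n⌋₊]

/-- Input of the encoder: message and state. -/
noncomputable def encInput (p : HashParams) (m : p.Message) (s : p.Blocks → Fin p.n → Bool) :
    List ℕ :=
  p.header ++ columns (fun b => bits (m b)) ++ columns (fun b => bits (s b))

/-- A codeword: the vectors, then the keys. -/
noncomputable def wordList (p : HashParams) (x : p.Blocks → Fin p.n → Bool) (key : p.Index) :
    List ℕ :=
  columns (fun b => bits (x b)) ++ flat fun j => bits (key j).1 ++ bits (key j).2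

/-- Output of the decoder. -/
noncomputable def messageList (p : HashParams) (m : p.Message) : List ℕ :=
  columns fun b => bits (m b)

end HashParams

/-! ## Rank-modulation rewriting codes

A permutation of a multiset on a set `P` of cells is given by its inverse, the function `P → ℕ` that
sends a cell to its rank. -/

/-- `f` is a permutation of the multiset that contains each element of `S` exactly `z` times. -/
def IsMultisetPerm {P : Type} [Fintype P] (S : Finset ℕ) (z : ℕ) (f : P → ℕ) : Prop :=
  ∀ v : ℕ, (Finset.univ.filter fun x => f x = v).card = if v ∈ S then z else 0

/-- The rewriting cost `max_j (σ⁻¹(j) - π⁻¹(j))`. It is only used for permutations of one multiset;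
the maximum is then nonnegative, since the two have the same sum of ranks, and the cut-off
subtraction does not change it. -/
def cost {P : Type} [Fintype P] (σ π : P → ℕ) : ℕ := Finset.univ.sup fun j => σ j - π j

/-- `D` is a `(q, z, K_R, r)` rank-modulation rewriting code with codebook `C`. The `q z` cells are
labelled by `P` and the `K_R` messages by `M`. -/
structure IsRMCode {P M : Type} [Fintype P] (q z KR r : ℕ) (C : Set (P → ℕ)) (D : C → M) :
    Prop where
  q_pos : 0 < q
  z_pos : 0 < z
  KR_pos : 0 < KR
  r_pos : 0 < r
  card_cells : Fintype.card P = q * z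
  card_message : Nat.card M = KR
  codebook : ∀ π ∈ C, IsMultisetPerm (Finset.Icc 1 q) z π
  surjective : Function.Surjective D
  rewritable : ∀ (m : M) (σ : C), ∃ π : C, D π = m ∧ cost (σ : P → ℕ) (π : P → ℕ) ≤ r

/-- The rate `(1 / (q z)) log₂ K_R`. -/
noncomputable def rmRate (q z KR : ℕ) : ℝ := Real.logb 2 (KR : ℝ) / ((q : ℝ) * (z : ℝ))

/-- The capacity `(r + 1) H(1 / (r + 1))`. -/
noncomputable def rmCapacity (r : ℕ) : ℝ := ((r : ℝ) + 1) * entropy (1 / ((r : ℝ) + 1))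

/-- The permutations, in one-line notation, of the multiset that contains each element of `S`
exactly `z` times. -/
def permLists (S : Finset ℕ) (z : ℕ) : Set (List ℕ) :=
  {L | ∀ v : ℕ, L.count v = if v ∈ S then z else 0}

/-- The number of permutations of that multiset. -/
noncomputable def numPerms (S : Finset ℕ) (z : ℕ) : ℕ := (permLists S z).ncard

/-- The enumerative code: the index of `L`, counted from `0`, among its rearrangements in
lexicographic order. -/
noncomputable def lexIndex (L : List ℕ) : ℕ := {L' : List ℕ | L'.Perm L ∧ L' < L}.ncard

theorem lexIndex_lt {S : Finset ℕ} {z : ℕ} {L : List ℕ} (h : L ∈ permLists S z) :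
    lexIndex L < numPerms S z := by
  have hset : permLists S z = {L' | L'.Perm L} := by
    ext L'
    constructor
    · intro h'
      exact List.perm_iff_count.2 fun v => (h' v).trans (h v).symm
    · intro h' v
      exact (List.perm_iff_count.1 h' v).trans (h v)
  have hfin : (permLists S z).Finite := by
    rw [hset]
    refine (List.finite_toSet L.permutations).subset ?_
    intro L' h'
    exact List.mem_permutations.2 h'
  refine Set.ncard_lt_ncard ?_ hfin
  rw [hset]
  refine ⟨fun L' h' => h'.1, fun hsub => ?_⟩
  exact lt_irrefl L (hsub (List.Perm.refl L)).2

theorem count_ofFn_filter {m z : ℕ} {S S' : Finset ℕ} {p : ℕ → Bool} {f : Fin m → ℕ}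
    (hf : IsMultisetPerm S z f) (hS : ∀ v, v ∈ S' ↔ v ∈ S ∧ p v = true) :
    (List.ofFn f).filter p ∈ permLists S' z := by
  intro v
  have h1 : (List.ofFn f).count v = if v ∈ S then z else 0 := by
    rw [← hf v, List.ofFn_eq_map, List.count, List.countP_map, List.countP_eq_length_filter,
      ← List.toFinset_card_of_nodup ((List.nodup_finRange m).filter _)]
    congr 1
    ext i
    simp
  by_cases hp : p v = true
  · rw [List.count_filter hp, h1]
    simp [hS, hp]
  · have h2 : v ∉ (List.ofFn f).filter p := fun h => hp (List.mem_filter.1 h).2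
    rw [List.count_eq_zero_of_not_mem h2]
    simp [hS, hp]

/-! ## The rank-modulation rewriting code built from the hash construction -/

/-- The parameters of the concatenated rank-modulation construction: the number `q` of ranks, the
cost `r`, and the parameters of the ingredient code. -/
structure RMParams where
  q : ℕ
  r : ℕ
  r_lt_q : r < q
  eps : ℝ
  del : ℝ
  c : ℝ

namespace RMParams

/-- The ingredient code has weights `w_s = (r+1)/q` and `w_x = 1/q`. -/
noncomputable def wom (p : RMParams) : HashParams :=
  ⟨p.eps, p.del, p.c, ((p.r : ℝ) + 1) / (p.q : ℝ), 1 / (p.q : ℝ)⟩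

/-- The range of the parameters; the block length of the ingredient code has to be `q z_W`. -/
structure Valid (p : RMParams) : Prop where
  r_pos : 0 < p.r
  eps_pos : 0 < p.eps
  eps_le : p.eps ≤ 1 / 2
  del_pos : 0 < p.del
  del_le : p.del ≤ 1 / 2
  c_gt : 20 < p.c
  dvd : p.q ∣ p.wom.n

/-- The multiplicity `z_W = n_W / q`. -/
noncomputable def zW (p : RMParams) : ℕ := p.wom.n / p.q

/-- The number `q - r - 1` of ranks that are written with the WOM code. -/
def u (p : RMParams) : ℕ := p.q - p.r - 1

/-- The least `a` such that there are at least `K_a` permutations of `{1^a, …, (r+1)^a}`. -/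
noncomputable def a (p : RMParams) : ℕ :=
  sInf {a : ℕ | p.wom.Ka ≤ numPerms (Finset.Icc 1 (p.r + 1)) a}

/-- The number `z = t z_W + (q-r-1) a` of cells in each rank. -/
noncomputable def z (p : RMParams) : ℕ := p.wom.t * p.zW + p.u * p.a

/-- The number `K_M` of permutations of `{(q-r)^{z_W}, …, q^{z_W}}`. -/
noncomputable def KM (p : RMParams) : ℕ := numPerms (Finset.Icc (p.q - p.r) p.q) p.zW

/-- The number `K_R = K_M^t K_W^(q-r-1)` of messages. -/
noncomputable def KR (p : RMParams) : ℕ := p.KM ^ p.wom.t * p.wom.KW ^ p.u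

/-- The cells: those of the parts `π_{a,i}`, of the part `π_b`, and of the parts `π_{x,l}`. -/
abbrev Cells (p : RMParams) : Type :=
  (Fin p.u × Fin ((p.r + 1) * p.a)) ⊕ (Fin (p.u * (p.u * p.a)) ⊕ (p.wom.Blocks × Fin p.wom.n))

/-- The part `π_{a,i}`. -/
def partA (p : RMParams) (π : p.Cells → ℕ) (i : Fin p.u) : Fin ((p.r + 1) * p.a) → ℕ :=
  fun j => π (Sum.inl (i, j))

/-- The part `π_b`. -/
def partB (p : RMParams) (π : p.Cells → ℕ) : Fin (p.u * (p.u * p.a)) → ℕ :=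
  fun j => π (Sum.inr (Sum.inl j))

/-- The part `π_{x,l}`. -/
def partX (p : RMParams) (π : p.Cells → ℕ) (l : p.wom.Blocks) : Fin p.wom.n → ℕ :=
  fun j => π (Sum.inr (Sum.inr (l, j)))

/-- The codebook. -/
def codebook (p : RMParams) : Set (p.Cells → ℕ) :=
  {π | (∀ i, IsMultisetPerm (Finset.Icc 1 (p.r + 1)) p.a (p.partA π i)) ∧
    IsMultisetPerm (Finset.Icc (p.r + 2) p.q) (p.u * p.a) (p.partB π) ∧
    ∀ l, IsMultisetPerm (Finset.Icc 1 p.q) p.zW (p.partX π l)}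

/-- Messages: a WOM message for each of the ranks `1, …, q-r-1`, and for each block the index of the
arrangement of its ranks `q-r, …, q`. -/
abbrev Message (p : RMParams) : Type :=
  (Fin p.u → p.wom.Message) × (p.wom.Blocks → Fin p.KM)

/-- The characteristic vector of the cells of rank `i + 1` in each block (`i` counts from `0`). -/
noncomputable def rankVec (p : RMParams) (π : p.Cells → ℕ) (i : Fin p.u) : p.wom.Blocks → Fin p.wom.n → Bool :=
  fun l j => decide (p.partX π l j = (i : ℕ) + 1)

/-- The characteristic vector, in each block, of the cells that have rank at most `i + 1 + r` in `σ`
and are not of rank at most `i` in `π`. -/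
noncomputable def stateVec (p : RMParams) (σ π : p.Cells → ℕ) (i : Fin p.u) :
    p.wom.Blocks → Fin p.wom.n → Bool :=
  fun l j => decide (p.partX σ l j ≤ (i : ℕ) + 1 + p.r ∧ ¬ p.partX π l j ≤ (i : ℕ))

/-- The arrangement of the ranks `q-r, …, q` in block `l`. -/
noncomputable def topRanks (p : RMParams) (π : p.Cells → ℕ) (l : p.wom.Blocks) : List ℕ :=
  (List.ofFn (p.partX π l)).filter fun v => decide (p.q - p.r ≤ v)

theorem topRanks_mem (p : RMParams) {π : p.Cells → ℕ} (h : π ∈ p.codebook) (l : p.wom.Blocks) :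
    p.topRanks π l ∈ permLists (Finset.Icc (p.q - p.r) p.q) p.zW := by
  refine count_ofFn_filter (h.2.2 l) fun v => ?_
  have := p.r_lt_q
  simp only [Finset.mem_Icc, decide_eq_true_eq]
  omega

/-- The keys whose bits, one after the other, are the binary digits of `x`. -/
noncomputable def keysOfNat (p : RMParams) (x : ℕ) : p.wom.Index :=
  fun j => (fun b => x.testBit ((j : ℕ) * (2 * p.wom.n) + (b : ℕ)),
    fun b => x.testBit ((j : ℕ) * (2 * p.wom.n) + p.wom.n + (b : ℕ)))

/-- The decoding function `D_R`. -/
noncomputable def decode (p : RMParams) (π : p.codebook) : p.Message :=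
  (fun i => hashDecode (p.rankVec π i) (p.keysOfNat (lexIndex (List.ofFn (p.partA π i)))),
   fun l => ⟨lexIndex (p.topRanks π l), lexIndex_lt (p.topRanks_mem π.2 l)⟩)

/-- `π` results from the steps of the encoder for the message `m` and the state `σ`: each rank
`i + 1 ≤ q-r-1` of the blocks is written with the WOM encoder, whose index is stored in `π_{a,i}`;
the top ranks of the blocks store the rest of the message; and `π_b = σ_b`. -/
def IsRMEncoding (p : RMParams) (m : p.Message) (σ π : p.Cells → ℕ) : Prop :=
  (∀ i : Fin p.u, lexIndex (List.ofFn (p.partA π i)) < p.wom.Ka ∧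
    IsHashEncoding p.wom.wx (m.1 i) (p.stateVec σ π i) (p.rankVec π i)
      (p.keysOfNat (lexIndex (List.ofFn (p.partA π i))))) ∧
  (∀ l, lexIndex (p.topRanks π l) = (m.2 l : ℕ)) ∧
  p.partB π = p.partB σ

/-- The rate of the code. -/
noncomputable def rate (p : RMParams) : ℝ := rmRate p.q p.z p.KR

/-- The integer parameters of a code: the head of every input. -/
noncomputable def header (p : RMParams) : List ℕ :=
  [p.q, p.r, p.wom.n, p.wom.k, p.wom.t₁, p.wom.t₂, p.a]

/-- A permutation as the list of the ranks of the cells, in the order of the concatenation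
`π_{a,1}, …, π_{a,q-r-1}, π_b, π_{x,1}, …, π_{x,t}`. -/
noncomputable def permList (p : RMParams) (π : p.Cells → ℕ) : List ℕ :=
  (flat fun i => List.ofFn (p.partA π i)) ++ List.ofFn (p.partB π) ++
    columns fun l => List.ofFn (p.partX π l)

/-- A message as a list. -/
noncomputable def messageList (p : RMParams) (m : p.Message) : List ℕ :=
  (flat fun i => p.wom.messageList (m.1 i)) ++ columns fun l => [(m.2 l : ℕ)]

end RMParams

end RankMod

namespace RAM

/-! ## A small functional language compiled to the machine -/

/-! Hashing. The maps x ↦ ax+b on 𝔽_{2^n} are pairwise independent: for x ≠ y the two hash values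
determine the key (`hashFn_pair_bijective`). By Chebyshev's inequality over all keys, a set of M
vectors misses a given k-bit value for at most a fraction (2^k-1)/M of the keys
(`card_bad_mul_card_le`). The candidates for one block are the vectors of weight ⌊w_x n⌋ below the
state, counted by the binomial coefficient of ⌊w_s n⌋ and ⌊w_x n⌋; if t₁·2^k does not exceed it, a
union bound over the t₁ blocks of a column leaves a common key (`exists_key`). The binomial
coefficient is at least 2^{n C_W} divided by (3/2)(n+1)² (`exp_entropy_le`). Since nε > 20 log(1/ε),
the slack 2^{2nε/3} left by the choice of k pays for this divisor and for t₁
(`HashParams.Valid.choose_ge`). A key costs 2n bits and serves t₁ blocks, so the rate is k/n - 2/t₁.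

Time. Exhaustive search over keys and vectors takes 2^{3n} t₁ poly(n) steps per column, while t₂ ≥
2^{4n/δ} makes N^δ ≥ 2^{4n}. The decoder needs the modulus once and then poly(n) steps per block; as
n itself is only 2^{O(nε)}, this overhead fits into N^{δε}.

Rank modulation. Rank i is written with the hash code into cells of old rank at most i+r that are
still free. The earlier ranks occupy (i-1)z_W of the (i+r)z_W cells of old rank at most i+r, so
(r+1)z_W = w_s n remain, exactly the weight the code requires (`RMParams.Valid.weight_freeVec`), and
the cost is at most r by construction. The top r+1 ranks are at least q-r and cannot cost more than
r, nor can the index parts, whose ranks lie in {1,…,r+1}; π_b does not change. Each of the q-r-1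
written ranks contributes about C_R/q to the rate, and the index parts are negligible because a ≤ 2n
t₂ while the blocks have n t₁ t₂ cells; so q is taken large first and ε small afterwards
(`RMParams.rate_bounds`). The upper bound holds because the top ranks carry at most log(r+1) ≤ C_R
bits per cell.

Machine. Programs are written in a language of expressions `E` and of statements `S` that append to
a list in memory; its compiler is verified once, together with a step count (`E.correct`,
`S.correct`). The class `Sp` then computes values and cost bounds by instance search, so that each
program reduces to an identity of lists and an inequality. Storing indices in permutations and
reading them back is lexicographic unranking and ranking with multinomial counts (`digitNat_eq`,
`rankNat_eq_lexIndex`). -/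

/-- Iteration of a function that may depend on the counter. -/
def iter {α : Type} (f : ℕ → α → α) (a : α) : ℕ → α
  | 0 => a
  | i + 1 => f i (iter f a i)

@[simp] theorem iter_zero {α : Type} (f : ℕ → α → α) (a : α) : iter f a 0 = a := rfl

@[simp] theorem iter_succ {α : Type} (f : ℕ → α → α) (a : α) (i : ℕ) :
    iter f a (i + 1) = f i (iter f a i) := rfl

theorem iter_invariant {α : Type} {f : ℕ → α → α} {a : α} (I : ℕ → α → Prop) (n : ℕ)
    (h0 : I 0 a) (hs : ∀ i < n, ∀ b, I i b → I (i + 1) (f i b)) : I n (iter f a n) := by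
  induction n with
  | zero => exact h0
  | succ n ih => exact hs n n.lt_succ_self _ (ih fun i hi => hs i (hi.trans n.lt_succ_self))

theorem iter_eq {α : Type} {f : ℕ → α → α} {a : α} (g : ℕ → α) (n : ℕ)
    (h0 : a = g 0) (hs : ∀ i < n, f i (g i) = g (i + 1)) : iter f a n = g n :=
  iter_invariant (fun i b => b = g i) n h0 fun i hi b hb => by rw [hb, hs i hi]

theorem iter_congr {α : Type} {f g : ℕ → α → α} {a : α} (n : ℕ)
    (hs : ∀ i < n, ∀ b, f i b = g i b) : iter f a n = iter g a n := by
  induction n with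
  | zero => rfl
  | succ n ih =>
    rw [iter_succ, iter_succ, ih fun i hi => hs i (hi.trans n.lt_succ_self), hs n n.lt_succ_self]

theorem iter_add_eq_sum (f : ℕ → ℕ) (n : ℕ) :
    iter (fun i acc => acc + f i) 0 n = ∑ i ∈ Finset.range n, f i := by
  induction n with
  | zero => rfl
  | succ n ih => rw [iter_succ, ih, Finset.sum_range_succ]

/-- Expressions. A variable is the position of its value in the environment. -/
inductive E : Type
  | var (i : ℕ) : E
  | lit (k : ℕ) : E
  | add (a b : E) : E
  | sub (a b : E) : E
  | half (a : E) : E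
  | ld (a : E) : E
  | cond (c a b : E) : E
  | bind (a b : E) : E
  | fold (n a b : E) : E
  | call (k : ℕ) (args : Fin k → E) (f : E) : E

namespace E

/-- The value of an expression, with the list `L` in memory. -/
def eval (L : List ℕ) : E → List ℕ → ℕ
  | var i, ρ => ρ.getD i 0
  | lit k, _ => k
  | add a b, ρ => a.eval L ρ + b.eval L ρ
  | sub a b, ρ => a.eval L ρ - b.eval L ρ
  | half a, ρ => a.eval L ρ / 2
  | ld a, ρ => L.getD (a.eval L ρ) 0
  | cond c a b, ρ => if c.eval L ρ ≠ 0 then a.eval L ρ else b.eval L ρ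
  -- New values go to the end of the environment, so a variable is counted from the outermost binder
  -- and keeps its number under further binders.
  | bind a b, ρ => b.eval L (ρ ++ [a.eval L ρ])
  | fold n a b, ρ => iter (fun i acc => b.eval L (ρ ++ [i, acc])) (a.eval L ρ) (n.eval L ρ)
  -- The callee sees its arguments and nothing else, so its value and cost can be established once,
  -- independently of the place of the call.
  | call _ args f, ρ => f.eval L (List.ofFn fun i => (args i).eval L ρ)

/-- A bound for the number of steps of the evaluation. -/
def cost (L : List ℕ) : E → List ℕ → ℕ
  | var _, _ => 2
  | lit _, _ => 1
  | add a b, ρ => a.cost L ρ + b.cost L ρ + 1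
  | sub a b, ρ => a.cost L ρ + b.cost L ρ + 1
  | half a, ρ => a.cost L ρ + 1
  | ld a, ρ => a.cost L ρ + 1
  | cond c a b, ρ => c.cost L ρ + (if c.eval L ρ ≠ 0 then a.cost L ρ else b.cost L ρ) + 1
  | bind a b, ρ => a.cost L ρ + b.cost L (ρ ++ [a.eval L ρ]) + 2
  -- Each round costs five steps of bookkeeping and one test; outside the rounds there are the
  -- initial counter, the last test and the final copy of two steps.
  | fold n a b, ρ => n.cost L ρ + a.cost L ρ + 4 + ∑ j ∈ Finset.range (n.eval L ρ),
      (b.cost L (ρ ++ [j, iter (fun i acc => b.eval L (ρ ++ [i, acc])) (a.eval L ρ) j]) + 6)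
  | call _ args f, ρ => (∑ i, (args i).cost L ρ) +
      f.cost L (List.ofFn fun i => (args i).eval L ρ) + 3

end E

/-- Copy register `s` to register `d`, with the help of register `t`. -/
def mov (d s t : ℕ) : Prog := .seq (.const t 0) (.add d s t)

/-- A program without effect. -/
def nop (d : ℕ) : Prog := .const d 0

/-- The programs in a list, one after the other. -/
def seqs (d : ℕ) : List Prog → Prog
  | [] => nop d
  | p :: l => .seq p (seqs d l)

/-- The loop of a fold. -/
def foldLoop (d : ℕ) (b : Prog) : Prog :=
  .whileNZ d (.seq b (.seq (mov (d + 1) (d + 3) (d + 4)) (.seq (.const (d + 3) 1)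
    (.seq (.add (d + 2) (d + 2) (d + 3)) (.sub d d (d + 3))))))

/-- The compiler. The values of the variables are in the registers listed in `ρ`; the result goes to
register `d`, and registers below `d` are not changed. -/
def E.compile : E → List ℕ → ℕ → Prog
  | .var i, ρ, d => if i < ρ.length then mov d (ρ.getD i 0) (d + 1) else .const d 0
  | .lit k, _, d => .const d k
  | .add a b, ρ, d => .seq (a.compile ρ d) (.seq (b.compile ρ (d + 1)) (.add d d (d + 1)))
  | .sub a b, ρ, d => .seq (a.compile ρ d) (.seq (b.compile ρ (d + 1)) (.sub d d (d + 1)))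
  | .half a, ρ, d => .seq (a.compile ρ d) (.half d d)
  | .ld a, ρ, d => .seq (a.compile ρ d) (.load d d)
  | .cond c a b, ρ, d => .seq (c.compile ρ d) (.ifNZ d (a.compile ρ d) (b.compile ρ d))
  | .bind a b, ρ, d => .seq (a.compile ρ d) (.seq (b.compile (ρ ++ [d]) (d + 1)) (mov d (d + 1) (d + 2)))
  -- Register `d` counts the remaining rounds, `d + 1` holds the accumulator, `d + 2` the counter
  -- visible to the body, and `d + 3` receives the value of the body.
  | .fold n a b, ρ, d => .seq (n.compile ρ d) (.seq (a.compile ρ (d + 1)) (.seq (.const (d + 2) 0)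
      (.seq (foldLoop d (b.compile (ρ ++ [d + 2, d + 1]) (d + 3))) (mov d (d + 1) (d + 3)))))
  | .call k args f, ρ, d => .seq (seqs (d + k) (List.ofFn fun i => (args i).compile ρ (d + i)))
      (.seq (f.compile (List.ofFn fun i : Fin k => d + i) (d + k)) (mov d (d + k) (d + k + 1)))

/-- The program `P`, started in `σ`, halts after at most `C` steps in a state with property `Q`. -/
def Runs (P : Prog) (σ : State) (C : ℕ) (Q : State → Prop) : Prop :=
  ∃ τ T, Exec P σ τ T ∧ T ≤ C ∧ Q τ

theorem Runs.mono {P : Prog} {σ : State} {C C' : ℕ} {Q Q' : State → Prop} (h : Runs P σ C Q)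
    (hC : C ≤ C') (hQ : ∀ τ, Q τ → Q' τ) : Runs P σ C' Q' := by
  obtain ⟨τ, T, h1, h2, h3⟩ := h
  exact ⟨τ, T, h1, h2.trans hC, hQ τ h3⟩

theorem Runs.seq {P P' : Prog} {σ : State} {C C' : ℕ} {Q Q' : State → Prop} (h : Runs P σ C Q)
    (h' : ∀ τ, Q τ → Runs P' τ C' Q') : Runs (.seq P P') σ (C + C') Q' := by
  obtain ⟨τ, T, h1, h2, h3⟩ := h
  obtain ⟨τ', T', h1', h2', h3'⟩ := h' τ h3
  exact ⟨τ', T + T', .seq h1 h1', by omega, h3'⟩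

theorem Runs.then {P P' : Prog} {σ : State} {C C' D : ℕ} {Q Q' : State → Prop} (h : Runs P σ C Q)
    (hD : C + C' ≤ D) (h' : ∀ τ, Q τ → Runs P' τ C' Q') : Runs (.seq P P') σ D Q' :=
  (h.seq h').mono hD fun _ h => h

/-- The invariant is indexed by the number of rounds done and also fixes the guard, so that the loop
makes exactly `n` rounds. The induction peels off the first round and shifts the invariant. -/
theorem Runs.while {P : Prog} {a : ℕ} (I : ℕ → State → Prop) (C : ℕ → ℕ) (n : ℕ)
    (hI : ∀ i < n, ∀ σ, I i σ → σ.reg a ≠ 0 ∧ Runs P σ (C i) (I (i + 1)))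
    (hn : ∀ σ, I n σ → σ.reg a = 0) {σ : State} (h0 : I 0 σ) :
    Runs (.whileNZ a P) σ (∑ i ∈ Finset.range n, (C i + 1) + 1) (I n) := by
  induction n generalizing I C σ with
  | zero => exact ⟨σ, 1, .whileEnd (hn σ h0), by simp, h0⟩
  | succ n ih =>
    obtain ⟨h1, τ, T, h2, h3, h4⟩ := hI 0 (by omega) σ h0
    obtain ⟨τ', T', h5, h6, h7⟩ := ih (fun i => I (i + 1)) (fun i => C (i + 1))
      (fun i hi => hI (i + 1) (by omega)) hn h4
    refine ⟨τ', T + T' + 1, .whileStep h1 h2 h5, ?_, h7⟩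
    rw [Finset.sum_range_succ']
    omega

theorem Runs.const {σ : State} {d v : ℕ} {Q : State → Prop} (h : Q (σ.setReg d v)) :
    Runs (.const d v) σ 1 Q := ⟨_, _, .const σ d v, le_rfl, h⟩

theorem Runs.add {σ : State} {d a b : ℕ} {Q : State → Prop}
    (h : Q (σ.setReg d (σ.reg a + σ.reg b))) : Runs (.add d a b) σ 1 Q :=
  ⟨_, _, .add σ d a b, le_rfl, h⟩

theorem Runs.sub {σ : State} {d a b : ℕ} {Q : State → Prop}
    (h : Q (σ.setReg d (σ.reg a - σ.reg b))) : Runs (.sub d a b) σ 1 Q :=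
  ⟨_, _, .sub σ d a b, le_rfl, h⟩

theorem Runs.half {σ : State} {d a : ℕ} {Q : State → Prop}
    (h : Q (σ.setReg d (σ.reg a / 2))) : Runs (.half d a) σ 1 Q :=
  ⟨_, _, .half σ d a, le_rfl, h⟩

theorem Runs.load {σ : State} {d a : ℕ} {Q : State → Prop}
    (h : Q (σ.setReg d (σ.mem (σ.reg a)))) : Runs (.load d a) σ 1 Q :=
  ⟨_, _, .load σ d a, le_rfl, h⟩

theorem Runs.store {σ : State} {a b : ℕ} {Q : State → Prop}
    (h : Q (σ.setMem (σ.reg a) (σ.reg b))) : Runs (.store a b) σ 1 Q :=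
  ⟨_, _, .store σ a b, le_rfl, h⟩

theorem Runs.cond {P P' : Prog} {σ : State} {a C : ℕ} {Q : State → Prop}
    (h : σ.reg a ≠ 0 → Runs P σ C Q) (h' : σ.reg a = 0 → Runs P' σ C Q) :
    Runs (.ifNZ a P P') σ (C + 1) Q := by
  by_cases ha : σ.reg a = 0
  · obtain ⟨τ, T, h1, h2, h3⟩ := h' ha
    exact ⟨τ, T + 1, .ifFalse ha h1, by omega, h3⟩
  · obtain ⟨τ, T, h1, h2, h3⟩ := h ha
    exact ⟨τ, T + 1, .ifTrue ha h1, by omega, h3⟩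

/-- There is no copy instruction: `t` is cleared and then added to `s`. The clearing comes first,
hence `s ≠ t`. -/
theorem Runs.mov {σ : State} {d s t : ℕ} {Q : State → Prop} (hst : s ≠ t)
    (h : Q ((σ.setReg t 0).setReg d (σ.reg s))) : Runs (mov d s t) σ 2 Q := by
  refine Runs.seq (C := 1) (C' := 1) (Q := fun τ => τ = σ.setReg t 0) (Runs.const rfl) ?_
  rintro τ rfl
  refine Runs.add ?_
  simpa [State.setReg, Function.update_of_ne hst] using h

@[simp] theorem State.setReg_mem (σ : State) (d v : ℕ) : (σ.setReg d v).mem = σ.mem := rfl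

theorem State.setReg_reg (σ : State) (d v i : ℕ) :
    (σ.setReg d v).reg i = if i = d then v else σ.reg i := by
  simp [State.setReg, Function.update_apply]

/-- The registers below `d` agree. -/
def Agree (d : ℕ) (σ τ : State) : Prop := ∀ r < d, τ.reg r = σ.reg r

theorem Agree.map {d : ℕ} {σ τ : State} (h : Agree d σ τ) {ρ : List ℕ} (hρ : ∀ r ∈ ρ, r < d) :
    ρ.map τ.reg = ρ.map σ.reg :=
  List.map_congr_left fun r hr => h r (hρ r hr)

theorem Agree.trans {d d' : ℕ} {σ τ υ : State} (h : Agree d σ τ) (h' : Agree d' τ υ)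
    (hd : d ≤ d') : Agree d σ υ := fun r hr => (h' r (hr.trans_le hd)).trans (h r hr)

/-- What the compiled expression does. -/
def E.Correct (e : E) : Prop :=
  ∀ (L ρ : List ℕ) (d : ℕ) (σ : State), (∀ i, σ.mem i = L.getD i 0) → (∀ r ∈ ρ, r < d) →
    Runs (e.compile ρ d) σ (e.cost L (ρ.map σ.reg)) fun τ =>
      τ.reg d = e.eval L (ρ.map σ.reg) ∧ Agree d σ τ ∧ τ.mem = σ.mem

/-- Argument `i` goes to register `d + i`. Later arguments have larger targets and therefore leave
the earlier ones intact; the closing `nop` writes to `e`, beyond all of them, and accounts for the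
extra step. -/
theorem runs_args {k : ℕ} {args : Fin k → E} (h : ∀ i, (args i).Correct) (L ρ : List ℕ) (d e : ℕ)
    (σ : State) (hL : ∀ i, σ.mem i = L.getD i 0) (hρ : ∀ r ∈ ρ, r < d) (hde : d + k ≤ e) :
    Runs (seqs e (List.ofFn fun i => (args i).compile ρ (d + i))) σ
      ((∑ i, (args i).cost L (ρ.map σ.reg)) + 1) fun τ =>
      (∀ i : Fin k, τ.reg (d + i) = (args i).eval L (ρ.map σ.reg)) ∧ Agree d σ τ ∧
        τ.mem = σ.mem := by
  induction k generalizing d σ with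
  | zero =>
    refine Runs.const ⟨fun i => i.elim0, fun r hr => ?_, rfl⟩
    rw [State.setReg_reg, if_neg (by omega)]
  | succ k ih =>
    rw [List.ofFn_succ, Fin.sum_univ_succ, add_assoc]
    refine Runs.seq (h 0 L ρ _ σ hL (by simpa using hρ)) fun τ ⟨h1, h2, h3⟩ => ?_
    rw [Fin.val_zero, add_zero] at h1 h2
    have hm := h2.map hρ
    have := ih (args := fun i => args i.succ) (fun i => h i.succ) (d + 1) τ
      (fun i => by rw [h3, hL]) (fun r hr => (hρ r hr).trans (by omega)) (by omega)
    rw [hm] at this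
    simp only [Fin.val_succ]
    have e1 : ∀ i : Fin k, d + ((i : ℕ) + 1) = d + 1 + i := fun i => by omega
    simp only [e1]
    refine this.mono le_rfl fun υ ⟨h4, h5, h6⟩ => ⟨fun i => ?_, h2.trans h5 (by omega),
      h6.trans h3⟩
    refine Fin.cases ?_ (fun j => ?_) i
    · simpa [h5 d (by omega)] using h1
    · rw [Fin.val_succ, e1]
      exact h4 j

/-- Structural induction. Operands are compiled to increasing target registers, and the frame
condition `Agree` says that an operand already in register `d` survives the evaluation of the next
one in `d + 1`. Expressions never write to memory. -/
theorem E.correct (e : E) : e.Correct := by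
  induction e with
  | var i =>
    intro L ρ d σ hL hρ
    by_cases hi : i < ρ.length
    · rw [compile, if_pos hi]
      have h1 : ρ.getD i 0 = ρ[i] := List.getD_eq_getElem _ _ hi
      have h2 := hρ ρ[i] (List.getElem_mem hi)
      refine Runs.mov (by omega) ⟨?_, fun r hr => ?_, rfl⟩
      · simp [State.setReg_reg, eval, hi]
      · simp only [State.setReg_reg]
        rw [if_neg (by omega), if_neg (by omega)]
    · rw [compile, if_neg hi]
      refine (Runs.const ⟨?_, fun r hr => ?_, rfl⟩).mono (by simp [cost]) fun _ h => h
      · simp [State.setReg_reg, eval, hi]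
      · rw [State.setReg_reg, if_neg (by omega)]
  | lit k =>
    intro L ρ d σ hL hρ
    refine Runs.const ⟨by simp [State.setReg_reg, eval], fun r hr => ?_, rfl⟩
    rw [State.setReg_reg, if_neg (by omega)]
  | add a b ha hb =>
    intro L ρ d σ hL hρ
    refine (ha L ρ d σ hL hρ).then (D := _) (by rw [cost, add_assoc]) fun τ ⟨h1, h2, h3⟩ =>
      (hb L ρ (d + 1) τ (fun i => by rw [h3, hL]) fun r hr => (hρ r hr).trans (by omega)).then
      (by rw [h2.map hρ]) fun υ ⟨h4, h5, h6⟩ => Runs.add ⟨?_, fun r hr => ?_, h6.trans h3⟩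
    · rw [State.setReg_reg, if_pos rfl, h4, h5 d (by omega), h1, h2.map hρ, eval]
    · rw [State.setReg_reg, if_neg (by omega), h5 r (by omega), h2 r hr]
  | sub a b ha hb =>
    intro L ρ d σ hL hρ
    refine (ha L ρ d σ hL hρ).then (D := _) (by rw [cost, add_assoc]) fun τ ⟨h1, h2, h3⟩ =>
      (hb L ρ (d + 1) τ (fun i => by rw [h3, hL]) fun r hr => (hρ r hr).trans (by omega)).then
      (by rw [h2.map hρ]) fun υ ⟨h4, h5, h6⟩ => Runs.sub ⟨?_, fun r hr => ?_, h6.trans h3⟩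
    · rw [State.setReg_reg, if_pos rfl, h4, h5 d (by omega), h1, h2.map hρ, eval]
    · rw [State.setReg_reg, if_neg (by omega), h5 r (by omega), h2 r hr]
  | half a ha =>
    intro L ρ d σ hL hρ
    refine (ha L ρ d σ hL hρ).then (D := _) (by rw [cost]) fun τ ⟨h1, h2, h3⟩ =>
      Runs.half ⟨?_, fun r hr => ?_, h3⟩
    · rw [State.setReg_reg, if_pos rfl, h1, eval]
    · rw [State.setReg_reg, if_neg (by omega), h2 r hr]
  | ld a ha =>
    intro L ρ d σ hL hρ
    refine (ha L ρ d σ hL hρ).then (D := _) (by rw [cost]) fun τ ⟨h1, h2, h3⟩ =>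
      Runs.load ⟨?_, fun r hr => ?_, h3⟩
    · rw [State.setReg_reg, if_pos rfl, h1, h3, hL, eval]
    · rw [State.setReg_reg, if_neg (by omega), h2 r hr]
  | cond c a b hc ha hb =>
    intro L ρ d σ hL hρ
    refine (hc L ρ d σ hL hρ).then (D := _) (C' := (if c.eval L (ρ.map σ.reg) ≠ 0 then
      a.cost L (ρ.map σ.reg) else b.cost L (ρ.map σ.reg)) + 1) (by rw [cost, add_assoc]) fun τ ⟨h1, h2, h3⟩ =>
      Runs.cond (fun h => ?_) (fun h => ?_)
    · rw [h1] at h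
      refine (ha L ρ d τ (fun i => by rw [h3, hL]) hρ).mono ?_ fun υ ⟨h4, h5, h6⟩ =>
        ⟨?_, h2.trans h5 le_rfl, h6.trans h3⟩
      · rw [if_pos h, h2.map hρ]
      · rw [h4, eval, if_pos h, h2.map hρ]
    · rw [h1] at h
      refine (hb L ρ d τ (fun i => by rw [h3, hL]) hρ).mono ?_ fun υ ⟨h4, h5, h6⟩ =>
        ⟨?_, h2.trans h5 le_rfl, h6.trans h3⟩
      · rw [if_neg (not_not.2 h), h2.map hρ]
      · rw [h4, eval, if_neg (not_not.2 h), h2.map hρ]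
  | bind a b ha hb =>
    intro L ρ d σ hL hρ
    refine (ha L ρ d σ hL hρ).then (D := _) (by rw [cost, add_assoc]) fun τ ⟨h1, h2, h3⟩ => ?_
    have hm : (ρ ++ [d]).map τ.reg = ρ.map σ.reg ++ [a.eval L (ρ.map σ.reg)] := by
      rw [List.map_append, h2.map hρ, List.map_singleton, h1]
    refine (hb L (ρ ++ [d]) (d + 1) τ (fun i => by rw [h3, hL]) fun r hr => ?_).then
      (by rw [hm]) fun υ ⟨h4, h5, h6⟩ => Runs.mov (by omega) ⟨?_, fun r hr => ?_, h6.trans h3⟩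
    · rcases List.mem_append.1 hr with hr | hr
      · exact (hρ r hr).trans (by omega)
      · rw [List.mem_singleton.1 hr]
        omega
    · rw [State.setReg_reg, if_pos rfl, h4, hm, eval]
    · rw [State.setReg_reg, if_neg (by omega), State.setReg_reg, if_neg (by omega),
        h5 r (by omega), h2 r hr]
  | fold n a b hn ha hb =>
    intro L ρ d σ hL hρ
    set env := ρ.map σ.reg with henv
    set N := n.eval L env
    set f : ℕ → ℕ → ℕ := fun i acc => b.eval L (env ++ [i, acc])
    set A := a.eval L env
    -- Loop invariant after `i` rounds: remaining rounds, `i`-th iterate and counter are in three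
    -- consecutive registers, and the registers of the variables are as at the start.
    have hbody : ∀ i < N, ∀ υ : State, (υ.reg d = N - i ∧ υ.reg (d + 1) = iter f A i ∧
        υ.reg (d + 2) = i ∧ Agree d σ υ ∧ υ.mem = σ.mem) → υ.reg d ≠ 0 ∧
        Runs (.seq (b.compile (ρ ++ [d + 2, d + 1]) (d + 3)) (.seq (mov (d + 1) (d + 3) (d + 4))
          (.seq (.const (d + 3) 1) (.seq (.add (d + 2) (d + 2) (d + 3)) (.sub d d (d + 3)))))) υ
        (b.cost L (env ++ [i, iter f A i]) + 5) fun υ => (υ.reg d = N - (i + 1) ∧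
          υ.reg (d + 1) = iter f A (i + 1) ∧
        υ.reg (d + 2) = i + 1 ∧ Agree d σ υ ∧ υ.mem = σ.mem) := by
      intro i hi υ ⟨g1, g2, g3, g4, g5⟩
      have hm : (ρ ++ [d + 2, d + 1]).map υ.reg = env ++ [i, iter f A i] := by
        rw [List.map_append, g4.map hρ, List.map_cons, List.map_singleton, g2, g3]
      refine ⟨by omega, (hb L (ρ ++ [d + 2, d + 1]) (d + 3) υ (fun i => by rw [g5, hL])
        fun r hr => ?_).then (by rw [hm]) fun φ ⟨h1, h2, h3⟩ => ?_⟩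
      · simp only [List.mem_append, List.mem_cons, List.not_mem_nil, or_false] at hr
        rcases hr with hr | rfl | rfl
        · exact (hρ r hr).trans (by omega)
        all_goals omega
      · refine Runs.then (C := 2) (C' := 3) (Q := fun ψ =>
            ψ = (φ.setReg (d + 4) 0).setReg (d + 1) (φ.reg (d + 3)))
          (Runs.mov (by omega) rfl) (by omega) ?_
        rintro _ rfl
        refine Runs.then (C := 1) (C' := 2) (Runs.const (Q := fun ψ => ψ = _) rfl) (by omega) ?_
        rintro _ rfl
        refine Runs.then (C := 1) (C' := 1) (Runs.add (Q := fun ψ => ψ = _) rfl) (by omega) ?_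
        rintro _ rfl
        have e1 := h2 d (by omega)
        have e2 := h2 (d + 2) (by omega)
        refine Runs.sub ⟨?_, ?_, ?_, fun r hr => ?_, h3.trans g5⟩
        · simp [State.setReg_reg, e1, g1]
          omega
        · simp [State.setReg_reg, h1, hm, f]
        · simp [State.setReg_reg, e2, g3]
        · have : r ≠ d ∧ r ≠ d + 1 ∧ r ≠ d + 2 ∧ r ≠ d + 3 ∧ r ≠ d + 4 := by omega
          simp [State.setReg_reg, this, h2 r (by omega), g4 r hr]
    refine (hn L ρ d σ hL hρ).then (D := _) (C' := a.cost L env + (1 +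
      ((∑ j ∈ Finset.range N, (b.cost L (env ++ [j, iter f A j]) + 5 + 1) + 1) + 2)))
      (by
        change n.cost L env + _ ≤ n.cost L env + a.cost L env + 4 + ∑ j ∈ Finset.range N,
          (b.cost L (env ++ [j, iter f A j]) + 6)
        simp only [add_assoc, Nat.reduceAdd]
        omega) fun τ ⟨h1, h2, h3⟩ => ?_
    refine (ha L ρ (d + 1) τ (fun i => by rw [h3, hL]) fun r hr => (hρ r hr).trans (by omega)).then
      (by rw [h2.map hρ]) fun υ ⟨h4, h5, h6⟩ => ?_
    rw [h2.map hρ] at h4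
    refine Runs.then (Runs.const (Q := fun ψ => ψ = _) rfl) le_rfl ?_
    rintro _ rfl
    refine (Runs.while _ _ N hbody (fun υ hυ => by rw [hυ.1]; omega) ⟨?_, ?_, ?_, ?_, ?_⟩).then
      le_rfl fun φ ⟨f1, f2, f3, f4, f5⟩ => Runs.mov (by omega) ⟨?_, fun r hr => ?_, f5⟩
    · simp [State.setReg_reg, h5 d (by omega), h1, N, henv]
    · simp [State.setReg_reg, h4, A, henv]
    · simp [State.setReg_reg]
    · intro r hr
      rw [State.setReg_reg, if_neg (by omega), h5 r (by omega), h2 r hr]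
    · exact h6.trans h3
    · rw [State.setReg_reg, if_pos rfl, f2, eval]
    · rw [State.setReg_reg, if_neg (by omega), State.setReg_reg, if_neg (by omega), f4 r hr]
  | call k args f hargs hf =>
    intro L ρ d σ hL hρ
    refine (runs_args hargs L ρ d (d + k) σ hL hρ le_rfl).then (D := _)
      (C' := f.cost L (List.ofFn fun i => (args i).eval L (ρ.map σ.reg)) + 2)
      (by
        change _ ≤ (∑ i, (args i).cost L (ρ.map σ.reg)) +
          f.cost L (List.ofFn fun i => (args i).eval L (ρ.map σ.reg)) + 3
        omega) fun τ ⟨h1, h2, h3⟩ => ?_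
    have hm : (List.ofFn fun i : Fin k => d + (i : ℕ)).map τ.reg =
        List.ofFn fun i => (args i).eval L (ρ.map σ.reg) := by
      rw [List.map_ofFn]
      congr 1
      ext i
      exact h1 i
    refine (hf L _ (d + k) τ (fun i => by rw [h3, hL]) fun r hr => ?_).then
      (by rw [hm]) fun υ ⟨h4, h5, h6⟩ => Runs.mov (by omega) ⟨?_, fun r hr => ?_, h6.trans h3⟩
    · obtain ⟨i, rfl⟩ := (List.mem_ofFn' _ _).1 hr
      have := i.2
      show d + (i : ℕ) < d + k
      omega
    · rw [State.setReg_reg, if_pos rfl, h4, hm, eval]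
    · rw [State.setReg_reg, if_neg (by omega), State.setReg_reg, if_neg (by omega),
        h5 r (by omega), h2 r hr]

end RAM

/-! ### Statements that append to the memory, and complete programs -/

namespace RAM

/-- Statements, which append numbers to the list in memory. -/
inductive S : Type
  | emit (e : E) : S
  | seq (s t : S) : S
  | cond (c : E) (s t : S) : S
  | bind (e : E) (s : S) : S
  -- Binds the length of the list, that is, the address at which the output of `s` will begin.
  | bindLen (s : S) : S
  | loop (n : E) (s : S) : S
  | skip : S
  | call (k : ℕ) (args : Fin k → E) (s : S) : S

namespace S

/-- What the statement appends to the list `L`. -/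
def out : S → List ℕ → List ℕ → List ℕ
  | emit e, L, ρ => [e.eval L ρ]
  | seq s t, L, ρ => s.out L ρ ++ t.out (L ++ s.out L ρ) ρ
  | cond c s t, L, ρ => if c.eval L ρ ≠ 0 then s.out L ρ else t.out L ρ
  | bind e s, L, ρ => s.out L (ρ ++ [e.eval L ρ])
  | bindLen s, L, ρ => s.out L (ρ ++ [L.length])
  | loop n s, L, ρ => iter (fun i o => o ++ s.out (L ++ o) (ρ ++ [i])) [] (n.eval L ρ)
  | skip, _, _ => []
  | call _ args s, L, ρ => s.out L (List.ofFn fun i => (args i).eval L ρ)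

/-- A bound for the number of steps of the execution. -/
def cost : S → List ℕ → List ℕ → ℕ
  | emit e, L, ρ => e.cost L ρ + 3
  | seq s t, L, ρ => s.cost L ρ + t.cost (L ++ s.out L ρ) ρ
  | cond c s t, L, ρ => c.cost L ρ + (if c.eval L ρ ≠ 0 then s.cost L ρ else t.cost L ρ) + 1
  | bind e s, L, ρ => e.cost L ρ + s.cost L (ρ ++ [e.eval L ρ])
  | bindLen s, L, ρ => s.cost L (ρ ++ [L.length]) + 2
  | loop n s, L, ρ => n.cost L ρ + 2 + ∑ j ∈ Finset.range (n.eval L ρ),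
      (s.cost (L ++ iter (fun i o => o ++ s.out (L ++ o) (ρ ++ [i])) [] j) (ρ ++ [j]) + 4)
  | skip, _, _ => 1
  | call _ args s, L, ρ => (∑ i, (args i).cost L ρ) +
      s.cost L (List.ofFn fun i => (args i).eval L ρ) + 1

/-- The compiler. Register `0` holds the length of the list. -/
def compile : S → List ℕ → ℕ → Prog
  | emit e, ρ, d => .seq (e.compile ρ d) (.seq (.store 0 d) (.seq (.const d 1) (.add 0 0 d)))
  | seq s t, ρ, d => .seq (s.compile ρ d) (t.compile ρ d)
  | cond c s t, ρ, d => .seq (c.compile ρ d) (.ifNZ d (s.compile ρ d) (t.compile ρ d))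
  | bind e s, ρ, d => .seq (e.compile ρ d) (s.compile (ρ ++ [d]) (d + 1))
  | bindLen s, ρ, d => .seq (mov d 0 (d + 1)) (s.compile (ρ ++ [d]) (d + 1))
  | loop n s, ρ, d => .seq (n.compile ρ d) (.seq (.const (d + 1) 0) (.whileNZ d
      (.seq (s.compile (ρ ++ [d + 1]) (d + 2)) (.seq (.const (d + 2) 1)
        (.seq (.add (d + 1) (d + 1) (d + 2)) (.sub d d (d + 2)))))))
  | skip, _, d => nop d
  | call k args s, ρ, d => .seq (seqs (d + k) (List.ofFn fun i => (args i).compile ρ (d + i)))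
      (s.compile (List.ofFn fun i : Fin k => d + i) (d + k))

end S

/-- The list `L` is in memory, and register `0` holds its length. -/
def Holds (L : List ℕ) (σ : State) : Prop :=
  (∀ i, σ.mem i = L.getD i 0) ∧ σ.reg 0 = L.length

/-- The registers between `0` and `d` agree. -/
def AgreeS (d : ℕ) (σ τ : State) : Prop := ∀ r, 0 < r → r < d → τ.reg r = σ.reg r

theorem AgreeS.map {d : ℕ} {σ τ : State} (h : AgreeS d σ τ) {ρ : List ℕ}
    (hρ : ∀ r ∈ ρ, 0 < r ∧ r < d) : ρ.map τ.reg = ρ.map σ.reg :=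
  List.map_congr_left fun r hr => h r (hρ r hr).1 (hρ r hr).2

theorem Holds.of_agree {L : List ℕ} {σ τ : State} {d : ℕ} (h : Holds L σ) (hd : 0 < d)
    (hr : Agree d σ τ) (hm : τ.mem = σ.mem) : Holds L τ :=
  ⟨fun i => by rw [hm, h.1], by rw [hr 0 hd, h.2]⟩

/-- What the compiled statement does. -/
def S.Correct (s : S) : Prop :=
  ∀ (L ρ : List ℕ) (d : ℕ) (σ : State), Holds L σ → 0 < d → (∀ r ∈ ρ, 0 < r ∧ r < d) →
    Runs (s.compile ρ d) σ (s.cost L (ρ.map σ.reg)) fun τ =>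
      Holds (L ++ s.out L (ρ.map σ.reg)) τ ∧ AgreeS d σ τ

/-- Memory beyond the list is zero, so one write just past its end represents the longer list
exactly. -/
theorem Holds.snoc {L : List ℕ} {σ : State} (h : Holds L σ) {τ : State} {v : ℕ}
    (hm : τ.mem = Function.update σ.mem L.length v) (hr : τ.reg 0 = L.length + 1) :
    Holds (L ++ [v]) τ := by
  refine ⟨fun i => ?_, by simpa using hr⟩
  rw [hm, Function.update_apply]
  split_ifs with hi
  · simp [hi]
  · rw [h.1]
    rcases lt_or_gt_of_ne hi with hi | hi
    · simp [List.getElem?_append, hi]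
    · rw [List.getD_eq_default _ _ hi.le, List.getD_eq_default _ _ (by simpa using hi)]

/-- Statements write only at the end of the list. Register `0` therefore changes, which is why
`AgreeS` leaves it out, and all addresses of earlier data stay valid. -/
theorem S.correct (s : S) : s.Correct := by
  induction s with
  | emit e =>
    intro L ρ d σ hL hd hρ
    refine (e.correct L ρ d σ hL.1 fun r hr => (hρ r hr).2).then (D := _) (C' := 3)
      (by rw [cost]) fun τ ⟨h1, h2, h3⟩ => ?_
    refine Runs.then (C := 1) (C' := 2) (Runs.store (Q := fun ψ => ψ = _) rfl) (by omega) ?_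
    rintro _ rfl
    refine Runs.then (C := 1) (C' := 1) (Runs.const (Q := fun ψ => ψ = _) rfl) (by omega) ?_
    rintro _ rfl
    have h0 : τ.reg 0 = L.length := (h2 0 hd).trans hL.2
    refine Runs.add ⟨hL.snoc ?_ ?_, fun r hr hrd => ?_⟩
    · simp [State.setMem, h0, h1, h3]
    · have : 0 ≠ d := by omega
      simp [State.setReg_reg, State.setMem, h0, this]
    · have : r ≠ 0 ∧ r ≠ d := by omega
      simp [State.setReg_reg, State.setMem, this, h2 r hrd]
  | seq s t hs ht =>
    intro L ρ d σ hL hd hρ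
    refine (hs L ρ d σ hL hd hρ).then (D := _) (by rw [cost]) fun τ ⟨h1, h2⟩ => ?_
    rw [← h2.map hρ] at h1 ⊢
    refine (ht _ ρ d τ h1 hd hρ).mono le_rfl fun υ ⟨h3, h4⟩ => ⟨?_, fun r hr hrd => ?_⟩
    · rw [out, ← List.append_assoc]
      exact h3
    · rw [h4 r hr hrd, h2 r hr hrd]
  | cond c s t hs ht =>
    intro L ρ d σ hL hd hρ
    have hρ' : ∀ r ∈ ρ, r < d := fun r hr => (hρ r hr).2
    refine (c.correct L ρ d σ hL.1 hρ').then (D := _) (C' := (if c.eval L (ρ.map σ.reg) ≠ 0 then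
      s.cost L (ρ.map σ.reg) else t.cost L (ρ.map σ.reg)) + 1) (by rw [cost, add_assoc])
      fun τ ⟨h1, h2, h3⟩ => Runs.cond (fun h => ?_) (fun h => ?_)
    · rw [h1] at h
      refine (hs L ρ d τ (hL.of_agree hd h2 h3) hd hρ).mono ?_ fun υ ⟨h4, h5⟩ =>
        ⟨?_, fun r hr hrd => (h5 r hr hrd).trans (h2 r hrd)⟩
      · rw [if_pos h, h2.map hρ']
      · rw [out, if_pos h, ← h2.map hρ']
        exact h4
    · rw [h1] at h
      refine (ht L ρ d τ (hL.of_agree hd h2 h3) hd hρ).mono ?_ fun υ ⟨h4, h5⟩ =>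
        ⟨?_, fun r hr hrd => (h5 r hr hrd).trans (h2 r hrd)⟩
      · rw [if_neg (not_not.2 h), h2.map hρ']
      · rw [out, if_neg (not_not.2 h), ← h2.map hρ']
        exact h4
  | bind e s hs =>
    intro L ρ d σ hL hd hρ
    have hρ' : ∀ r ∈ ρ, r < d := fun r hr => (hρ r hr).2
    refine (e.correct L ρ d σ hL.1 hρ').then (D := _) (by rw [cost]) fun τ ⟨h1, h2, h3⟩ => ?_
    have hm : (ρ ++ [d]).map τ.reg = ρ.map σ.reg ++ [e.eval L (ρ.map σ.reg)] := by
      rw [List.map_append, h2.map hρ', List.map_singleton, h1]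
    refine (hs L (ρ ++ [d]) (d + 1) τ (hL.of_agree hd h2 h3) (by omega) fun r hr => ?_).mono
      (by rw [hm]) fun υ ⟨h4, h5⟩ => ⟨?_, fun r hr hrd => ?_⟩
    · rcases List.mem_append.1 hr with hr | hr
      · exact ⟨(hρ r hr).1, (hρ r hr).2.trans (by omega)⟩
      · rw [List.mem_singleton.1 hr]
        omega
    · rw [out, ← hm]
      exact h4
    · rw [h5 r hr (by omega), h2 r hrd]
  | bindLen s hs =>
    intro L ρ d σ hL hd hρ
    refine (Runs.mov (σ := σ) (d := d) (s := 0) (t := d + 1) (Q := fun ψ => ψ = _)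
      (by omega) rfl).then (D := _) (by rw [cost, add_comm]) ?_
    rintro τ hτ
    have h2 : Agree d σ τ := fun r hr => by
      rw [hτ, State.setReg_reg, if_neg (by omega), State.setReg_reg, if_neg (by omega)]
    have h3 : τ.mem = σ.mem := by rw [hτ]; rfl
    have h1 : τ.reg d = L.length := by rw [hτ, State.setReg_reg, if_pos rfl, hL.2]
    have hm : (ρ ++ [d]).map τ.reg = ρ.map σ.reg ++ [L.length] := by
      rw [List.map_append, h2.map fun r hr => (hρ r hr).2, List.map_singleton, h1]
    refine (hs L (ρ ++ [d]) (d + 1) τ (hL.of_agree hd h2 h3) (by omega) fun r hr => ?_).mono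
      (by rw [hm]) fun υ ⟨h4, h5⟩ => ⟨?_, fun r hr hrd => ?_⟩
    · rcases List.mem_append.1 hr with hr | hr
      · exact ⟨(hρ r hr).1, (hρ r hr).2.trans (by omega)⟩
      · rw [List.mem_singleton.1 hr]
        omega
    · rw [out, ← hm]
      exact h4
    · rw [h5 r hr (by omega), h2 r hrd]
  | skip =>
    intro L ρ d σ hL hd hρ
    refine Runs.const ⟨⟨fun i => ?_, ?_⟩, fun r hr hrd => ?_⟩
    · simpa [out] using hL.1 i
    · rw [State.setReg_reg, if_neg (by omega), out, List.append_nil, hL.2]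
    · rw [State.setReg_reg, if_neg (by omega)]
  | call k args s hs =>
    intro L ρ d σ hL hd hρ
    refine (runs_args (fun i => (args i).correct) L ρ d (d + k) σ hL.1
      (fun r hr => (hρ r hr).2) le_rfl).then (D := _)
      (C' := s.cost L (List.ofFn fun i => (args i).eval L (ρ.map σ.reg)))
      (by
        change _ ≤ (∑ i, (args i).cost L (ρ.map σ.reg)) +
          s.cost L (List.ofFn fun i => (args i).eval L (ρ.map σ.reg)) + 1
        omega) fun τ ⟨h1, h2, h3⟩ => ?_
    have hm : (List.ofFn fun i : Fin k => d + (i : ℕ)).map τ.reg =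
        List.ofFn fun i => (args i).eval L (ρ.map σ.reg) := by
      rw [List.map_ofFn]
      congr 1
      ext i
      exact h1 i
    refine (hs L _ (d + k) τ (hL.of_agree hd h2 h3) (by omega) fun r hr => ?_).mono
      (by rw [hm]) fun υ ⟨h4, h5⟩ => ⟨?_, fun r hr hrd => ?_⟩
    · obtain ⟨i, rfl⟩ := (List.mem_ofFn' _ _).1 hr
      have := i.2
      change 0 < d + (i : ℕ) ∧ d + (i : ℕ) < d + k
      omega
    · rw [out, ← hm]
      exact h4
    · rw [h5 r hr (by omega), h2 r hrd]
  | loop n s hs =>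
    intro L ρ d σ hL hd hρ
    have hρ' : ∀ r ∈ ρ, r < d := fun r hr => (hρ r hr).2
    set env := ρ.map σ.reg with henv
    set N := n.eval L env
    set f : ℕ → List ℕ → List ℕ := fun i o => o ++ s.out (L ++ o) (env ++ [i])
    have hbody : ∀ i < N, ∀ υ : State, (υ.reg d = N - i ∧ υ.reg (d + 1) = i ∧
        Holds (L ++ iter f [] i) υ ∧ AgreeS d σ υ) → υ.reg d ≠ 0 ∧
        Runs (.seq (s.compile (ρ ++ [d + 1]) (d + 2)) (.seq (.const (d + 2) 1)
          (.seq (.add (d + 1) (d + 1) (d + 2)) (.sub d d (d + 2))))) υ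
        (s.cost (L ++ iter f [] i) (env ++ [i]) + 3) fun υ => (υ.reg d = N - (i + 1) ∧
          υ.reg (d + 1) = i + 1 ∧ Holds (L ++ iter f [] (i + 1)) υ ∧ AgreeS d σ υ) := by
      intro i hi υ ⟨g1, g2, g3, g4⟩
      have hm : (ρ ++ [d + 1]).map υ.reg = env ++ [i] := by
        rw [List.map_append, g4.map hρ, List.map_singleton, g2]
      refine ⟨by omega, (hs _ (ρ ++ [d + 1]) (d + 2) υ g3 (by omega) fun r hr => ?_).then
        (by rw [hm]) fun φ ⟨h1, h2⟩ => ?_⟩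
      · rcases List.mem_append.1 hr with hr | hr
        · exact ⟨(hρ r hr).1, (hρ r hr).2.trans (by omega)⟩
        · rw [List.mem_singleton.1 hr]
          omega
      · refine Runs.then (C := 1) (C' := 2) (Runs.const (Q := fun ψ => ψ = _) rfl) (by omega) ?_
        rintro _ rfl
        refine Runs.then (C := 1) (C' := 1) (Runs.add (Q := fun ψ => ψ = _) rfl) (by omega) ?_
        rintro _ rfl
        have e1 := h2 d (by omega) (by omega)
        have e2 := h2 (d + 1) (by omega) (by omega)
        have e3 : 0 ≠ d := by omega
        refine Runs.sub ⟨?_, ?_, ⟨fun i => ?_, ?_⟩, fun r hr hrd => ?_⟩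
        · simp [State.setReg_reg, e1, g1]
          omega
        · simp [State.setReg_reg, e2, g2]
        · rw [hm, List.append_assoc] at h1
          exact h1.1 i
        · rw [hm, List.append_assoc] at h1
          simpa [State.setReg_reg, e3, f] using h1.2
        · have : r ≠ d ∧ r ≠ d + 1 ∧ r ≠ d + 2 := by omega
          simp [State.setReg_reg, this, h2 r hr (by omega), g4 r hr hrd]
    refine (n.correct L ρ d σ hL.1 hρ').then (D := _) (C' := (1 +
      ((∑ j ∈ Finset.range N, (s.cost (L ++ iter f [] j) (env ++ [j]) + 3 + 1) + 1))))
      (by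
        change n.cost L env + _ ≤ n.cost L env + 2 + ∑ j ∈ Finset.range N,
          (s.cost (L ++ iter f [] j) (env ++ [j]) + 4)
        simp only [add_assoc, Nat.reduceAdd]
        omega) fun τ ⟨h1, h2, h3⟩ => ?_
    refine Runs.then (Runs.const (Q := fun ψ => ψ = _) rfl) le_rfl ?_
    rintro _ rfl
    refine (Runs.while _ _ N hbody (fun υ hυ => by rw [hυ.1]; omega)
      ⟨?_, ?_, ⟨fun i => ?_, ?_⟩, fun r hr hrd => ?_⟩).mono le_rfl fun φ ⟨f1, f2, f3, f4⟩ => ⟨f3, f4⟩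
    · simp [State.setReg_reg, h1, N, henv]
    · simp [State.setReg_reg]
    · rw [iter_zero, List.append_nil, State.setReg_mem, h3, hL.1]
    · rw [iter_zero, List.append_nil, State.setReg_reg, if_neg (by omega), h2 0 hd, hL.2]
    · rw [State.setReg_reg, if_neg (by omega), h2 r hrd]

/-- The program that runs the statement `s` on a list whose length is the value of `len`, and
returns the last `res` numbers of the resulting list. -/
def S.prog (len : E) (s : S) (res : E) : Prog :=
  .seq (len.compile [] 1) (.seq (mov 0 1 2) (.seq (s.compile [] 1) (.seq (res.compile [] 1)
    (.seq (.sub 2 0 1) (.seq (.const 3 0) (.seq (.const 4 1) (.whileNZ 1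
      (.seq (.load 5 2) (.seq (.store 3 5) (.seq (.add 2 2 4) (.seq (.add 3 3 4)
        (.sub 1 1 4))))))))))))

/-- The list ends with the result, preceded by the input and by scratch data `A`; a last loop copies
the result to address zero. Source and target may overlap, but copying upwards is safe because the
target never runs ahead of the source. -/
theorem S.computes {len : E} {s : S} {res : E} {inp A out : List ℕ} {C : ℕ}
    (hlen : len.eval inp [] = inp.length) (hs : s.out inp [] = A ++ out)
    (hres : res.eval (inp ++ (A ++ out)) [] = out.length)
    (hC : len.cost inp [] + s.cost inp [] + res.cost (inp ++ (A ++ out)) [] + 6 * out.length + 6 ≤ C) :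
    ∃ T, Computes (s.prog len res) inp out T ∧ T ≤ C := by
  suffices h : Runs (s.prog len res) (initState inp) C fun τ =>
      ∀ i, i < out.length → τ.mem i = out.getD i 0 by
    obtain ⟨τ, T, h1, h2, h3⟩ := h
    exact ⟨T, ⟨τ, h1, h3⟩, h2⟩
  set L := inp ++ (A ++ out) with hL
  set p := (inp ++ A).length with hp
  have hLp : ∀ j, j < out.length → L.getD (p + j) 0 = out.getD j 0 := by
    intro j hj
    rw [hL, ← List.append_assoc, List.getD_append_right _ _ _ _ (by omega), hp,
      Nat.add_sub_cancel_left]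
  refine (len.correct inp [] 1 (initState inp) (fun i => rfl) (by simp)).then
    (C' := 2 + (s.cost inp [] + (res.cost L [] + (1 + (1 + (1 +
      (∑ _i ∈ Finset.range out.length, 6 + 1)))))))
    (by
      rw [Finset.sum_const, Finset.card_range, smul_eq_mul]
      rw [List.map_nil]
      omega) fun σ ⟨h1, h2, h3⟩ => ?_
  refine (Runs.mov (Q := fun ψ => ψ = _) (by omega) rfl).then le_rfl ?_
  rintro _ rfl
  refine (s.correct inp [] 1 _ ⟨fun i => ?_, ?_⟩ (by omega) (by simp)).then le_rfl
    fun σ ⟨h4, h5⟩ => ?_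
  · simp [h3, initState]
  · simpa [State.setReg_reg, h1] using hlen
  rw [List.map_nil, hs] at h4
  refine (res.correct L [] 1 σ h4.1 (by simp)).then le_rfl fun τ ⟨h6, h7, h8⟩ => ?_
  rw [List.map_nil, hres] at h6
  have h9 : τ.reg 0 = p + out.length := by
    rw [h7 0 (by omega), h4.2]
    simp [p]
    omega
  refine Runs.then (Runs.sub (Q := fun ψ => ψ = _) rfl) le_rfl ?_
  rintro _ rfl
  refine Runs.then (Runs.const (Q := fun ψ => ψ = _) rfl) le_rfl ?_
  rintro _ rfl
  refine Runs.then (Runs.const (Q := fun ψ => ψ = _) rfl) le_rfl ?_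
  rintro _ rfl
  -- Registers `1` to `4` hold the remaining length, the source, the target and the constant one.
  -- The last clause says that cells not yet copied have not been overwritten.
  refine (Runs.while (fun i (υ : State) => υ.reg 1 = out.length - i ∧ υ.reg 2 = p + i ∧ υ.reg 3 = i ∧
    υ.reg 4 = 1 ∧ (∀ j < i, υ.mem j = out.getD j 0) ∧ ∀ j, i ≤ j → j < out.length →
      υ.mem (p + j) = out.getD j 0) (fun _ => 5) out.length ?_ (fun υ hυ => by rw [hυ.1]; omega)
      ?_).mono le_rfl fun υ ⟨_, _, _, _, g5, _⟩ => g5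
  · intro i hi υ ⟨g1, g2, g3, g4, g5, g6⟩
    refine ⟨by omega, ?_⟩
    refine Runs.then (C := 1) (C' := 4) (Runs.load (Q := fun ψ => ψ = _) rfl) (by omega) ?_
    rintro _ rfl
    refine Runs.then (C := 1) (C' := 3) (Runs.store (Q := fun ψ => ψ = _) rfl) (by omega) ?_
    rintro _ rfl
    refine Runs.then (C := 1) (C' := 2) (Runs.add (Q := fun ψ => ψ = _) rfl) (by omega) ?_
    rintro _ rfl
    refine Runs.then (C := 1) (C' := 1) (Runs.add (Q := fun ψ => ψ = _) rfl) (by omega) ?_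
    rintro _ rfl
    refine Runs.sub ⟨?_, ?_, ?_, ?_, fun j hj => ?_, fun j hj hj' => ?_⟩
    · simp [State.setReg_reg, State.setMem, g1, g4]
      omega
    · simp [State.setReg_reg, State.setMem, g2, g4, add_assoc]
    · simp [State.setReg_reg, State.setMem, g3, g4]
    · simp [State.setReg_reg, State.setMem, g4]
    · simp only [State.setReg_reg, State.setReg_mem, State.setMem, Function.update_apply]
      norm_num [g2, g3, g6 i le_rfl hi]
      split_ifs with hji
      · rw [hji]
      · simpa using g5 j (by omega)
    · simp only [State.setReg_reg, State.setReg_mem, State.setMem, Function.update_apply]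
      norm_num [g2, g3, g6 i le_rfl hi]
      rw [if_neg (by omega)]
      simpa using g6 j (by omega) hj'
  · refine ⟨by simp [State.setReg_reg, h6], ?_, by simp [State.setReg_reg], by simp [State.setReg_reg],
      fun j hj => by omega, fun j _ hj => ?_⟩
    · simp [State.setReg_reg, h6, h9]
    · simp only [State.setReg_mem]
      rw [h8, h4.1, hLp j hj]

end RAM

namespace RAM

set_option synthInstance.maxHeartbeats 400000
set_option synthInstance.maxSize 4000

/-! ## Automatic evaluation and cost bounds -/

/-- The expression has the value `v`, and its cost is at most `c`. -/
class Sp (e : E) (L ρ : List ℕ) (v c : outParam ℕ) : Prop where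
  eval_eq : e.eval L ρ = v
  cost_le : e.cost L ρ ≤ c

/-- The entry of a list at a position. -/
class Entry (l : List ℕ) (i : ℕ) (v : outParam ℕ) : Prop where
  eq : l.getD i 0 = v

instance (a : ℕ) (l : List ℕ) : Entry (a :: l) 0 a := ⟨rfl⟩

instance (a : ℕ) (l : List ℕ) (i v : ℕ) [h : Entry l i v] : Entry (a :: l) (i + 1) v := ⟨h.1⟩

/-- The concatenation of two lists. -/
class Concat (l m : List ℕ) (l' : outParam (List ℕ)) : Prop where
  eq : l ++ m = l'

instance (m : List ℕ) : Concat [] m m := ⟨rfl⟩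

instance (a : ℕ) (l m l' : List ℕ) [h : Concat l m l'] : Concat (a :: l) m (a :: l') :=
  ⟨by rw [List.cons_append, h.1]⟩

-- Value and cost are output parameters: instance resolution walks through the syntax of a program
-- and computes both. What remains by hand is to bring the resulting terms into a usable form.
section Instances
variable {L ρ ρ' : List ℕ} {a b e : E} {v v' w c c' c'' : ℕ}

instance (i : ℕ) [h : Entry ρ i v] : Sp (.var i) L ρ v 2 := ⟨h.1, le_rfl⟩

instance (k : ℕ) : Sp (.lit k) L ρ k 1 := ⟨rfl, le_rfl⟩

instance [ha : Sp a L ρ v c] [hb : Sp b L ρ v' c'] : Sp (.add a b) L ρ (v + v') (c + c' + 1) :=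
  ⟨by rw [E.eval, ha.1, hb.1], by rw [E.cost]; have := ha.2; have := hb.2; omega⟩

instance [ha : Sp a L ρ v c] [hb : Sp b L ρ v' c'] : Sp (.sub a b) L ρ (v - v') (c + c' + 1) :=
  ⟨by rw [E.eval, ha.1, hb.1], by rw [E.cost]; have := ha.2; have := hb.2; omega⟩

instance [ha : Sp a L ρ v c] : Sp (.half a) L ρ (v / 2) (c + 1) :=
  ⟨by rw [E.eval, ha.1], by rw [E.cost]; have := ha.2; omega⟩

instance [ha : Sp a L ρ v c] : Sp (.ld a) L ρ (L.getD v 0) (c + 1) :=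
  ⟨by rw [E.eval, ha.1], by rw [E.cost]; have := ha.2; omega⟩

instance [he : Sp e L ρ w c''] [ha : Sp a L ρ v c] [hb : Sp b L ρ v' c'] :
    Sp (.cond e a b) L ρ (if w ≠ 0 then v else v') (c'' + c + c' + 1) :=
  ⟨by rw [E.eval, he.1, ha.1, hb.1], by
    rw [E.cost]; have := he.2; have := ha.2; have := hb.2; split_ifs <;> omega⟩

instance [ha : Sp a L ρ v c] [hρ : Concat ρ [v] ρ'] [hb : Sp b L ρ' v' c'] :
    Sp (.bind a b) L ρ v' (c + c' + 2) :=
  ⟨by rw [E.eval, ha.1, hρ.1, hb.1], by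
    rw [E.cost, ha.1, hρ.1]; have := ha.2; have := hb.2; omega⟩

/-- The value and the cost of the body are found as functions of the counter and of the accumulator;
the total cost sums the latter over the actual iterates. -/
instance {F C : ℕ → ℕ → ℕ} {R : ℕ → ℕ → List ℕ} [he : Sp e L ρ w c''] [ha : Sp a L ρ v c]
    [hρ : ∀ i acc, Concat ρ [i, acc] (R i acc)]
    [hb : ∀ i acc, Sp b L (R i acc) (F i acc) (C i acc)] :
    Sp (.fold e a b) L ρ (iter F v w)
      (c'' + c + 4 + ∑ j ∈ Finset.range w, (C j (iter F v j) + 6)) := by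
  have h : (fun i acc => b.eval L (ρ ++ [i, acc])) = F := by
    ext i acc
    rw [(hρ i acc).1]
    exact (hb i acc).1
  refine ⟨by rw [E.eval, he.1, ha.1, h], ?_⟩
  rw [E.cost, he.1, ha.1, h]
  have := he.2
  have := ha.2
  simp only [(hρ _ _).1]
  have := Finset.sum_le_sum fun j (_ : j ∈ Finset.range w) =>
    Nat.add_le_add_right (hb j (iter F v j)).2 6
  omega

end Instances

theorem sum_range_le {n B : ℕ} {f : ℕ → ℕ} (h : ∀ i < n, f i ≤ B) :
    ∑ i ∈ Finset.range n, f i ≤ n * B := by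
  have := Finset.sum_le_card_nsmul (Finset.range n) f B fun i hi => h i (Finset.mem_range.1 hi)
  rwa [Finset.card_range, smul_eq_mul] at this

/-- The general rule for calls. The versions of fixed arity below present the arguments one by one,
so that each can be supplied by a separate instance. -/
theorem Sp.of_call {k : ℕ} {args : Fin k → E} {f : E} {L ρ : List ℕ} {v c : Fin k → ℕ} {w d C: ℕ}
    (h : ∀ i, Sp (args i) L ρ (v i) (c i)) (hf : Sp f L (List.ofFn v) w d)
    (hC : ∑ i, c i + d + 3 ≤ C) :
    Sp (.call k args f) L ρ w C := by
  have e : (fun i => (args i).eval L ρ) = v := funext fun i => (h i).1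
  refine ⟨by rw [E.eval, e, hf.1], ?_⟩
  rw [E.cost, e]
  have := hf.2
  have := Finset.sum_le_sum fun i (_ : i ∈ Finset.univ) => (h i).2
  omega

theorem Sp.call1 {f a : E} {L ρ : List ℕ} {v c w d : ℕ} (ha : Sp a L ρ v c)
    (hf : Sp f L [v] w d) : Sp (.call 1 ![a] f) L ρ w (c + d + 3) :=
  Sp.of_call (v := ![v]) (c := ![c]) (d := d) (by simpa using ha) (by simpa using hf) (by simp)

theorem Sp.call2 {f a a' : E} {L ρ : List ℕ} {v v' c c' w d : ℕ} (ha : Sp a L ρ v c)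
    (ha' : Sp a' L ρ v' c') (hf : Sp f L [v, v'] w d) :
    Sp (.call 2 ![a, a'] f) L ρ w (c + c' + d + 3) :=
  Sp.of_call (v := ![v, v']) (c := ![c, c']) (d := d)
    (by simp [Fin.forall_fin_succ, ha, ha']) (by simpa using hf) (by simp)

theorem Sp.mono {e : E} {L ρ : List ℕ} {v v' c c' : ℕ} (h : Sp e L ρ v c) (hv : v = v')
    (hc : c ≤ c') : Sp e L ρ v' c' := ⟨h.1.trans hv, h.2.trans hc⟩

theorem Sp.call3 {f a0 a1 a2 : E} {L ρ : List ℕ} {v0 v1 v2 c0 c1 c2 w d : ℕ}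
    (h0 : Sp a0 L ρ v0 c0) (h1 : Sp a1 L ρ v1 c1) (h2 : Sp a2 L ρ v2 c2) (hf : Sp f L [v0, v1, v2] w d) :
    Sp (.call 3 ![a0, a1, a2] f) L ρ w
      (c0 + c1 + c2 + d + 3) :=
  Sp.of_call (v := ![v0, v1, v2]) (c := ![c0, c1, c2]) (d := d)
    (by simp [Fin.forall_fin_succ, h0, h1, h2]) (by simpa using hf)
    (by simp [Fin.sum_univ_succ]; omega)

theorem Sp.call4 {f a0 a1 a2 a3 : E} {L ρ : List ℕ} {v0 v1 v2 v3 c0 c1 c2 c3 w d : ℕ}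
    (h0 : Sp a0 L ρ v0 c0) (h1 : Sp a1 L ρ v1 c1) (h2 : Sp a2 L ρ v2 c2) (h3 : Sp a3 L ρ v3 c3) (hf : Sp f L [v0, v1, v2, v3] w d) :
    Sp (.call 4 ![a0, a1, a2, a3] f) L ρ w
      (c0 + c1 + c2 + c3 + d + 3) :=
  Sp.of_call (v := ![v0, v1, v2, v3]) (c := ![c0, c1, c2, c3]) (d := d)
    (by simp [Fin.forall_fin_succ, h0, h1, h2, h3]) (by simpa using hf)
    (by simp [Fin.sum_univ_succ]; omega)

theorem Sp.call5 {f a0 a1 a2 a3 a4 : E} {L ρ : List ℕ} {v0 v1 v2 v3 v4 c0 c1 c2 c3 c4 w d : ℕ}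
    (h0 : Sp a0 L ρ v0 c0) (h1 : Sp a1 L ρ v1 c1) (h2 : Sp a2 L ρ v2 c2) (h3 : Sp a3 L ρ v3 c3) (h4 : Sp a4 L ρ v4 c4) (hf : Sp f L [v0, v1, v2, v3, v4] w d) :
    Sp (.call 5 ![a0, a1, a2, a3, a4] f) L ρ w
      (c0 + c1 + c2 + c3 + c4 + d + 3) :=
  Sp.of_call (v := ![v0, v1, v2, v3, v4]) (c := ![c0, c1, c2, c3, c4]) (d := d)
    (by simp [Fin.forall_fin_succ, h0, h1, h2, h3, h4]) (by simpa using hf)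
    (by simp [Fin.sum_univ_succ]; omega)

theorem Sp.call7 {f a0 a1 a2 a3 a4 a5 a6 : E} {L ρ : List ℕ} {v0 v1 v2 v3 v4 v5 v6 c0 c1 c2 c3 c4 c5 c6 w d : ℕ}
    (h0 : Sp a0 L ρ v0 c0) (h1 : Sp a1 L ρ v1 c1) (h2 : Sp a2 L ρ v2 c2) (h3 : Sp a3 L ρ v3 c3) (h4 : Sp a4 L ρ v4 c4) (h5 : Sp a5 L ρ v5 c5) (h6 : Sp a6 L ρ v6 c6) (hf : Sp f L [v0, v1, v2, v3, v4, v5, v6] w d) :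
    Sp (.call 7 ![a0, a1, a2, a3, a4, a5, a6] f) L ρ w
      (c0 + c1 + c2 + c3 + c4 + c5 + c6 + d + 3) :=
  Sp.of_call (v := ![v0, v1, v2, v3, v4, v5, v6]) (c := ![c0, c1, c2, c3, c4, c5, c6]) (d := d)
    (by simp [Fin.forall_fin_succ, h0, h1, h2, h3, h4, h5, h6]) (by simpa using hf)
    (by simp [Fin.sum_univ_succ]; omega)

theorem Sp.call8 {f a0 a1 a2 a3 a4 a5 a6 a7 : E} {L ρ : List ℕ} {v0 v1 v2 v3 v4 v5 v6 v7 c0 c1 c2 c3 c4 c5 c6 c7 w d : ℕ}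
    (h0 : Sp a0 L ρ v0 c0) (h1 : Sp a1 L ρ v1 c1) (h2 : Sp a2 L ρ v2 c2) (h3 : Sp a3 L ρ v3 c3) (h4 : Sp a4 L ρ v4 c4) (h5 : Sp a5 L ρ v5 c5) (h6 : Sp a6 L ρ v6 c6) (h7 : Sp a7 L ρ v7 c7) (hf : Sp f L [v0, v1, v2, v3, v4, v5, v6, v7] w d) :
    Sp (.call 8 ![a0, a1, a2, a3, a4, a5, a6, a7] f) L ρ w
      (c0 + c1 + c2 + c3 + c4 + c5 + c6 + c7 + d + 3) :=
  Sp.of_call (v := ![v0, v1, v2, v3, v4, v5, v6, v7]) (c := ![c0, c1, c2, c3, c4, c5, c6, c7]) (d := d)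
    (by simp [Fin.forall_fin_succ, h0, h1, h2, h3, h4, h5, h6, h7]) (by simpa using hf)
    (by simp [Fin.sum_univ_succ]; omega)

/-! ## Arithmetic and bits -/

/-- Nonzero if and only if the values differ. -/
def neE (a b : E) : E := .add (.sub a b) (.sub b a)

instance {L ρ : List ℕ} {a b : E} {v v' c c' : ℕ} [Sp a L ρ v c] [Sp b L ρ v' c'] :
    Sp (neE a b) L ρ (v - v' + (v' - v)) (2 * c + 2 * c' + 3) := by
  refine Sp.mono (e := .add (.sub a b) (.sub b a)) inferInstance rfl ?_
  omega

/-- Multiplication by repeated addition has a cost linear in the second factor. Where time is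
critical, in the programs for the hash code, `t₂` and the column number therefore always stand on
the left. -/
def mulE (x y : E) : E := .call 2 ![x, y] (.fold (.var 1) (.lit 0) (.add (.var 3) (.var 0)))

theorem iter_add_const (x y : ℕ) : iter (fun _ acc => acc + x) 0 y = x * y := by
  induction y with
  | zero => simp
  | succ i ih => rw [iter_succ, ih, Nat.mul_succ]

instance {L ρ : List ℕ} {x i : E} {vx vi cx ci : ℕ} [Sp x L ρ vx cx] [Sp i L ρ vi ci] :
    Sp (mulE x i) L ρ (vx * vi) (cx + ci + 11 * vi + 12) := by
  refine (Sp.call2 ‹_› ‹_› inferInstance).mono ?_ ?_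
  · simp [iter_add_const]
  · simp; omega

def shrE (x i : E) : E := .call 2 ![x, i] (.fold (.var 1) (.var 0) (.half (.var 3)))

theorem iter_half (x i : ℕ) : iter (fun _ acc => acc / 2) x i = x / 2 ^ i := by
  induction i with
  | zero => simp
  | succ i ih => rw [iter_succ, ih, Nat.div_div_eq_div_mul, pow_succ]

instance {L ρ : List ℕ} {x i : E} {vx vi cx ci : ℕ} [Sp x L ρ vx cx] [Sp i L ρ vi ci] :
    Sp (shrE x i) L ρ (vx / 2 ^ vi) (cx + ci + 9 * vi + 12) := by
  refine (Sp.call2 ‹_› ‹_› inferInstance).mono ?_ ?_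
  · simp [iter_half]
  · simp; omega

def shlE (x i : E) : E := .call 2 ![x, i] (.fold (.var 1) (.var 0) (.add (.var 3) (.var 3)))

theorem iter_double (x i : ℕ) : iter (fun _ acc => acc + acc) x i = x * 2 ^ i := by
  induction i with
  | zero => simp
  | succ i ih => rw [iter_succ, ih, pow_succ]; ring

instance {L ρ : List ℕ} {x i : E} {vx vi cx ci : ℕ} [Sp x L ρ vx cx] [Sp i L ρ vi ci] :
    Sp (shlE x i) L ρ (vx * 2 ^ vi) (cx + ci + 11 * vi + 12) := by
  refine (Sp.call2 ‹_› ‹_› inferInstance).mono ?_ ?_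
  · simp [iter_double]
  · simp; omega

/-- The remainder modulo `2 ^ i`. -/
def lowE (x i : E) : E := .call 2 ![x, i]
  (.sub (.var 0) (shlE (shrE (.var 0) (.var 1)) (.var 1)))

instance {L ρ : List ℕ} {x i : E} {vx vi cx ci : ℕ} [Sp x L ρ vx cx] [Sp i L ρ vi ci] :
    Sp (lowE x i) L ρ (vx % 2 ^ vi) (cx + ci + 20 * vi + 40) := by
  refine (Sp.call2 ‹_› ‹_› inferInstance).mono ?_ ?_
  · have := Nat.div_add_mod' vx (2 ^ vi)
    omega
  · simp; omega

def bitE (x i : E) : E := .call 2 ![x, i] (.bind (shrE (.var 0) (.var 1))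
  (.sub (.var 2) (.add (.half (.var 2)) (.half (.var 2)))))

instance {L ρ : List ℕ} {x i : E} {vx vi cx ci : ℕ} [Sp x L ρ vx cx] [Sp i L ρ vi ci] :
    Sp (bitE x i) L ρ (vx.testBit vi).toNat (cx + ci + 9 * vi + 40) := by
  refine (Sp.call2 ‹_› ‹_› inferInstance).mono ?_ ?_
  · simp [Nat.toNat_testBit]; omega
  · simp; omega

/-- Horner's rule from the highest bit down: after `i` rounds the accumulator is the number formed
by the bits `w - i, …, w - 1`. -/
theorem iter_horner (g : ℕ → Bool) (w : ℕ) :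
    iter (fun i acc => acc + acc + (g (w - 1 - i)).toNat) 0 w =
      Nat.ofBits fun i : Fin w => g i := by
  have h := iter_eq (f := fun i acc => acc + acc + (g (w - 1 - i)).toNat) (a := 0)
    (fun i => Nat.ofBits fun j : Fin i => g (j + (w - i))) w (by simp) fun i hi => ?_
  · rw [h]
    simp
  · rw [Nat.ofBits_succ, two_mul]
    have e1 : w - 1 - i = 0 + (w - (i + 1)) := by omega
    have e2 : (fun j : Fin i => g (j + (w - i))) =
        (fun j : Fin (i + 1) => g (j + (w - (i + 1)))) ∘ Fin.succ := by
      funext j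
      simp only [Function.comp, Fin.val_succ]
      congr 1
      omega
    rw [e1, e2]
    rfl

/-- Bit by bit, from the top, as the parity of the sum of the two bits; the width `w` has to be
given and the result is truncated to it. -/
def xorE (x y w : E) : E := .call 3 ![x, y, w] (.fold (.var 2) (.lit 0)
  (.bind (.sub (.sub (.var 2) (.lit 1)) (.var 3))
    (.bind (.add (bitE (.var 0) (.var 5)) (bitE (.var 1) (.var 5)))
    (.add (.add (.var 4) (.var 4)) (.sub (.var 6) (.add (.half (.var 6)) (.half (.var 6))))))))

instance {L ρ : List ℕ} {x y w : E} {vx vy vw cx cy cw : ℕ} [Sp x L ρ vx cx] [Sp y L ρ vy cy]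
    [Sp w L ρ vw cw] :
    Sp (xorE x y w) L ρ ((vx ^^^ vy) % 2 ^ vw) (cx + cy + cw + vw * (18 * vw + 150) + 20) := by
  refine (Sp.call3 ‹_› ‹_› ‹_› inferInstance).mono ?_ ?_
  · rw [← Nat.ofBits_testBit, ← iter_horner]
    refine iter_congr _ fun i _ b => ?_
    simp only [Nat.testBit_xor]
    cases vx.testBit (vw - 1 - i) <;> cases vy.testBit (vw - 1 - i) <;> simp
  · generalize hS : Finset.sum (M := ℕ) (Finset.range _) _ = T
    have hT : T ≤ vw * (18 * vw + 150) := hS ▸ sum_range_le fun j hj => by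
      omega
    omega

/-- The product of `a` and `x` as polynomials over `𝔽₂`, reduced with `f`, by Horner's rule. -/
def mulmodStep (a f n acc : ℕ) (b : Bool) : ℕ :=
  let y := if (acc + acc).testBit n = true then ((acc + acc) ^^^ f) % 2 ^ (n + n) else acc + acc
  if b = true then (y ^^^ a) % 2 ^ (n + n) else y

/-- The width `n + n` of the exclusive-ors leaves room for an unreduced product of two numbers of
`n` bits. With `f = 0` the reduction has no effect and the result is the plain product, with `f` of
degree `n` it is the product in the quotient ring. -/
def mulmod (a x f n : ℕ) : ℕ :=
  iter (fun i acc => mulmodStep a f n acc (x.testBit (n - 1 - i))) 0 n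

def mulmodE (a x f n : E) : E := .call 4 ![a, x, f, n] (.fold (.var 3) (.lit 0)
  (.bind (.add (.var 5) (.var 5))
    (.bind (.cond (bitE (.var 6) (.var 3)) (xorE (.var 6) (.var 2) (.add (.var 3) (.var 3)))
      (.var 6))
    (.cond (bitE (.var 1) (.sub (.sub (.var 3) (.lit 1)) (.var 4)))
      (xorE (.var 7) (.var 0) (.add (.var 3) (.var 3))) (.var 7)))))

instance {L ρ : List ℕ} {a x f n : E} {va vx vf vn ca cx cf cn : ℕ} [Sp a L ρ va ca]
    [Sp x L ρ vx cx] [Sp f L ρ vf cf] [Sp n L ρ vn cn] :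
    Sp (mulmodE a x f n) L ρ (mulmod va vx vf vn)
      (ca + cx + cf + cn + 800 * (vn + 1) ^ 3) := by
  refine (Sp.call4 ‹_› ‹_› ‹_› ‹_› inferInstance).mono ?_ ?_
  · simp [mulmod, mulmodStep]
  · generalize hS : Finset.sum (M := ℕ) (Finset.range _) _ = T
    have hT : T ≤ vn * (2 * ((vn + vn) * (18 * (vn + vn) + 150)) + 20 * vn + 300) :=
      hS ▸ sum_range_le fun j hj => by
          omega
    nlinarith

-- A loop that clears its accumulator whenever `P` holds decides a bounded existential quantifier.
@[simp] theorem iter_all (P : ℕ → Prop) [DecidablePred P] (v n : ℕ) :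
    iter (fun i acc => if P i then 0 else acc) v n = if ∃ i < n, P i then 0 else v := by
  induction n with
  | zero => simp
  | succ n ih =>
    rw [iter_succ, ih]
    by_cases h : P n
    · rw [if_pos h, if_pos ⟨n, n.lt_succ_self, h⟩]
    · rw [if_neg h]
      congr 1
      refine propext ⟨fun ⟨i, hi, hp⟩ => ⟨i, by omega, hp⟩, fun ⟨i, hi, hp⟩ => ⟨i, ?_, hp⟩⟩
      rcases Nat.lt_succ_iff_lt_or_eq.1 hi with h' | rfl
      · exact h'
      · exact absurd hp h

/-- The number `m` is the product of two numbers of at most `n` bits, as polynomials. -/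
def Splits (n m : ℕ) : Prop := ∃ a < 2 ^ n, ∃ b < 2 ^ n, mulmod a b 0 n = m

open Classical in
/-- The least polynomial of degree `n` which is not such a product. -/
noncomputable def leastPoly (n : ℕ) : ℕ :=
  -- The candidates run downwards from `2 ^ (n + 1) - 1` and later successes overwrite earlier ones,
  -- so the final value is the least success.
  iter (fun i acc => if Splits n (2 ^ n + 2 ^ n - 1 - i) then acc else 2 ^ n + 2 ^ n - 1 - i) 0 (2 ^ n)

/-- All pairs of factors are tried. The value is nonzero exactly when no pair has the product `m`.
-/
def splitsE (n m : E) : E := .call 2 ![n, m] (.fold (shlE (.lit 1) (.var 0)) (.lit 1)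
  (.fold (shlE (.lit 1) (.var 0)) (.var 3)
    (.cond (neE (mulmodE (.var 2) (.var 4) (.lit 0) (.var 0)) (.var 1)) (.var 5) (.lit 0))))

open Classical in
instance {L ρ : List ℕ} {n m : E} {vn vm cn cm : ℕ} [Sp n L ρ vn cn] [Sp m L ρ vm cm] :
    Sp (splitsE n m) L ρ (if Splits vn vm then 0 else 1)
      (cn + cm + 2 ^ vn * 2 ^ vn * (2000 * (vn + 1) ^ 3)) := by
  have h1 : 1 ≤ 2 ^ vn := Nat.one_le_two_pow
  have h2 : vn + 1 ≤ (vn + 1) ^ 3 := Nat.le_self_pow (by norm_num) _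
  refine (Sp.call2 ‹_› ‹_› inferInstance).mono ?_ ?_
  · have h : ∀ i v, iter (fun j acc => if mulmod i j 0 vn - vm + (vm - mulmod i j 0 vn) ≠ 0 then acc
        else 0) v (2 ^ vn) = if ∃ j < 2 ^ vn, mulmod i j 0 vn = vm then 0 else v := by
      intro i v
      rw [← iter_all]
      refine iter_congr _ fun j _ b => ?_
      by_cases h : mulmod i j 0 vn = vm
      · simp [h]
      · rw [if_neg h, if_pos (by omega)]
    simp only [one_mul, h, iter_all]
    congr
  · generalize 2 ^ vn = P at *
    generalize (vn + 1) ^ 3 = K at *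
    generalize hS : Finset.sum (M := ℕ) (Finset.range _) _ = T
    have hT : T ≤ 1 * P * (P * (1700 * K) + 50 * K) := hS ▸ sum_range_le fun j hj => by
      generalize hS : Finset.sum (M := ℕ) (Finset.range _) _ = T
      have hT : T ≤ 1 * P * (1700 * K) := hS ▸ sum_range_le fun j hj => by omega
      rw [one_mul] at hT
      omega
    nlinarith [Nat.mul_le_mul h1 h2, Nat.mul_le_mul h1 (Nat.mul_le_mul h1 h2)]

/-- A loop that overwrites its accumulator on success returns the last success. This serves the
search for the modulus, for a vector and for a key alike. -/
theorem iter_last (P : ℕ → Prop) [DecidablePred P] (g : ℕ → ℕ) (v n : ℕ) (h : ∃ i < n, P i) :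
    ∃ i < n, P i ∧ (∀ j < n, i < j → ¬ P j) ∧ iter (fun i acc => if P i then g i else acc) v n = g i := by
  induction n with
  | zero => simp at h
  | succ n ih =>
    by_cases hn : P n
    · exact ⟨n, by omega, hn, fun j hj hj' => by omega, by simp [hn]⟩
    · obtain ⟨i, hi, hP⟩ := h
      have : i < n := lt_of_le_of_ne (by omega) fun e => hn (e ▸ hP)
      obtain ⟨k, hk, hPk, hl, he⟩ := ih ⟨i, this, hP⟩
      refine ⟨k, by omega, hPk, fun j hj hkj => ?_, by simp [hn, he]⟩
      rcases Nat.lt_succ_iff_lt_or_eq.1 hj with h' | rfl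
      · exact hl j h' hkj
      · exact hn

theorem leastPoly_eq (n m : ℕ) (hm : 2 ^ n ≤ m) (hm' : m < 2 ^ (n + 1)) (h : ¬ Splits n m)
    (hmin : ∀ m', 2 ^ n ≤ m' → m' < m → Splits n m') : leastPoly n = m := by
  classical
  have e : 2 ^ (n + 1) = 2 ^ n + 2 ^ n := by ring
  have h1 : leastPoly n = iter (fun i acc => if ¬ Splits n (2 ^ n + 2 ^ n - 1 - i) then
      2 ^ n + 2 ^ n - 1 - i else acc) 0 (2 ^ n) := by
    unfold leastPoly
    exact iter_congr _ fun i _ b => by simp only [ite_not]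
  obtain ⟨i, hi, hP, hl, he⟩ := iter_last (fun i => ¬ Splits n (2 ^ n + 2 ^ n - 1 - i))
    (fun i => 2 ^ n + 2 ^ n - 1 - i) 0 (2 ^ n) ⟨2 ^ n + 2 ^ n - 1 - m, by omega, by
      rwa [show 2 ^ n + 2 ^ n - 1 - (2 ^ n + 2 ^ n - 1 - m) = m by omega]⟩
  rw [h1, he]
  rcases lt_trichotomy (2 ^ n + 2 ^ n - 1 - i) m with hlt | heq | hgt
  · exact absurd (hmin _ (by omega) hlt) hP
  · exact heq
  · refine absurd ?_ (hl (2 ^ n + 2 ^ n - 1 - m) (by omega) (by omega))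
    rwa [show 2 ^ n + 2 ^ n - 1 - (2 ^ n + 2 ^ n - 1 - m) = m by omega]

def leastPolyE (n : E) : E := .call 1 ![n] (.bind (shlE (.lit 1) (.var 0))
  (.fold (.var 1) (.lit 0) (.bind (.sub (.sub (.add (.var 1) (.var 1)) (.lit 1)) (.var 2))
    (.cond (splitsE (.var 0) (.var 4)) (.var 4) (.var 3)))))

/-- There are `2 ^ n` candidates with `2 ^ n * 2 ^ n` products each. Finding the modulus by brute
force is thus no worse than the search of one column. -/
instance {L ρ : List ℕ} {n : E} {vn cn : ℕ} [Sp n L ρ vn cn] :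
    Sp (leastPolyE n) L ρ (leastPoly vn) (cn + (2 ^ vn) ^ 3 * (3000 * (vn + 1) ^ 3)) := by
  classical
  have h1 : 1 ≤ 2 ^ vn := Nat.one_le_two_pow
  have h2 : vn + 1 ≤ (vn + 1) ^ 3 := Nat.le_self_pow (by norm_num) _
  refine (Sp.call1 ‹_› inferInstance).mono ?_ ?_
  · rw [leastPoly, one_mul]
    refine iter_congr _ fun i _ b => ?_
    split_ifs <;> simp_all
  · generalize 2 ^ vn = P at *
    generalize (vn + 1) ^ 3 = K at *
    generalize hS : Finset.sum (M := ℕ) (Finset.range _) _ = T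
    have hT : T ≤ 1 * P * (P * P * (2000 * K) + 50) := hS ▸ sum_range_le fun j hj => by
      omega
    have h3 : 1 ≤ P * P := Nat.mul_le_mul h1 h1
    have h4 : 1 ≤ P * P * P := Nat.mul_le_mul h3 h1
    have e : 1 * P * (P * P * (2000 * K) + 50) + 100 * K + cn ≤ cn + P ^ 3 * (3000 * K) := by
      have : P ≤ P * P * P := by nlinarith
      nlinarith [Nat.mul_le_mul h4 h2]
    omega

end RAM

namespace RAM

set_option synthInstance.maxHeartbeats 400000
set_option synthInstance.maxSize 4000

/-! ## The search for a key -/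

/-- Addition in characteristic two is exclusive-or; the truncation only reflects the width of `xorE`
and never acts on numbers of `n` bits. -/
def hashNat (a b x f n : ℕ) : ℕ := (mulmod a x f n ^^^ b) % 2 ^ (n + n)

def hashE (a b x f n : E) : E := .call 5 ![a, b, x, f, n]
  (xorE (mulmodE (.var 0) (.var 2) (.var 3) (.var 4)) (.var 1) (.add (.var 4) (.var 4)))

instance {L ρ : List ℕ} {a b x f n : E} {va vb vx vf vn ca cb cx cf cn : ℕ} [Sp a L ρ va ca]
    [Sp b L ρ vb cb] [Sp x L ρ vx cx] [Sp f L ρ vf cf] [Sp n L ρ vn cn] :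
    Sp (hashE a b x f n) L ρ (hashNat va vb vx vf vn)
      (ca + cb + cx + cf + cn + 1400 * (vn + 1) ^ 3) := by
  refine (Sp.call5 ‹_› ‹_› ‹_› ‹_› ‹_› inferInstance).mono rfl ?_
  have : (vn + 1) ^ 3 = vn ^ 3 + 3 * vn ^ 2 + 3 * vn + 1 := by ring
  have := Nat.zero_le (vn ^ 3)
  nlinarith

/-- The number of reasons why the vector `x` is not suitable for the key `c`. -/
def failCount (L : List ℕ) (n k f w c pm ps x : ℕ) : ℕ :=
  let h := hashNat (c % 2 ^ n) (c / 2 ^ n) x f n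
  let s := ∑ b ∈ Finset.range n, (x.testBit b).toNat
  -- A cut-off difference of bits is positive only where `x` has a one outside the state. Adding the
  -- cut-off differences in both directions gives an absolute difference, used to test the weight
  -- and the hash bits. The number `c` encodes the key with `a = c % 2 ^ n` and `b = c / 2 ^ n`.
  ∑ b ∈ Finset.range n, ((x.testBit b).toNat - L.getD (ps + b) 0) + ((s - w + (w - s)) +
    ∑ b ∈ Finset.range k, ((h.testBit b).toNat - L.getD (pm + b) 0 +
      (L.getD (pm + b) 0 - (h.testBit b).toNat)))

def failE (n k f w c pm ps x : E) : E := .call 8 ![n, k, f, w, c, pm, ps, x]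
  (.bind (hashE (lowE (.var 4) (.var 0)) (shrE (.var 4) (.var 0)) (.var 7) (.var 2) (.var 0))
  (.add (.fold (.var 0) (.lit 0) (.add (.var 10) (.sub (bitE (.var 7) (.var 9))
      (.ld (.add (.var 6) (.var 9))))))
    (.add (neE (.fold (.var 0) (.lit 0) (.add (.var 10) (bitE (.var 7) (.var 9)))) (.var 3))
      (.fold (.var 1) (.lit 0) (.add (.var 10) (neE (bitE (.var 8) (.var 9))
        (.ld (.add (.var 5) (.var 9)))))))))

instance {L ρ : List ℕ} {n k f w c pm ps x : E} {vn vk vf vw vc vpm vps vx : ℕ}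
    {cn ck cf cw cc cpm cps cx : ℕ} [Sp n L ρ vn cn] [Sp k L ρ vk ck] [Sp f L ρ vf cf]
    [Sp w L ρ vw cw] [Sp c L ρ vc cc] [Sp pm L ρ vpm cpm] [Sp ps L ρ vps cps] [Sp x L ρ vx cx] :
    Sp (failE n k f w c pm ps x) L ρ (failCount L vn vk vf vw vc vpm vps vx)
      (cn + ck + cf + cw + cc + cpm + cps + cx + 2500 * (vn + vk + 1) ^ 3) := by
  refine (Sp.call8 ‹_› ‹_› ‹_› ‹_› ‹_› ‹_› ‹_› ‹_› inferInstance).mono ?_ ?_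
  · simp only [iter_add_eq_sum, failCount]
  · generalize hS : Finset.sum (M := ℕ) (Finset.range vn) _ = T
    generalize hS' : Finset.sum (M := ℕ) (Finset.range vn) _ = T'
    generalize hS'' : Finset.sum (M := ℕ) (Finset.range vk) _ = T''
    have hT : T ≤ vn * (9 * vn + 100) := hS ▸ sum_range_le fun j hj => by omega
    have hT' : T' ≤ vn * (9 * vn + 100) := hS' ▸ sum_range_le fun j hj => by omega
    have hT'' : T'' ≤ vk * (18 * vk + 200) := hS'' ▸ sum_range_le fun j hj => by omega
    have h1 : (vn + 1) ^ 3 ≤ (vn + vk + 1) ^ 3 := Nat.pow_le_pow_left (by omega) 3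
    have h2 : (vn + vk + 1) ^ 2 ≤ (vn + vk + 1) ^ 3 := Nat.pow_le_pow_right (by omega) (by omega)
    have h3 : (vn + vk + 1) ^ 2 = vn ^ 2 + vk ^ 2 + 2 * (vn * vk) + 2 * vn + 2 * vk + 1 := by ring
    nlinarith

/-- `0` if no vector is suitable, otherwise the successor of a suitable vector. -/
def findX (L : List ℕ) (n k f w c pm ps : ℕ) : ℕ :=
  iter (fun x acc => if failCount L n k f w c pm ps x ≠ 0 then acc else x + 1) 0 (2 ^ n)

def findXE (n k f w c pm ps : E) : E := .call 7 ![n, k, f, w, c, pm, ps]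
  (.fold (shlE (.lit 1) (.var 0)) (.lit 0) (.cond
    (failE (.var 0) (.var 1) (.var 2) (.var 3) (.var 4) (.var 5) (.var 6) (.var 7)) (.var 8)
    (.add (.var 7) (.lit 1))))

instance {L ρ : List ℕ} {n k f w c pm ps : E} {vn vk vf vw vc vpm vps : ℕ}
    {cn ck cf cw cc cpm cps : ℕ} [Sp n L ρ vn cn] [Sp k L ρ vk ck] [Sp f L ρ vf cf]
    [Sp w L ρ vw cw] [Sp c L ρ vc cc] [Sp pm L ρ vpm cpm] [Sp ps L ρ vps cps] :
    Sp (findXE n k f w c pm ps) L ρ (findX L vn vk vf vw vc vpm vps)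
      (cn + ck + cf + cw + cc + cpm + cps + 2 ^ vn * (2600 * (vn + vk + 1) ^ 3)) := by
  refine (Sp.call7 ‹_› ‹_› ‹_› ‹_› ‹_› ‹_› ‹_› inferInstance).mono ?_ ?_
  · rw [one_mul]
    rfl
  · have h1 : 1 ≤ 2 ^ vn := Nat.one_le_two_pow
    have h2 : vn + vk + 1 ≤ (vn + vk + 1) ^ 3 := Nat.le_self_pow (by norm_num) _
    generalize 2 ^ vn = P at *
    generalize (vn + vk + 1) ^ 3 = K at *
    generalize hS : Finset.sum (M := ℕ) (Finset.range _) _ = T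
    have hT : T ≤ 1 * P * (2500 * K + 50) := hS ▸ sum_range_le fun j hj => by omega
    nlinarith [Nat.mul_le_mul h1 h2]

/-- Not zero if and only if there are suitable vectors in all `t₁` blocks of a column. -/
def goodKey (L : List ℕ) (n k f w t₁ c pm ps : ℕ) : ℕ :=
  iter (fun i acc => if findX L n k f w c (pm + i * k) (ps + i * n) ≠ 0 then acc else 0) 1 t₁

def goodKeyE (n k f w t₁ c pm ps : E) : E := .call 8 ![n, k, f, w, t₁, c, pm, ps]
  (.fold (.var 4) (.lit 1) (.cond (findXE (.var 0) (.var 1) (.var 2) (.var 3) (.var 5)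
    (.add (.var 6) (mulE (.var 8) (.var 1))) (.add (.var 7) (mulE (.var 8) (.var 0))))
    (.var 9) (.lit 0)))

instance {L ρ : List ℕ} {n k f w t₁ c pm ps : E} {vn vk vf vw vt vc vpm vps : ℕ}
    {cn ck cf cw ct cc cpm cps : ℕ} [Sp n L ρ vn cn] [Sp k L ρ vk ck] [Sp f L ρ vf cf]
    [Sp w L ρ vw cw] [Sp t₁ L ρ vt ct] [Sp c L ρ vc cc] [Sp pm L ρ vpm cpm] [Sp ps L ρ vps cps] :
    Sp (goodKeyE n k f w t₁ c pm ps) L ρ (goodKey L vn vk vf vw vt vc vpm vps)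
      (cn + ck + cf + cw + ct + cc + cpm + cps +
        (vt * (2 ^ vn * (2800 * (vn + vk + 1) ^ 3)) + 20)) := by
  refine (Sp.call8 ‹_› ‹_› ‹_› ‹_› ‹_› ‹_› ‹_› ‹_› inferInstance).mono rfl ?_
  have h1 : 1 ≤ 2 ^ vn := Nat.one_le_two_pow
  have h2 : vn + vk + 1 ≤ (vn + vk + 1) ^ 3 := Nat.le_self_pow (by norm_num) _
  have h3 := Nat.mul_le_mul h1 h2
  generalize 2 ^ vn = P at *
  generalize (vn + vk + 1) ^ 3 = K at *
  generalize hS : Finset.sum (M := ℕ) (Finset.range _) _ = T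
  have hT : T ≤ vt * (P * (2800 * K)) := hS ▸ sum_range_le fun j hj => by
    have : P * (2800 * K) = P * (2600 * K) + 200 * (P * K) := by ring
    omega
  omega

/-- A key that is suitable for a column, if there is one. -/
def findKey (L : List ℕ) (n k f w t₁ pm ps : ℕ) : ℕ :=
  iter (fun c acc => if goodKey L n k f w t₁ c pm ps ≠ 0 then c else acc) 0 (2 ^ (n + n))

def findKeyE (n k f w t₁ pm ps : E) : E := .call 7 ![n, k, f, w, t₁, pm, ps]
  (.fold (shlE (.lit 1) (.add (.var 0) (.var 0))) (.lit 0) (.cond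
    (goodKeyE (.var 0) (.var 1) (.var 2) (.var 3) (.var 4) (.var 7) (.var 5) (.var 6)) (.var 7)
    (.var 8)))

/-- The dominating cost of the encoder: `2 ^ (2n)` keys, `t₁` blocks for each key, `2 ^ n` vectors
for each block. -/
instance {L ρ : List ℕ} {n k f w t₁ pm ps : E} {vn vk vf vw vt vpm vps : ℕ}
    {cn ck cf cw ct cpm cps : ℕ} [Sp n L ρ vn cn] [Sp k L ρ vk ck] [Sp f L ρ vf cf]
    [Sp w L ρ vw cw] [Sp t₁ L ρ vt ct] [Sp pm L ρ vpm cpm] [Sp ps L ρ vps cps] :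
    Sp (findKeyE n k f w t₁ pm ps) L ρ (findKey L vn vk vf vw vt vpm vps)
      (cn + ck + cf + cw + ct + cpm + cps +
        (2 ^ (vn + vn) * ((vt + 1) * (2 ^ vn * (3000 * (vn + vk + 1) ^ 3))))) := by
  refine (Sp.call7 ‹_› ‹_› ‹_› ‹_› ‹_› ‹_› ‹_› inferInstance).mono ?_ ?_
  · rw [one_mul]
    rfl
  have h1 : 1 ≤ 2 ^ vn := Nat.one_le_two_pow
  have h0 : 1 ≤ 2 ^ (vn + vn) := Nat.one_le_two_pow
  have h2 : vn + vk + 1 ≤ (vn + vk + 1) ^ 3 := Nat.le_self_pow (by norm_num) _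
  have h3 := Nat.mul_le_mul h1 h2
  generalize 2 ^ vn = P at *
  generalize 2 ^ (vn + vn) = Q at *
  generalize (vn + vk + 1) ^ 3 = K at *
  generalize hS : Finset.sum (M := ℕ) (Finset.range _) _ = T
  have hT : T ≤ 1 * Q * (vt * (P * (2800 * K)) + 60) := hS ▸ sum_range_le fun j hj => by
    omega
  have h4 := Nat.mul_le_mul h0 h3
  have e : Q * ((vt + 1) * (P * (3000 * K))) = Q * (vt * (P * (2800 * K))) +
    200 * (Q * (vt * (P * K))) + 3000 * (Q * (P * K)) := by ring
  have e2 : 1 * Q * (vt * (P * (2800 * K)) + 60) = Q * (vt * (P * (2800 * K))) + 60 * Q := by ring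
  have h5 : Q ≤ Q * (P * K) := Nat.le_mul_of_pos_right _ (by nlinarith)
  nlinarith

end RAM

namespace RankMod
open Polynomial RAM

/-! ## Polynomials over `𝔽₂` as natural numbers -/

/-- Valid for every `i`, also beyond the range of the defining sum, where the bits of `m` vanish.
All further facts about `natPoly` are read off from its coefficients. -/
theorem coeff_natPoly (m i : ℕ) : (natPoly m).coeff i = if m.testBit i = true then 1 else 0 := by
  unfold natPoly
  rw [finsetSum_coeff]
  have h : ∀ j ∈ Finset.range m.size, (if m.testBit j = true then (X : (ZMod 2)[X]) ^ j else 0).coeff i =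
      if i = j then (if m.testBit i = true then 1 else 0) else 0 := by
    intro j _
    by_cases hij : i = j
    · subst hij
      by_cases hb : m.testBit i = true <;> simp [hb]
    · by_cases hb : m.testBit j = true <;> simp [hb, hij, coeff_X_pow]
  rw [Finset.sum_congr rfl h, Finset.sum_ite_eq]
  split_ifs with h1 h2 h2 <;> try rfl
  refine absurd ?_ h1
  by_contra hlt
  rw [Finset.mem_range] at hlt
  rw [Nat.testBit_eq_false_of_lt (lt_of_lt_of_le (Nat.lt_size_self m)
    (Nat.pow_le_pow_right (by norm_num) (not_lt.1 hlt)))] at h2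
  exact absurd h2 (by simp)

theorem natPoly_injective : Function.Injective natPoly := by
  intro a b h
  refine Nat.eq_of_testBit_eq fun i => ?_
  have := congrArg (fun p : (ZMod 2)[X] => p.coeff i) h
  simp only [coeff_natPoly] at this
  by_cases ha : a.testBit i = true <;> by_cases hb : b.testBit i = true <;> simp_all

@[simp] theorem natPoly_zero : natPoly 0 = 0 := by
  ext i
  simp [coeff_natPoly]

theorem natPoly_xor (a b : ℕ) : natPoly (a ^^^ b) = natPoly a + natPoly b := by
  ext i
  rw [coeff_add, coeff_natPoly, coeff_natPoly, coeff_natPoly, Nat.testBit_xor]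
  cases a.testBit i <;> cases b.testBit i <;> simp
  decide

theorem natPoly_double (a : ℕ) : natPoly (a + a) = X * natPoly a := by
  ext i
  rw [← two_mul]
  cases i with
  | zero => simp [coeff_natPoly]
  | succ i => rw [coeff_X_mul, coeff_natPoly, coeff_natPoly, Nat.testBit_succ]; simp

theorem natPoly_bit (a : ℕ) (b : Bool) : natPoly (2 * a + b.toNat) =
    X * natPoly a + if b = true then 1 else 0 := by
  ext i
  rw [coeff_add]
  cases i with
  | zero =>
    cases b <;> simp [coeff_natPoly, Nat.testBit_zero]
  | succ i =>
    rw [coeff_X_mul, coeff_natPoly, coeff_natPoly, Nat.testBit_succ]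
    cases b
    · simp
    · simp [coeff_one, show (2 * a + 1) / 2 = a by omega]

theorem degree_natPoly_lt {m n : ℕ} : (natPoly m).degree < n ↔ m < 2 ^ n := by
  rw [degree_lt_iff_coeff_zero]
  constructor
  · intro h
    refine Nat.lt_pow_two_of_testBit _ fun i hi => ?_
    have := h i hi
    rw [coeff_natPoly] at this
    by_contra hb
    simp_all
  · intro h i hi
    rw [coeff_natPoly, Nat.testBit_eq_false_of_lt
      (h.trans_le (Nat.pow_le_pow_right (by norm_num) hi))]
    simp

theorem exists_natPoly (p : (ZMod 2)[X]) : ∃ m, natPoly m = p := by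
  refine ⟨Nat.ofBits fun i : Fin (p.natDegree + 1) => decide (p.coeff i = 1), ?_⟩
  ext i
  rw [coeff_natPoly]
  by_cases hi : i < p.natDegree + 1
  · rw [Nat.testBit_ofBits_lt _ _ hi]
    simp only [decide_eq_true_eq]
    generalize p.coeff i = c
    revert c
    decide
  · rw [Nat.testBit_ofBits_ge _ _ (not_lt.1 hi), coeff_eq_zero_of_natDegree_lt (by omega)]
    simp

/-- The case `n = 0` is excluded because the zero polynomial also has `natDegree` zero. -/
theorem natDegree_natPoly {m n : ℕ} (hn : n ≠ 0) :
    (natPoly m).natDegree = n ↔ 2 ^ n ≤ m ∧ m < 2 ^ (n + 1) := by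
  have h1 : (natPoly m).degree < (n + 1 : ℕ) ↔ (natPoly m).natDegree < n + 1 := by
    by_cases h0 : natPoly m = 0
    · simp [h0]
    · exact (natDegree_lt_iff_degree_lt h0).symm
  have h2 : (natPoly m).degree < n ↔ (natPoly m).natDegree < n := by
    by_cases h0 : natPoly m = 0
    · simp [h0, Nat.pos_of_ne_zero hn]
    · exact (natDegree_lt_iff_degree_lt h0).symm
  rw [degree_natPoly_lt] at h1 h2
  rw [h1, ← not_lt, h2]
  omega

/-- The only nonzero coefficient available in 𝔽₂ is one. -/
theorem monic_of_ne_zero {p : (ZMod 2)[X]} (hp : p ≠ 0) : p.Monic := by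
  have h : p.leadingCoeff ≠ 0 := leadingCoeff_ne_zero.2 hp
  unfold Monic
  generalize p.leadingCoeff = c at *
  revert c
  decide

theorem natPoly_ofBits {n : ℕ} (x : Fin n → Bool) : natPoly (Nat.ofBits x) = bitPoly x := by
  ext i
  rw [coeff_natPoly]
  unfold bitPoly
  rw [finsetSum_coeff]
  have h : ∀ j ∈ (Finset.univ : Finset (Fin n)), (if x j = true then (X : (ZMod 2)[X]) ^ (j : ℕ) else 0).coeff i =
      if i = (j : ℕ) then (if x j = true then 1 else 0) else 0 := by
    intro j _
    by_cases hij : i = j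
    · by_cases hb : x j = true <;> simp [hb, hij]
    · by_cases hb : x j = true <;> simp [hb, hij, coeff_X_pow]
  rw [Finset.sum_congr rfl h]
  by_cases hi : i < n
  · rw [Nat.testBit_ofBits_lt _ _ hi, Finset.sum_eq_single ⟨i, hi⟩]
    · simp
    · intro j _ hj
      rw [if_neg]
      rintro rfl
      exact hj rfl
    · simp
  · rw [Nat.testBit_ofBits_ge _ _ (not_lt.1 hi), Finset.sum_eq_zero]
    · simp
    · intro j _
      rw [if_neg]
      have := j.2
      omega

/-! ## Multiplication -/

/-- `B` bounds the bit length after the step. As long as `B ≤ 2n` the truncations are invisible, and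
the step is a Horner step up to a multiple of `f`. -/
theorem mulmodStep_spec {a f n acc B : ℕ} (b : Bool) (ha : a < 2 ^ B) (hB : B ≤ n + n)
    (h : (if (acc + acc).testBit n = true then (acc + acc) ^^^ f else acc + acc) < 2 ^ B) :
    mulmodStep a f n acc b < 2 ^ B ∧ ∃ q, natPoly (mulmodStep a f n acc b) =
      X * natPoly acc + (if b = true then natPoly a else 0) + q * natPoly f := by
  have hBn : 2 ^ B ≤ 2 ^ (n + n) := Nat.pow_le_pow_right (by norm_num) hB
  have e : mulmodStep a f n acc b = if b = true then
      (if (acc + acc).testBit n = true then (acc + acc) ^^^ f else acc + acc) ^^^ a else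
      (if (acc + acc).testBit n = true then (acc + acc) ^^^ f else acc + acc) := by
    have e1 : (if (acc + acc).testBit n = true then ((acc + acc) ^^^ f) % 2 ^ (n + n) else acc + acc) =
        if (acc + acc).testBit n = true then (acc + acc) ^^^ f else acc + acc := by
      by_cases hb : (acc + acc).testBit n = true
      · rw [if_pos hb] at h
        rw [if_pos hb, if_pos hb, Nat.mod_eq_of_lt (h.trans_le hBn)]
      · rw [if_neg hb, if_neg hb]
    unfold mulmodStep
    rw [e1]
    by_cases hb : b = true
    · rw [if_pos hb, if_pos hb, Nat.mod_eq_of_lt ((Nat.xor_lt_two_pow h ha).trans_le hBn)]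
    · rw [if_neg hb, if_neg hb]
  have hq : ∃ q, natPoly (if (acc + acc).testBit n = true then (acc + acc) ^^^ f else acc + acc) =
      X * natPoly acc + q * natPoly f := by
    by_cases hb : (acc + acc).testBit n = true
    · exact ⟨1, by rw [if_pos hb, natPoly_xor, natPoly_double, one_mul]⟩
    · exact ⟨0, by rw [if_neg hb, natPoly_double, zero_mul, add_zero]⟩
  obtain ⟨q, hq⟩ := hq
  rw [e]
  by_cases hb : b = true
  · rw [if_pos hb]
    refine ⟨Nat.xor_lt_two_pow h ha, q, ?_⟩
    rw [natPoly_xor, hq, if_pos hb]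
    ring
  · rw [if_neg hb]
    refine ⟨h, q, ?_⟩
    rw [hq, if_neg hb, add_zero]

/-- Invariant: after `i` rounds the accumulator has at most `B i` bits and is congruent modulo `f`
to `a` times the number formed by the top `i` bits of `x`. The profile `B` is left open so that both
the reduced and the unreduced product are covered. -/
theorem mulmod_spec {a x f n : ℕ} (B : ℕ → ℕ) (ha : ∀ i < n, a < 2 ^ B (i + 1)) (hx : x < 2 ^ n)
    (hB : ∀ i < n, B (i + 1) ≤ n + n)
    (h : ∀ i < n, ∀ acc < 2 ^ B i, (if (acc + acc).testBit n = true then (acc + acc) ^^^ f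
      else acc + acc) < 2 ^ B (i + 1)) :
    mulmod a x f n < 2 ^ B n ∧ ∃ q, natPoly (mulmod a x f n) =
      natPoly a * natPoly x + q * natPoly f := by
  have := iter_invariant (f := fun i acc => mulmodStep a f n acc (x.testBit (n - 1 - i))) (a := 0)
    (fun i acc => acc < 2 ^ B i ∧ ∃ q, natPoly acc =
      natPoly a * natPoly (x / 2 ^ (n - i)) + q * natPoly f) n ?_ ?_
  · simpa [mulmod] using this
  · refine ⟨by positivity, 0, ?_⟩
    rw [Nat.sub_zero, Nat.div_eq_of_lt hx]
    simp
  · rintro i hi acc ⟨h1, q, h2⟩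
    obtain ⟨h3, q', h4⟩ := mulmodStep_spec (x.testBit (n - 1 - i)) (ha i hi) (hB i hi) (h i hi acc h1)
    refine ⟨h3, X * q + q', ?_⟩
    have e : x / 2 ^ (n - (i + 1)) = 2 * (x / 2 ^ (n - i)) + (x.testBit (n - 1 - i)).toNat := by
      rw [Nat.toNat_testBit, show n - i = n - (i + 1) + 1 by omega, pow_succ,
        ← Nat.div_div_eq_div_mul, show n - 1 - i = n - (i + 1) by omega]
      omega
    rw [h4, h2, e, natPoly_bit]
    split_ifs <;> ring

/-- With `f = 0` nothing is reduced and the bit length grows by one in each round, so `B i = n + i`.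
-/
theorem natPoly_clmul {a b n : ℕ} (ha : a < 2 ^ n) (hb : b < 2 ^ n) :
    natPoly (mulmod a b 0 n) = natPoly a * natPoly b := by
  obtain ⟨-, q, h⟩ := mulmod_spec (a := a) (x := b) (f := 0) (n := n) (fun i => n + i)
    (fun i hi => ha.trans_le (Nat.pow_le_pow_right (by norm_num) (by omega))) hb
    (fun i hi => by omega) fun i hi acc hacc => by
      have : 2 ^ (n + (i + 1)) = 2 * 2 ^ (n + i) := by ring
      split_ifs
      · rw [Nat.xor_zero]
        omega
      · omega
  simpa using h

/-- Here `f` has leading bit `n`. Whenever doubling produces bit `n`, the exclusive-or with `f`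
removes it, so the accumulator keeps `n` bits throughout. -/
theorem mulmod_lt {a x f n : ℕ} (ha : a < 2 ^ n) (hx : x < 2 ^ n) (hf : 2 ^ n ≤ f)
    (hf' : f < 2 ^ (n + 1)) :
    mulmod a x f n < 2 ^ n ∧ ∃ q, natPoly (mulmod a x f n) =
      natPoly a * natPoly x + q * natPoly f := by
  refine mulmod_spec (fun i => n) (fun i hi => ha) hx (fun i hi => by omega) fun i hi acc hacc => ?_
  have e : 2 ^ (n + 1) = 2 * 2 ^ n := by ring
  have hlt : acc + acc < 2 ^ (n + 1) := by omega
  have bit_f : f.testBit n = true := by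
    rw [Nat.testBit_eq_decide_div_mod_eq, decide_eq_true_eq]
    have : f / 2 ^ n = 1 := by
      refine Nat.div_eq_of_lt_le (by omega) (by omega)
    rw [this]
  split_ifs with hb
  · refine Nat.lt_pow_two_of_testBit _ fun j hj => ?_
    rw [Nat.testBit_xor]
    rcases eq_or_lt_of_le hj with rfl | hj'
    · rw [hb, bit_f]
      rfl
    · have hp : 2 ^ (n + 1) ≤ 2 ^ j := Nat.pow_le_pow_right (by norm_num) hj'
      rw [Nat.testBit_eq_false_of_lt (hlt.trans_le hp), Nat.testBit_eq_false_of_lt (hf'.trans_le hp)]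
      rfl
  · by_contra hge
    refine hb ?_
    rw [Nat.testBit_eq_decide_div_mod_eq, decide_eq_true_eq]
    have : (acc + acc) / 2 ^ n = 1 := Nat.div_eq_of_lt_le (by omega) (by omega)
    rw [this]

end RankMod

/-! ### Irreducible polynomials over 𝔽₂ and the values of the hash functions -/

namespace RankMod
open Polynomial RAM

/-- The minimal polynomial of a primitive element of the field with 2^n elements. -/
theorem exists_irreducible_natDegree {n : ℕ} (hn : n ≠ 0) :
    ∃ m, Irreducible (natPoly m) ∧ (natPoly m).natDegree = n := by
  have : Fact (Nat.Prime 2) := ⟨Nat.prime_two⟩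
  obtain ⟨α, hα⟩ := Field.exists_primitive_element (ZMod 2) (GaloisField 2 n)
  have h1 := (Field.primitive_element_iff_minpoly_natDegree_eq (ZMod 2) α).1 hα
  rw [GaloisField.finrank 2 hn] at h1
  obtain ⟨m, hm⟩ := exists_natPoly (minpoly (ZMod 2) α)
  exact ⟨m, hm ▸ minpoly.irreducible (Algebra.IsIntegral.isIntegral α), by rw [hm, h1]⟩

/-- Over 𝔽₂ the units are the nonzero constants, so a proper factor of a polynomial of degree `n`
has positive degree less than `n` and is a number below `2 ^ n`. Conversely, two factors below `2 ^
n` have degrees less than `n` with sum `n`, so neither is a unit. -/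
theorem irreducible_natPoly_iff {n m : ℕ} (hn : n ≠ 0) (hm : 2 ^ n ≤ m) (hm' : m < 2 ^ (n + 1)) :
    Irreducible (natPoly m) ↔ ¬ Splits n m := by
  have hdeg : (natPoly m).natDegree = n := (natDegree_natPoly hn).2 ⟨hm, hm'⟩
  have hm0 : natPoly m ≠ 0 := by
    intro h
    rw [h, natDegree_zero] at hdeg
    exact hn hdeg.symm
  have hlt : ∀ a, a < 2 ^ n → (natPoly a).natDegree < n := by
    intro a ha
    by_cases h0 : natPoly a = 0
    · rw [h0, natDegree_zero]
      omega
    · exact (natDegree_lt_iff_degree_lt h0).2 (degree_natPoly_lt.2 ha)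
  constructor
  · rintro h ⟨a, ha, b, hb, hab⟩
    have e := natPoly_clmul ha hb
    rw [hab] at e
    have ha0 : natPoly a ≠ 0 := fun h0 => hm0 (by rw [e, h0, zero_mul])
    have hb0 : natPoly b ≠ 0 := fun h0 => hm0 (by rw [e, h0, mul_zero])
    have hd := natDegree_mul ha0 hb0
    rw [← e, hdeg] at hd
    have := hlt a ha
    have := hlt b hb
    rcases h.isUnit_or_isUnit e with hu | hu
    · have := natDegree_eq_zero_of_isUnit hu
      omega
    · have := natDegree_eq_zero_of_isUnit hu
      omega
  · intro h
    refine ⟨fun hu => hn (by rw [← hdeg, natDegree_eq_zero_of_isUnit hu]), fun p q hpq => ?_⟩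
    by_contra hcon
    push Not at hcon
    have hp0 : p ≠ 0 := fun h0 => hm0 (by rw [hpq, h0, zero_mul])
    have hq0 : q ≠ 0 := fun h0 => hm0 (by rw [hpq, h0, mul_zero])
    have hpd : p.natDegree ≠ 0 := fun h0 => hcon.1 (by
      rw [(monic_of_ne_zero hp0).natDegree_eq_zero.1 h0]
      exact isUnit_one)
    have hqd : q.natDegree ≠ 0 := fun h0 => hcon.2 (by
      rw [(monic_of_ne_zero hq0).natDegree_eq_zero.1 h0]
      exact isUnit_one)
    have hd := natDegree_mul hp0 hq0
    rw [← hpq, hdeg] at hd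
    obtain ⟨a, rfl⟩ := exists_natPoly p
    obtain ⟨b, rfl⟩ := exists_natPoly q
    have ha : a < 2 ^ n := degree_natPoly_lt.1 ((natDegree_lt_iff_degree_lt hp0).1 (by omega))
    have hb : b < 2 ^ n := degree_natPoly_lt.1 ((natDegree_lt_iff_degree_lt hq0).1 (by omega))
    exact h ⟨a, ha, b, hb, natPoly_injective (by rw [natPoly_clmul ha hb, hpq])⟩

/-- The numbers in `[2 ^ n, 2 ^ (n + 1))` are exactly those of degree `n`, and they are all visited
by the search; hence it finds the infimum by which `modulus` is defined. -/
theorem leastPoly_spec {n : ℕ} (hn : n ≠ 0) : natPoly (leastPoly n) = modulus n ∧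
    Irreducible (modulus n) ∧ 2 ^ n ≤ leastPoly n ∧ leastPoly n < 2 ^ (n + 1) := by
  have hmem := Nat.sInf_mem (s := {m : ℕ | Irreducible (natPoly m) ∧ (natPoly m).natDegree = n})
    (exists_irreducible_natDegree hn)
  set m₀ := sInf {m : ℕ | Irreducible (natPoly m) ∧ (natPoly m).natDegree = n} with hm₀
  have hb := (natDegree_natPoly hn).1 hmem.2
  have e : leastPoly n = m₀ := by
    refine leastPoly_eq n m₀ hb.1 hb.2 ((irreducible_natPoly_iff hn hb.1 hb.2).1 hmem.1)
      fun m' h1 h2 => ?_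
    by_contra hs
    have hlt : m' < 2 ^ (n + 1) := h2.trans hb.2
    have := Nat.sInf_le (s := {m : ℕ | Irreducible (natPoly m) ∧ (natPoly m).natDegree = n})
      ⟨(irreducible_natPoly_iff hn h1 hlt).2 hs, (natDegree_natPoly hn).2 ⟨h1, hlt⟩⟩
    omega
  rw [e]
  exact ⟨rfl, hmem.1, hb.1, hb.2⟩

theorem modulus_monic {n : ℕ} (hn : n ≠ 0) : (modulus n).Monic :=
  monic_of_ne_zero (leastPoly_spec hn).2.1.ne_zero

theorem degree_modulus {n : ℕ} (hn : n ≠ 0) : (modulus n).degree = n := by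
  obtain ⟨h1, h2, h3, h4⟩ := leastPoly_spec hn
  rw [degree_eq_natDegree h2.ne_zero, ← h1, (natDegree_natPoly hn).2 ⟨h3, h4⟩]

theorem degree_bitPoly_lt {n : ℕ} (x : Fin n → Bool) : (bitPoly x).degree < n := by
  rw [← natPoly_ofBits, degree_natPoly_lt]
  exact Nat.ofBits_lt_two_pow x

theorem bitPoly_injective {n : ℕ} : Function.Injective (bitPoly : (Fin n → Bool) → _) := by
  intro x y h
  rw [← natPoly_ofBits, ← natPoly_ofBits] at h
  have := natPoly_injective h
  ext i
  rw [← Nat.testBit_ofBits_lt x i i.2, this, Nat.testBit_ofBits_lt y i i.2]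

/-- The computed number has degree less than `n` and differs from `ax + b` by a multiple of the
modulus, which characterizes the remainder. -/
theorem hashNat_spec {n : ℕ} (hn : n ≠ 0) (a b x : Fin n → Bool) :
    natPoly (hashNat (Nat.ofBits a) (Nat.ofBits b) (Nat.ofBits x) (leastPoly n) n) =
      (bitPoly a * bitPoly x + bitPoly b) %ₘ modulus n := by
  obtain ⟨h1, h2, h3, h4⟩ := leastPoly_spec hn
  have ha := Nat.ofBits_lt_two_pow a
  have hb := Nat.ofBits_lt_two_pow b
  have hx := Nat.ofBits_lt_two_pow x
  obtain ⟨hlt, q, hq⟩ := mulmod_lt ha hx h3 h4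
  have hxor := Nat.xor_lt_two_pow hlt hb
  have e : hashNat (Nat.ofBits a) (Nat.ofBits b) (Nat.ofBits x) (leastPoly n) n =
      mulmod (Nat.ofBits a) (Nat.ofBits x) (leastPoly n) n ^^^ Nat.ofBits b :=
    Nat.mod_eq_of_lt (hxor.trans_le (Nat.pow_le_pow_right (by norm_num) (by omega)))
  have hdeg : (natPoly (mulmod (Nat.ofBits a) (Nat.ofBits x) (leastPoly n) n ^^^ Nat.ofBits b)).degree <
      (modulus n).degree := by
    rw [degree_modulus hn]
    exact degree_natPoly_lt.2 hxor
  have e2 : bitPoly a * bitPoly x + bitPoly b =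
      natPoly (mulmod (Nat.ofBits a) (Nat.ofBits x) (leastPoly n) n ^^^ Nat.ofBits b)
        - q * modulus n := by
    rw [natPoly_xor, hq, h1, natPoly_ofBits, natPoly_ofBits, natPoly_ofBits]
    ring
  rw [e, e2, sub_modByMonic, (modByMonic_eq_self_iff (modulus_monic hn)).2 hdeg,
    (modByMonic_eq_zero_iff_dvd (modulus_monic hn)).2 (dvd_mul_left _ _), sub_zero]

theorem hashFn_eq {n : ℕ} (hn : n ≠ 0) (k : ℕ) (key : Key n) (x : Fin n → Bool) (i : Fin k) :
    hashFn n k key x i =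
      (hashNat (Nat.ofBits key.1) (Nat.ofBits key.2) (Nat.ofBits x) (leastPoly n) n).testBit i := by
  unfold hashFn
  rw [← hashNat_spec hn, coeff_natPoly, Bool.eq_iff_iff]
  by_cases h : (hashNat (Nat.ofBits key.1) (Nat.ofBits key.2) (Nat.ofBits x) (leastPoly n) n).testBit
    i = true <;> simp [h]

/-! ## Pairwise independence -/

/-- If two keys agree at `x` and at `y`, the modulus divides `(a - a')(x - y)`. It is prime and both
factors have degree less than `n`, so `a = a'`, and then `b = b'`. Source and target have the same
size, so injectivity suffices. -/
theorem hashFn_pair_bijective {n : ℕ} (hn : n ≠ 0) {x y : Fin n → Bool} (hxy : x ≠ y) :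
    Function.Bijective fun key : Key n => (hashFn n n key x, hashFn n n key y) := by
  rw [Fintype.bijective_iff_injective_and_card]
  refine ⟨fun κ κ' h => ?_, rfl⟩
  have hp : Prime (modulus n) := (leastPoly_spec hn).2.1.prime
  have key : ∀ z : Fin n → Bool, hashFn n n κ z = hashFn n n κ' z → modulus n ∣
      (bitPoly κ.1 * bitPoly z + bitPoly κ.2) - (bitPoly κ'.1 * bitPoly z + bitPoly κ'.2) := by
    intro z hz
    rw [← modByMonic_eq_zero_iff_dvd (modulus_monic hn), sub_modByMonic, sub_eq_zero]
    ext i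
    by_cases hi : i < n
    · have := congrFun hz ⟨i, hi⟩
      simp only [hashFn, decide_eq_decide] at this
      revert this
      generalize ((bitPoly κ.1 * bitPoly z + bitPoly κ.2) %ₘ modulus n).coeff i = u
      generalize ((bitPoly κ'.1 * bitPoly z + bitPoly κ'.2) %ₘ modulus n).coeff i = v
      revert u v
      decide
    · have hd : ∀ p : (ZMod 2)[X], (p %ₘ modulus n).coeff i = 0 := fun p =>
        coeff_eq_zero_of_degree_lt ((degree_modByMonic_lt p (modulus_monic hn)).trans_le (by
          rw [degree_modulus hn]
          exact_mod_cast not_lt.1 hi))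
      rw [hd, hd]
  have small : ∀ p : (ZMod 2)[X], p.degree < n → modulus n ∣ p → p = 0 := fun p hd hdvd =>
    eq_zero_of_dvd_of_degree_lt hdvd (by rwa [degree_modulus hn])
  simp only [Prod.mk.injEq] at h
  have h1 := key x h.1
  have h2 := key y h.2
  have h3 : modulus n ∣ (bitPoly κ.1 - bitPoly κ'.1) * (bitPoly x - bitPoly y) := by
    convert dvd_sub h1 h2 using 1
    ring
  have ha : κ.1 = κ'.1 := by
    rcases hp.dvd_or_dvd h3 with h4 | h4
    · exact bitPoly_injective (sub_eq_zero.1 (small _ ((degree_sub_le _ _).trans_lt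
        (max_lt (degree_bitPoly_lt _) (degree_bitPoly_lt _))) h4))
    · exact absurd (bitPoly_injective (sub_eq_zero.1 (small _ ((degree_sub_le _ _).trans_lt
        (max_lt (degree_bitPoly_lt _) (degree_bitPoly_lt _))) h4))) hxy
  have hb : κ.2 = κ'.2 := by
    rw [ha, add_sub_add_left_eq_sub] at h1
    exact bitPoly_injective (sub_eq_zero.1 (small _ ((degree_sub_le _ _).trans_lt
        (max_lt (degree_bitPoly_lt _) (degree_bitPoly_lt _))) h1))
  exact Prod.ext ha hb

/-- A second moment bound for pairwise independent hash functions. -/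
theorem card_bad_mul_card_le {K X V W : Type} [Fintype K] [Fintype V] [Fintype W] [Nontrivial X]
    [DecidableEq W] (g : K → X → V)
    (hg : ∀ x y, x ≠ y → Function.Bijective fun κ => (g κ x, g κ y)) (π : V → W) (c : ℕ)
    (hc : ∀ w, (Finset.univ.filter fun v => π v = w).card = c) (S : Finset X) (hS : S.Nonempty)
    (m : W) :
    ((Finset.univ.filter fun κ => ∀ x ∈ S, π (g κ x) ≠ m).card : ℤ) * S.card ≤
      Fintype.card K * (Fintype.card W - 1 : ℤ) := by
  classical
  set v := Fintype.card V
  set w := Fintype.card W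
  have hv : v = w * c := by
    have := Finset.card_eq_sum_card_fiberwise (s := (Finset.univ : Finset V)) (t := Finset.univ)
      (f := π) (fun _ _ => Finset.mem_univ _)
    simpa [hc] using this
  have hK : Fintype.card K = v * v := by
    obtain ⟨x, y, hxy⟩ := exists_pair_ne X
    rw [Fintype.card_congr (Equiv.ofBijective _ (hg x y hxy)), Fintype.card_prod]
  have h2 : ∀ x y, x ≠ y → (Finset.univ.filter fun κ => π (g κ x) = m ∧ π (g κ y) = m).card =
      c * c := by
    intro x y hxy
    rw [← hc m, ← Finset.card_product]
    refine Finset.card_bijective _ (hg x y hxy) fun κ => ?_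
    simp
  have h1 : ∀ x, (Finset.univ.filter fun κ => π (g κ x) = m).card = c * v := by
    intro x
    obtain ⟨y, hy⟩ := exists_ne x
    rw [← hc m, show v = (Finset.univ : Finset V).card from rfl, ← Finset.card_product]
    refine Finset.card_bijective _ (hg x y hy.symm) fun κ => ?_
    simp
  set I : K → X → ℤ := fun κ x => if π (g κ x) = m then 1 else 0
  have s1 : ∀ x, ∑ κ, I κ x = c * v := by
    intro x
    have := h1 x
    simp only [I, Finset.sum_boole]
    exact_mod_cast this
  have s2 : ∀ x y, ∑ κ, I κ x * I κ y = if x = y then (c * v : ℤ) else c * c := by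
    intro x y
    split_ifs with hxy
    · subst hxy
      rw [← s1 x]
      refine Finset.sum_congr rfl fun κ _ => ?_
      simp only [I]
      split_ifs <;> simp
    · have := h2 x y hxy
      simp only [I, ← ite_and, mul_ite, mul_one, mul_zero, Finset.sum_boole]
      rw [← Nat.cast_mul, ← this]
      congr 2
      ext κ
      simp only [Finset.mem_filter, Finset.mem_univ, true_and]
      tauto
  set N : ℤ := (S.card : ℤ)
  have hN : 0 < N := Int.natCast_pos.2 hS.card_pos
  have t1 : ∑ κ, ∑ x ∈ S, I κ x = N * (c * v) := by
    rw [Finset.sum_comm, Finset.sum_congr rfl fun x _ => s1 x]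
    simp [N]
  have t2 : ∑ κ, (∑ x ∈ S, I κ x) * (∑ x ∈ S, I κ x) = N * (c * v) + N * (N - 1) * (c * c) := by
    have e : ∀ x ∈ S, ∑ y ∈ S, (if x = y then (c * v : ℤ) else c * c) = c * v + (N - 1) * (c * c) := by
      intro x hx
      have : ∀ y, (if x = y then (c * v : ℤ) else c * c) = c * c + if x = y then (c * v - c * c : ℤ) else 0 := by
        intro y
        split_ifs <;> ring
      simp only [this]
      rw [Finset.sum_add_distrib, Finset.sum_ite_eq, if_pos hx]
      simp only [Finset.sum_const, nsmul_eq_mul]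
      ring
    simp only [Finset.sum_mul_sum]
    rw [Finset.sum_comm]
    simp only [Finset.sum_comm (s := Finset.univ), s2]
    rw [Finset.sum_congr rfl e]
    simp only [Finset.sum_const, nsmul_eq_mul]
    ring
  -- The variance of the number of hits over all keys, scaled by the number `w` of hash values so
  -- that everything stays an integer: the mean number of hits is `N / w`.
  have t3 : ∑ κ, (w * ∑ x ∈ S, I κ x - N) ^ 2 = N * (v * v) * (w - 1) := by
    have : ∀ κ, (w * ∑ x ∈ S, I κ x - N) ^ 2 = w * w * ((∑ x ∈ S, I κ x) * (∑ x ∈ S, I κ x)) -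
        2 * w * N * (∑ x ∈ S, I κ x) + N * N := fun κ => by ring
    simp only [this]
    rw [Finset.sum_add_distrib, Finset.sum_sub_distrib, ← Finset.mul_sum, ← Finset.mul_sum, t1, t2]
    simp only [Finset.sum_const, nsmul_eq_mul, Finset.card_univ, hK]
    have hv' : (v : ℤ) = w * c := by exact_mod_cast hv
    push_cast
    rw [hv']
    ring
  set B := Finset.univ.filter fun κ => ∀ x ∈ S, π (g κ x) ≠ m
  -- Chebyshev's inequality: a bad key has no hits and contributes `N ^ 2` to the variance, and the
  -- other keys contribute nonnegative terms.
  have t4 : (B.card : ℤ) * N ^ 2 ≤ N * (v * v) * (w - 1) := by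
    rw [← t3]
    calc (B.card : ℤ) * N ^ 2 = ∑ κ ∈ B, (w * ∑ x ∈ S, I κ x - N) ^ 2 := by
          rw [Finset.sum_congr rfl (g := fun _ => N ^ 2), Finset.sum_const, nsmul_eq_mul]
          intro κ hκ
          rw [Finset.sum_eq_zero]
          · ring
          · intro x hx
            exact if_neg ((Finset.mem_filter.1 hκ).2 x hx)
      _ ≤ _ := Finset.sum_le_sum_of_subset_of_nonneg (Finset.subset_univ _) fun _ _ _ => sq_nonneg _
  rw [hK]
  push_cast
  have : N * ((B.card : ℤ) * N) ≤ N * (v * v * (w - 1)) := by linarith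
  exact le_of_mul_le_mul_left this hN

/-- Every prefix has equally many extensions, so truncation to `k` bits keeps the hash values
uniform. -/
theorem card_prefix_fiber {k n : ℕ} (hk : k ≤ n) (m : Fin k → Bool) :
    (Finset.univ.filter fun u : Fin n → Bool => (fun i : Fin k => u (Fin.castLE hk i)) = m).card =
      2 ^ (n - k) := by
  obtain ⟨l, rfl⟩ := Nat.exists_eq_add_of_le hk
  have hinj : Function.Injective fun v : Fin l → Bool => Fin.append m v := fun v v' h => by
    funext i
    simpa using congrFun h (Fin.natAdd k i)
  have : (Finset.univ.filter fun u : Fin (k + l) → Bool => (fun i : Fin k => u (Fin.castLE hk i)) = m) =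
      Finset.univ.map ⟨_, hinj⟩ := by
    ext u
    simp only [Finset.mem_filter, Finset.mem_univ, true_and, Finset.mem_map,
      Function.Embedding.coeFn_mk]
    constructor
    · intro hu
      refine ⟨fun i => u (Fin.natAdd k i), ?_⟩
      funext i
      refine Fin.addCases (fun i => ?_) (fun i => ?_) i
      · rw [Fin.append_left, ← hu]
        rfl
      · rw [Fin.append_right]
    · rintro ⟨v, rfl⟩
      funext i
      exact Fin.append_left m v i
  rw [this, Finset.card_map]
  simp

open Classical in
theorem card_weight_le {n : ℕ} (s : Fin n → Bool) (w : ℕ) :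
    (Finset.univ.filter fun x : Fin n → Bool => x ≤ s ∧ weight x = w).card = (weight s).choose w := by
  unfold weight
  rw [← Finset.card_powersetCard]
  refine Finset.card_bij (fun (x : Fin n → Bool) _ => Finset.univ.filter fun i => x i = true) ?_ ?_ ?_
  · intro x hx
    simp only [Finset.mem_filter, Finset.mem_univ, true_and] at hx
    rw [Finset.mem_powersetCard]
    refine ⟨fun i hi => ?_, hx.2⟩
    simp only [Finset.mem_filter, Finset.mem_univ, true_and] at hi ⊢
    have := hx.1 i
    rw [hi] at this
    exact top_le_iff.1 this
  · intro x _ y _ hxy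
    funext i
    have := Finset.ext_iff.1 hxy i
    simpa [← Bool.eq_iff_iff] using this
  · intro T hT
    rw [Finset.mem_powersetCard] at hT
    have e : (Finset.univ.filter fun i => decide (i ∈ T) = true) = T := by
      ext i
      simp
    refine ⟨fun i => decide (i ∈ T), ?_, e⟩
    simp only [Finset.mem_filter, Finset.mem_univ, true_and]
    refine ⟨fun i => ?_, by simpa using hT.2⟩
    by_cases hi : i ∈ T
    · have := hT.1 hi
      simp only [Finset.mem_filter, Finset.mem_univ, true_and] at this
      simp [this]
    · simp [hi]

/-- Keys that are suitable for all blocks of a column exist. -/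
theorem exists_key {n k w t : ℕ} (hn : n ≠ 0) (hk : k ≤ n) (s : Fin t → Fin n → Bool)
    (m : Fin t → Fin k → Bool) (hw : ∀ i, w ≤ weight (s i))
    (h : k = 0 ∨ ∀ i, t * 2 ^ k ≤ (weight (s i)).choose w) :
    ∃ key : Key n, ∀ i, ∃ x, x ≤ s i ∧ weight x = w ∧ hashFn n k key x = m i := by
  classical
  have : Nonempty (Fin n) := ⟨⟨0, Nat.pos_of_ne_zero hn⟩⟩
  set S : Fin t → Finset (Fin n → Bool) := fun i => Finset.univ.filter fun x => x ≤ s i ∧ weight x = w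
  have hS : ∀ i, (S i).card = (weight (s i)).choose w := fun i => card_weight_le _ _
  have hS0 : ∀ i, 0 < (S i).card := fun i => by rw [hS]; exact Nat.choose_pos (hw i)
  set π : (Fin n → Bool) → (Fin k → Bool) := fun u i => u (Fin.castLE hk i)
  have hπ : ∀ key x, π (hashFn n n key x) = hashFn n k key x := fun key x => rfl
  set B : Fin t → Finset (Key n) := fun i => Finset.univ.filter fun κ =>
    ∀ x ∈ S i, π (hashFn n n κ x) ≠ m i
  have hB : ∀ i, ((B i).card : ℤ) * (S i).card ≤ Fintype.card (Key n) * (2 ^ k - 1) := by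
    intro i
    have := card_bad_mul_card_le (fun κ x => hashFn n n κ x)
      (fun x y hxy => hashFn_pair_bijective hn hxy) π _ (card_prefix_fiber hk) (S i)
      (Finset.card_pos.1 (hS0 i)) (m i)
    simpa using this
  have hK : 0 < Fintype.card (Key n) := Fintype.card_pos
  -- Union bound: any key outside the bad sets of all blocks is suitable.
  suffices hlt : (Finset.univ.biUnion B).card < Fintype.card (Key n) by
    obtain ⟨κ, hκ⟩ : ∃ κ, κ ∉ Finset.univ.biUnion B := by
      by_contra hcon
      push Not at hcon
      rw [Finset.eq_univ_of_forall hcon, Finset.card_univ] at hlt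
      exact lt_irrefl _ hlt
    refine ⟨κ, fun i => ?_⟩
    have h1 : κ ∉ B i := fun hb => hκ (Finset.mem_biUnion.2 ⟨i, Finset.mem_univ _, hb⟩)
    simp only [B, Finset.mem_filter, Finset.mem_univ, true_and, not_forall, not_not] at h1
    obtain ⟨x, hx, hm⟩ := h1
    have hx' := (Finset.mem_filter.1 hx).2
    exact ⟨x, hx'.1, hx'.2, by rw [← hπ, hm]⟩
  refine Finset.card_biUnion_le.trans_lt ?_
  rcases Nat.eq_zero_or_pos t with ht | ht
  · subst ht
    simp
  -- For `k = 0` the second moment bound has the factor `2 ^ 0 - 1 = 0`, so there are no bad keys at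
  -- all and no lower bound on the number of candidates is needed.
  rcases h with h | h
  · subst h
    have : ∀ i, (B i).card = 0 := fun i => by
      have h1 := hB i
      have h2 : (0 : ℤ) < (S i).card := by exact_mod_cast hS0 i
      have h3 : ((B i).card : ℤ) ≤ 0 := by nlinarith
      omega
    simp [this]
  -- From `t * 2 ^ k ≤ |S i|` the bad keys of a block satisfy `|B i| * t * 2 ^ k ≤ |K| * (2 ^ k -
  -- 1)`, so `|B i| * t < |K|` strictly. This strictness leaves one key after summing over `t`
  -- blocks.
  · have h1 : ∀ i, ((B i).card : ℤ) * t ≤ Fintype.card (Key n) - 1 := by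
      intro i
      have h1 := hB i
      have h2 : (t : ℤ) * 2 ^ k ≤ (S i).card := by
        rw [hS]
        exact_mod_cast h i
      have h3 : (0 : ℤ) < 2 ^ k := by positivity
      have h4 : (0 : ℤ) < Fintype.card (Key n) := by exact_mod_cast hK
      by_contra hcon
      push Not at hcon
      have h5 : (Fintype.card (Key n) : ℤ) ≤ (B i).card * t := by omega
      have h6 : ((B i).card : ℤ) * (t * 2 ^ k) ≤ (B i).card * (S i).card :=
        mul_le_mul_of_nonneg_left h2 (by positivity)
      nlinarith
    have h2 : (∑ i, ((B i).card : ℤ)) * t ≤ t * (Fintype.card (Key n) - 1) := by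
      rw [Finset.sum_mul]
      have := Finset.sum_le_card_nsmul Finset.univ (fun i => ((B i).card : ℤ) * t) _ fun i _ => h1 i
      simpa using this
    have h3 : (0 : ℤ) < t := by exact_mod_cast ht
    have h4 : (∑ i, ((B i).card : ℤ)) ≤ Fintype.card (Key n) - 1 := by
      rw [mul_comm] at h2
      exact le_of_mul_le_mul_left h2 h3
    have h5 : ((∑ i, (B i).card : ℕ) : ℤ) = ∑ i, ((B i).card : ℤ) := by push_cast; rfl
    omega

end RankMod

namespace RankMod
open RAM

/-! ## Correctness of the search -/

/-- The `n` lowest bits of a number. -/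
def vecOf (n x : ℕ) : Fin n → Bool := fun i => x.testBit i

/-- The key with number `c`. -/
def keyOf (n c : ℕ) : Key n := (fun i => c.testBit i, fun i => c.testBit (n + i))

theorem ofBits_vecOf {n x : ℕ} (hx : x < 2 ^ n) : Nat.ofBits (vecOf n x) = x := by
  unfold vecOf
  rw [Nat.ofBits_testBit, Nat.mod_eq_of_lt hx]

theorem vecOf_ofBits {n : ℕ} (x : Fin n → Bool) : vecOf n (Nat.ofBits x) = x := by
  funext i
  exact Nat.testBit_ofBits_lt x i i.2

theorem ofBits_keyOf {n c : ℕ} (hc : c < 2 ^ (n + n)) : Nat.ofBits (keyOf n c).1 = c % 2 ^ n ∧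
    Nat.ofBits (keyOf n c).2 = c / 2 ^ n := by
  refine ⟨Nat.ofBits_testBit _ _, ?_⟩
  have : (keyOf n c).2 = fun i : Fin n => (c / 2 ^ n).testBit i := by
    funext i
    rw [Nat.testBit_div_two_pow]
    simp [keyOf, add_comm]
  rw [this, Nat.ofBits_testBit, Nat.mod_eq_of_lt]
  rw [Nat.div_lt_iff_lt_mul (by positivity), ← pow_add]
  exact hc

theorem exists_keyOf {n : ℕ} (key : Key n) : ∃ c < 2 ^ (n + n), keyOf n c = key := by
  have ha := Nat.ofBits_lt_two_pow key.1
  have hb := Nat.ofBits_lt_two_pow key.2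
  refine ⟨2 ^ n * Nat.ofBits key.2 + Nat.ofBits key.1, ?_, ?_⟩
  · rw [pow_add]
    nlinarith
  · refine Prod.ext (funext fun i => ?_) (funext fun i => ?_)
    · simp [keyOf, Nat.testBit_two_pow_mul_add _ ha, Nat.testBit_ofBits_lt]
    · simp [keyOf, Nat.testBit_two_pow_mul_add _ ha, Nat.testBit_ofBits_lt]

theorem sum_testBit (n x : ℕ) : ∑ b ∈ Finset.range n, (x.testBit b).toNat = weight (vecOf n x) := by
  rw [weight, Finset.card_filter, Finset.sum_range]
  refine Finset.sum_congr rfl fun i _ => ?_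
  by_cases h : x.testBit i = true <;> simp [vecOf, h]

/-- A sum of natural numbers vanishes only termwise, which turns the single number into the three
conditions on the vector. -/
theorem failCount_eq_zero {L : List ℕ} {n k w c pm ps x : ℕ} (hn : n ≠ 0) (hc : c < 2 ^ (n + n))
    (hx : x < 2 ^ n) {m : Fin k → Bool} {s : Fin n → Bool}
    (hm : ∀ b : Fin k, L.getD (pm + b) 0 = (m b).toNat)
    (hs : ∀ b : Fin n, L.getD (ps + b) 0 = (s b).toNat) :
    failCount L n k (leastPoly n) w c pm ps x = 0 ↔
      vecOf n x ≤ s ∧ weight (vecOf n x) = w ∧ hashFn n k (keyOf n c) (vecOf n x) = m := by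
  have h1 : (∑ b ∈ Finset.range n, ((x.testBit b).toNat - L.getD (ps + b) 0) = 0) ↔
      vecOf n x ≤ s := by
    rw [Finset.sum_eq_zero_iff]
    constructor
    · intro h i
      have := h i (Finset.mem_range.2 i.2)
      rw [hs i] at this
      show x.testBit i ≤ s i
      revert this
      cases x.testBit i <;> cases s i <;> simp
    · intro h i hi
      have h1 : x.testBit i ≤ s ⟨i, Finset.mem_range.1 hi⟩ := h ⟨i, Finset.mem_range.1 hi⟩
      have h2 := hs ⟨i, Finset.mem_range.1 hi⟩
      simp only at h2
      rw [h2]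
      revert h1
      cases x.testBit i <;> cases s ⟨i, _⟩ <;> simp
  have h3 : (∑ b ∈ Finset.range k, (((hashNat (c % 2 ^ n) (c / 2 ^ n) x (leastPoly n) n).testBit b).toNat -
      L.getD (pm + b) 0 + (L.getD (pm + b) 0 -
        ((hashNat (c % 2 ^ n) (c / 2 ^ n) x (leastPoly n) n).testBit b).toNat)) = 0) ↔
      hashFn n k (keyOf n c) (vecOf n x) = m := by
    have he : ∀ b : Fin k, hashFn n k (keyOf n c) (vecOf n x) b =
        (hashNat (c % 2 ^ n) (c / 2 ^ n) x (leastPoly n) n).testBit b := by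
      intro b
      rw [hashFn_eq hn, ofBits_vecOf hx, (ofBits_keyOf hc).1, (ofBits_keyOf hc).2]
    rw [Finset.sum_eq_zero_iff]
    constructor
    · intro h
      funext i
      have := h i (Finset.mem_range.2 i.2)
      rw [hm i, ← he] at this
      revert this
      cases hashFn n k (keyOf n c) (vecOf n x) i <;> cases m i <;> simp
    · intro h i hi
      have h1 := congrFun h ⟨i, Finset.mem_range.1 hi⟩
      rw [he] at h1
      have h2 := hm ⟨i, Finset.mem_range.1 hi⟩
      simp only at h1 h2
      rw [h2, h1]
      simp
  unfold failCount
  simp only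
  rw [Nat.add_eq_zero_iff, Nat.add_eq_zero_iff, h1, h3, sum_testBit]
  have h2 : weight (vecOf n x) - w + (w - weight (vecOf n x)) = 0 ↔ weight (vecOf n x) = w := by
    omega
  rw [h2]

theorem findX_spec (L : List ℕ) (n k f w c pm ps : ℕ) :
    (findX L n k f w c pm ps = 0 ∧ ∀ x < 2 ^ n, failCount L n k f w c pm ps x ≠ 0) ∨
      ∃ x < 2 ^ n, failCount L n k f w c pm ps x = 0 ∧ findX L n k f w c pm ps = x + 1 := by
  by_cases h : ∃ x < 2 ^ n, failCount L n k f w c pm ps x = 0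
  · right
    obtain ⟨x, hx, h1, -, h2⟩ := iter_last (fun x => failCount L n k f w c pm ps x = 0)
      (fun x => x + 1) 0 (2 ^ n) h
    refine ⟨x, hx, h1, ?_⟩
    rw [← h2]
    refine iter_congr _ fun i _ b => ?_
    simp only [ne_eq, ite_not]
  · left
    push Not at h
    refine ⟨?_, h⟩
    refine iter_eq (fun _ => 0) (2 ^ n) rfl fun i hi => ?_
    rw [if_pos (h i hi)]

theorem goodKey_ne_zero (L : List ℕ) (n k f w t₁ c pm ps : ℕ) :
    goodKey L n k f w t₁ c pm ps ≠ 0 ↔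
      ∀ i < t₁, findX L n k f w c (pm + i * k) (ps + i * n) ≠ 0 := by
  have : goodKey L n k f w t₁ c pm ps = iter (fun i acc =>
      if findX L n k f w c (pm + i * k) (ps + i * n) = 0 then 0 else acc) 1 t₁ := by
    refine iter_congr _ fun i _ b => ?_
    simp only [ne_eq, ite_not]
  rw [this, iter_all]
  split_ifs with h
  · simpa using h
  · push Not at h
    simpa using h

/-- The search finds a suitable key and suitable vectors. -/
theorem findKey_spec {L : List ℕ} {n k w t₁ pm ps : ℕ} (hn : n ≠ 0) (hk : k ≤ n)
    {m : Fin t₁ → Fin k → Bool} {s : Fin t₁ → Fin n → Bool}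
    (hm : ∀ (i : Fin t₁) (b : Fin k), L.getD (pm + i * k + b) 0 = (m i b).toNat)
    (hs : ∀ (i : Fin t₁) (b : Fin n), L.getD (ps + i * n + b) 0 = (s i b).toNat)
    (hw : ∀ i, w ≤ weight (s i))
    (h : k = 0 ∨ ∀ i, t₁ * 2 ^ k ≤ (weight (s i)).choose w) :
    findKey L n k (leastPoly n) w t₁ pm ps < 2 ^ (n + n) ∧ ∀ i : Fin t₁,
      ∃ x < 2 ^ n, findX L n k (leastPoly n) w (findKey L n k (leastPoly n) w t₁ pm ps)
        (pm + i * k) (ps + i * n) = x + 1 ∧ vecOf n x ≤ s i ∧ weight (vecOf n x) = w ∧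
        hashFn n k (keyOf n (findKey L n k (leastPoly n) w t₁ pm ps)) (vecOf n x) = m i := by
  have hex : ∃ c < 2 ^ (n + n), goodKey L n k (leastPoly n) w t₁ c pm ps ≠ 0 := by
    obtain ⟨key, hkey⟩ := exists_key hn hk s m hw h
    obtain ⟨c, hc, rfl⟩ := exists_keyOf key
    refine ⟨c, hc, (goodKey_ne_zero ..).2 fun i hi => ?_⟩
    obtain ⟨x, hx⟩ := hkey ⟨i, hi⟩
    rcases findX_spec L n k (leastPoly n) w c (pm + i * k) (ps + i * n) with ⟨-, hf⟩ | ⟨y, -, -, hy⟩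
    · refine absurd ?_ (hf (Nat.ofBits x) (Nat.ofBits_lt_two_pow x))
      rw [failCount_eq_zero hn hc (Nat.ofBits_lt_two_pow x) (hm ⟨i, hi⟩) (hs ⟨i, hi⟩), vecOf_ofBits]
      exact hx
    · omega
  obtain ⟨c, hc, h1, -, h2⟩ := iter_last (fun c => goodKey L n k (leastPoly n) w t₁ c pm ps ≠ 0)
      (fun c => c) 0 (2 ^ (n + n)) hex
  have e : findKey L n k (leastPoly n) w t₁ pm ps = c := h2
  rw [e]
  refine ⟨hc, fun i => ?_⟩
  have h3 := (goodKey_ne_zero ..).1 h1 i i.2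
  rcases findX_spec L n k (leastPoly n) w c (pm + i * k) (ps + i * n) with ⟨hf, -⟩ | ⟨x, hx, hf, hx'⟩
  · exact absurd hf h3
  · exact ⟨x, hx, hx', (failCount_eq_zero hn hc hx (hm i) (hs i)).1 hf⟩

end RankMod

namespace RankMod
open RAM

/-! ## A lower bound for binomial coefficients -/

/-- The largest term of a binomial distribution. -/
theorem binomial_mode {a b : ℕ} {p : ℝ} (hp : 0 < p) (hp1 : p < 1) (hb : (b : ℝ) ≤ (a + 1) * p)
    (hb1 : (a + 1) * p < b + 1) :
    1 ≤ ((a : ℝ) + 1) * (a.choose b * p ^ b * (1 - p) ^ (a - b)) := by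
  set f : ℕ → ℝ := fun j => a.choose j * p ^ j * (1 - p) ^ (a - j) with hf
  have hq : 0 < 1 - p := by linarith
  have hf0 : ∀ j, 0 ≤ f j := fun j => by positivity
  -- The ratio of consecutive terms, cleared of denominators. The hypotheses say that `b` is the
  -- integer part of `(a + 1) * p`, which is where the ratio passes one.
  have step : ∀ j < a, f (j + 1) * ((j + 1) * (1 - p)) = f j * ((a - j) * p) := by
    intro j hj
    have h1 : ((a.choose (j + 1) : ℕ) : ℝ) * (j + 1) = a.choose j * (a - j) := by
      have := Nat.choose_succ_right_eq a j
      rw [← Nat.cast_sub hj.le]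
      exact_mod_cast this
    simp only [hf]
    rw [show a - j = a - (j + 1) + 1 by omega, pow_succ, pow_succ]
    linear_combination (p ^ j * p * ((1 - p) ^ (a - (j + 1)) * (1 - p))) * h1
  have hba : b ≤ a := by
    by_contra h
    have : (a : ℝ) + 1 ≤ b := by exact_mod_cast not_le.1 h
    nlinarith
  have up : ∀ j, j + 1 ≤ b → f j ≤ f (j + 1) := by
    intro j hj
    have h1 := step j (by omega)
    have h2 : ((j : ℝ) + 1) ≤ b := by exact_mod_cast hj
    have h3 : ((j : ℝ) + 1) * (1 - p) ≤ (a - j) * p := by nlinarith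
    have h4 : 0 < ((j : ℝ) + 1) * (1 - p) := by positivity
    by_contra hlt
    nlinarith [mul_lt_mul_of_pos_right (not_le.1 hlt) h4, mul_le_mul_of_nonneg_left h3 (hf0 j)]
  have down : ∀ j, b ≤ j → f (j + 1) ≤ f j := by
    intro j hj
    rcases lt_or_ge j a with h | h
    · have h1 := step j h
      have h2 : (b : ℝ) ≤ j := by exact_mod_cast hj
      have h3 : ((a : ℝ) - j) * p ≤ (j + 1) * (1 - p) := by nlinarith
      have h4 : 0 < ((j : ℝ) + 1) * (1 - p) := by positivity
      by_contra hlt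
      nlinarith [mul_lt_mul_of_pos_right (not_le.1 hlt) h4, mul_le_mul_of_nonneg_left h3 (hf0 j)]
    · have : f (j + 1) = 0 := by simp [hf, Nat.choose_eq_zero_of_lt (show a < j + 1 by omega)]
      rw [this]
      exact hf0 j
  have hmax : ∀ j, f j ≤ f b := by
    intro j
    rcases le_total j b with h | h
    · have hm : Antitone fun i => f (b - i) := antitone_nat_of_succ_le fun i => by
        rcases Nat.lt_or_ge i b with hi | hi
        · have := up (b - (i + 1)) (by omega)
          rwa [show b - (i + 1) + 1 = b - i by omega] at this
        · rw [show b - (i + 1) = b - i by omega]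
      have := hm (Nat.zero_le (b - j))
      simpa [show b - (b - j) = j by omega] using this
    · have hm : Antitone fun i => f (b + i) := antitone_nat_of_succ_le fun i => by
        exact down (b + i) (by omega)
      have := hm (Nat.zero_le (j - b))
      simpa [show b + (j - b) = j by omega] using this
  -- The `a + 1` terms sum to one, so the largest is at least `1 / (a + 1)`.
  have hsum : ∑ j ∈ Finset.range (a + 1), f j = 1 := by
    have := add_pow p (1 - p) a
    rw [add_sub_cancel, one_pow] at this
    rw [this]
    refine Finset.sum_congr rfl fun j _ => ?_
    simp only [hf]
    ring
  have := Finset.sum_le_card_nsmul (Finset.range (a + 1)) f (f b) fun j _ => hmax j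
  rw [hsum, Finset.card_range, nsmul_eq_mul] at this
  exact_mod_cast this

/-- Nonnegativity of the relative entropy of `X / S` with respect to `p`, from `log u ≤ u - 1`. -/
theorem gibbs {S X p : ℝ} (hX : 0 < X) (hXS : X < S) (hp : 0 < p) (hp1 : p < 1) :
    S * Real.binEntropy (X / S) ≤ -(X * Real.log p + (S - X) * Real.log (1 - p)) := by
  have hS : 0 < S := hX.trans hXS
  have hu : 0 < X / S := by positivity
  have hu1 : 0 < 1 - X / S := by
    rw [sub_pos, div_lt_one hS]
    exact hXS
  have h1 := Real.log_le_sub_one_of_pos (div_pos hp hu)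
  have h2 := Real.log_le_sub_one_of_pos (div_pos (sub_pos.2 hp1) hu1)
  rw [Real.log_div hp.ne' hu.ne'] at h1
  rw [Real.log_div (sub_pos.2 hp1).ne' hu1.ne'] at h2
  have h3 := mul_le_mul_of_nonneg_left h1 hX.le
  have h4 := mul_le_mul_of_nonneg_left h2 (sub_pos.2 hXS).le
  have e1 : X * (p / (X / S) - 1) = S * p - X := by field_simp
  have e2 : (S - X) * ((1 - p) / (1 - X / S) - 1) = S * (1 - p) - (S - X) := by
    have : S - X ≠ 0 := (sub_pos.2 hXS).ne'
    field_simp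
  rw [e1] at h3
  rw [e2] at h4
  have e3 : S * Real.binEntropy (X / S) = -(X * Real.log (X / S) + (S - X) * Real.log (1 - X / S)) := by
    unfold Real.binEntropy
    rw [Real.log_inv, Real.log_inv]
    field_simp
    ring
  rw [e3]
  linarith

/-- For `p = X / (a + 1)` the integer `b` is the mode of the binomial distribution, so the binomial
coefficient is at least `p⁻ᵇ(1-p)⁻⁽ᵃ⁻ᵇ⁾ / (a + 1)`. Gibbs' inequality compares this with the entropy
at the real parameters. The rounding `θ = X - b` leaves a factor `p⁻ᶿ(1-p)⁻⁽¹⁻ᶿ⁾`, which the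
weighted inequality between geometric and arithmetic means bounds by a multiple of `a + 1`. -/
theorem exp_entropy_le {S X : ℝ} {a b n : ℕ} (hX : 0 < X) (hXS : X < S) (ha : (a : ℝ) ≤ S)
    (ha1 : S < a + 1) (hb : (b : ℝ) ≤ X) (hb1 : X < b + 1) (han : a ≤ n) (hn : 1 ≤ n) :
    Real.exp (S * Real.binEntropy (X / S)) ≤ 3 / 2 * ((n : ℝ) + 1) ^ 2 * a.choose b := by
  have hA : (0 : ℝ) < a + 1 := by positivity
  set p : ℝ := X / (a + 1) with hp
  have hp0 : 0 < p := by positivity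
  have hp1 : p < 1 := by rw [hp, div_lt_one hA]; linarith
  have hq0 : 0 < 1 - p := by linarith
  have hpX : (a + 1) * p = X := by rw [hp]; field_simp
  have hmode := binomial_mode hp0 hp1 (by rw [hpX]; exact hb) (by rw [hpX]; exact hb1)
  have hba : b ≤ a := by
    have : (b : ℝ) < a + 1 := by linarith
    have : b < a + 1 := by exact_mod_cast this
    omega
  set θ : ℝ := X - b with hθ
  have hθ0 : 0 ≤ θ := by linarith
  have hθ1 : 0 < 1 - θ := by linarith
  have h1 : Real.exp (S * Real.binEntropy (X / S)) ≤
      ((p ^ b)⁻¹ * ((1 - p) ^ (a - b))⁻¹) * (p⁻¹ ^ θ * (1 - p)⁻¹ ^ (1 - θ)) := by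
    have e : ((p ^ b)⁻¹ * ((1 - p) ^ (a - b))⁻¹) * (p⁻¹ ^ θ * (1 - p)⁻¹ ^ (1 - θ)) =
        Real.exp (-(X * Real.log p + (a + 1 - X) * Real.log (1 - p))) := by
      rw [Real.rpow_def_of_pos (inv_pos.2 hp0), Real.rpow_def_of_pos (inv_pos.2 hq0),
        ← Real.exp_log (inv_pos.2 (pow_pos hp0 b)), ← Real.exp_log (inv_pos.2 (pow_pos hq0 (a - b))),
        ← Real.exp_add, ← Real.exp_add, ← Real.exp_add]
      simp only [Real.log_inv, Real.log_pow]
      rw [Nat.cast_sub hba]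
      congr 1
      simp only [hθ]
      ring
    rw [e]
    refine Real.exp_le_exp.2 ((gibbs hX hXS hp0 hp1).trans ?_)
    have : Real.log (1 - p) ≤ 0 := Real.log_nonpos hq0.le (by linarith)
    nlinarith
  have h2 : p⁻¹ ^ θ * (1 - p)⁻¹ ^ (1 - θ) ≤ θ * p⁻¹ + (1 - θ) * (1 - p)⁻¹ :=
    Real.geom_mean_le_arith_mean2_weighted hθ0 hθ1.le (inv_nonneg.2 hp0.le) (inv_nonneg.2 hq0.le)
      (by ring)
  have hd : 0 < a + 1 - X := by linarith
  have e3 : θ * p⁻¹ + (1 - θ) * (1 - p)⁻¹ = (a + 1) * (θ / X + (1 - θ) / (a + 1 - X)) := by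
    have : 1 - p = (a + 1 - X) / (a + 1) := by rw [hp]; field_simp
    rw [this, hp]
    field_simp
  have f1 : θ / X ≤ 1 := by rw [div_le_one hX]; linarith [(Nat.cast_nonneg b : (0 : ℝ) ≤ b)]
  have hbaR : (b : ℝ) ≤ a := by exact_mod_cast hba
  have f2 : (1 - θ) / (a + 1 - X) ≤ 1 := by rw [div_le_one hd]; linarith
  -- Both fractions are at most one. If `a ≥ 1`, one of them is at most `1/2`: the first when `b ≥
  -- 1`, the second when `b = 0`. This gives the constant `3/2`; for `a = 0` the factor `(n + 1) ^ 2
  -- ≥ 4` is more than enough.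
  have h4 : (a + 1) * ((a + 1) * (θ / X + (1 - θ) / (a + 1 - X))) ≤ 3 / 2 * ((n : ℝ) + 1) ^ 2 := by
    have hn1 : (1 : ℝ) ≤ n := by exact_mod_cast hn
    have hann : (a : ℝ) ≤ n := by exact_mod_cast han
    rcases Nat.eq_zero_or_pos a with h0 | h0
    · subst h0
      simp only [Nat.cast_zero, zero_add, one_mul] at f1 f2 ⊢
      nlinarith
    · have hsum : θ / X + (1 - θ) / (a + 1 - X) ≤ 3 / 2 := by
        rcases Nat.eq_zero_or_pos b with hb0 | hb0
        · have a1 : (1 : ℝ) ≤ a := by exact_mod_cast h0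
          have : (1 - θ) / (a + 1 - X) ≤ 1 / 2 := by
            rw [div_le_div_iff₀ hd (by norm_num)]
            subst hb0
            simp only [Nat.cast_zero, sub_zero] at hθ
            linarith
          linarith
        · have b1 : (1 : ℝ) ≤ b := by exact_mod_cast hb0
          have : θ / X ≤ 1 / 2 := by
            rw [div_le_div_iff₀ hX (by norm_num)]
            linarith
          linarith
      have h5 : ((a : ℝ) + 1) * (a + 1) ≤ (n + 1) * (n + 1) := by nlinarith
      nlinarith [mul_le_mul_of_nonneg_left hsum (mul_pos hA hA).le]
  have hP : 0 < p ^ b * (1 - p) ^ (a - b) := by positivity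
  calc Real.exp (S * Real.binEntropy (X / S))
      ≤ ((p ^ b)⁻¹ * ((1 - p) ^ (a - b))⁻¹) * ((a + 1) * (θ / X + (1 - θ) / (a + 1 - X))) := by
        refine h1.trans ?_
        rw [← e3]
        exact mul_le_mul_of_nonneg_left h2 (by positivity)
    _ ≤ ((a + 1) * a.choose b) * ((a + 1) * (θ / X + (1 - θ) / (a + 1 - X))) := by
        refine mul_le_mul_of_nonneg_right ?_ (by positivity)
        rw [← mul_inv, inv_le_iff_one_le_mul₀ hP]
        calc (1 : ℝ) ≤ _ := hmode
          _ = _ := by ring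
    _ = (a + 1) * ((a + 1) * (θ / X + (1 - θ) / (a + 1 - X))) * a.choose b := by ring
    _ ≤ _ := mul_le_mul_of_nonneg_right h4 (by positivity)

/-! ## The parameters of the hash construction -/

namespace HashParams

variable {p : HashParams}

theorem Valid.one_le_logb (hp : p.Valid) : 1 ≤ Real.logb 2 (1 / p.eps) := by
  rw [Real.le_logb_iff_rpow_le (by norm_num) (by have := hp.eps_pos; positivity), Real.rpow_one,
    le_div_iff₀ hp.eps_pos]
  linarith [hp.eps_le]

theorem Valid.n_mul_eps (hp : p.Valid) : p.c * Real.logb 2 (1 / p.eps) ≤ p.n * p.eps := by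
  have h := Nat.le_ceil (p.c / p.eps * Real.logb 2 (1 / p.eps))
  have := mul_le_mul_of_nonneg_right h hp.eps_pos.le
  refine le_trans (le_of_eq ?_) this
  have := hp.eps_pos
  field_simp

theorem Valid.twenty_lt (hp : p.Valid) : 20 * Real.logb 2 (1 / p.eps) < p.n * p.eps :=
  lt_of_lt_of_le (mul_lt_mul_of_pos_right hp.c_gt (by linarith [hp.one_le_logb])) hp.n_mul_eps

theorem Valid.n_ge (hp : p.Valid) : 41 ≤ p.n := by
  have h1 := hp.twenty_lt
  have h2 := hp.one_le_logb
  have h3 := hp.eps_le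
  have h4 : (40 : ℝ) < p.n := by nlinarith [(Nat.cast_nonneg p.n : (0 : ℝ) ≤ p.n)]
  exact_mod_cast h4

theorem Valid.inv_eps_le (hp : p.Valid) : 1 / p.eps ≤ 2 ^ (p.n * p.eps / 20) := by
  have h0 : 0 < 1 / p.eps := by have := hp.eps_pos; positivity
  rw [← Real.logb_le_iff_le_rpow (by norm_num) h0]
  linarith [hp.twenty_lt]

/-- The exponent `c / 12` lets `t₁` use one twelfth of the `n * eps` bits of slack. -/
theorem Valid.pow_le (hp : p.Valid) : (1 / p.eps) ^ (p.c / 12) ≤ 2 ^ (p.n * p.eps / 12) := by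
  have h0 : 0 < 1 / p.eps := by have := hp.eps_pos; positivity
  rw [← Real.logb_le_iff_le_rpow (by norm_num) (by positivity), Real.logb_rpow_eq_mul_logb_of_pos h0]
  linarith [hp.n_mul_eps]

theorem Valid.t₁_le (hp : p.Valid) : (p.t₁ : ℝ) ≤ (1 / p.eps) ^ (p.c / 12) := by
  have h0 : 0 < 1 / p.eps := by have := hp.eps_pos; positivity
  have h1 : (1 : ℝ) ≤ (1 / p.eps) ^ (p.c / 12) := by
    refine Real.one_le_rpow ?_ (by linarith [hp.c_gt])
    rw [le_div_iff₀ hp.eps_pos]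
    linarith [hp.eps_le]
  have := Nat.floor_le (sub_nonneg.2 h1)
  unfold t₁
  linarith

/-- Put `v = n * eps / 20` and `T = 2 ^ v`. Then `1 / eps ≤ T`, so `n = 20 * v / eps ≤ 20 * v * T`.
The tangent to the exponential gives `T ≥ (e log 2) v ≥ 1.884 v`, hence `n ≤ 10.62 T ^ 2`, and `1 ≤
T ^ 2 / 4` because `T ≥ 2`. -/
theorem Valid.n_add_one_le (hp : p.Valid) :
    (p.n : ℝ) + 1 ≤ 10.87 * ((2 : ℝ) ^ (p.n * p.eps / 20)) ^ 2 := by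
  set v : ℝ := p.n * p.eps / 20
  have hv : 1 ≤ v := by
    have := hp.twenty_lt
    have := hp.one_le_logb
    simp only [v]
    linarith
  set T : ℝ := 2 ^ v with hT
  have hT2 : 2 ≤ T := by
    calc (2 : ℝ) = 2 ^ (1 : ℝ) := by norm_num
      _ ≤ T := Real.rpow_le_rpow_of_exponent_le (by norm_num) hv
  have hvT : 1.884 * v ≤ T := by
    have h1 := Real.add_one_le_exp (v * Real.log 2 - 1)
    have e : Real.exp (v * Real.log 2 - 1) * Real.exp 1 = T := by
      rw [← Real.exp_add, hT, Real.rpow_def_of_pos (by norm_num)]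
      congr 1
      ring
    have h2 := Real.exp_one_gt_d9
    have h3 := Real.log_two_gt_d9
    rw [← e]
    have h4 : v * 0.6931 ≤ Real.exp (v * Real.log 2 - 1) := by nlinarith
    nlinarith
  have hn : (p.n : ℝ) = 20 * v * (1 / p.eps) := by
    have := hp.eps_pos
    simp only [v]
    field_simp
  have h5 : (p.n : ℝ) ≤ 20 * v * T := by
    rw [hn]
    exact mul_le_mul_of_nonneg_left hp.inv_eps_le (by linarith)
  nlinarith

/-- The budget: of the exponent `2y/3` with `y = n * eps`, the factor `t₁` takes `y/12` and `(n + 1)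
^ 2` takes `4 * y/20`. The remaining `23y/60` is for the constants. -/
theorem Valid.t₁_mul_le (hp : p.Valid) :
    (p.t₁ : ℝ) * (3 / 2 * ((p.n : ℝ) + 1) ^ 2) ≤ 2 ^ (2 * (p.n * p.eps) / 3) := by
  set y : ℝ := p.n * p.eps with hy
  have hy20 : 20 ≤ y := by
    have := hp.twenty_lt
    have := hp.one_le_logb
    linarith
  have e : (2 : ℝ) ^ (2 * y / 3) = 2 ^ (y / 12) * (((2 : ℝ) ^ (y / 20)) ^ 2) ^ 2 * 2 ^ (23 * y / 60) := by
    rw [← pow_mul, ← Real.rpow_natCast, ← Real.rpow_mul (by norm_num), ← Real.rpow_add (by norm_num),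
      ← Real.rpow_add (by norm_num)]
    congr 1
    push_cast
    ring
  -- `178` exceeds `3/2 * 10.87 ^ 2`; with `y ≥ 20` the exponent is at least `23/3`, and the
  -- comparison is made between cubes.
  have h1 : (178 : ℝ) ≤ 2 ^ (23 * y / 60) := by
    calc (178 : ℝ) = ((178 : ℝ) ^ (3 : ℕ)) ^ ((1 : ℝ) / 3) := by
          rw [← Real.rpow_natCast, ← Real.rpow_mul (by norm_num)]
          norm_num
      _ ≤ ((2 : ℝ) ^ (23 : ℕ)) ^ ((1 : ℝ) / 3) :=
          Real.rpow_le_rpow (by norm_num) (by norm_num) (by norm_num)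
      _ = 2 ^ ((23 : ℝ) / 3) := by
          rw [← Real.rpow_natCast, ← Real.rpow_mul (by norm_num)]
          norm_num
      _ ≤ _ := Real.rpow_le_rpow_of_exponent_le (by norm_num) (by linarith)
  have h2 := hp.n_add_one_le
  rw [← hy] at h2
  have h3 := hp.t₁_le.trans hp.pow_le
  rw [← hy] at h3
  rw [e]
  set A : ℝ := 2 ^ (y / 12)
  set T : ℝ := ((2 : ℝ) ^ (y / 20)) ^ 2
  set D : ℝ := 2 ^ (23 * y / 60)
  have hA : 0 < A := by positivity
  have hT : 0 < T := by positivity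
  have h4 : 3 / 2 * ((p.n : ℝ) + 1) ^ 2 ≤ 178 * T ^ 2 := by
    have : ((p.n : ℝ) + 1) ^ 2 ≤ (10.87 * T) ^ 2 := pow_le_pow_left₀ (by positivity) h2 2
    nlinarith
  calc (p.t₁ : ℝ) * (3 / 2 * ((p.n : ℝ) + 1) ^ 2) ≤ A * (178 * T ^ 2) :=
        mul_le_mul h3 h4 (by positivity) hA.le
    _ = A * T ^ 2 * 178 := by ring
    _ ≤ _ := mul_le_mul_of_nonneg_left h1 (by positivity)

theorem capacity_eq (p : HashParams) :
    p.capacity = p.ws * (Real.binEntropy (p.wx / p.ws) / Real.log 2) := rfl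

theorem Valid.ratio_mem (hp : p.Valid) : 0 ≤ p.wx / p.ws ∧ p.wx / p.ws ≤ 1 :=
  ⟨div_nonneg hp.wx_mem.1 hp.ws_mem.1, div_le_one_of_le₀ hp.wx_mem.2 hp.ws_mem.1⟩

theorem Valid.capacity_nonneg (hp : p.Valid) : 0 ≤ p.capacity := by
  rw [capacity_eq]
  exact mul_nonneg hp.ws_mem.1 (div_nonneg (Real.binEntropy_nonneg hp.ratio_mem.1 hp.ratio_mem.2)
    (Real.log_nonneg (by norm_num)))

theorem Valid.capacity_le_one (hp : p.Valid) : p.capacity ≤ 1 := by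
  rw [capacity_eq]
  have h1 : Real.binEntropy (p.wx / p.ws) / Real.log 2 ≤ 1 :=
    div_le_one_of_le₀ Real.binEntropy_le_log_two (Real.log_nonneg (by norm_num))
  have h0 : 0 ≤ Real.binEntropy (p.wx / p.ws) / Real.log 2 :=
    div_nonneg (Real.binEntropy_nonneg hp.ratio_mem.1 hp.ratio_mem.2) (Real.log_nonneg (by norm_num))
  nlinarith [hp.ws_mem.1, hp.ws_mem.2]

theorem Valid.k_le (hp : p.Valid) : (p.k : ℝ) ≤ p.n * p.capacity := by
  have h := hp.capacity_nonneg
  have h2 := hp.eps_pos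
  rcases Nat.eq_zero_or_pos p.k with h0 | h0
  · rw [h0, Nat.cast_zero]
    positivity
  · have h1 := Nat.floor_le (Nat.floor_pos.1 h0 |>.trans' zero_le_one)
    refine h1.trans (mul_le_mul_of_nonneg_left ?_ (by positivity))
    change p.capacity - _ ≤ _
    linarith

theorem Valid.k_le_n (hp : p.Valid) : p.k ≤ p.n := by
  have h1 := hp.k_le
  have h2 := mul_le_mul_of_nonneg_left hp.capacity_le_one (Nat.cast_nonneg p.n : (0 : ℝ) ≤ p.n)
  have h3 : (p.k : ℝ) ≤ p.n := by linarith
  exact_mod_cast h3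

/-- There are enough vectors below a state for the hash functions to reach all messages. -/
theorem Valid.choose_ge (hp : p.Valid) :
    p.k = 0 ∨ p.t₁ * 2 ^ p.k ≤ ⌊p.ws * p.n⌋₊.choose ⌊p.wx * p.n⌋₊ := by
  rw [or_iff_not_imp_left]
  intro hk
  have hn41 := hp.n_ge
  have hn : (0 : ℝ) < p.n := by
    have : 0 < p.n := by omega
    exact_mod_cast this
  have hk1 : (1 : ℝ) ≤ p.n * (p.capacity - 2 * p.eps / 3) := Nat.floor_pos.1 (Nat.pos_of_ne_zero hk)
  have hkle : (p.k : ℝ) ≤ p.n * (p.capacity - 2 * p.eps / 3) := Nat.floor_le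
    (zero_le_one.trans hk1)
  -- A nonzero `k` forces positive capacity and hence `0 < wx < ws`, so the degenerate cases of the
  -- entropy do not occur from here on.
  have hcap : 0 < p.capacity := by
    by_contra h
    have := hp.eps_pos
    nlinarith
  have hent : Real.binEntropy (p.wx / p.ws) ≠ 0 := by
    intro h
    rw [capacity_eq, h] at hcap
    simp at hcap
  have hws : 0 < p.ws := by
    rcases hp.ws_mem.1.lt_or_eq with h | h
    · exact h
    · rw [capacity_eq, ← h] at hcap
      simp at hcap
  have hwx : 0 < p.wx := by
    rcases hp.wx_mem.1.lt_or_eq with h | h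
    · exact h
    · rw [← h] at hent
      simp at hent
  have hlt : p.wx < p.ws := by
    rcases hp.wx_mem.2.lt_or_eq with h | h
    · exact h
    · rw [h, div_self hws.ne'] at hent
      simp at hent
  have hexp := exp_entropy_le (S := p.ws * p.n) (X := p.wx * p.n) (n := p.n)
    (mul_pos hwx hn) (mul_lt_mul_of_pos_right hlt hn) (Nat.floor_le (by positivity))
    (Nat.lt_floor_add_one _) (Nat.floor_le (by positivity)) (Nat.lt_floor_add_one _)
    (Nat.floor_le_of_le (by nlinarith [hp.ws_mem.2])) (by omega)
  rw [mul_div_mul_right _ _ hn.ne'] at hexp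
  have e : Real.exp (p.ws * p.n * Real.binEntropy (p.wx / p.ws)) = 2 ^ (p.n * p.capacity) := by
    rw [Real.rpow_def_of_pos (by norm_num), capacity_eq]
    congr 1
    have : Real.log 2 ≠ 0 := (Real.log_pos (by norm_num)).ne'
    field_simp
  rw [e] at hexp
  set Ch : ℕ := ⌊p.ws * p.n⌋₊.choose ⌊p.wx * p.n⌋₊
  have h1 : ((2 : ℝ) ^ p.k) ≤ 2 ^ (p.n * p.capacity) / 2 ^ (2 * (p.n * p.eps) / 3) := by
    rw [← Real.rpow_sub (by norm_num), ← Real.rpow_natCast]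
    refine Real.rpow_le_rpow_of_exponent_le (by norm_num) ?_
    linarith
  have h2 := hp.t₁_mul_le
  have h3 : (0 : ℝ) < 2 ^ (2 * (p.n * p.eps) / 3) := by positivity
  rw [le_div_iff₀ h3] at h1
  have h4 : ((p.t₁ : ℝ) * 2 ^ p.k) * 2 ^ (2 * (p.n * p.eps) / 3) ≤ Ch * 2 ^ (2 * (p.n * p.eps) / 3) := by
    calc ((p.t₁ : ℝ) * 2 ^ p.k) * 2 ^ (2 * (p.n * p.eps) / 3)
        = p.t₁ * (2 ^ p.k * 2 ^ (2 * (p.n * p.eps) / 3)) := by ring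
      _ ≤ p.t₁ * (3 / 2 * ((p.n : ℝ) + 1) ^ 2 * Ch) :=
          mul_le_mul_of_nonneg_left (h1.trans hexp) (by positivity)
      _ = (p.t₁ * (3 / 2 * ((p.n : ℝ) + 1) ^ 2)) * Ch := by ring
      _ ≤ 2 ^ (2 * (p.n * p.eps) / 3) * Ch := mul_le_mul_of_nonneg_right h2 (by positivity)
      _ = _ := by ring
  have h5 := le_of_mul_le_mul_right h4 h3
  exact_mod_cast h5

end HashParams

end RankMod

/-! ### The hash construction as a WOM code, and its rate -/

namespace RankMod
open RAM

namespace HashParams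

variable {p : HashParams}

theorem Valid.floor_le (hp : p.Valid) : ⌊p.wx * p.n⌋₊ ≤ ⌊p.ws * p.n⌋₊ :=
  Nat.floor_le_floor (mul_le_mul_of_nonneg_right hp.wx_mem.2 (Nat.cast_nonneg _))

/-- The search succeeds in every column. -/
theorem Valid.findKey_spec (hp : p.Valid) {L : List ℕ} {pm ps : ℕ}
    {m : Fin p.t₁ → Fin p.k → Bool} {s : Fin p.t₁ → Fin p.n → Bool}
    (hm : ∀ (i : Fin p.t₁) (b : Fin p.k), L.getD (pm + i * p.k + b) 0 = (m i b).toNat)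
    (hs : ∀ (i : Fin p.t₁) (b : Fin p.n), L.getD (ps + i * p.n + b) 0 = (s i b).toNat)
    (hw : ∀ i, s i ∈ J p.ws p.n) :
    findKey L p.n p.k (leastPoly p.n) ⌊p.wx * p.n⌋₊ p.t₁ pm ps < 2 ^ (p.n + p.n) ∧
      ∀ i : Fin p.t₁,
      ∃ x < 2 ^ p.n, findX L p.n p.k (leastPoly p.n) ⌊p.wx * p.n⌋₊
        (findKey L p.n p.k (leastPoly p.n) ⌊p.wx * p.n⌋₊ p.t₁ pm ps)
        (pm + i * p.k) (ps + i * p.n) = x + 1 ∧ vecOf p.n x ≤ s i ∧ vecOf p.n x ∈ J p.wx p.n ∧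
        hashFn p.n p.k (keyOf p.n (findKey L p.n p.k (leastPoly p.n) ⌊p.wx * p.n⌋₊ p.t₁ pm ps))
          (vecOf p.n x) = m i :=
  RankMod.findKey_spec (by have := hp.n_ge; omega) hp.k_le_n hm hs
    (fun i => hp.floor_le.trans (hw i).ge) (hp.choose_ge.imp_right fun h i => h.trans (by
      have : weight (s i) = ⌊p.ws * p.n⌋₊ := hw i
      rw [this]))

theorem Valid.exists_encoding (hp : p.Valid) (m : p.Message) (s : p.Blocks → J p.ws p.n) :
    ∃ (x : p.Blocks → J p.wx p.n) (key : p.Index), p.decode (x, key) = m ∧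
      ∀ b, (x b : Fin p.n → Bool) ≤ (s b : Fin p.n → Bool) := by
  have h : ∀ j : Fin p.t₂, ∃ key : Key p.n, ∀ i : Fin p.t₁, ∃ x, x ≤ (s (i, j) : Fin p.n → Bool) ∧
      weight x = ⌊p.wx * p.n⌋₊ ∧ hashFn p.n p.k key x = m (i, j) := fun j => by
    have hw : ∀ i, weight (s (i, j) : Fin p.n → Bool) = ⌊p.ws * p.n⌋₊ := fun i => (s (i, j)).2
    exact exists_key (by have := hp.n_ge; omega) hp.k_le_n _ _
      (fun i => hp.floor_le.trans (hw i).ge) (hp.choose_ge.imp_right fun h i => by rwa [hw])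
  choose key x h1 h2 h3 using h
  refine ⟨fun b => ⟨x b.2 b.1, h2 b.2 b.1⟩, key, ?_, fun b => h1 b.2 b.1⟩
  funext b
  exact h3 b.2 b.1

/-- Surjectivity of the decoder is obtained by writing the message over some state, so a state has
to exist. -/
theorem J_nonempty {w : ℝ} {n : ℕ} (h1 : w ≤ 1) : (J w n).Nonempty := by
  have : ⌊w * n⌋₊ ≤ n := Nat.floor_le_of_le (by nlinarith [(Nat.cast_nonneg n : (0 : ℝ) ≤ n)])
  obtain ⟨T, -, hT⟩ := Finset.exists_subset_card_eq (s := (Finset.univ : Finset (Fin n)))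
    (n := ⌊w * n⌋₊) (by simpa using this)
  refine ⟨fun i => decide (i ∈ T), ?_⟩
  show weight _ = _
  rw [weight, ← hT]
  congr 1
  ext i
  simp

/-- `c > 20` makes the exponent exceed `5/3`; of the loss `2`, one comes from the definition of `t₁`
and one from rounding. -/
theorem Valid.t₁_gt (hp : p.Valid) : (1 / p.eps) ^ ((5 : ℝ) / 3) - 2 < p.t₁ := by
  have h1 : (1 / p.eps) ^ ((5 : ℝ) / 3) ≤ (1 / p.eps) ^ (p.c / 12) := by
    refine Real.rpow_le_rpow_of_exponent_le ?_ (by linarith [hp.c_gt])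
    rw [le_div_iff₀ hp.eps_pos]
    linarith [hp.eps_le]
  have h2 := Nat.lt_floor_add_one ((1 / p.eps) ^ (p.c / 12) - 1)
  change _ < (p.t₁ : ℝ) + 1 at h2
  linarith

theorem Valid.t₁_pos (hp : p.Valid) : 0 < p.t₁ := by
  have h1 := hp.t₁_gt
  have h2 : (2 : ℝ) ≤ (1 / p.eps) ^ ((5 : ℝ) / 3) := by
    have h3 : (2 : ℝ) ≤ 1 / p.eps := by
      rw [le_div_iff₀ hp.eps_pos]
      linarith [hp.eps_le]
    calc (2 : ℝ) ≤ 2 ^ ((5 : ℝ) / 3) := by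
          nth_rewrite 1 [← Real.rpow_one 2]
          exact Real.rpow_le_rpow_of_exponent_le (by norm_num) (by norm_num)
      _ ≤ _ := Real.rpow_le_rpow (by norm_num) h3 (by norm_num)
  have : (0 : ℝ) < p.t₁ := by linarith
  exact_mod_cast this

theorem t₂_pos (p : HashParams) : 0 < p.t₂ := Nat.ceil_pos.2 (by positivity)

theorem Valid.isConcatWOMCode (hp : p.Valid) :
    IsConcatWOMCode p.n p.t p.KW p.Ka p.ws p.wx p.decode where
  n_pos := by have := hp.n_ge; omega
  t_pos := Nat.mul_pos hp.t₁_pos p.t₂_pos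
  KW_pos := by unfold KW; positivity
  Ka_pos := by unfold Ka; positivity
  ws_mem := hp.ws_mem
  wx_mem := hp.wx_mem
  card_blocks := by simp [t]
  card_index := by simp [Ka, two_mul, pow_add]
  card_message := by simp [KW, t, Blocks]
  surjective := fun m => by
    obtain ⟨s, hs⟩ := J_nonempty (w := p.ws) (n := p.n) hp.ws_mem.2
    obtain ⟨x, key, h, -⟩ := hp.exists_encoding m fun _ => ⟨s, hs⟩
    exact ⟨_, h⟩
  writable := hp.exists_encoding

/-! ## The rate -/

/-- A key of `2n` bits is shared by `t₁` blocks of `n` cells, which costs `2 / t₁` per cell. -/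
theorem rate_eq (p : HashParams) (hn : 0 < p.n) (ht : 0 < p.t₁) :
    p.rate = p.k / p.n - 2 / p.t₁ := by
  have h2 := p.t₂_pos
  have hn' : (p.n : ℝ) ≠ 0 := by positivity
  have ht' : (p.t₁ : ℝ) ≠ 0 := by positivity
  have h2' : (p.t₂ : ℝ) ≠ 0 := by positivity
  unfold rate concatRate KW Ka t
  rw [Real.logb_div (by positivity) (by positivity)]
  push_cast
  rw [← pow_mul, ← pow_mul, Real.logb_pow, Real.logb_pow, Real.logb_self_eq_one (by norm_num)]
  push_cast
  field_simp

theorem logb_KW (p : HashParams) (hn : 0 < p.n) (ht : 0 < p.t₁) :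
    Real.logb 2 (p.KW : ℝ) / (p.N : ℝ) = p.k / p.n := by
  have h2 := p.t₂_pos
  have hn' : (p.n : ℝ) ≠ 0 := by positivity
  have ht' : (p.t₁ : ℝ) ≠ 0 := by positivity
  have h2' : (p.t₂ : ℝ) ≠ 0 := by positivity
  unfold KW N t
  push_cast
  rw [← pow_mul, Real.logb_pow, Real.logb_self_eq_one (by norm_num)]
  push_cast
  field_simp

theorem Valid.k_div_n_gt (hp : p.Valid) : p.capacity - 2 * p.eps / 3 - 1 / p.n < p.k / p.n := by
  have hn : (0 : ℝ) < p.n := by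
    have := hp.n_ge
    have : 0 < p.n := by omega
    exact_mod_cast this
  have h := Nat.lt_floor_add_one ((p.n : ℝ) * (p.capacity - 2 * p.eps / 3))
  change _ < (p.k : ℝ) + 1 at h
  rw [lt_div_iff₀ hn, sub_mul, one_div_mul_cancel hn.ne']
  linarith

theorem Valid.k_div_n_le (hp : p.Valid) : (p.k : ℝ) / p.n ≤ p.capacity := by
  have hn : (0 : ℝ) < p.n := by
    have := hp.n_ge
    have : 0 < p.n := by omega
    exact_mod_cast this
  rw [div_le_iff₀ hn, mul_comm]
  exact hp.k_le

/-- The loss is at most `2/3` of `eps` from the definition of `k`, `1/20` from rounding `k`, and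
`0.28` from the keys; the sum is below `eps`. -/
theorem Valid.rate_bounds (hp : p.Valid) (he : p.eps ≤ 1 / 20) :
    p.capacity - p.eps < p.rate ∧ p.rate ≤ Real.logb 2 (p.KW : ℝ) / (p.N : ℝ) ∧
      Real.logb 2 (p.KW : ℝ) / (p.N : ℝ) ≤ p.capacity := by
  have hn : 0 < p.n := by have := hp.n_ge; omega
  have ht := hp.t₁_pos
  have hn' : (0 : ℝ) < p.n := by exact_mod_cast hn
  have ht' : (0 : ℝ) < p.t₁ := by exact_mod_cast ht
  rw [logb_KW p hn ht, rate_eq p hn ht]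
  refine ⟨?_, ?_, hp.k_div_n_le⟩
  · have h1 := hp.k_div_n_gt
    have h2 : 1 / (p.n : ℝ) ≤ p.eps / 20 := by
      have := hp.twenty_lt
      have := hp.one_le_logb
      rw [div_le_div_iff₀ hn' (by norm_num)]
      nlinarith
    -- With `1 / eps ≥ 20` the power `(1 / eps) ^ (5/3)` is at least `7.36 / eps`, and the loss `2`
    -- is at most `0.1 / eps`; so `t₁ ≥ 7.26 / eps`.
    have h3 : 2 / (p.t₁ : ℝ) ≤ p.eps * 0.28 := by
      have h4 := hp.t₁_gt
      have hL : (20 : ℝ) ≤ 1 / p.eps := by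
        rw [le_div_iff₀ hp.eps_pos]
        linarith
      have h5 : (7.36 : ℝ) ≤ (1 / p.eps) ^ ((2 : ℝ) / 3) := by
        calc (7.36 : ℝ) = ((7.36 : ℝ) ^ (3 : ℕ)) ^ ((1 : ℝ) / 3) := by
              rw [← Real.rpow_natCast, ← Real.rpow_mul (by norm_num)]
              norm_num
          _ ≤ ((20 : ℝ) ^ (2 : ℕ)) ^ ((1 : ℝ) / 3) :=
              Real.rpow_le_rpow (by norm_num) (by norm_num) (by norm_num)
          _ = 20 ^ ((2 : ℝ) / 3) := by
              rw [← Real.rpow_natCast, ← Real.rpow_mul (by norm_num)]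
              norm_num
          _ ≤ _ := Real.rpow_le_rpow (by norm_num) hL (by norm_num)
      have h6 : (1 / p.eps) ^ ((5 : ℝ) / 3) = (1 / p.eps) * (1 / p.eps) ^ ((2 : ℝ) / 3) := by
        nth_rewrite 2 [← Real.rpow_one (1 / p.eps)]
        rw [← Real.rpow_add (by linarith)]
        norm_num
      have h7 : 7.26 * (1 / p.eps) ≤ p.t₁ := by
        rw [h6] at h4
        nlinarith
      rw [div_le_iff₀ ht']
      have h8 : p.eps * (1 / p.eps) = 1 := mul_one_div_cancel hp.eps_pos.ne'
      nlinarith [mul_le_mul_of_nonneg_left h7 hp.eps_pos.le]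
    linarith [hp.eps_pos]
  · have : 0 < 2 / (p.t₁ : ℝ) := by positivity
    linarith

end HashParams

theorem tendsto_rate {del c ws wx : ℝ} (h1 : 0 < del) (h2 : del ≤ 1 / 2) (h3 : 20 < c)
    (h4 : ws ∈ Set.Icc (0 : ℝ) 1) (h5 : wx ∈ Set.Icc (0 : ℝ) ws) :
    Tendsto (fun eps : ℝ => (HashParams.mk eps del c ws wx).rate) (𝓝[>] 0)
      (𝓝 (womCapacity ws wx)) := by
  have hev : ∀ᶠ eps : ℝ in 𝓝[>] 0, 0 < eps ∧ eps ≤ 1 / 20 := by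
    filter_upwards [Ioo_mem_nhdsGT (show (0 : ℝ) < 1 / 20 by norm_num)] with e he
    exact ⟨he.1, he.2.le⟩
  have hlim : Tendsto (fun eps : ℝ => womCapacity ws wx - eps) (𝓝[>] 0) (𝓝 (womCapacity ws wx)) := by
    have : Tendsto (fun eps : ℝ => womCapacity ws wx - eps) (𝓝 0) (𝓝 (womCapacity ws wx - 0)) :=
      tendsto_const_nhds.sub tendsto_id
    rw [sub_zero] at this
    exact this.mono_left nhdsWithin_le_nhds
  have hv : ∀ eps : ℝ, 0 < eps → eps ≤ 1 / 20 → (HashParams.mk eps del c ws wx).Valid :=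
    fun eps e1 e2 => ⟨e1, by simp only; linarith, h1, h2, h3, h4, h5⟩
  refine tendsto_of_tendsto_of_tendsto_of_le_of_le' hlim tendsto_const_nhds ?_ ?_
  · filter_upwards [hev] with eps ⟨e1, e2⟩
    exact ((hv eps e1 e2).rate_bounds e2).1.le
  · filter_upwards [hev] with eps ⟨e1, e2⟩
    have := (hv eps e1 e2).rate_bounds e2
    exact this.2.1.trans this.2.2

end RankMod

/-! ### Rules for the output and the cost of statements -/

namespace RAM

set_option synthInstance.maxHeartbeats 400000
set_option synthInstance.maxSize 4000

/-- The statement appends `o`, and its cost is at most `c`. -/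
structure SpS (s : S) (L ρ o : List ℕ) (c : ℕ) : Prop where
  out_eq : s.out L ρ = o
  cost_le : s.cost L ρ ≤ c

namespace SpS

variable {L ρ ρ' o o' : List ℕ} {s t : S} {e : E} {v v' c c' d : ℕ}

theorem mono (h : SpS s L ρ o c) (hc : c ≤ c') : SpS s L ρ o c' := ⟨h.1, h.2.trans hc⟩

theorem emit (he : Sp e L ρ v c) (hv : v = v') : SpS (.emit e) L ρ [v'] (c + 3) :=
  ⟨by rw [S.out, he.1, hv], by rw [S.cost]; have := he.2; omega⟩

theorem seq (hs : SpS s L ρ o c) (ht : SpS t (L ++ o) ρ o' c') :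
    SpS (.seq s t) L ρ (o ++ o') (c + c') :=
  ⟨by rw [S.out, hs.1, ht.1], by rw [S.cost, hs.1]; have := hs.2; have := ht.2; omega⟩

theorem bind (he : Sp e L ρ v c) (hv : v = v') [hρ : Concat ρ [v'] ρ'] (hs : SpS s L ρ' o c') :
    SpS (.bind e s) L ρ o (c + c') := by
  subst hv
  rw [← hρ.1] at hs
  exact ⟨by rw [S.out, he.1, hs.1], by rw [S.cost, he.1]; have := he.2; have := hs.2; omega⟩

theorem bindLen (hv : L.length = v) [hρ : Concat ρ [v] ρ'] (hs : SpS s L ρ' o c) :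
    SpS (.bindLen s) L ρ o (c + 2) := by
  subst hv
  rw [← hρ.1] at hs
  exact ⟨by rw [S.out, hs.1], by rw [S.cost]; have := hs.2; omega⟩

theorem cond (he : Sp e L ρ v d) (hs : v ≠ 0 → SpS s L ρ o c) (ht : v = 0 → SpS t L ρ o c) :
    SpS (.cond e s t) L ρ o (d + c + 1) := by
  by_cases h : v = 0
  · have h' : ¬ e.eval L ρ ≠ 0 := by rw [he.1, not_not, h]
    refine ⟨by rw [S.out, if_neg h', (ht h).1], ?_⟩
    rw [S.cost, if_neg h']
    have := he.2
    have := (ht h).2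
    omega
  · have h' : e.eval L ρ ≠ 0 := by rwa [he.1]
    refine ⟨by rw [S.out, if_pos h', (hs h).1], ?_⟩
    rw [S.cost, if_pos h']
    have := he.2
    have := (hs h).2
    omega

/-- Round `i` runs on a memory that already contains the outputs `g 0, …, g (i - 1)`. These are
predicted by `g`, so the rounds can be verified independently. -/
theorem loop {R : ℕ → List ℕ} (g : ℕ → List ℕ) (C : ℕ) (he : Sp e L ρ v d) (hv : v = v')
    [hρ : ∀ i, Concat ρ [i] (R i)]
    (hs : ∀ i < v', SpS s (L ++ (List.range i).flatMap g) (R i) (g i) C) :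
    SpS (.loop e s) L ρ ((List.range v').flatMap g) (d + 2 + v' * (C + 4)) := by
  subst hv
  simp only [← (hρ _).1] at hs
  have key : ∀ n ≤ v, iter (fun i o => o ++ s.out (L ++ o) (ρ ++ [i])) [] n =
      (List.range n).flatMap g := by
    intro n
    induction n with
    | zero => intro _; rfl
    | succ n ih =>
      intro hn
      rw [iter_succ, ih (by omega), (hs n hn).1, List.range_succ]
      simp
  refine ⟨by rw [S.out, he.1, key v le_rfl], ?_⟩
  rw [S.cost, he.1]
  have := he.2
  have h2 := sum_range_le (n := v) (B := C + 4) (f := fun j =>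
    s.cost (L ++ iter (fun i o => o ++ s.out (L ++ o) (ρ ++ [i])) [] j) (ρ ++ [j]) + 4) fun i hi => by
      rw [key i hi.le]
      have := (hs i hi).2
      omega
  omega

/-- A loop whose body does not read what the loop writes. -/
theorem loop' {R : ℕ → List ℕ} (g : ℕ → List ℕ) (C : ℕ) (he : Sp e L ρ v d) (hv : v = v')
    [∀ i, Concat ρ [i] (R i)] (hs : ∀ i < v', ∀ o, SpS s (L ++ o) (R i) (g i) C) :
    SpS (.loop e s) L ρ ((List.range v').flatMap g) (d + 2 + v' * (C + 4)) :=
  loop g C he hv fun i hi => hs i hi _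

end SpS

theorem getD_append_of_lt {L : List ℕ} (o : List ℕ) {a : ℕ} (h : a < L.length) :
    (L ++ o).getD a 0 = L.getD a 0 := List.getD_append _ _ _ _ h

theorem getD_append_add (L o : List ℕ) (a : ℕ) : (L ++ o).getD (L.length + a) 0 = o.getD a 0 := by
  rw [List.getD_append_right _ _ _ _ (by omega), Nat.add_sub_cancel_left]

theorem length_flatMap_range {g : ℕ → List ℕ} {n l : ℕ} (h : ∀ i < n, (g i).length = l) :
    ((List.range n).flatMap g).length = n * l := by
  induction n with
  | zero => simp
  | succ n ih =>
    rw [List.range_succ, List.flatMap_append, List.length_append, ih fun i hi => h i (by omega)]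
    simp [h n (by omega), Nat.succ_mul]

/-- The address computation for arrays of equally long blocks, the only layout used in memory. -/
theorem getD_flatMap_range {g : ℕ → List ℕ} {n l i r : ℕ} (h : ∀ i < n, (g i).length = l)
    (hi : i < n) (hr : r < l) : ((List.range n).flatMap g).getD (i * l + r) 0 = (g i).getD r 0 := by
  induction n with
  | zero => omega
  | succ n ih =>
    have hl := length_flatMap_range fun i hi => h i (Nat.lt_succ_of_lt hi)
    rw [List.range_succ, List.flatMap_append]
    rcases Nat.lt_succ_iff_lt_or_eq.1 hi with h' | rfl
    · rw [List.getD_append _ _ _ _ (by rw [hl]; nlinarith), ih (fun i hi => h i (by omega)) h']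
    · rw [← hl, getD_append_add]
      simp

theorem flatMap_range_congr {g g' : ℕ → List ℕ} {n : ℕ} (h : ∀ i < n, g i = g' i) :
    (List.range n).flatMap g = (List.range n).flatMap g' :=
  List.flatMap_congr fun i hi => h i (List.mem_range.1 hi)

end RAM

namespace RankMod
open RAM

/-! ## Inputs and outputs as lists -/

theorem flat_eq {m : ℕ} (f : Fin m → List ℕ) (g : ℕ → List ℕ) (h : ∀ i : Fin m, f i = g i) :
    flat f = (List.range m).flatMap g := by
  unfold flat
  rw [List.ofFn_eq_map, List.flatMap_def, ← List.map_coe_finRange_eq_range, List.map_map]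
  congr 1
  exact List.map_congr_left fun i _ => h i

theorem ofFn_eq {m : ℕ} (f : Fin m → ℕ) (g : ℕ → ℕ) (h : ∀ i : Fin m, f i = g i) :
    List.ofFn f = (List.range m).flatMap fun i => [g i] := by
  rw [List.ofFn_eq_map, ← List.map_eq_flatMap, ← List.map_coe_finRange_eq_range, List.map_map]
  exact List.map_congr_left fun i _ => h i

theorem length_flat {m l : ℕ} {f : Fin m → List ℕ} (h : ∀ i, (f i).length = l) :
    (flat f).length = m * l := by
  rw [flat_eq f (fun i => if hi : i < m then f ⟨i, hi⟩ else []) (fun i => by simp)]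
  exact length_flatMap_range fun i hi => by simp [hi, h]

theorem getD_flat {m l : ℕ} {f : Fin m → List ℕ} (h : ∀ i, (f i).length = l) (i : Fin m) {r : ℕ}
    (hr : r < l) : (flat f).getD (i * l + r) 0 = (f i).getD r 0 := by
  rw [flat_eq f (fun i => if hi : i < m then f ⟨i, hi⟩ else []) (fun i => by simp),
    getD_flatMap_range (fun i hi => by simp [hi, h]) i.2 hr]
  simp

theorem columns_eq {t₁ t₂ : ℕ} (f : Fin t₁ × Fin t₂ → List ℕ) (g : ℕ → ℕ → List ℕ)
    (h : ∀ b, f b = g b.2 b.1) :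
    columns f = (List.range t₂).flatMap fun j => (List.range t₁).flatMap fun i => g j i :=
  flat_eq _ _ fun j => flat_eq _ _ fun i => h (i, j)

theorem length_columns {t₁ t₂ l : ℕ} {f : Fin t₁ × Fin t₂ → List ℕ} (h : ∀ b, (f b).length = l) :
    (columns f).length = t₂ * (t₁ * l) :=
  length_flat fun _ => length_flat fun _ => h _

theorem getD_columns {t₁ t₂ l : ℕ} {f : Fin t₁ × Fin t₂ → List ℕ} (h : ∀ b, (f b).length = l)
    (i : Fin t₁) (j : Fin t₂) {r : ℕ} (hr : r < l) :
    (columns f).getD (j * (t₁ * l) + (i * l + r)) 0 = (f (i, j)).getD r 0 := by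
  have hlt : (i : ℕ) * l + r < t₁ * l := by
    have := i.2
    nlinarith
  unfold columns
  rw [getD_flat (fun j => length_flat fun i => h _) j hlt, getD_flat (fun i => h _) i hr]

theorem length_bits {n : ℕ} (x : Fin n → Bool) : (bits x).length = n := by simp [bits]

theorem getD_bits {n : ℕ} (x : Fin n → Bool) (i : Fin n) : (bits x).getD i 0 = (x i).toNat := by
  simp [bits]

theorem getD_ofFn {n : ℕ} (x : Fin n → ℕ) (i : Fin n) : (List.ofFn x).getD i 0 = x i := by
  simp

theorem bits_vecOf (n x : ℕ) :
    bits (vecOf n x) = (List.range n).flatMap fun b => [(x.testBit b).toNat] :=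
  ofFn_eq _ _ fun _ => rfl

/-- Both halves of a key, one after the other, are the `2n` lowest bits of its number, so a single
loop emits them. -/
theorem bits_keyOf (n c : ℕ) : bits (keyOf n c).1 ++ bits (keyOf n c).2 =
    (List.range (n + n)).flatMap fun b => [(c.testBit b).toNat] := by
  have h1 : bits (keyOf n c).1 = (List.range n).flatMap fun b => [(c.testBit b).toNat] :=
    ofFn_eq _ _ fun _ => rfl
  have h2 : bits (keyOf n c).2 = (List.range n).flatMap fun b => [(c.testBit (n + b)).toNat] :=
    ofFn_eq _ _ fun _ => rfl
  rw [h1, h2, List.range_add, List.flatMap_append, List.flatMap_map]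

end RankMod

/-! ### The encoder of the hash code as a program -/

namespace RAM

set_option synthInstance.maxHeartbeats 400000
set_option synthInstance.maxSize 4000

theorem SpS.of_call {k : ℕ} {args : Fin k → E} {s : S} {L ρ o : List ℕ} {v c : Fin k → ℕ} {d C : ℕ}
    (h : ∀ i, Sp (args i) L ρ (v i) (c i)) (hs : SpS s L (List.ofFn v) o d)
    (hC : ∑ i, c i + d + 1 ≤ C) : SpS (.call k args s) L ρ o C := by
  have e : (fun i => (args i).eval L ρ) = v := funext fun i => (h i).1
  refine ⟨by rw [S.out, e, hs.1], ?_⟩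
  rw [S.cost, e]
  have := hs.2
  have := Finset.sum_le_sum fun i (_ : i ∈ Finset.univ) => (h i).2
  omega

theorem SpS.call8 {s : S} {a0 a1 a2 a3 a4 a5 a6 a7 : E} {L ρ o : List ℕ}
    {v0 v1 v2 v3 v4 v5 v6 v7 c0 c1 c2 c3 c4 c5 c6 c7 d : ℕ}
    (h0 : Sp a0 L ρ v0 c0) (h1 : Sp a1 L ρ v1 c1) (h2 : Sp a2 L ρ v2 c2) (h3 : Sp a3 L ρ v3 c3)
    (h4 : Sp a4 L ρ v4 c4) (h5 : Sp a5 L ρ v5 c5) (h6 : Sp a6 L ρ v6 c6) (h7 : Sp a7 L ρ v7 c7)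
    (hs : SpS s L [v0, v1, v2, v3, v4, v5, v6, v7] o d) :
    SpS (.call 8 ![a0, a1, a2, a3, a4, a5, a6, a7] s) L ρ o
      (c0 + c1 + c2 + c3 + c4 + c5 + c6 + c7 + d + 1) :=
  SpS.of_call (v := ![v0, v1, v2, v3, v4, v5, v6, v7]) (c := ![c0, c1, c2, c3, c4, c5, c6, c7])
    (d := d) (by simp [Fin.forall_fin_succ, h0, h1, h2, h3, h4, h5, h6, h7]) (by simpa using hs)
    (by simp [Fin.sum_univ_succ]; omega)

/-! ## The search reads only the message and the state -/

section Congr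
variable {L L' : List ℕ} {A n k f w t₁ pm ps : ℕ} (hL : ∀ a < A, L.getD a 0 = L'.getD a 0)
include hL

/-- The memory grows between the search for a key and the later search for its vectors. Both read
only message and state at addresses below `A`, so they agree. -/
theorem failCount_congr (hm : pm + k ≤ A) (hs : ps + n ≤ A) (c x : ℕ) :
    failCount L n k f w c pm ps x = failCount L' n k f w c pm ps x := by
  unfold failCount
  simp only
  congr 1
  · refine Finset.sum_congr rfl fun b hb => ?_
    have := Finset.mem_range.1 hb
    rw [hL _ (by omega)]
  · congr 1
    refine Finset.sum_congr rfl fun b hb => ?_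
    have := Finset.mem_range.1 hb
    rw [hL _ (by omega)]

theorem findX_congr (hm : pm + k ≤ A) (hs : ps + n ≤ A) (c : ℕ) :
    findX L n k f w c pm ps = findX L' n k f w c pm ps := by
  refine iter_congr _ fun x _ b => ?_
  rw [failCount_congr hL hm hs]

theorem findKey_congr (hm : pm + t₁ * k ≤ A) (hs : ps + t₁ * n ≤ A) :
    findKey L n k f w t₁ pm ps = findKey L' n k f w t₁ pm ps := by
  refine iter_congr _ fun c _ b => ?_
  have : goodKey L n k f w t₁ c pm ps = goodKey L' n k f w t₁ c pm ps := by
    refine iter_congr _ fun i hi b => ?_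
    rw [findX_congr hL (by nlinarith) (by nlinarith)]
  rw [this]

end Congr

/-- Block number `j` of length `l` ends inside an array of `n` blocks. -/
theorem succ_mul_le {j n : ℕ} (l : ℕ) (h : j < n) : j * l + l ≤ n * l := by
  rw [← Nat.succ_mul]
  exact Nat.mul_le_mul_right _ h

/-- The keys for all columns. -/
def keysS (n k f w t₁ t₂ pm ps : E) : S := .call 8 ![n, k, f, w, t₁, t₂, pm, ps]
  (.bind (mulE (.var 4) (.var 1)) (.bind (mulE (.var 4) (.var 0)) (.loop (.var 5)
    (.emit (findKeyE (.var 0) (.var 1) (.var 2) (.var 3) (.var 4)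
      (.add (.var 6) (mulE (.var 10) (.var 8))) (.add (.var 7) (mulE (.var 10) (.var 9))))))))

/-- The number of the key for column `j`. -/
def keyNum (L : List ℕ) (n k f w t₁ pm ps j : ℕ) : ℕ :=
  findKey L n k f w t₁ (pm + j * (t₁ * k)) (ps + j * (t₁ * n))

theorem SpS.keys {L ρ : List ℕ} {n k f w t₁ t₂ pm ps : E} {vn vk vf vw vt vt₂ vpm vps : ℕ}
    {cn ck cf cw ct ct₂ cpm cps : ℕ} (hn : Sp n L ρ vn cn) (hk : Sp k L ρ vk ck)
    (hf : Sp f L ρ vf cf) (hw : Sp w L ρ vw cw) (ht : Sp t₁ L ρ vt ct) (ht₂ : Sp t₂ L ρ vt₂ ct₂)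
    (hpm : Sp pm L ρ vpm cpm) (hps : Sp ps L ρ vps cps)
    (hlm : vpm + vt₂ * (vt * vk) ≤ L.length) (hls : vps + vt₂ * (vt * vn) ≤ L.length) :
    SpS (keysS n k f w t₁ t₂ pm ps) L ρ
      ((List.range vt₂).flatMap fun j => [keyNum L vn vk vf vw vt vpm vps j])
      (cn + ck + cf + cw + ct + ct₂ + cpm + cps +
        (vt₂ + 1) * (2 ^ (vn + vn) * ((vt + 1) * (2 ^ vn * (4000 * (vn + vk + 1) ^ 3))))) := by
  have h1 : 1 ≤ 2 ^ vn := Nat.one_le_two_pow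
  have h0 : 1 ≤ 2 ^ (vn + vn) := Nat.one_le_two_pow
  have h2 : vn + vk + 1 ≤ (vn + vk + 1) ^ 3 := Nat.le_self_pow (by norm_num) _
  -- The bound for one column: the search for its key, and two address computations by repeated
  -- addition.
  set C := 2 ^ (vn + vn) * ((vt + 1) * (2 ^ vn * (3000 * (vn + vk + 1) ^ 3))) +
    (vt * vk + vt * vn) * 11 + 200 with hC
  refine (SpS.call8 hn hk hf hw ht ht₂ hpm hps (SpS.bind inferInstance rfl
    (SpS.bind inferInstance rfl (SpS.loop' _ C inferInstance rfl fun j hj o => ?_)))).mono ?_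
  · refine (SpS.emit inferInstance ?_).mono ?_
    · refine findKey_congr (A := L.length) (fun a ha => getD_append_of_lt _ ha) ?_ ?_
      · have := succ_mul_le (vt * vk) hj
        omega
      · have := succ_mul_le (vt * vn) hj
        omega
    · rw [hC]
      omega
  · have e : 2 ^ (vn + vn) * ((vt + 1) * (2 ^ vn * (4000 * (vn + vk + 1) ^ 3))) =
      2 ^ (vn + vn) * ((vt + 1) * (2 ^ vn * (3000 * (vn + vk + 1) ^ 3))) +
        1000 * (2 ^ (vn + vn) * 2 ^ vn * ((vt + 1) * (vn + vk + 1) ^ 3)) := by ring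
    have e1 : (vt + 1) * (vn + vk + 1) ≤ 2 ^ (vn + vn) * 2 ^ vn * ((vt + 1) * (vn + vk + 1) ^ 3) :=
      (Nat.mul_le_mul_left _ h2).trans (Nat.le_mul_of_pos_left _ (by positivity))
    have e2 : (vt + 1) * (vn + vk + 1) = vt * vk + vt * vn + vt + vn + vk + 1 := by ring
    have e3 : C + 200 + 11 * vn + 11 * vk ≤
        2 ^ (vn + vn) * ((vt + 1) * (2 ^ vn * (4000 * (vn + vk + 1) ^ 3))) := by
      rw [e, hC]
      omega
    generalize 2 ^ (vn + vn) * ((vt + 1) * (2 ^ vn * (4000 * (vn + vk + 1) ^ 3))) = D at *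
    have e4 : vt₂ * (C + 4) ≤ vt₂ * D := Nat.mul_le_mul_left _ (by omega)
    rw [add_one_mul]
    omega

/-- The lowest `n` binary digits of `x`. -/
def natBits (n x : ℕ) : List ℕ := (List.range n).flatMap fun b => [(x.testBit b).toNat]

theorem length_natBits (n x : ℕ) : (natBits n x).length = n := by
  rw [natBits, length_flatMap_range (l := 1) fun _ _ => rfl, mul_one]

/-- The number of the vector for block `(i, j)`. -/
def xNum (L : List ℕ) (n k f w t₁ pm ps j i : ℕ) : ℕ :=
  findX L n k f w (keyNum L n k f w t₁ pm ps j) (pm + j * (t₁ * k) + i * k)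
    (ps + j * (t₁ * n) + i * n) - 1

theorem SpS.natBits {L ρ ρ' : List ℕ} {e x n : E} {vx vn cx cn c c' : ℕ} {R : ℕ → List ℕ}
    [hx : Sp e L ρ vx cx] [Concat ρ [vx] ρ'] [hn : Sp n L ρ' vn cn]
    [hR : ∀ i, Concat ρ' [i] (R i)] (he : ∀ i < vn, ∀ o, Sp x (L ++ o) (R i) (vx.testBit i).toNat c)
    (hC : cx + cn + 2 + vn * (c + 7) ≤ c') :
    SpS (.bind e (.loop n (.emit x))) L ρ (natBits vn vx) c' :=
  (SpS.bind hx rfl (SpS.loop' _ (c + 3) hn rfl fun i hi o => SpS.emit (he i hi o) rfl)).mono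
    (by rw [show c + 3 + 4 = c + 7 from rfl]; omega)

/-- Variables `0` to `4` are the header, `5` the modulus, `6` and `7` the lengths of a column of
message and state, `8` the address of the state, `9` the address of the output. The key numbers are
emitted as scratch data; then each vector is searched again with its key fixed, and at last the key
numbers are spelled out in bits. -/
def womEncS : S := .bind (.ld (.lit 0)) (.bind (.ld (.lit 1)) (.bind (.ld (.lit 2))
  (.bind (.ld (.lit 3)) (.bind (.ld (.lit 4)) (.bind (leastPolyE (.var 0))
  (.bind (mulE (.var 2) (.var 1)) (.bind (mulE (.var 2) (.var 0))
  (.bind (.add (.lit 5) (mulE (mulE (.var 3) (.var 1)) (.var 2))) (.bindLen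
    (.seq (keysS (.var 0) (.var 1) (.var 5) (.var 4) (.var 2) (.var 3) (.lit 5) (.var 8))
    (.seq (.loop (.var 3) (.loop (.var 2) (.bind (.sub (findXE (.var 0) (.var 1) (.var 5) (.var 4)
        (.ld (.add (.var 9) (.var 10)))
        (.add (.add (.lit 5) (mulE (.var 10) (.var 6))) (mulE (.var 11) (.var 1)))
        (.add (.add (.var 8) (mulE (.var 10) (.var 7))) (mulE (.var 11) (.var 0)))) (.lit 1))
      (.loop (.var 0) (.emit (bitE (.var 12) (.var 13)))))))
    (.loop (.var 3) (.bind (.ld (.add (.var 9) (.var 10)))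
      (.loop (.add (.var 0) (.var 0)) (.emit (bitE (.var 11) (.var 12)))))))))))))))))

theorem womEncS_spec {L : List ℕ} {n k t₁ t₂ w : ℕ} (h0 : L.getD 0 0 = n) (h1 : L.getD 1 0 = k)
    (h2 : L.getD 2 0 = t₁) (h3 : L.getD 3 0 = t₂) (h4 : L.getD 4 0 = w)
    (hL : L.length = 5 + t₂ * (t₁ * k) + t₂ * (t₁ * n)) (ht : t₁ ≤ 2 ^ n) :
    SpS womEncS L [] (((List.range t₂).flatMap fun j =>
        [keyNum L n k (leastPoly n) w t₁ 5 (5 + t₂ * (t₁ * k)) j]) ++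
      (((List.range t₂).flatMap fun j => (List.range t₁).flatMap fun i =>
        natBits n (xNum L n k (leastPoly n) w t₁ 5 (5 + t₂ * (t₁ * k)) j i)) ++
      (List.range t₂).flatMap fun j =>
        natBits (n + n) (keyNum L n k (leastPoly n) w t₁ 5 (5 + t₂ * (t₁ * k)) j)))
      ((t₂ + 1) * ((2 ^ n) ^ 3 * ((t₁ + 1) * (20000 * (n + k + 1) ^ 3)))) := by
  have hP : 1 ≤ 2 ^ n := Nat.one_le_two_pow
  have hK0 : n + k + 1 ≤ (n + k + 1) ^ 3 := Nat.le_self_pow (by norm_num) _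
  have hK1 : (n + k + 1) * (n + k + 1) ≤ (n + k + 1) ^ 3 := by
    rw [← sq]
    exact Nat.pow_le_pow_right (by omega) (by omega)
  set ps := 5 + t₂ * (t₁ * k) with hps
  set K := (List.range t₂).flatMap fun j => [keyNum L n k (leastPoly n) w t₁ 5 ps j] with hK
  have hKl : K.length = t₂ := by rw [hK, length_flatMap_range (l := 1) fun _ _ => rfl, mul_one]
  -- The key numbers can be read back at the same addresses whatever has been emitted afterwards.
  have hKj : ∀ j < t₂, ∀ o, (L ++ K ++ o).getD (L.length + j) 0 =
      keyNum L n k (leastPoly n) w t₁ 5 ps j := by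
    intro j hj o
    rw [List.append_assoc, getD_append_add, getD_append_of_lt _ (by omega), hK]
    have := getD_flatMap_range (g := fun j => [keyNum L n k (leastPoly n) w t₁ 5 ps j]) (l := 1)
      (r := 0) (fun _ _ => rfl) hj one_pos
    simpa using this
  refine SpS.mono (SpS.bind inferInstance h0 <| SpS.bind inferInstance h1 <|
    SpS.bind inferInstance h2 <| SpS.bind inferInstance h3 <| SpS.bind inferInstance h4 <|
    SpS.bind inferInstance rfl <| SpS.bind inferInstance rfl <| SpS.bind inferInstance rfl <|
    SpS.bind (v' := ps) inferInstance ?_ <| SpS.bindLen rfl <|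
    SpS.seq (SpS.keys inferInstance inferInstance inferInstance inferInstance
      inferInstance inferInstance inferInstance inferInstance ?_ ?_) <|
    SpS.seq (SpS.loop' (fun j => (List.range t₁).flatMap fun i =>
          natBits n (xNum L n k (leastPoly n) w t₁ 5 ps j i))
        (t₁ * (2 ^ n * (5100 * (n + k + 1) ^ 3)) + 4) inferInstance rfl
        fun j hj o => (SpS.loop' _ (2 ^ n * (5000 * (n + k + 1) ^ 3))
          inferInstance rfl fun i hi o' => (SpS.natBits (ρ' := [n, k, t₁, t₂, w, leastPoly n,
              t₁ * k, t₁ * n, ps, L.length, j, i, xNum L n k (leastPoly n) w t₁ 5 ps j i])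
            (c := 9 * n + 100) (hx := Sp.mono inferInstance ?_ le_rfl) ?_ ?_)).mono ?_)
      (SpS.loop' (fun j => natBits (n + n) (keyNum L n k (leastPoly n) w t₁ 5 ps j))
        (10000 * (n + k + 1) ^ 3) inferInstance rfl
        fun j hj o => SpS.natBits (ρ' := [n, k, t₁, t₂, w, leastPoly n, t₁ * k, t₁ * n, ps,
            L.length, j, keyNum L n k (leastPoly n) w t₁ 5 ps j])
          (c := 18 * n + 100) (hx := Sp.mono inferInstance ?_ le_rfl) ?_ ?_)) ?_
  · rw [hps]
    ring
  · omega
  · omega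
  · rw [List.append_assoc, List.append_assoc, ← List.append_assoc L, hKj j hj, xNum]
    congr 1
    refine findX_congr (A := L.length) (fun a ha => ?_) ?_ ?_ _
    · rw [List.append_assoc, getD_append_of_lt _ ha]
    · have := succ_mul_le (t₁ * k) hj
      have := succ_mul_le k hi
      omega
    · have := succ_mul_le (t₁ * n) hj
      have := succ_mul_le n hi
      omega
  · exact fun b hb o => Sp.mono inferInstance rfl (by omega)
  · nlinarith
  · have h5 : 2 ^ n * (5000 * (n + k + 1) ^ 3) + 4 ≤ 2 ^ n * (5100 * (n + k + 1) ^ 3) := by nlinarith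
    have := Nat.mul_le_mul_left t₁ h5
    omega
  · rw [List.append_assoc, hKj j hj]
  · exact fun b hb o => Sp.mono inferInstance rfl (by omega)
  · nlinarith
  -- Every contribution is compared with `D = (2 ^ n) ^ 3 * ((t₁ + 1) * (n + k + 1) ^ 3)`, times the
  -- number of columns where it arises in a loop; after that the inequality is linear.
  · have e1 : 2 ^ (n + n) * ((t₁ + 1) * (2 ^ n * (4000 * (n + k + 1) ^ 3))) =
        4000 * ((2 ^ n) ^ 3 * ((t₁ + 1) * (n + k + 1) ^ 3)) := by ring
    have e2 : (2 ^ n) ^ 3 * ((t₁ + 1) * (20000 * (n + k + 1) ^ 3)) =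
        20000 * ((2 ^ n) ^ 3 * ((t₁ + 1) * (n + k + 1) ^ 3)) := by ring
    have hP3 : 2 ^ n ≤ (2 ^ n) ^ 3 := Nat.le_self_pow (by norm_num) _
    have h6 : 2 ^ n * (t₁ * (n + k + 1) ^ 3) ≤ (2 ^ n) ^ 3 * ((t₁ + 1) * (n + k + 1) ^ 3) :=
      Nat.mul_le_mul hP3 (Nat.mul_le_mul_right _ (by omega))
    have h7 : (2 ^ n) ^ 3 * (n + 1) ^ 3 ≤ (2 ^ n) ^ 3 * ((t₁ + 1) * (n + k + 1) ^ 3) :=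
      Nat.mul_le_mul_left _ ((Nat.pow_le_pow_left (by omega) 3).trans
        (Nat.le_mul_of_pos_left _ (by omega)))
    have h8 : (t₁ + 1) * (n + k + 1) ^ 3 ≤ (2 ^ n) ^ 3 * ((t₁ + 1) * (n + k + 1) ^ 3) :=
      Nat.le_mul_of_pos_left _ (by positivity)
    have h9 : (t₁ + 1) * (n + k + 1) ≤ (t₁ + 1) * (n + k + 1) ^ 3 := Nat.mul_le_mul_left _ hK0
    have h10 : (t₁ + 1) * (n + k + 1) = t₁ * (n + k) + t₁ + n + k + 1 := by ring
    have h11 : (n + k + 1) ^ 3 ≤ (t₁ + 1) * (n + k + 1) ^ 3 := Nat.le_mul_of_pos_left _ (by omega)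
    have e3 : t₁ * (2 ^ n * (5100 * (n + k + 1) ^ 3)) = 5100 * (2 ^ n * (t₁ * (n + k + 1) ^ 3)) := by
      ring
    have e4 : (2 ^ n) ^ 3 * (3000 * (n + 1) ^ 3) = 3000 * ((2 ^ n) ^ 3 * (n + 1) ^ 3) := by ring
    rw [e1, e2, e3, e4]
    generalize (2 ^ n) ^ 3 * ((t₁ + 1) * (n + k + 1) ^ 3) = D at *
    generalize 2 ^ n * (t₁ * (n + k + 1) ^ 3) = D1 at *
    generalize (2 ^ n) ^ 3 * (n + 1) ^ 3 = D2 at *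
    generalize (n + k + 1) ^ 3 = K3 at *
    have f1 : t₂ * (5100 * D1 + 4 + 4) ≤ t₂ * (5200 * D) := Nat.mul_le_mul_left _ (by omega)
    have f2 : t₂ * (10000 * K3 + 4) ≤ t₂ * (10100 * D) := Nat.mul_le_mul_left _ (by omega)
    have e5 : (t₂ + 1) * (4000 * D) = 4000 * (t₂ * D) + 4000 * D := by ring
    have e6 : (t₂ + 1) * (20000 * D) = 20000 * (t₂ * D) + 20000 * D := by ring
    have e7 : t₂ * (5200 * D) = 5200 * (t₂ * D) := by ring
    have e8 : t₂ * (10100 * D) = 10100 * (t₂ * D) := by ring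
    have h12 := Nat.zero_le (t₁ * (n + k))
    rw [e5, e6]
    rw [e7] at f1
    rw [e8] at f2
    omega

end RAM

/-! ### Correctness and running time of the encoder of the hash code -/

namespace RankMod
open RAM

namespace HashParams

variable {p : HashParams}

/-- The addresses `pm` and `ps` are arbitrary because the rank-modulation encoder runs the same
search on states that it has computed itself. -/
theorem Valid.search_spec (hp : p.Valid) {L : List ℕ} {pm ps : ℕ} {m : p.Message}
    {s : p.Blocks → Fin p.n → Bool}
    (hm : ∀ (i : Fin p.t₁) (j : Fin p.t₂) (b : Fin p.k),
      L.getD (pm + j * (p.t₁ * p.k) + i * p.k + b) 0 = (m (i, j) b).toNat)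
    (hs : ∀ (i : Fin p.t₁) (j : Fin p.t₂) (b : Fin p.n),
      L.getD (ps + j * (p.t₁ * p.n) + i * p.n + b) 0 = (s (i, j) b).toNat)
    (hw : ∀ b, s b ∈ J p.ws p.n) :
    IsHashEncoding p.wx m s
      (fun b => vecOf p.n (xNum L p.n p.k (leastPoly p.n) ⌊p.wx * p.n⌋₊ p.t₁ pm ps b.2 b.1))
      (fun j => keyOf p.n (keyNum L p.n p.k (leastPoly p.n) ⌊p.wx * p.n⌋₊ p.t₁ pm ps j)) ∧
    ∀ j : Fin p.t₂,
      keyNum L p.n p.k (leastPoly p.n) ⌊p.wx * p.n⌋₊ p.t₁ pm ps j < 2 ^ (p.n + p.n) := by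
  have h := fun j : Fin p.t₂ => hp.findKey_spec (m := fun i => m (i, j)) (s := fun i => s (i, j))
    (fun i b => hm i j b) (fun i b => hs i j b) fun i => hw (i, j)
  refine ⟨fun j i => ?_, fun j => (h j).1⟩
  obtain ⟨x, hx, h1, h2, h3, h4⟩ := (h j).2 i
  have e : xNum L p.n p.k (leastPoly p.n) ⌊p.wx * p.n⌋₊ p.t₁ pm ps j i = x := by
    rw [xNum, keyNum, h1, Nat.add_sub_cancel]
  simp only [e]
  exact ⟨h2, h3, h4⟩

theorem length_header (p : HashParams) : p.header.length = 5 := rfl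

theorem length_bitColumns {t₁ t₂ l : ℕ} (x : Fin t₁ × Fin t₂ → Fin l → Bool) :
    (columns fun b => bits (x b)).length = t₂ * (t₁ * l) := length_columns fun _ => length_bits _

theorem getD_bitColumns {t₁ t₂ l : ℕ} (x : Fin t₁ × Fin t₂ → Fin l → Bool) (i : Fin t₁)
    (j : Fin t₂) (r : Fin l) : (columns fun b => bits (x b)).getD (j * (t₁ * l) + i * l + r) 0 =
      (x (i, j) r).toNat := by
  rw [add_assoc, getD_columns (fun _ => length_bits _) i j r.2, getD_bits]

theorem bitColumn_lt {t₁ t₂ l : ℕ} (i : Fin t₁) (j : Fin t₂) (r : Fin l) :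
    j * (t₁ * l) + i * l + r < t₂ * (t₁ * l) := by
  have := succ_mul_le (t₁ * l) j.2
  have := succ_mul_le l i.2
  have := r.2
  omega

theorem length_encInput (p : HashParams) (m : p.Message) (s : p.Blocks → Fin p.n → Bool) :
    (p.encInput m s).length = 5 + p.t₂ * (p.t₁ * p.k) + p.t₂ * (p.t₁ * p.n) := by
  unfold encInput
  rw [List.length_append, List.length_append, length_bitColumns, length_bitColumns, length_header]

theorem encInput_message (p : HashParams) (m : p.Message) (s : p.Blocks → Fin p.n → Bool)
    (i : Fin p.t₁) (j : Fin p.t₂) (b : Fin p.k) :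
    (p.encInput m s).getD (5 + j * (p.t₁ * p.k) + i * p.k + b) 0 = (m (i, j) b).toNat := by
  have h := bitColumn_lt i j b
  unfold encInput
  rw [getD_append_of_lt _ (by rw [List.length_append, length_bitColumns, length_header]; omega),
    ← getD_bitColumns m i j b, ← length_header p, add_assoc, add_assoc, getD_append_add, add_assoc]

theorem encInput_state (p : HashParams) (m : p.Message) (s : p.Blocks → Fin p.n → Bool)
    (i : Fin p.t₁) (j : Fin p.t₂) (b : Fin p.n) :
    (p.encInput m s).getD (5 + p.t₂ * (p.t₁ * p.k) + j * (p.t₁ * p.n) + i * p.n + b) 0 =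
      (s (i, j) b).toNat := by
  unfold encInput
  have e : 5 + p.t₂ * (p.t₁ * p.k) = (p.header ++ columns fun b => bits (m b)).length := by
    rw [List.length_append, length_bitColumns, length_header]
  rw [← getD_bitColumns s i j b, e, add_assoc, add_assoc, getD_append_add, add_assoc]

theorem wordList_eq (p : HashParams) (x : ℕ → ℕ → ℕ) (c : ℕ → ℕ) :
    p.wordList (fun b => vecOf p.n (x b.2 b.1)) (fun j => keyOf p.n (c j)) =
      ((List.range p.t₂).flatMap fun j => (List.range p.t₁).flatMap fun i => natBits p.n (x j i)) ++
      (List.range p.t₂).flatMap fun j => natBits (p.n + p.n) (c j) := by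
  unfold wordList
  rw [columns_eq _ (fun j i => natBits p.n (x j i)) fun b => bits_vecOf _ _,
    flat_eq _ (fun j => natBits (p.n + p.n) (c j)) fun j => bits_keyOf _ _]

theorem length_wordList (p : HashParams) (x : p.Blocks → Fin p.n → Bool) (key : p.Index) :
    (p.wordList x key).length = p.t₂ * (p.t₁ * p.n) + p.t₂ * (p.n + p.n) := by
  unfold wordList
  rw [List.length_append, length_bitColumns, length_flat (l := p.n + p.n) fun j => by
    rw [List.length_append, length_bits, length_bits]]

/-- Programs may spend `2 ^ (4 n)` steps on each cell. -/
theorem Valid.two_pow_le (hp : p.Valid) : (2 : ℝ) ^ (4 * p.n) ≤ (p.N : ℝ) ^ p.del := by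
  have ht := hp.t₁_pos
  have hn : 0 < p.n := by have := hp.n_ge; omega
  have h1 : (2 : ℝ) ^ (4 * (p.n : ℝ) / p.del) ≤ p.N := by
    have h2 : (2 : ℝ) ^ (4 * (p.n : ℝ) / p.del) ≤ p.t₂ := Nat.le_ceil _
    refine h2.trans ?_
    have : p.t₂ ≤ p.N := by
      unfold N t
      rw [← mul_assoc]
      exact Nat.le_mul_of_pos_left _ (Nat.mul_pos hn ht)
    exact_mod_cast this
  calc (2 : ℝ) ^ (4 * p.n) = ((2 : ℝ) ^ (4 * (p.n : ℝ) / p.del)) ^ p.del := by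
        rw [← Real.rpow_mul (by norm_num), div_mul_cancel₀ _ hp.del_pos.ne', ← Real.rpow_natCast]
        push_cast
        rfl
    _ ≤ _ := Real.rpow_le_rpow (by positivity) h1 hp.del_pos.le

theorem Valid.t₁_le_two_pow (hp : p.Valid) : p.t₁ ≤ 2 ^ p.n := by
  have h1 := hp.t₁_le.trans hp.pow_le
  have h2 : (2 : ℝ) ^ (p.n * p.eps / 12) ≤ 2 ^ (p.n : ℝ) := by
    refine Real.rpow_le_rpow_of_exponent_le (by norm_num) ?_
    have := hp.eps_le
    have : (0 : ℝ) ≤ p.n := Nat.cast_nonneg _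
    nlinarith
  have h3 := h1.trans h2
  rw [Real.rpow_natCast] at h3
  exact_mod_cast h3

/-- The smallest possible block length `41` is already large enough for `2 ^ n` to dominate the
cubic cost of an elementary test with its constant. -/
theorem poly_le_two_pow {n : ℕ} (hn : 41 ≤ n) : 500000 * (2 * n + 1) ^ 3 ≤ 2 ^ n * n := by
  have h : 100000000 * n ^ 2 ≤ 2 ^ n := by
    induction n, hn using Nat.le_induction with
    | base => norm_num
    | succ n hn ih =>
      rw [pow_succ 2 n]
      nlinarith
  have h2 : (2 * n + 1) ^ 3 ≤ 27 * n ^ 3 := by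
    calc (2 * n + 1) ^ 3 ≤ (3 * n) ^ 3 := Nat.pow_le_pow_left (by omega) 3
      _ = _ := by ring
  calc 500000 * (2 * n + 1) ^ 3 ≤ 100000000 * n ^ 2 * n := by nlinarith
    _ ≤ _ := Nat.mul_le_mul_right _ h

/-- The program takes `2 ^ (3n) * t₁ * t₂` steps times a polynomial in `n`, and `N = n * t₁ * t₂`. A
fourth factor `2 ^ n` absorbs the polynomial, and `2 ^ (4n) ≤ N ^ del` is what `t₂` has been chosen
for. -/
theorem exists_encoder : ∃ P : RAM.Prog, ∀ p : RankMod.HashParams, p.Valid →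
      ∀ (m : p.Message) (s : p.Blocks → RankMod.J p.ws p.n),
        ∃ (x : p.Blocks → Fin p.n → Bool) (key : p.Index) (T : ℕ),
          RankMod.IsHashEncoding p.wx m (fun b => (s b : Fin p.n → Bool)) x key ∧
          RAM.Computes P (p.encInput m fun b => (s b : Fin p.n → Bool)) (p.wordList x key) T ∧
          (T : ℝ) < (p.N : ℝ) ^ (1 + p.del) := by
  refine ⟨S.prog (.add (.lit 5) (.add
      (mulE (mulE (.ld (.lit 3)) (.ld (.lit 1))) (.ld (.lit 2)))
      (mulE (mulE (.ld (.lit 3)) (.ld (.lit 0))) (.ld (.lit 2))))) womEncS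
    (.add (mulE (mulE (.ld (.lit 3)) (.ld (.lit 0))) (.ld (.lit 2)))
      (mulE (.ld (.lit 3)) (.add (.ld (.lit 0)) (.ld (.lit 0))))), fun p hp m s => ?_⟩
  set s' : p.Blocks → Fin p.n → Bool := fun b => (s b : Fin p.n → Bool)
  set L := p.encInput m s' with hL
  have hLl := p.length_encInput m s'
  obtain ⟨h1, h2⟩ := hp.search_spec (L := L) (p.encInput_message m s') (p.encInput_state m s')
    fun b => (s b).2
  have h0 : L.getD 0 0 = p.n ∧ L.getD 1 0 = p.k ∧ L.getD 2 0 = p.t₁ ∧ L.getD 3 0 = p.t₂ :=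
    ⟨rfl, rfl, rfl, rfl⟩
  have hs := womEncS_spec (L := L) (w := ⌊p.wx * p.n⌋₊) h0.1 h0.2.1 h0.2.2.1 h0.2.2.2 rfl hLl
    hp.t₁_le_two_pow
  have hw := p.wordList_eq (xNum L p.n p.k (leastPoly p.n) ⌊p.wx * p.n⌋₊ p.t₁ 5
    (5 + p.t₂ * (p.t₁ * p.k))) (keyNum L p.n p.k (leastPoly p.n) ⌊p.wx * p.n⌋₊ p.t₁ 5
    (5 + p.t₂ * (p.t₁ * p.k)))
  rw [← hw] at hs
  have hlen : Sp (.add (.lit 5) (.add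
      (mulE (mulE (.ld (.lit 3)) (.ld (.lit 1))) (.ld (.lit 2)))
      (mulE (mulE (.ld (.lit 3)) (.ld (.lit 0))) (.ld (.lit 2))))) L [] L.length
      (22 * p.t₁ + 11 * p.k + 11 * p.n + 100) := by
    refine Sp.mono inferInstance ?_ ?_
    · rw [h0.1, h0.2.1, h0.2.2.1, h0.2.2.2, hLl]
      ring
    · rw [h0.1, h0.2.1, h0.2.2.1]
      omega
  set M := (p.t₂ + 1) * ((2 ^ p.n) ^ 3 * ((p.t₁ + 1) * (20000 * (p.n + p.k + 1) ^ 3))) with hM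
  have hout := fun x key => p.length_wordList x key
  have hres : ∀ L', Sp (.add (mulE (mulE (.ld (.lit 3)) (.ld (.lit 0))) (.ld (.lit 2)))
      (mulE (.ld (.lit 3)) (.add (.ld (.lit 0)) (.ld (.lit 0))))) (L ++ L') []
      (p.t₂ * (p.t₁ * p.n) + p.t₂ * (p.n + p.n)) (33 * p.n + 11 * p.t₁ + 100) := by
    intro L'
    have g0 : (L ++ L').getD 0 0 = p.n := rfl
    have g2 : (L ++ L').getD 2 0 = p.t₁ := rfl
    have g3 : (L ++ L').getD 3 0 = p.t₂ := rfl
    refine Sp.mono inferInstance ?_ ?_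
    · rw [g0, g2, g3]
      ring
    · rw [g0, g2]
      omega
  -- Computing the lengths and copying the output cost no more than the search bound `M` itself.
  obtain ⟨T, hT, hT'⟩ := S.computes (C := 2 * M) hlen.1 hs.1 ((hres _).1.trans (hout _ _).symm) (by
    have c1 := hlen.2
    have c2 := hs.2
    have c3 := fun L' => (hres L').2
    rw [hout]
    refine (Nat.add_le_add_right (Nat.add_le_add_right (Nat.add_le_add
      (Nat.add_le_add c1 c2) (c3 _)) _) _).trans ?_
    have e1 : 20000 * ((p.t₂ + 1) * ((p.t₁ + 1) * (p.n + p.k + 1))) ≤ M := by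
      have h3 : p.n + p.k + 1 ≤ (p.n + p.k + 1) ^ 3 := Nat.le_self_pow (by norm_num) _
      calc 20000 * ((p.t₂ + 1) * ((p.t₁ + 1) * (p.n + p.k + 1)))
          ≤ 20000 * ((p.t₂ + 1) * ((p.t₁ + 1) * (p.n + p.k + 1) ^ 3)) := by gcongr
        _ ≤ (2 ^ p.n) ^ 3 * (20000 * ((p.t₂ + 1) * ((p.t₁ + 1) * (p.n + p.k + 1) ^ 3))) :=
            Nat.le_mul_of_pos_left _ (by positivity)
        _ = M := by rw [hM]; ring
    have e2 : (p.t₂ + 1) * ((p.t₁ + 1) * (p.n + p.k + 1)) =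
        p.t₂ * (p.t₁ * p.n) + p.t₂ * (p.t₁ * p.k) + p.t₂ * p.t₁ + p.t₂ * p.n + p.t₂ * p.k + p.t₂ +
        (p.t₁ * p.n + p.t₁ * p.k) + p.t₁ + p.n + p.k + 1 := by ring
    rw [mul_add p.t₂ p.n p.n]
    omega)
  refine ⟨_, _, T, h1, hT, ?_⟩
  have hn : 0 < p.n := by have := hp.n_ge; omega
  have ht := hp.t₁_pos
  have ht' := p.t₂_pos
  -- The gap between `160000` and `500000` gives the strict inequality.
  have h3 : 2 * M < p.N * 2 ^ (4 * p.n) := by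
    have h4 := poly_le_two_pow hp.n_ge
    have h5 : (p.n + p.k + 1) ^ 3 ≤ (2 * p.n + 1) ^ 3 :=
      Nat.pow_le_pow_left (by have := hp.k_le_n; omega) 3
    calc 2 * M ≤ 2 * ((2 * p.t₂) * ((2 ^ p.n) ^ 3 * ((2 * p.t₁) *
          (20000 * (2 * p.n + 1) ^ 3)))) := by
          rw [hM]
          gcongr <;> omega
      _ = 160000 * (p.t₂ * p.t₁ * (2 ^ p.n) ^ 3 * (2 * p.n + 1) ^ 3) := by ring
      _ < 500000 * (p.t₂ * p.t₁ * (2 ^ p.n) ^ 3 * (2 * p.n + 1) ^ 3) :=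
          Nat.mul_lt_mul_of_pos_right (by norm_num) (by positivity)
      _ = p.t₂ * p.t₁ * (2 ^ p.n) ^ 3 * (500000 * (2 * p.n + 1) ^ 3) := by ring
      _ ≤ p.t₂ * p.t₁ * (2 ^ p.n) ^ 3 * (2 ^ p.n * p.n) := Nat.mul_le_mul_left _ h4
      _ = p.N * 2 ^ (4 * p.n) := by
          unfold N t
          ring
  have h4 : (T : ℝ) < (p.N : ℝ) * 2 ^ (4 * p.n) := by exact_mod_cast hT'.trans_lt h3
  refine h4.trans_le ?_
  have hN : (0 : ℝ) < p.N := by exact_mod_cast Nat.mul_pos hn (Nat.mul_pos ht ht')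
  rw [Real.rpow_add hN, Real.rpow_one]
  exact mul_le_mul_of_nonneg_left hp.two_pow_le hN.le

end HashParams

end RankMod

/-! ### The decoder of the hash code as a program -/

namespace RAM

set_option synthInstance.maxHeartbeats 400000
set_option synthInstance.maxSize 4000

theorem SpS.call7 {s : S} {a0 a1 a2 a3 a4 a5 a6 : E} {L ρ o : List ℕ}
    {v0 v1 v2 v3 v4 v5 v6 c0 c1 c2 c3 c4 c5 c6 d : ℕ}
    (h0 : Sp a0 L ρ v0 c0) (h1 : Sp a1 L ρ v1 c1) (h2 : Sp a2 L ρ v2 c2) (h3 : Sp a3 L ρ v3 c3)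
    (h4 : Sp a4 L ρ v4 c4) (h5 : Sp a5 L ρ v5 c5) (h6 : Sp a6 L ρ v6 c6)
    (hs : SpS s L [v0, v1, v2, v3, v4, v5, v6] o d) :
    SpS (.call 7 ![a0, a1, a2, a3, a4, a5, a6] s) L ρ o
      (c0 + c1 + c2 + c3 + c4 + c5 + c6 + d + 1) :=
  SpS.of_call (v := ![v0, v1, v2, v3, v4, v5, v6]) (c := ![c0, c1, c2, c3, c4, c5, c6])
    (d := d) (by simp [Fin.forall_fin_succ, h0, h1, h2, h3, h4, h5, h6]) (by simpa using hs)
    (by simp [Fin.sum_univ_succ]; omega)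

theorem SpS.congr {s : S} {L ρ o o' : List ℕ} {c : ℕ} (h : SpS s L ρ o c) (ho : o = o') :
    SpS s L ρ o' c := ho ▸ h

theorem SpS.computes {len : E} {s : S} {res : E} {inp A out : List ℕ} {C c c' c'' : ℕ}
    (hlen : Sp len inp [] inp.length c) (hs : SpS s inp [] (A ++ out) c')
    (hres : Sp res (inp ++ (A ++ out)) [] out.length c'')
    (hC : c + c' + c'' + 6 * out.length + 6 ≤ C) :
    ∃ T, Computes (s.prog len res) inp out T ∧ T ≤ C :=
  S.computes hlen.1 hs.1 hres.1 (le_trans (by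
    have := hlen.2
    have := hs.2
    have := hres.2
    omega) hC)

/-- The number whose binary digits are in the cells `p, …, p + n - 1`. -/
def pack (L : List ℕ) (p n : ℕ) : ℕ :=
  iter (fun i acc => acc + acc + L.getD (p + (n - 1 - i)) 0) 0 n

theorem pack_eq {L : List ℕ} {p n : ℕ} (x : Fin n → Bool)
    (h : ∀ b : Fin n, L.getD (p + b) 0 = (x b).toNat) : pack L p n = Nat.ofBits x := by
  have e : x = fun i : Fin n => (Nat.ofBits x).testBit i := by
    funext i
    rw [Nat.testBit_ofBits_lt _ _ i.2]
  conv_rhs => rw [e]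
  rw [← iter_horner]
  refine iter_congr _ fun i hi b => ?_
  have hlt : n - 1 - i < n := by omega
  rw [h ⟨n - 1 - i, hlt⟩, Nat.testBit_ofBits_lt _ _ hlt]

def packE (p n : E) : E := .call 2 ![p, n] (.fold (.var 1) (.lit 0) (.add (.add (.var 3) (.var 3))
  (.ld (.add (.var 0) (.sub (.sub (.var 1) (.lit 1)) (.var 2))))))

instance {L ρ : List ℕ} {p n : E} {vp vn cp cn : ℕ} [Sp p L ρ vp cp] [Sp n L ρ vn cn] :
    Sp (packE p n) L ρ (pack L vp vn) (cp + cn + 30 * vn + 20) := by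
  refine (Sp.call2 ‹_› ‹_› inferInstance).mono rfl ?_
  simp
  omega

/-- The decoder, for vectors and keys in the cells from `px` and `pk` on. -/
def decS (n k f t₁ t₂ px pk : E) : S := .call 7 ![n, k, f, t₁, t₂, px, pk]
  (.bind (mulE (.var 3) (.var 0)) (.loop (.var 4) (.bind (.add (.var 5) (mulE (.var 8) (.var 7)))
    (.bind (.add (.var 6) (mulE (.var 8) (.add (.var 0) (.var 0))))
    (.bind (packE (.var 10) (.var 0)) (.bind (packE (.add (.var 10) (.var 0)) (.var 0))
    (.loop (.var 3) (.bind (hashE (.var 11) (.var 12)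
        (packE (.add (.var 9) (mulE (.var 13) (.var 0))) (.var 0)) (.var 2) (.var 0))
      (.loop (.var 1) (.emit (bitE (.var 14) (.var 15))))))))))))

/-- The contents of vectors and keys are assumed for every extension of the memory, so the
hypotheses apply in each round. A key is packed into numbers once per column, not once per block. -/
theorem SpS.dec {L ρ : List ℕ} {n k f t₁ t₂ px pk : E} {vn vk vf vt vt₂ vpx vpk : ℕ}
    {cn ck cf ct ct₂ cpx cpk : ℕ} (hn : Sp n L ρ vn cn) (hk : Sp k L ρ vk ck)
    (hf : Sp f L ρ vf cf) (ht : Sp t₁ L ρ vt ct) (ht₂ : Sp t₂ L ρ vt₂ ct₂)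
    (hpx : Sp px L ρ vpx cpx) (hpk : Sp pk L ρ vpk cpk) (a b : ℕ → ℕ) (x : ℕ → ℕ → ℕ)
    (ha : ∀ j < vt₂, ∀ o, pack (L ++ o) (vpk + j * (vn + vn)) vn = a j)
    (hb : ∀ j < vt₂, ∀ o, pack (L ++ o) (vpk + j * (vn + vn) + vn) vn = b j)
    (hx : ∀ j < vt₂, ∀ i < vt, ∀ o, pack (L ++ o) (vpx + j * (vt * vn) + i * vn) vn = x j i) :
    SpS (decS n k f t₁ t₂ px pk) L ρ
      ((List.range vt₂).flatMap fun j => (List.range vt).flatMap fun i =>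
        RAM.natBits vk (hashNat (a j) (b j) (x j i) vf vn))
      (cn + ck + cf + ct + ct₂ + cpx + cpk +
        (vt₂ + 1) * ((vt + 1) * (3000 * (vn + vk + 1) ^ 3))) := by
  have hK0 : vn + vk + 1 ≤ (vn + vk + 1) ^ 3 := Nat.le_self_pow (by norm_num) _
  have hK1 : (vn + vk + 1) * (vn + vk + 1) ≤ (vn + vk + 1) ^ 3 := by
    rw [← sq]
    exact Nat.pow_le_pow_right (by omega) (by omega)
  have hK2 : (vn + 1) ^ 3 ≤ (vn + vk + 1) ^ 3 := Nat.pow_le_pow_left (by omega) 3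
  refine SpS.mono (SpS.call7 hn hk hf ht ht₂ hpx hpk <| SpS.bind inferInstance rfl <|
    SpS.loop' _ ((vt + 1) * (2500 * (vn + vk + 1) ^ 3)) inferInstance rfl fun j hj o => SpS.mono
    (SpS.bind inferInstance rfl <| SpS.bind inferInstance rfl <|
      SpS.bind inferInstance (ha j hj o) <| SpS.bind inferInstance (hb j hj o) <|
      SpS.loop' (fun i => RAM.natBits vk (hashNat (a j) (b j) (x j i) vf vn))
        (2300 * (vn + vk + 1) ^ 3) inferInstance rfl fun i hi o' =>
        SpS.natBits (ρ' := [vn, vk, vf, vt, vt₂, vpx, vpk, vt * vn, j, vpx + j * (vt * vn),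
            vpk + j * (vn + vn), a j, b j, i, hashNat (a j) (b j) (x j i) vf vn])
          (c := 9 * vk + 100) (hx := Sp.mono inferInstance ?_ le_rfl) ?_ ?_) ?_) ?_
  · rw [List.append_assoc, hx j hj i hi]
  · exact fun b hb o => Sp.mono inferInstance rfl (by omega)
  · nlinarith
  · have h1 : vt * (2300 * (vn + vk + 1) ^ 3 + 4) ≤ vt * (2304 * (vn + vk + 1) ^ 3) :=
      Nat.mul_le_mul_left _ (by omega)
    have h2 : vt * vn ≤ vt * (vn + vk + 1) ^ 3 := Nat.mul_le_mul_left _ (by omega)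
    have e : (vt + 1) * (2500 * (vn + vk + 1) ^ 3) =
      vt * (2304 * (vn + vk + 1) ^ 3) + 196 * (vt * (vn + vk + 1) ^ 3) + 2500 * (vn + vk + 1) ^ 3 := by
      ring
    omega
  · have h1 : (vt + 1) * (2500 * (vn + vk + 1) ^ 3) + 4 + 200 * (vn + vk + 1) ≤
        (vt + 1) * (3000 * (vn + vk + 1) ^ 3) := by
      have e : (vt + 1) * (3000 * (vn + vk + 1) ^ 3) = (vt + 1) * (2500 * (vn + vk + 1) ^ 3) +
        500 * (vt * (vn + vk + 1) ^ 3) + 500 * (vn + vk + 1) ^ 3 := by ring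
      omega
    generalize (vt + 1) * (3000 * (vn + vk + 1) ^ 3) = D at *
    have h2 : vt₂ * ((vt + 1) * (2500 * (vn + vk + 1) ^ 3) + 4) ≤ vt₂ * D :=
      Nat.mul_le_mul_left _ (by omega)
    rw [add_one_mul vt₂]
    omega

end RAM

namespace RankMod
open RAM

theorem hashFn_natBits {n k : ℕ} (hn : n ≠ 0) (key : Key n) (x : Fin n → Bool) :
    bits (hashFn n k key x) = natBits k
      (hashNat (Nat.ofBits key.1) (Nat.ofBits key.2) (Nat.ofBits x) (leastPoly n) n) :=
  ofFn_eq _ _ fun i => by rw [hashFn_eq hn]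

/-- The decoder computes the decoding function of the hash construction. -/
theorem SpS.decode {p : HashParams} (hn : p.n ≠ 0) {L ρ : List ℕ} {n k f t₁ t₂ px pk : E}
    {vpx vpk cn ck cf ct ct₂ cpx cpk : ℕ} (h1 : Sp n L ρ p.n cn) (h2 : Sp k L ρ p.k ck)
    (h3 : Sp f L ρ (leastPoly p.n) cf) (h4 : Sp t₁ L ρ p.t₁ ct) (h5 : Sp t₂ L ρ p.t₂ ct₂)
    (h6 : Sp px L ρ vpx cpx) (h7 : Sp pk L ρ vpk cpk) {x : p.Blocks → Fin p.n → Bool}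
    {key : p.Index} {A : List ℕ} {B : List ℕ} (hL : L = A ++ p.wordList x key ++ B)
    (hx : vpx = A.length) (hk : vpk = A.length + p.t₂ * (p.t₁ * p.n)) :
    SpS (decS n k f t₁ t₂ px pk) L ρ (p.messageList (hashDecode x key))
      (cn + ck + cf + ct + ct₂ + cpx + cpk +
        (p.t₂ + 1) * ((p.t₁ + 1) * (3000 * (p.n + p.k + 1) ^ 3))) := by
  -- The word may stand between arbitrary data `A` and `B`: the rank-modulation decoder applies this
  -- to words in the middle of its memory.
  have hgx : ∀ o (i : Fin p.t₁) (j : Fin p.t₂) (b : Fin p.n),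
      (L ++ o).getD (vpx + j * (p.t₁ * p.n) + i * p.n + b) 0 = (x (i, j) b).toNat := by
    intro o i j b
    have h := HashParams.bitColumn_lt i j b
    rw [← HashParams.getD_bitColumns, hL, hx, HashParams.wordList, List.append_assoc,
      List.append_assoc, List.append_assoc, add_assoc, add_assoc, getD_append_add, ← add_assoc,
      getD_append_of_lt _ (by rwa [HashParams.length_bitColumns])]
  have hgk : ∀ o (j : Fin p.t₂), ∀ r < p.n + p.n, (L ++ o).getD (vpk + j * (p.n + p.n) + r) 0 =
      (bits (key j).1 ++ bits (key j).2).getD r 0 := by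
    intro o j r hr
    have hl : ∀ j, (bits (key j).1 ++ bits (key j).2).length = p.n + p.n := fun j => by
      rw [List.length_append, length_bits, length_bits]
    have h := succ_mul_le (p.n + p.n) j.2
    rw [← getD_flat hl j hr, hL, hk, HashParams.wordList, List.append_assoc, List.append_assoc,
      List.append_assoc, add_assoc, add_assoc, getD_append_add, ← HashParams.length_bitColumns x,
      getD_append_add, getD_append_of_lt _ (by rw [length_flat hl]; omega)]
  refine (SpS.dec h1 h2 h3 h4 h5 h6 h7
    (fun j => if hj : j < p.t₂ then Nat.ofBits (key ⟨j, hj⟩).1 else 0)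
    (fun j => if hj : j < p.t₂ then Nat.ofBits (key ⟨j, hj⟩).2 else 0)
    (fun j i => if h : i < p.t₁ ∧ j < p.t₂ then Nat.ofBits (x (⟨i, h.1⟩, ⟨j, h.2⟩)) else 0)
    ?_ ?_ ?_).congr ?_
  · intro j hj o
    rw [dif_pos hj]
    refine pack_eq _ fun b => ?_
    rw [hgk o ⟨j, hj⟩ b (by omega), getD_append_of_lt _ (by rw [length_bits]; exact b.2), getD_bits]
  · intro j hj o
    rw [dif_pos hj]
    refine pack_eq _ fun b => ?_
    rw [add_assoc _ p.n, hgk o ⟨j, hj⟩ (p.n + b) (by omega)]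
    have h := getD_append_add (bits (key ⟨j, hj⟩).1) (bits (key ⟨j, hj⟩).2) b
    rw [length_bits] at h
    rw [h, getD_bits]
  · intro j hj i hi o
    rw [dif_pos ⟨hi, hj⟩]
    exact pack_eq _ fun b => hgx o ⟨i, hi⟩ ⟨j, hj⟩ b
  · refine (columns_eq _ _ fun b => ?_).symm
    rw [dif_pos b.2.2, dif_pos b.2.2, dif_pos ⟨b.1.2, b.2.2⟩]
    exact hashFn_natBits hn _ _

def womDecS : S := .bind (.ld (.lit 0)) (.bind (.ld (.lit 1)) (.bind (.ld (.lit 2))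
  (.bind (.ld (.lit 3)) (.bind (leastPolyE (.var 0)) (decS (.var 0) (.var 1) (.var 4) (.var 2)
    (.var 3) (.lit 5) (.add (.lit 5) (mulE (mulE (.var 3) (.var 0)) (.var 2))))))))

set_option synthInstance.maxHeartbeats 400000
set_option synthInstance.maxSize 4000

namespace HashParams
variable {p : HashParams}

/-- The exponential term is the search for the modulus; it occurs once and is not multiplied by the
number of blocks. -/
theorem womDecS_spec (hp : p.Valid) (x : p.Blocks → Fin p.n → Bool) (key : p.Index) :
    SpS womDecS (p.header ++ p.wordList x key) [] (p.messageList (hashDecode x key))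
      ((2 ^ p.n) ^ 3 * (3000 * (p.n + 1) ^ 3) +
        (p.t₂ + 1) * ((p.t₁ + 1) * (4000 * (p.n + p.k + 1) ^ 3))) := by
  refine SpS.mono (SpS.bind (v' := p.n) inferInstance rfl <| SpS.bind (v' := p.k) inferInstance rfl <|
    SpS.bind (v' := p.t₁) inferInstance rfl <| SpS.bind (v' := p.t₂) inferInstance rfl <|
    SpS.bind (v' := leastPoly p.n) inferInstance rfl <|
    SpS.decode (B := []) (A := p.header) (x := x) (key := key) (by have := hp.n_ge; omega)
      inferInstance inferInstance inferInstance inferInstance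
      inferInstance inferInstance inferInstance ?_ ?_ ?_) ?_
  · simp
  · rfl
  · rw [length_header]
    ring
  · have hK0 : p.n + p.k + 1 ≤ (p.n + p.k + 1) ^ 3 := Nat.le_self_pow (by norm_num) _
    have e : (p.t₂ + 1) * ((p.t₁ + 1) * (4000 * (p.n + p.k + 1) ^ 3)) =
      (p.t₂ + 1) * ((p.t₁ + 1) * (3000 * (p.n + p.k + 1) ^ 3)) +
        1000 * ((p.t₂ + 1) * ((p.t₁ + 1) * (p.n + p.k + 1) ^ 3)) := by ring
    have e1 : (p.t₁ + 1) * (p.n + p.k + 1) ≤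
        (p.t₂ + 1) * ((p.t₁ + 1) * (p.n + p.k + 1) ^ 3) :=
      (Nat.mul_le_mul_left _ hK0).trans (Nat.le_mul_of_pos_left _ (by omega))
    have e2 : (p.t₁ + 1) * (p.n + p.k + 1) = p.t₁ * (p.n + p.k) + p.t₁ + p.n + p.k + 1 := by ring
    have := Nat.zero_le (p.t₁ * (p.n + p.k))
    omega

/-- Programs may spend `2 ^ (4 n ε)` steps on each cell. -/
theorem Valid.two_pow_eps_le (hp : p.Valid) :
    (2 : ℝ) ^ (4 * (p.n * p.eps)) ≤ (p.N : ℝ) ^ (p.del * p.eps) := by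
  have h := Real.rpow_le_rpow (by positivity) hp.two_pow_le hp.eps_pos.le
  rw [← Real.rpow_mul (Nat.cast_nonneg _)] at h
  refine le_trans (le_of_eq ?_) h
  rw [← Real.rpow_natCast, ← Real.rpow_mul (by norm_num)]
  push_cast
  ring_nf

/-- `del ≤ 1/2` turns the exponent `4n / del` into at least `8n`. So `t₂` alone pays for searches of
size `2 ^ (3n)`. -/
theorem Valid.t₂_ge (hp : p.Valid) : (2 ^ p.n) ^ 8 ≤ p.t₂ := by
  have h : (2 : ℝ) ^ (4 * (p.n : ℝ) / p.del) ≤ p.t₂ := Nat.le_ceil _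
  have h2 : (2 : ℝ) ^ (((p.n * 8 : ℕ)) : ℝ) ≤ (2 : ℝ) ^ (4 * (p.n : ℝ) / p.del) := by
    refine Real.rpow_le_rpow_of_exponent_le (by norm_num) ?_
    rw [le_div_iff₀ hp.del_pos]
    push_cast
    nlinarith [hp.del_le, (Nat.cast_nonneg p.n : (0 : ℝ) ≤ p.n)]
  rw [Real.rpow_natCast] at h2
  rw [← pow_mul]
  exact_mod_cast h2.trans h

/-- After the search for the modulus has been charged to `t₂`, the time per cell is of order `n ^
2`. The allowance `N ^ (del * eps)` is at least `2 ^ (4 * n * eps)`, and a polynomial in `n` fits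
into it because `n` is bounded by a fixed power of `2 ^ (n * eps)`. The constant `A = 1` suffices.
-/
theorem exists_decoder : ∃ (P : RAM.Prog) (A : ℝ), ∀ p : RankMod.HashParams, p.Valid →
      ∀ (x : p.Blocks → RankMod.J p.wx p.n) (key : p.Index),
        ∃ T : ℕ,
          RAM.Computes P (p.header ++ p.wordList (fun b => (x b : Fin p.n → Bool)) key)
            (p.messageList (p.decode (x, key))) T ∧
          (T : ℝ) ≤ (p.N : ℝ) ^ (1 + A * (p.del * p.eps)) := by
  refine ⟨S.prog (.add (.lit 5) (.add
      (mulE (mulE (.ld (.lit 3)) (.ld (.lit 0))) (.ld (.lit 2)))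
      (mulE (.ld (.lit 3)) (.add (.ld (.lit 0)) (.ld (.lit 0)))))) womDecS
    (mulE (mulE (.ld (.lit 3)) (.ld (.lit 1))) (.ld (.lit 2))), 1, fun p hp x key => ?_⟩
  set x' : p.Blocks → Fin p.n → Bool := fun b => (x b : Fin p.n → Bool) with hx'
  have hs := womDecS_spec hp x' key
  set L := p.header ++ p.wordList x' key with hL
  have hLl : L.length = 5 + (p.t₂ * (p.t₁ * p.n) + p.t₂ * (p.n + p.n)) := by
    rw [hL, List.length_append, length_wordList, length_header]
  have g : ∀ L', (L ++ L').getD 0 0 = p.n ∧ (L ++ L').getD 1 0 = p.k ∧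
    (L ++ L').getD 2 0 = p.t₁ ∧ (L ++ L').getD 3 0 = p.t₂ := fun _ => ⟨rfl, rfl, rfl, rfl⟩
  have g' : L.getD 0 0 = p.n ∧ L.getD 2 0 = p.t₁ ∧ L.getD 3 0 = p.t₂ := ⟨rfl, rfl, rfl⟩
  have hlen : Sp (.add (.lit 5) (.add
      (mulE (mulE (.ld (.lit 3)) (.ld (.lit 0))) (.ld (.lit 2)))
      (mulE (.ld (.lit 3)) (.add (.ld (.lit 0)) (.ld (.lit 0)))))) L [] L.length
      (33 * p.n + 11 * p.t₁ + 100) := by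
    refine Sp.mono inferInstance ?_ ?_
    · rw [g'.1, g'.2.1, g'.2.2, hLl]
      ring
    · rw [g'.1, g'.2.1]
      omega
  have hout : (p.messageList (hashDecode x' key : p.Message)).length = p.t₂ * (p.t₁ * p.k) :=
    length_bitColumns _
  have hres : ∀ L', Sp (mulE (mulE (.ld (.lit 3)) (.ld (.lit 1))) (.ld (.lit 2))) (L ++ L') []
      (p.t₂ * (p.t₁ * p.k)) (11 * p.k + 11 * p.t₁ + 100) := by
    intro L'
    refine Sp.mono inferInstance ?_ ?_
    · rw [(g L').2.1, (g L').2.2.1, (g L').2.2.2]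
      ring
    · rw [(g L').2.1, (g L').2.2.1]
      omega
  have hn : 0 < p.n := by have := hp.n_ge; omega
  have ht := hp.t₁_pos
  have ht' := p.t₂_pos
  obtain ⟨T, hT, hT'⟩ := SpS.computes (C := p.t₂ * p.t₁ * (40000 * (2 * p.n + 1) ^ 3)) hlen
    (A := []) (out := p.messageList (hashDecode x' key : p.Message)) hs (hout ▸ hres _) (by
    rw [hout]
    have h5 : (p.n + p.k + 1) ^ 3 ≤ (2 * p.n + 1) ^ 3 :=
      Nat.pow_le_pow_left (by have := hp.k_le_n; omega) 3
    have h6 : (p.n + 1) ^ 3 ≤ (2 * p.n + 1) ^ 3 := Nat.pow_le_pow_left (by omega) 3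
    have h7 : (2 ^ p.n) ^ 3 ≤ p.t₂ :=
      (Nat.pow_le_pow_right Nat.one_le_two_pow (by norm_num)).trans hp.t₂_ge
    have h8 : 2 * p.n + 1 ≤ (2 * p.n + 1) ^ 3 := Nat.le_self_pow (by norm_num) _
    have h9 := hp.k_le_n
    have f1 : (2 ^ p.n) ^ 3 * (3000 * (p.n + 1) ^ 3) ≤ p.t₂ * p.t₁ * (3000 * (2 * p.n + 1) ^ 3) := by
      refine Nat.mul_le_mul (h7.trans (Nat.le_mul_of_pos_right _ ht)) (by omega)
    have f2 : (p.t₂ + 1) * ((p.t₁ + 1) * (4000 * (p.n + p.k + 1) ^ 3)) ≤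
        p.t₂ * p.t₁ * (16000 * (2 * p.n + 1) ^ 3) := by
      calc _ ≤ (2 * p.t₂) * ((2 * p.t₁) * (4000 * (2 * p.n + 1) ^ 3)) := by gcongr <;> omega
        _ = _ := by ring
    have f3 : p.t₂ * (p.t₁ * p.k) ≤ p.t₂ * p.t₁ * (2 * p.n + 1) ^ 3 := by
      rw [← mul_assoc]
      exact Nat.mul_le_mul_left _ (by omega)
    have f4 : p.t₁ * (2 * p.n + 1) ≤ p.t₂ * p.t₁ * (2 * p.n + 1) ^ 3 :=
      Nat.mul_le_mul (Nat.le_mul_of_pos_left _ ht') h8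
    have f5 : p.t₁ + 2 * p.n ≤ p.t₁ * (2 * p.n + 1) := by nlinarith
    have e1 : ∀ c, p.t₂ * p.t₁ * (c * (2 * p.n + 1) ^ 3) =
      c * (p.t₂ * p.t₁ * (2 * p.n + 1) ^ 3) := fun c => by ring
    rw [e1] at *
    omega)
  refine ⟨T, hT, ?_⟩
  set y : ℝ := (2 : ℝ) ^ (p.n * p.eps / 20) with hy
  have hy2 : 2 ≤ y := by
    have h1 := hp.twenty_lt
    have h2 := hp.one_le_logb
    rw [hy]
    nth_rewrite 1 [← Real.rpow_one 2]
    exact Real.rpow_le_rpow_of_exponent_le (by norm_num) (by linarith)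
  have hy80 : y ^ 80 = 2 ^ (4 * (p.n * p.eps)) := by
    rw [hy, ← Real.rpow_natCast, ← Real.rpow_mul (by norm_num)]
    congr 1
    push_cast
    ring
  have hny := hp.n_add_one_le
  rw [← hy] at hny
  have hn0 : (0 : ℝ) < p.n := by exact_mod_cast hn
  -- With `n ≤ 10.87 * y ^ 2` the left side is below `2 ^ 27 * y ^ 4`, and `y ≥ 2` makes this at
  -- most `y ^ 31`.
  have hpoly : 1080000 * (p.n : ℝ) ^ 2 ≤ y ^ 80 := by
    have h1 : (p.n : ℝ) ^ 2 ≤ (10.87 * y ^ 2) ^ 2 := by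
      refine pow_le_pow_left₀ hn0.le (by linarith) 2
    have h2 : (2 : ℝ) ^ 27 ≤ y ^ 27 := pow_le_pow_left₀ (by norm_num) hy2 27
    have h3 : y ^ 31 ≤ y ^ 80 := pow_le_pow_right₀ (by linarith) (by norm_num)
    have h4 : (0 : ℝ) < y ^ 4 := by positivity
    calc 1080000 * (p.n : ℝ) ^ 2 ≤ 2 ^ 27 * y ^ 4 := by nlinarith
      _ ≤ y ^ 27 * y ^ 4 := mul_le_mul_of_nonneg_right h2 h4.le
      _ = y ^ 31 := by ring
      _ ≤ _ := h3
  have h10 : (2 * p.n + 1) ^ 3 ≤ 27 * p.n ^ 3 := by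
    calc (2 * p.n + 1) ^ 3 ≤ (3 * p.n) ^ 3 := Nat.pow_le_pow_left (by omega) 3
      _ = _ := by ring
  have h11 : T ≤ p.N * (1080000 * p.n ^ 2) := by
    refine hT'.trans ?_
    calc p.t₂ * p.t₁ * (40000 * (2 * p.n + 1) ^ 3) ≤ p.t₂ * p.t₁ * (40000 * (27 * p.n ^ 3)) := by
          gcongr
      _ = _ := by
          unfold N t
          ring
  have hN : (0 : ℝ) < p.N := by exact_mod_cast Nat.mul_pos hn (Nat.mul_pos ht ht')
  calc (T : ℝ) ≤ p.N * (1080000 * p.n ^ 2) := by exact_mod_cast h11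
    _ ≤ p.N * y ^ 80 := mul_le_mul_of_nonneg_left hpoly hN.le
    _ ≤ p.N * (p.N : ℝ) ^ (p.del * p.eps) := by
        rw [hy80]
        exact mul_le_mul_of_nonneg_left hp.two_pow_eps_le hN.le
    _ = _ := by rw [Real.rpow_add hN, Real.rpow_one, one_mul]

end HashParams

end RankMod

namespace RankMod

/-! ## The lexicographic index -/

/-- The number of rearrangements of a list. -/
noncomputable def numArr (L : List ℕ) : ℕ := {L' : List ℕ | L'.Perm L}.ncard

/-- The number of rearrangements of `L` that start with `w`. -/
noncomputable def startArr (L : List ℕ) (w : ℕ) : ℕ := {L' : List ℕ | (w :: L').Perm L}.ncard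

theorem finite_perm (L : List ℕ) : {L' : List ℕ | L'.Perm L}.Finite :=
  (List.finite_toSet L.permutations).subset fun _ h => List.mem_permutations.2 h

/-- A set of nonempty words is split by the first letter. The same recursion yields both the number
of rearrangements and the lexicographic index. -/
theorem ncard_eq_sum_cons {A : Set (List ℕ)} {q : ℕ} (hA : A.Finite) (h0 : [] ∉ A)
    (hq : ∀ w L, w :: L ∈ A → w < q) :
    A.ncard = ∑ w ∈ Finset.range q, {L : List ℕ | w :: L ∈ A}.ncard := by
  have hinj : ∀ w : ℕ, Function.Injective (List.cons w) := fun w => List.cons_injective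
  have e : A = ⋃ w ∈ Finset.range q, List.cons w '' {L | w :: L ∈ A} := by
    ext L
    simp only [Set.mem_iUnion, Set.mem_image, Set.mem_ofPred_eq, Finset.mem_range]
    constructor
    · intro h
      cases L with
      | nil => exact absurd h h0
      | cons w L => exact ⟨w, hq w L h, L, h, rfl⟩
    · rintro ⟨w, -, L', h, rfl⟩
      exact h
  conv_lhs => rw [e]
  rw [Set.ncard_eq_toFinset_card _ (e ▸ hA)]
  have hf : ∀ w, (List.cons w '' {L | w :: L ∈ A}).Finite := fun w =>
    hA.subset (by rintro _ ⟨L, h, rfl⟩; exact h)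
  have e2 : (e ▸ hA : (⋃ w ∈ Finset.range q, List.cons w '' {L | w :: L ∈ A}).Finite).toFinset =
      (Finset.range q).biUnion fun w => (hf w).toFinset := by
    ext L
    simp
  rw [e2, Finset.card_biUnion]
  · refine Finset.sum_congr rfl fun w _ => ?_
    rw [← Set.ncard_eq_toFinset_card _ (hf w), Set.ncard_image_of_injective _ (hinj w)]
  · intro w _ w' _ hne
    rw [Function.onFun, Finset.disjoint_left]
    intro L h h'
    simp only [Set.Finite.mem_toFinset, Set.mem_image] at h h'
    obtain ⟨L1, -, rfl⟩ := h
    obtain ⟨L2, -, h2⟩ := h'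
    exact hne (List.cons.inj h2).1.symm

theorem numArr_nil : numArr [] = 1 := by
  simp [numArr]

theorem numArr_eq_sum {L : List ℕ} {q : ℕ} (hL : L ≠ []) (hq : ∀ x ∈ L, x < q) :
    numArr L = ∑ w ∈ Finset.range q, startArr L w :=
  ncard_eq_sum_cons (finite_perm L) (fun h => hL (List.nil_perm.1 h)) fun w L' h =>
    hq w (h.mem_iff.1 (by simp))

theorem startArr_of_mem {L : List ℕ} {w : ℕ} (h : w ∈ L) : startArr L w = numArr (L.erase w) := by
  unfold startArr numArr
  congr 1
  ext L'
  simp only [Set.mem_ofPred_eq, List.cons_perm_iff_perm_erase, h, true_and]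

theorem startArr_of_notMem {L : List ℕ} {w : ℕ} (h : w ∉ L) : startArr L w = 0 := by
  have : {L' : List ℕ | (w :: L').Perm L} = ∅ := by
    ext L'
    simp only [Set.mem_ofPred_eq, List.cons_perm_iff_perm_erase, h, false_and, Set.mem_empty_iff_false]
  rw [startArr, this, Set.ncard_empty]

theorem startArr_head (v : ℕ) (L : List ℕ) : startArr (v :: L) v = numArr L := by
  rw [startArr_of_mem (by simp), List.erase_cons_head]

theorem prod_factorial_erase {L : List ℕ} {q w : ℕ} (hw : w ∈ L) (hq : w < q) :
    ∏ x ∈ Finset.range q, (L.count x).factorial =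
      L.count w * ∏ x ∈ Finset.range q, ((L.erase w).count x).factorial := by
  rw [← Finset.mul_prod_erase _ _ (Finset.mem_range.2 hq),
    ← Finset.mul_prod_erase _ (fun x => ((L.erase w).count x).factorial) (Finset.mem_range.2 hq),
    List.count_erase_self, ← mul_assoc, Nat.mul_factorial_pred (List.count_pos_iff.2 hw).ne']
  congr 1
  refine Finset.prod_congr rfl fun x hx => ?_
  rw [List.count_erase_of_ne (Finset.ne_of_mem_erase hx)]

theorem sum_count {q : ℕ} {L : List ℕ} (hq : ∀ x ∈ L, x < q) :
    ∑ x ∈ Finset.range q, L.count x = L.length := by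
  have hms := Multiset.toFinset_sum_count_eq (L : Multiset ℕ)
  simp only [Multiset.coe_card, Multiset.coe_count] at hms
  rw [← hms]
  symm
  refine Finset.sum_subset (M := ℕ) (fun x hx => ?_) fun x _ hx => ?_
  · simp only [Multiset.mem_toFinset, Multiset.mem_coe] at hx
    exact Finset.mem_range.2 (hq x hx)
  · simp only [Multiset.mem_toFinset, Multiset.mem_coe] at hx
    exact List.count_eq_zero_of_not_mem hx

/-- The multinomial formula without division. Splitting by the first letter, letter `w` contributes
its multiplicity times `m!` by induction, and the multiplicities sum to the length `m + 1`. -/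
theorem numArr_mul_prod {q : ℕ} : ∀ (m : ℕ) (L : List ℕ), L.length = m → (∀ x ∈ L, x < q) →
    numArr L * ∏ x ∈ Finset.range q, (L.count x).factorial = m.factorial := by
  intro m
  induction m with
  | zero =>
    intro L hL _
    rw [List.length_eq_zero_iff.1 hL, numArr_nil]
    simp
  | succ m ih =>
    intro L hL hq
    have hne : L ≠ [] := by rintro rfl; simp at hL
    rw [numArr_eq_sum hne hq, Finset.sum_mul]
    have h : ∀ w ∈ Finset.range q, startArr L w * ∏ x ∈ Finset.range q, (L.count x).factorial =
        L.count w * m.factorial := by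
      intro w hw
      by_cases hm : w ∈ L
      · rw [startArr_of_mem hm, prod_factorial_erase hm (Finset.mem_range.1 hw), mul_left_comm,
          ih _ (by rw [List.length_erase_of_mem hm, hL, Nat.add_sub_cancel])
            fun x hx => hq x (List.mem_of_mem_erase hx)]
      · rw [startArr_of_notMem hm, List.count_eq_zero_of_not_mem hm, zero_mul, zero_mul]
    rw [Finset.sum_congr rfl h, ← Finset.sum_mul, sum_count hq, hL, Nat.factorial_succ]

/-- The division is exact. This closed form is the one that the machine evaluates. -/
theorem startArr_eq {q w : ℕ} {L : List ℕ} (hq : ∀ x ∈ L, x < q) :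
    startArr L w = L.count w * (L.length - 1).factorial /
      ∏ x ∈ Finset.range q, (L.count x).factorial := by
  have hpos : 0 < ∏ x ∈ Finset.range q, (L.count x).factorial :=
    Finset.prod_pos fun x _ => Nat.factorial_pos _
  symm
  by_cases hm : w ∈ L
  · refine Nat.div_eq_of_eq_mul_left hpos ?_
    rw [startArr_of_mem hm, prod_factorial_erase hm (hq w hm), mul_left_comm,
      numArr_mul_prod (L.length - 1) _ (List.length_erase_of_mem hm)
        fun x hx => hq x (List.mem_of_mem_erase hx)]
  · rw [startArr_of_notMem hm, List.count_eq_zero_of_not_mem hm, zero_mul, Nat.zero_div]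

theorem lexIndex_nil : lexIndex [] = 0 := by
  have : {L' : List ℕ | L'.Perm [] ∧ L' < []} = ∅ := by
    ext L'
    simp
  rw [lexIndex, this, Set.ncard_empty]

/-- A smaller word either starts with a smaller letter, or starts with the same letter and has a
smaller tail. -/
theorem lexIndex_cons (v : ℕ) (L : List ℕ) :
    lexIndex (v :: L) = ∑ w ∈ Finset.range v, startArr (v :: L) w + lexIndex L := by
  have hsub : {L' : List ℕ | L'.Perm (v :: L) ∧ L' < v :: L} ⊆ {L' | L'.Perm (v :: L)} :=
    fun _ h => h.1
  unfold lexIndex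
  rw [ncard_eq_sum_cons (q := v + 1) ((finite_perm _).subset hsub) (by simp) ?_,
    Finset.sum_range_succ]
  · congr 1
    · refine Finset.sum_congr rfl fun w hw => ?_
      have hw' := Finset.mem_range.1 hw
      unfold startArr
      congr 1
      ext L'
      simp [List.cons_lt_cons_iff, hw']
    · congr 1
      ext L'
      simp
  · rintro w L' ⟨-, h⟩
    rw [List.cons_lt_cons_iff] at h
    omega

theorem lexIndex_lt_numArr (L : List ℕ) : lexIndex L < numArr L := by
  induction L with
  | nil => rw [lexIndex_nil, numArr_nil]; exact one_pos
  | cons v L ih =>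
    rw [lexIndex_cons]
    obtain ⟨q, hq⟩ : ∃ q, ∀ x ∈ v :: L, x < q :=
      ⟨(v :: L).sum + 1, fun x hx => Nat.lt_succ_of_le (List.le_sum_of_mem hx)⟩
    have hv := hq v (by simp)
    rw [numArr_eq_sum (by simp) hq]
    have h : ∑ w ∈ Finset.range (v + 1), startArr (v :: L) w ≤
        ∑ w ∈ Finset.range q, startArr (v :: L) w :=
      Finset.sum_le_sum_of_subset (Finset.range_subset_range.2 hv)
    rw [Finset.sum_range_succ, startArr_head] at h
    omega

theorem lexIndex_eq_sum (L : List ℕ) : lexIndex L =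
    ∑ p ∈ Finset.range L.length, ∑ w ∈ Finset.range (L.getD p 0), startArr (L.drop p) w := by
  induction L with
  | nil => exact lexIndex_nil
  | cons v L ih =>
    rw [lexIndex_cons, List.length_cons, Finset.sum_range_succ', ih, add_comm]
    rfl

/-- Once the contribution of the first `p` letters is subtracted, the index of the remaining word is
left; unranking proceeds letter by letter in this way. -/
theorem lexIndex_drop_add (L : List ℕ) : ∀ p ≤ L.length, lexIndex L =
    ∑ p' ∈ Finset.range p, ∑ w ∈ Finset.range (L.getD p' 0), startArr (L.drop p') w +
      lexIndex (L.drop p) := by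
  intro p
  induction p with
  | zero => simp
  | succ p ih =>
    intro hp
    rw [ih (by omega), Finset.sum_range_succ, add_assoc]
    congr 1
    rw [List.drop_eq_getElem_cons (by omega : p < L.length), lexIndex_cons]
    simp [List.getElem?_eq_getElem (by omega : p < L.length)]

/-- The first letter of a list, recovered from its lexicographic index. -/
theorem card_filter_lexIndex {v q : ℕ} {L : List ℕ} (hv : v < q) :
    ((Finset.range q).filter fun w => ∑ x ∈ Finset.range (w + 1), startArr (v :: L) x ≤
      lexIndex (v :: L)).card = v := by
  have h : ((Finset.range q).filter fun w => ∑ x ∈ Finset.range (w + 1), startArr (v :: L) x ≤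
      lexIndex (v :: L)) = Finset.range v := by
    ext w
    rw [Finset.mem_filter, Finset.mem_range, Finset.mem_range, lexIndex_cons]
    constructor
    · rintro ⟨-, h⟩
      by_contra hw
      have h2 : ∑ x ∈ Finset.range (v + 1), startArr (v :: L) x ≤
          ∑ x ∈ Finset.range (w + 1), startArr (v :: L) x :=
        Finset.sum_le_sum_of_subset (Finset.range_subset_range.2 (by omega))
      rw [Finset.sum_range_succ, startArr_head] at h2
      have := lexIndex_lt_numArr L
      omega
    · intro hw
      have h2 : ∑ x ∈ Finset.range (w + 1), startArr (v :: L) x ≤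
          ∑ x ∈ Finset.range v, startArr (v :: L) x :=
        Finset.sum_le_sum_of_subset (Finset.range_subset_range.2 hw)
      exact ⟨by omega, by omega⟩
  rw [h, Finset.card_range]

theorem lexIndex_strictMono {L L' : List ℕ} (h : L.Perm L') (hlt : L < L') :
    lexIndex L < lexIndex L' := by
  refine Set.ncard_lt_ncard ⟨fun M hM => ⟨hM.1.trans h, hM.2.trans hlt⟩, fun hsub => ?_⟩
    ((finite_perm L').subset fun _ hM => hM.1)
  exact lt_irrefl L (hsub ⟨h, hlt⟩).2

theorem permLists_perm {S : Finset ℕ} {z : ℕ} {L L' : List ℕ} (h : L ∈ permLists S z)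
    (h' : L' ∈ permLists S z) : L.Perm L' :=
  List.perm_iff_count.2 fun v => (h v).trans (h' v).symm

theorem permLists_eq {S : Finset ℕ} {z : ℕ} {L : List ℕ} (h : L ∈ permLists S z) :
    permLists S z = {L' | L'.Perm L} := by
  ext L'
  exact ⟨fun h' => permLists_perm h' h, fun h' v => (List.perm_iff_count.1 h' v).trans (h v)⟩

theorem exists_mem_permLists (S : Finset ℕ) (z : ℕ) : (permLists S z).Nonempty := by
  refine ⟨(∑ v ∈ S, Multiset.replicate z v).toList, fun v => ?_⟩
  rw [← Multiset.coe_count, Multiset.coe_toList, Multiset.count_sum']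
  simp [Multiset.count_replicate]

theorem numPerms_eq {S : Finset ℕ} {z : ℕ} {L : List ℕ} (h : L ∈ permLists S z) :
    numPerms S z = numArr L := by rw [numPerms, permLists_eq h, numArr]

theorem finite_permLists (S : Finset ℕ) (z : ℕ) : (permLists S z).Finite := by
  obtain ⟨L, hL⟩ := exists_mem_permLists S z
  rw [permLists_eq hL]
  exact finite_perm L

theorem lexIndex_injOn {S : Finset ℕ} {z : ℕ} : Set.InjOn lexIndex (permLists S z) := by
  intro L hL L' hL' h
  rcases lt_trichotomy L L' with hlt | rfl | hlt
  · exact absurd h (lexIndex_strictMono (permLists_perm hL hL') hlt).ne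
  · rfl
  · exact absurd h (lexIndex_strictMono (permLists_perm hL' hL) hlt).ne'

/-- The index is an injection from a set of `numPerms S z` words into as many numbers, hence onto.
-/
theorem exists_lexIndex_eq {S : Finset ℕ} {z y : ℕ} (hy : y < numPerms S z) :
    ∃ L ∈ permLists S z, lexIndex L = y := by
  have hf := finite_permLists S z
  have h1 : (hf.toFinset.image lexIndex).card = numPerms S z := by
    rw [Finset.card_image_of_injOn (by simpa using lexIndex_injOn), numPerms,
      Set.ncard_eq_toFinset_card _ hf]
  have h2 : hf.toFinset.image lexIndex = Finset.range (numPerms S z) := by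
    refine Finset.eq_of_subset_of_card_le (fun x hx => ?_) (by rw [h1, Finset.card_range])
    obtain ⟨L, hL, rfl⟩ := Finset.mem_image.1 hx
    exact Finset.mem_range.2 (lexIndex_lt (by simpa using hL))
  have h3 := Finset.mem_range.2 hy
  rw [← h2, Finset.mem_image] at h3
  obtain ⟨L, hL, h⟩ := h3
  exact ⟨L, by simpa using hL, h⟩

theorem mem_permLists {S : Finset ℕ} {z : ℕ} {L : List ℕ} (h : L ∈ permLists S z) {v : ℕ}
    (hv : v ∈ L) : v ∈ S := by
  by_contra hS
  have := h v
  rw [if_neg hS] at this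
  exact absurd (List.count_pos_iff.2 hv) (by omega)

theorem exists_bound (S : Finset ℕ) : ∃ q, ∀ x ∈ S, x < q :=
  ⟨S.sup id + 1, fun _ hx => Nat.lt_succ_of_le (Finset.le_sup (f := id) hx)⟩

theorem filter_mem_range {S : Finset ℕ} {q : ℕ} (hq : ∀ x ∈ S, x < q) :
    (Finset.range q).filter (· ∈ S) = S := by
  ext x
  simp only [Finset.mem_filter, Finset.mem_range]
  exact ⟨fun hx => hx.2, fun hx => ⟨hq x hx, hx⟩⟩

theorem length_permLists {S : Finset ℕ} {z : ℕ} {L : List ℕ} (h : L ∈ permLists S z) :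
    L.length = S.card * z := by
  obtain ⟨q, hq⟩ := exists_bound S
  rw [← sum_count fun x hx => hq x (mem_permLists h hx), Finset.sum_congr rfl fun x _ => h x,
    ← Finset.sum_filter, filter_mem_range hq, Finset.sum_const, smul_eq_mul]

/-- The formula for the number of permutations of a multiset. -/
theorem numPerms_mul (S : Finset ℕ) (z : ℕ) :
    numPerms S z * z.factorial ^ S.card = (S.card * z).factorial := by
  obtain ⟨L, hL⟩ := exists_mem_permLists S z
  obtain ⟨q, hq⟩ := exists_bound S
  rw [numPerms_eq hL, ← numArr_mul_prod (q := q) _ L (length_permLists hL)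
    fun x hx => hq x (mem_permLists hL hx)]
  congr 1
  have h : ∀ x ∈ Finset.range q, (L.count x).factorial = if x ∈ S then z.factorial else 1 := by
    intro x _
    rw [hL x]
    split_ifs <;> rfl
  rw [Finset.prod_congr rfl h, Finset.prod_ite, Finset.prod_const, Finset.prod_const_one, mul_one,
    filter_mem_range hq]

end RankMod

namespace RankMod

/-! ## The rank-modulation code -/

theorem count_ofFn {n : ℕ} (f : Fin n → ℕ) (v : ℕ) :
    (List.ofFn f).count v = (Finset.univ.filter fun i => f i = v).card := by
  rw [List.ofFn_eq_map, List.count, List.countP_map, List.countP_eq_length_filter,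
    ← List.toFinset_card_of_nodup ((List.nodup_finRange n).filter _)]
  congr 1
  ext i
  simp

theorem isMultisetPerm_iff {n : ℕ} {S : Finset ℕ} {z : ℕ} {f : Fin n → ℕ} :
    IsMultisetPerm S z f ↔ List.ofFn f ∈ permLists S z :=
  forall_congr' fun v => by rw [count_ofFn]

/-- The zeros of the first list, replaced by the entries of the second one. -/
def fill : List ℕ → List ℕ → List ℕ
  | [], _ => []
  | 0 :: f, T => T.headD 0 :: fill f T.tail
  | (v + 1) :: f, T => (v + 1) :: fill f T

theorem length_fill : ∀ f T : List ℕ, (fill f T).length = f.length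
  | [], _ => rfl
  | 0 :: f, T => by rw [fill, List.length_cons, List.length_cons, length_fill f]
  | (v + 1) :: f, T => by rw [fill, List.length_cons, List.length_cons, length_fill f]

/-- The entry that replaces a zero is found by counting the zeros before it; the program evaluates
this formula. -/
theorem getD_fill : ∀ (f T : List ℕ) (b : ℕ), b < f.length → (fill f T).getD b 0 =
    if f.getD b 0 ≠ 0 then f.getD b 0 else T.getD ((f.take b).count 0) 0
  | [], _, _, h => by simp at h
  | 0 :: f, T, 0, _ => by cases T <;> simp [fill]
  | 0 :: f, T, b + 1, h => by
    rw [fill, List.getD_cons_succ, getD_fill f T.tail b (by simpa using h)]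
    cases T <;> simp
  | (v + 1) :: f, T, 0, _ => by simp [fill]
  | (v + 1) :: f, T, b + 1, h => by
    rw [fill, List.getD_cons_succ, getD_fill f T b (by simpa using h)]
    simp

theorem count_fill (v : ℕ) : ∀ f T : List ℕ, f.count 0 = T.length →
    (fill f T).count v = (if v = 0 then 0 else f.count v) + T.count v
  | [], T, h => by
    have : T = [] := List.length_eq_zero_iff.1 (by simpa using h.symm)
    simp [fill, this]
  | 0 :: f, [], h => by simp at h
  | 0 :: f, t :: T, h => by
    rw [fill, List.count_cons, List.tail_cons, count_fill v f T (by simpa using h), List.headD_cons,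
      List.count_cons (l := T), List.count_cons (l := f)]
    rcases Nat.eq_zero_or_pos v with rfl | hv
    · simp
    · have : ¬ (0 = v) := by omega
      simp [hv.ne', this]
      omega
  | (w + 1) :: f, T, h => by
    rw [fill, List.count_cons, count_fill v f T (by simpa using h), List.count_cons (l := f)]
    rcases Nat.eq_zero_or_pos v with rfl | hv
    · simp
    · simp [hv.ne']
      omega

/-- All ranks written before are smaller than `lo`, so the inserted word is recovered by size alone.
This is how the decoder finds the arrangement of the top ranks. -/
theorem filter_fill {lo : ℕ} (hlo : 0 < lo) : ∀ f T : List ℕ, f.count 0 = T.length →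
    (∀ x ∈ f, x < lo) → (∀ x ∈ T, lo ≤ x) → (fill f T).filter (fun v => decide (lo ≤ v)) = T
  | [], T, h, _, _ => by
    have : T = [] := List.length_eq_zero_iff.1 (by simpa using h.symm)
    simp [fill, this]
  | 0 :: f, [], h, _, _ => by simp at h
  | 0 :: f, t :: T, h, hf, hT => by
    rw [fill, List.headD_cons, List.tail_cons, List.filter_cons_of_pos (by simpa using hT t (by simp)),
      filter_fill hlo f T (by simpa using h) (fun x hx => hf x (by simp [hx]))
        fun x hx => hT x (by simp [hx])]
  | (w + 1) :: f, T, h, hf, hT => by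
    have := hf (w + 1) (by simp)
    rw [fill, List.filter_cons_of_neg (by simpa using this),
      filter_fill hlo f T (by simpa using h) (fun x hx => hf x (by simp [hx])) hT]

/-- For two symbols this is the central binomial coefficient, and further symbols only add
arrangements. -/
theorem two_pow_le_numPerms {S : Finset ℕ} (hS : 2 ≤ S.card) (z : ℕ) : 2 ^ z ≤ numPerms S z := by
  have hc : ∀ z, 2 ^ z ≤ Nat.centralBinom z := by
    intro z
    induction z with
    | zero => simp
    | succ z ih =>
      have := Nat.succ_mul_centralBinom_succ z
      rw [pow_succ]
      nlinarith
  have h : ∀ s, 2 ≤ s → 2 ^ z * z.factorial ^ s ≤ (s * z).factorial := by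
    intro s hs
    induction s, hs using Nat.le_induction with
    | base =>
      rw [← Nat.choose_mul_factorial_mul_factorial (show z ≤ 2 * z by omega), mul_assoc,
        show 2 * z - z = z by omega, ← sq]
      exact Nat.mul_le_mul_right _ (hc z)
    | succ s hs ih =>
      rw [add_one_mul, pow_succ, ← mul_assoc]
      exact (Nat.mul_le_mul_right _ ih).trans (Nat.le_of_dvd (Nat.factorial_pos _)
        (Nat.factorial_mul_factorial_dvd_factorial_add _ _))
  have h1 := h _ hS
  rw [← numPerms_mul] at h1
  exact Nat.le_of_mul_le_mul_right h1 (by positivity)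

namespace RMParams

variable {p : RMParams}

theorem q_pos (p : RMParams) : 0 < p.q := lt_of_le_of_lt (Nat.zero_le _) p.r_lt_q

theorem Valid.wom (hp : p.Valid) : p.wom.Valid where
  eps_pos := hp.eps_pos
  eps_le := hp.eps_le
  del_pos := hp.del_pos
  del_le := hp.del_le
  c_gt := hp.c_gt
  ws_mem := by
    have hq : (0 : ℝ) < p.q := by exact_mod_cast p.q_pos
    refine ⟨?_, ?_⟩
    · show (0 : ℝ) ≤ ((p.r : ℝ) + 1) / p.q
      positivity
    · show ((p.r : ℝ) + 1) / p.q ≤ 1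
      rw [div_le_one hq]
      exact_mod_cast p.r_lt_q
  wx_mem := by
    have hq : (0 : ℝ) < p.q := by exact_mod_cast p.q_pos
    refine ⟨?_, ?_⟩
    · show (0 : ℝ) ≤ 1 / p.q
      positivity
    · show 1 / (p.q : ℝ) ≤ ((p.r : ℝ) + 1) / p.q
      gcongr
      linarith [(Nat.cast_nonneg p.r : (0 : ℝ) ≤ p.r)]

theorem Valid.n_eq (hp : p.Valid) : p.q * p.zW = p.wom.n := Nat.mul_div_cancel' hp.dvd

theorem Valid.zW_pos (hp : p.Valid) : 0 < p.zW := by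
  have h := hp.wom.n_ge
  rw [← hp.n_eq] at h
  exact Nat.pos_of_ne_zero fun h0 => by rw [h0] at h; omega

/-- Since `q` divides the block length, `wx * n` is an integer and nothing is lost in rounding; the
same holds for `ws * n`. -/
theorem Valid.floor_wx (hp : p.Valid) : ⌊p.wom.wx * p.wom.n⌋₊ = p.zW := by
  have hq : (p.q : ℝ) ≠ 0 := by exact_mod_cast p.q_pos.ne'
  have : p.wom.wx * (p.wom.n : ℝ) = p.zW := by
    rw [← hp.n_eq]
    show 1 / (p.q : ℝ) * _ = _
    push_cast
    field_simp
  rw [this, Nat.floor_natCast]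

theorem Valid.floor_ws (hp : p.Valid) : ⌊p.wom.ws * p.wom.n⌋₊ = (p.r + 1) * p.zW := by
  have hq : (p.q : ℝ) ≠ 0 := by exact_mod_cast p.q_pos.ne'
  have : p.wom.ws * (p.wom.n : ℝ) = ((p.r + 1) * p.zW : ℕ) := by
    rw [← hp.n_eq]
    show ((p.r : ℝ) + 1) / (p.q : ℝ) * _ = _
    push_cast
    field_simp
  rw [this, Nat.floor_natCast]

theorem u_add (p : RMParams) : p.u + p.r + 1 = p.q := by
  have := p.r_lt_q
  unfold u
  omega

/-- `Ka` is a power of two with exponent `2 * n * t₂`, and permutations of at least two symbols of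
multiplicity `2 * n * t₂` are that many. The set of admissible `a` is nonempty and its least element
is bounded. -/
theorem Valid.a_spec (hp : p.Valid) : p.wom.Ka ≤ numPerms (Finset.Icc 1 (p.r + 1)) p.a ∧
    p.a ≤ 2 * p.wom.n * p.wom.t₂ := by
  have h : 2 * p.wom.n * p.wom.t₂ ∈ {a : ℕ | p.wom.Ka ≤ numPerms (Finset.Icc 1 (p.r + 1)) a} := by
    have := two_pow_le_numPerms (S := Finset.Icc 1 (p.r + 1)) (by
      have := hp.r_pos
      rw [Nat.card_Icc]
      omega) (2 * p.wom.n * p.wom.t₂)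
    rwa [pow_mul] at this
  exact ⟨Nat.sInf_mem ⟨_, h⟩, Nat.sInf_le h⟩

/-- The cells of a block that have rank at most `i + 1 + r` in `σ`, and no rank at most `i` yet. -/
def freeVec (p : RMParams) (σ : p.Cells → ℕ) (f : p.wom.Blocks → Fin p.wom.n → ℕ) (i : ℕ) :
    p.wom.Blocks → Fin p.wom.n → Bool :=
  -- In `f` the value `0` marks a cell without a rank. Ranks above `i` count as free too, so the
  -- vector does not change when later ranks are written.
  fun l b => decide (p.partX σ l b ≤ i + 1 + p.r ∧ (f l b ≤ i → f l b = 0))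

theorem sum_card_fiber {n q : ℕ} (f : Fin n → ℕ) :
    ∑ v ∈ Finset.range q, (Finset.univ.filter fun b => f b = v).card =
      (Finset.univ.filter fun b => f b < q).card := by
  rw [Finset.card_eq_sum_card_fiberwise (t := Finset.range q) (f := f)]
  · refine Finset.sum_congr rfl fun v hv => ?_
    congr 1
    ext b
    have := Finset.mem_range.1 hv
    simp only [Finset.mem_filter, Finset.mem_univ, true_and]
    omega
  · intro b hb
    simpa using hb

/-- In a block, `(i + 1 + r) * zW` cells have old rank at most `i + 1 + r`. The `i * zW` cells that
already carry a rank are among them, as rank `i' + 1` was put only on cells of old rank at most `i'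
+ 1 + r`. So `(r + 1) * zW` cells remain, the weight of a state of the WOM code. -/
theorem Valid.weight_freeVec (hp : p.Valid) {σ : p.Cells → ℕ} (hσ : σ ∈ p.codebook)
    {f : p.wom.Blocks → Fin p.wom.n → ℕ} {i : ℕ} (hi : i < p.u) (l : p.wom.Blocks)
    (h : ∀ i' < i, (fun b => decide (f l b = i' + 1)) ∈ J p.wom.wx p.wom.n ∧
      (fun b => decide (f l b = i' + 1)) ≤ p.freeVec σ f i' l) :
    p.freeVec σ f i l ∈ J p.wom.ws p.wom.n := by
  have hu := p.u_add
  change weight _ = _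
  rw [hp.floor_ws]
  have h1 : (Finset.univ.filter fun b => p.partX σ l b < i + 1 + p.r + 1).card =
      (i + 1 + p.r) * p.zW := by
    rw [← sum_card_fiber, Finset.sum_range_succ', Finset.sum_congr rfl (g := fun _ => p.zW)]
    · have h0 := hσ.2.2 l 0
      rw [if_neg (by simp)] at h0
      rw [Finset.sum_const, Finset.card_range, smul_eq_mul, h0, add_zero]
    · intro v hv
      rw [hσ.2.2 l (v + 1), if_pos]
      have := Finset.mem_range.1 hv
      rw [Finset.mem_Icc]
      omega
  have h2 : (Finset.univ.filter fun b => f l b ≠ 0 ∧ f l b < i + 1).card = i * p.zW := by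
    have e : (Finset.univ.filter fun b => f l b ≠ 0 ∧ f l b < i + 1) =
        Finset.univ.filter fun b : Fin p.wom.n => (f l b - 1 < i ∧ f l b ≠ 0) := by
      ext b
      simp only [Finset.mem_filter, Finset.mem_univ, true_and]
      omega
    rw [e]
    have h3 := sum_card_fiber (q := i + 1) (f l)
    rw [Finset.sum_range_succ', Finset.sum_congr rfl (g := fun _ => p.zW)] at h3
    · rw [Finset.sum_const, Finset.card_range, smul_eq_mul] at h3
      have h4 := Finset.card_filter_add_card_filter_not (s := Finset.univ.filter fun b => f l b < i + 1)
        (fun b => f l b = 0)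
      rw [Finset.filter_filter, Finset.filter_filter] at h4
      have e1 : (Finset.univ.filter fun b => f l b < i + 1 ∧ f l b = 0) =
          Finset.univ.filter fun b => f l b = 0 := by
        ext b
        simp only [Finset.mem_filter, Finset.mem_univ, true_and]
        omega
      have e2 : (Finset.univ.filter fun b => f l b < i + 1 ∧ ¬ f l b = 0) =
          Finset.univ.filter fun b => f l b - 1 < i ∧ f l b ≠ 0 := by
        ext b
        simp only [Finset.mem_filter, Finset.mem_univ, true_and]
        omega
      rw [e1, e2] at h4
      omega
    · intro v hv
      have := (h v (Finset.mem_range.1 hv)).1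
      change weight _ = _ at this
      rw [hp.floor_wx] at this
      rw [← this, weight]
      simp
  have h4 := Finset.card_filter_add_card_filter_not
    (s := Finset.univ.filter fun b => p.partX σ l b < i + 1 + p.r + 1) (fun b => f l b ≠ 0 ∧ f l b < i + 1)
  rw [Finset.filter_filter, Finset.filter_filter, h1] at h4
  -- Cells with an assigned rank lie below the threshold automatically, so intersecting with the
  -- threshold condition does not change their number.
  have e1 : (Finset.univ.filter fun b => p.partX σ l b < i + 1 + p.r + 1 ∧ f l b ≠ 0 ∧ f l b < i + 1) =
      Finset.univ.filter fun b => f l b ≠ 0 ∧ f l b < i + 1 := by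
    ext b
    simp only [Finset.mem_filter, Finset.mem_univ, true_and, and_iff_right_iff_imp]
    rintro ⟨g1, g2⟩
    have g3 := (h (f l b - 1) (by omega)).2 b
    have g4 : f l b = f l b - 1 + 1 := by omega
    simp only [← g4] at g3
    simp only [decide_true, freeVec] at g3
    have g5 := of_decide_eq_true (Bool.eq_true_of_true_le g3)
    omega
  have e2 : (Finset.univ.filter fun b => p.partX σ l b < i + 1 + p.r + 1 ∧
      ¬ (f l b ≠ 0 ∧ f l b < i + 1)).card = weight (p.freeVec σ f i l) := by
    unfold weight freeVec
    congr 1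
    ext b
    simp only [Finset.mem_filter, Finset.mem_univ, true_and, decide_eq_true_eq]
    omega
  rw [e1, h2, e2] at h4
  have e3 : (i + 1 + p.r) * p.zW = i * p.zW + (p.r + 1) * p.zW := by ring
  omega

theorem Valid.count_ranks (hp : p.Valid) {f : Fin p.wom.n → ℕ} {v : ℕ}
    (h : (fun b => decide (f b = v + 1)) ∈ J p.wom.wx p.wom.n) :
    (List.ofFn f).count (v + 1) = p.zW := by
  change weight _ = _ at h
  rw [hp.floor_wx] at h
  rw [count_ofFn, ← h, weight]
  simp

theorem Valid.count_zero (hp : p.Valid) {f : Fin p.wom.n → ℕ} (hf : ∀ b, f b ≤ p.u)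
    (hcount : ∀ v < p.u, (List.ofFn f).count (v + 1) = p.zW) :
    (List.ofFn f).count 0 = (p.r + 1) * p.zW := by
  have h1 := sum_count (q := p.u + 1) (L := List.ofFn f) fun x hx => by
    obtain ⟨b, rfl⟩ := (List.mem_ofFn' _ _).1 hx
    exact Nat.lt_succ_of_le (hf b)
  rw [Finset.sum_range_succ', Finset.sum_congr rfl fun v hv => hcount v (Finset.mem_range.1 hv),
    Finset.sum_const, Finset.card_range, smul_eq_mul, List.length_ofFn] at h1
  have h2 := hp.n_eq
  rw [← p.u_add] at h2
  have e : (p.u + p.r + 1) * p.zW = p.u * p.zW + (p.r + 1) * p.zW := by ring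
  omega

/-- Everything that makes up a codeword: the low ranks `f`, the index words `A` and the top words
`T`. The encoder program only has to produce these data; that they form a codeword of cost at most
`r` which decodes to `m` is purely combinatorial. -/
theorem Valid.encoding_spec (hp : p.Valid) (σ : p.codebook) (m : p.Message)
    (f : p.wom.Blocks → Fin p.wom.n → ℕ) (hf : ∀ l b, f l b ≤ p.u)
    (A : Fin p.u → List ℕ) (hA : ∀ i, A i ∈ permLists (Finset.Icc 1 (p.r + 1)) p.a)
    (hlt : ∀ i, lexIndex (A i) < p.wom.Ka)
    (henc : ∀ i : Fin p.u, IsHashEncoding p.wom.wx (m.1 i) (p.freeVec σ f i)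
      (fun l b => decide (f l b = i + 1)) (p.keysOfNat (lexIndex (A i))))
    (T : p.wom.Blocks → List ℕ) (hT : ∀ l, T l ∈ permLists (Finset.Icc (p.q - p.r) p.q) p.zW)
    (hTm : ∀ l, lexIndex (T l) = m.2 l) :
    ∃ π : p.codebook, p.decode π = m ∧ cost (σ : p.Cells → ℕ) (π : p.Cells → ℕ) ≤ p.r ∧
      p.IsRMEncoding m σ π ∧ (∀ i, List.ofFn (p.partA π i) = A i) ∧
      p.partB π = p.partB σ ∧ ∀ l, List.ofFn (p.partX π l) = fill (List.ofFn (f l)) (T l) := by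
  have hu := p.u_add
  have ofFn_getD : ∀ (L : List ℕ) (n : ℕ), L.length = n → (List.ofFn fun b : Fin n => L.getD b 0) = L := by
    rintro L n rfl
    refine List.ext_getElem (by simp) fun i h1 h2 => ?_
    simp [List.getD_eq_getElem?_getD]
  have hAl : ∀ i, (A i).length = (p.r + 1) * p.a := fun i => by
    rw [length_permLists (hA i), Nat.card_Icc, Nat.add_sub_cancel]
  have hTl : ∀ l, (T l).length = (p.r + 1) * p.zW := fun l => by
    rw [length_permLists (hT l), Nat.card_Icc]
    congr 1
    omega
  have hcount : ∀ l v, v < p.u → (List.ofFn (f l)).count (v + 1) = p.zW :=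
    fun l v hv => hp.count_ranks (henc ⟨v, hv⟩ l.2 l.1).2.1
  have hzero : ∀ l, (List.ofFn (f l)).count 0 = (T l).length := fun l => by
    rw [hTl, hp.count_zero (hf l) (hcount l)]
  set π : p.Cells → ℕ := Sum.elim (fun x => (A x.1).getD x.2 0) (Sum.elim (p.partB σ)
    fun x => (fill (List.ofFn (f x.1)) (T x.1)).getD x.2 0)
  have hπA : ∀ i, List.ofFn (p.partA π i) = A i := fun i => ofFn_getD _ _ (hAl i)
  have hπX : ∀ l, List.ofFn (p.partX π l) = fill (List.ofFn (f l)) (T l) := fun l =>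
    ofFn_getD (fill (List.ofFn (f l)) (T l)) _ (by rw [length_fill, List.length_ofFn])
  have hπx : ∀ l b, (f l b ≠ 0 → p.partX π l b = f l b) ∧ (f l b = 0 → p.partX π l b ∈ T l) := by
    intro l b
    have h := getD_fill (List.ofFn (f l)) (T l) b (by rw [List.length_ofFn]; exact b.2)
    rw [getD_ofFn] at h
    have h' : p.partX π l b = _ := h
    refine ⟨fun h0 => ?_, fun h0 => ?_⟩
    · rw [h', if_pos h0]
    · have hb : ((List.ofFn (f l)).take b).count 0 < (T l).length := by
        rw [← hzero, ← List.take_append_drop b (List.ofFn (f l)), List.count_append]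
        have : 0 < ((List.ofFn (f l)).drop b).count 0 := by
          rw [List.count_pos_iff, List.drop_eq_getElem_cons (by simp)]
          simp [h0]
        simp only [List.take_append_drop]
        omega
      rw [h', if_neg (not_not.2 h0), List.getD_eq_getElem _ _ hb]
      exact List.getElem_mem hb
  have hπB : p.partB π = p.partB σ := rfl
  have hTmem : ∀ l, ∀ x ∈ T l, p.q - p.r ≤ x ∧ x ≤ p.q := fun l x hx =>
    Finset.mem_Icc.1 (mem_permLists (hT l) hx)
  have hcode : π ∈ p.codebook := by
    refine ⟨fun i => ?_, σ.2.2.1, fun l => ?_⟩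
    · rw [isMultisetPerm_iff, hπA]
      exact hA i
    · rw [isMultisetPerm_iff, hπX]
      intro v
      rw [count_fill v _ _ (hzero l), hT l v]
      rcases Nat.eq_zero_or_pos v with rfl | hv
      · have := hp.r_pos
        have : ¬ (p.q - p.r ≤ 0) := by have := p.r_lt_q; omega
        simp [this]
      · rw [if_neg hv.ne']
        simp only [Finset.mem_Icc]
        by_cases hvu : v ≤ p.u
        · have := hcount l (v - 1) (by omega)
          rw [Nat.sub_add_cancel hv] at this
          rw [this, if_neg (by omega), if_pos (by omega), add_zero]
        · rw [List.count_eq_zero_of_not_mem, zero_add]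
          · congr 1
            refine propext ⟨fun h => by omega, fun h => by omega⟩
          · intro hm
            obtain ⟨b, rfl⟩ := (List.mem_ofFn' _ _).1 hm
            exact hvu (hf l b)
  have hrank : ∀ i, p.rankVec π i = fun l b => decide (f l b = i + 1) := by
    intro i
    funext l b
    have := i.2
    refine decide_eq_decide.2 ?_
    by_cases h0 : f l b = 0
    · have := hTmem l _ ((hπx l b).2 h0)
      rw [h0]
      omega
    · rw [(hπx l b).1 h0]
  -- The state seen from the finished `π` equals the state seen during writing: cells still marked
  -- `0` in `f` receive a rank of at least `q - r`, which exceeds `i`.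
  have hstate : ∀ i : Fin p.u, p.stateVec σ π i = p.freeVec σ f i := by
    intro i
    funext l b
    have := i.2
    refine decide_eq_decide.2 (and_congr_right fun _ => ?_)
    by_cases h0 : f l b = 0
    · have := hTmem l _ ((hπx l b).2 h0)
      rw [h0]
      simp only [implies_true, iff_true]
      omega
    · rw [(hπx l b).1 h0]
      omega
  have htop : ∀ l, p.topRanks π l = T l := by
    intro l
    unfold topRanks
    rw [hπX]
    refine filter_fill (by omega) _ _ (hzero l) (fun x hx => ?_) fun x hx => (hTmem l x hx).1
    obtain ⟨b, rfl⟩ := (List.mem_ofFn' _ _).1 hx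
    have := hf l b
    omega
  have hE : p.IsRMEncoding m σ π := by
    refine ⟨fun i => ?_, fun l => by rw [htop, hTm], hπB⟩
    rw [hπA, hrank, hstate]
    exact ⟨hlt i, henc i⟩
  refine ⟨⟨π, hcode⟩, ?_, ?_, hE, hπA, hπB, hπX⟩
  · refine Prod.ext (funext fun i => funext fun l => ((hE.1 i).2 l.2 l.1).2.2) (funext fun l => ?_)
    exact Fin.ext (hE.2.1 l)
  -- In an index part all ranks lie in `1, …, r + 1`; the part `π_b` is unchanged. In a block, a
  -- cell of top rank has rank at least `q - r`, and any other cell was free, so its old rank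
  -- exceeds the new one by at most `r`.
  · refine Finset.sup_le fun x _ => ?_
    rcases x with x | x | x
    · have h1 : (σ : p.Cells → ℕ) (Sum.inl x) ≤ p.r + 1 := by
        have := mem_permLists (isMultisetPerm_iff.1 (σ.2.1 x.1)) ((List.mem_ofFn' _ _).2 ⟨x.2, rfl⟩)
        exact (Finset.mem_Icc.1 this).2
      have h2 : 1 ≤ π (Sum.inl x) := by
        have := mem_permLists (isMultisetPerm_iff.1 (hcode.1 x.1)) ((List.mem_ofFn' _ _).2 ⟨x.2, rfl⟩)
        exact (Finset.mem_Icc.1 this).1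
      simp only
      omega
    · exact (Nat.sub_self _).trans_le (Nat.zero_le _)
    · obtain ⟨l, b⟩ := x
      have h1 : p.partX σ l b ≤ p.q := by
        have := mem_permLists (isMultisetPerm_iff.1 (σ.2.2.2 l)) ((List.mem_ofFn' _ _).2 ⟨b, rfl⟩)
        exact (Finset.mem_Icc.1 this).2
      change p.partX σ l b - p.partX π l b ≤ p.r
      by_cases h0 : f l b = 0
      · have := hTmem l _ ((hπx l b).2 h0)
        omega
      · rw [(hπx l b).1 h0]
        have hle := hf l b
        have h3 := (henc ⟨f l b - 1, by omega⟩ l.2 l.1).1 b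
        have h4 : f l b - 1 + 1 = f l b := by omega
        simp only [h4, decide_true, freeVec] at h3
        have h5 := of_decide_eq_true (Bool.eq_true_of_true_le h3)
        have h6 := h5.1
        change p.partX σ l b ≤ _ at h6
        omega

end RMParams

end RankMod

namespace RankMod

/-! ## The rate of the rank-modulation code -/

/-- The multinomial coefficient is one of the terms in the expansion of a power of `1 + … + 1`. -/
theorem numPerms_le (S : Finset ℕ) (z : ℕ) : numPerms S z ≤ S.card ^ (S.card * z) := by
  set k : ℕ → ℕ := fun i => if i ∈ S then z else 0 with hk
  have hs : ∑ i ∈ S, k i = S.card * z := by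
    rw [Finset.sum_congr rfl fun i hi => if_pos hi, Finset.sum_const, smul_eq_mul]
  have h1 : numPerms S z = Nat.multinomial S k := by
    have h2 := Nat.multinomial_spec S k
    have h3 := numPerms_mul S z
    have h4 : ∏ i ∈ S, (k i).factorial = ∏ _i ∈ S, z.factorial :=
      Finset.prod_congr rfl fun i hi => by rw [show k i = z from if_pos hi]
    rw [hs, h4, Finset.prod_const, ← h3, mul_comm] at h2
    exact (Nat.eq_of_mul_eq_mul_right (by positivity) h2).symm
  have h2 := Finset.sum_pow_eq_sum_piAntidiag S (fun _ => (1 : ℕ)) (S.card * z)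
  simp only [one_pow, Finset.prod_const_one, mul_one, Finset.sum_const, smul_eq_mul, Nat.cast_id] at h2
  rw [h1, h2]
  refine Finset.single_le_sum (f := fun k => Nat.multinomial S k) (fun _ _ => Nat.zero_le _) ?_
  rw [Finset.mem_piAntidiag]
  refine ⟨hs, fun i hi => ?_⟩
  by_contra h
  exact hi (if_neg h)

/-- The capacity is `log (r + 1) + r log ((r + 1) / r)`. So the top ranks, which carry at most `log
(r + 1)` bits per cell, cannot push the rate above it. -/
theorem logb_le_rmCapacity {r : ℕ} (hr : 0 < r) : Real.logb 2 ((r : ℝ) + 1) ≤ rmCapacity r := by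
  have hr' : (0 : ℝ) < r := by exact_mod_cast hr
  have hr1 : (0 : ℝ) < (r : ℝ) + 1 := by positivity
  have hl : 0 < Real.log 2 := Real.log_pos (by norm_num)
  unfold rmCapacity entropy
  rw [Real.logb, ← mul_div_assoc]
  refine div_le_div_of_nonneg_right ?_ hl.le
  unfold Real.binEntropy
  have e : 1 - 1 / ((r : ℝ) + 1) = r / (r + 1) := by field_simp; ring
  rw [e, one_div, inv_inv, inv_div, mul_add, ← mul_assoc, ← mul_assoc, mul_inv_cancel₀ hr1.ne',
    one_mul, mul_div_cancel₀ _ hr1.ne']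
  have : 0 ≤ Real.log ((r + 1) / r) := Real.log_nonneg (by rw [le_div_iff₀ hr']; linarith)
  nlinarith

theorem rmCapacity_le (r : ℕ) : rmCapacity r ≤ (r : ℝ) + 1 := by
  have hl : 0 < Real.log 2 := Real.log_pos (by norm_num)
  have : entropy (1 / ((r : ℝ) + 1)) ≤ 1 := by
    unfold entropy
    rw [div_le_one hl]
    exact Real.binEntropy_le_log_two
  unfold rmCapacity
  exact mul_le_of_le_one_right (by positivity) this

namespace RMParams

variable {p : RMParams}

/-- The ratio of the weights is `1 / (r + 1)`; each written rank can carry `1 / q` of the capacity.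
-/
theorem capacity_wom (p : RMParams) : p.wom.capacity = rmCapacity p.r / p.q := by
  have hq : (p.q : ℝ) ≠ 0 := by exact_mod_cast p.q_pos.ne'
  have hr : ((p.r : ℝ) + 1) ≠ 0 := by positivity
  change (((p.r : ℝ) + 1) / (p.q : ℝ)) * entropy (1 / (p.q : ℝ) / (((p.r : ℝ) + 1) / (p.q : ℝ))) = _
  rw [show 1 / (p.q : ℝ) / (((p.r : ℝ) + 1) / (p.q : ℝ)) = 1 / ((p.r : ℝ) + 1) by field_simp]
  unfold rmCapacity
  ring

theorem Valid.KM_pos (_hp : p.Valid) : 0 < p.KM := by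
  obtain ⟨L, hL⟩ := exists_mem_permLists (Finset.Icc (p.q - p.r) p.q) p.zW
  exact (Nat.zero_le _).trans_lt (lexIndex_lt hL)

theorem Valid.KR_pos (hp : p.Valid) : 0 < p.KR := by
  have := hp.KM_pos
  unfold KR HashParams.KW
  positivity

theorem Valid.logb_KR (hp : p.Valid) : Real.logb 2 (p.KR : ℝ) =
    p.wom.t * Real.logb 2 (p.KM : ℝ) + p.u * (p.wom.k * p.wom.t) := by
  have := hp.KM_pos
  unfold KR HashParams.KW
  push_cast
  rw [Real.logb_mul (by positivity) (by positivity), Real.logb_pow, Real.logb_pow, Real.logb_pow,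
    Real.logb_pow, Real.logb_self_eq_one (by norm_num)]
  ring

theorem Valid.q_mul_z (hp : p.Valid) :
    p.q * p.z = p.wom.n * p.wom.t + p.q * (p.u * p.a) := by
  rw [← hp.n_eq]
  unfold z
  ring

theorem Valid.t_pos (hp : p.Valid) : 0 < p.wom.t := Nat.mul_pos hp.wom.t₁_pos p.wom.t₂_pos

theorem Valid.z_pos (hp : p.Valid) : 0 < p.z :=
  Nat.add_pos_left (Nat.mul_pos hp.t_pos hp.zW_pos) _

theorem rmCapacity_nonneg {r : ℕ} (hr : 0 < r) : 0 ≤ rmCapacity r :=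
  (Real.logb_nonneg (by norm_num) (by linarith [(Nat.cast_nonneg r : (0 : ℝ) ≤ r)])).trans
    (logb_le_rmCapacity hr)

theorem Valid.logb_KM_le (hp : p.Valid) :
    Real.logb 2 (p.KM : ℝ) ≤ ((p.r : ℝ) + 1) * p.zW * rmCapacity p.r := by
  have hcard : (Finset.Icc (p.q - p.r) p.q).card = p.r + 1 := by
    have := p.r_lt_q
    rw [Nat.card_Icc]
    omega
  have h1 : p.KM ≤ (p.r + 1) ^ ((p.r + 1) * p.zW) := by
    have := numPerms_le (Finset.Icc (p.q - p.r) p.q) p.zW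
    rwa [hcard] at this
  have h2 : (p.KM : ℝ) ≤ ((p.r : ℝ) + 1) ^ ((p.r + 1) * p.zW) := by exact_mod_cast h1
  have h0 : (0 : ℝ) < p.KM := by exact_mod_cast hp.KM_pos
  refine (Real.logb_le_logb_of_le (by norm_num) h0 h2).trans ?_
  rw [Real.logb_pow]
  push_cast
  exact mul_le_mul_of_nonneg_left (logb_le_rmCapacity hp.r_pos) (by positivity)

theorem Valid.k_le (hp : p.Valid) : (p.wom.k : ℝ) ≤ p.zW * rmCapacity p.r := by
  have hq : (p.q : ℝ) ≠ 0 := by exact_mod_cast p.q_pos.ne'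
  refine hp.wom.k_le.trans (le_of_eq ?_)
  rw [capacity_wom, ← hp.n_eq]
  push_cast
  field_simp

/-- Per block, each of the `u` written ranks carries at most `zW` times the capacity and the `r + 1`
top ranks together at most `(r + 1) * zW` times; as `u + r + 1 = q` this is the capacity per cell of
the block. The index parts only enlarge the denominator. -/
theorem Valid.rate_le (hp : p.Valid) : p.rate ≤ rmCapacity p.r := by
  have hz : (0 : ℝ) < p.z := by exact_mod_cast hp.z_pos
  have hq : (0 : ℝ) < p.q := by exact_mod_cast p.q_pos
  have hC := rmCapacity_nonneg hp.r_pos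
  unfold rate rmRate
  rw [div_le_iff₀ (by positivity), hp.logb_KR]
  have h1 := mul_le_mul_of_nonneg_left hp.logb_KM_le (Nat.cast_nonneg p.wom.t : (0 : ℝ) ≤ p.wom.t)
  have h2 := mul_le_mul_of_nonneg_left hp.k_le
    (by positivity : (0 : ℝ) ≤ (p.u : ℝ) * p.wom.t)
  have hu : (p.u : ℝ) + p.r + 1 = p.q := by exact_mod_cast p.u_add
  have h3 : (p.q : ℝ) * p.z = p.q * p.zW * p.wom.t + p.q * (p.u * p.a) := by
    rw [← Nat.cast_mul, hp.q_mul_z, ← hp.n_eq]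
    push_cast
    ring
  rw [h3, ← hu]
  have h4 : 0 ≤ rmCapacity p.r * (((p.u : ℝ) + p.r + 1) * (p.u * p.a)) := by positivity
  nlinarith

/-- The bits stored in the top ranks are discarded, which costs a fraction `(r + 1) / q` of the
capacity. The other losses are `2 * eps` for each written rank from `k / n`, and the index cells,
which enlarge the code by a factor of at most `1 + d`. -/
theorem Valid.rate_ge (hp : p.Valid) (he : p.eps ≤ 1 / 4) :
    rmCapacity p.r - ((p.r : ℝ) + 1) ^ 2 / p.q - 6 * (((p.r : ℝ) + 1) * p.q ^ 2) * p.eps ≤ p.rate := by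
  have hq : (0 : ℝ) < p.q := by exact_mod_cast p.q_pos
  have hq1 : (1 : ℝ) ≤ p.q := by exact_mod_cast p.q_pos
  have hC := rmCapacity_nonneg hp.r_pos
  have hC1 := rmCapacity_le p.r
  have he0 : 0 < p.eps := hp.eps_pos
  have hn : (0 : ℝ) < p.wom.n := by
    have := hp.wom.n_ge
    exact_mod_cast (by omega : 0 < p.wom.n)
  have ht : (0 : ℝ) < p.wom.t₁ := by exact_mod_cast hp.wom.t₁_pos
  have ht2 : (0 : ℝ) < p.wom.t₂ := by exact_mod_cast p.wom.t₂_pos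
  have hu : (p.u : ℝ) + p.r + 1 = p.q := by exact_mod_cast p.u_add
  have hu0 : (0 : ℝ) ≤ p.u := Nat.cast_nonneg _
  have hr0 : (0 : ℝ) ≤ p.r := Nat.cast_nonneg _
  -- The extra cells number at most `q * q * (2 * n * t₂)`, and `t₁ ≥ 1 / (2 * eps)` makes this at
  -- most `d` times `n * t₁ * t₂`.
  set d : ℝ := 4 * p.q ^ 2 * p.eps with hd
  have hd0 : 0 ≤ d := by positivity
  have ht1 : 1 / (2 * p.eps) ≤ p.wom.t₁ := by
    have h1 := hp.wom.t₁_gt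
    have h2 : (1 : ℝ) ≤ 1 / p.eps := by rw [le_div_iff₀ he0]; linarith
    have h3 : 1 / p.eps ≤ (1 / p.eps) ^ ((5 : ℝ) / 3) := by
      nth_rewrite 1 [← Real.rpow_one (1 / p.eps)]
      exact Real.rpow_le_rpow_of_exponent_le h2 (by norm_num)
    have h4 : 2 ≤ 1 / (2 * p.eps) := by rw [le_div_iff₀ (by positivity)]; linarith
    have h5 : 1 / p.eps = 1 / (2 * p.eps) + 1 / (2 * p.eps) := by field_simp; norm_num
    change (1 / p.eps) ^ ((5 : ℝ) / 3) - 2 < (p.wom.t₁ : ℝ) at h1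
    linarith
  have hqz : (p.q : ℝ) * p.z ≤ p.wom.n * p.wom.t * (1 + d) := by
    have h1 : (p.a : ℝ) ≤ 2 * p.wom.n * p.wom.t₂ := by exact_mod_cast hp.a_spec.2
    have h2 : (p.q : ℝ) * p.z = p.wom.n * p.wom.t + p.q * (p.u * p.a) := by
      exact_mod_cast congrArg (Nat.cast (R := ℝ)) hp.q_mul_z
    have h3 : (1 : ℝ) ≤ 2 * p.eps * p.wom.t₁ := by
      rw [div_le_iff₀ (by positivity)] at ht1
      linarith
    have h4 : (p.q : ℝ) * (p.u * p.a) ≤ p.q * (p.q * (2 * p.wom.n * p.wom.t₂)) := by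
      refine mul_le_mul_of_nonneg_left (mul_le_mul (by linarith) h1 (Nat.cast_nonneg _) hq.le) hq.le
    have h5 : (p.wom.t : ℝ) = p.wom.t₁ * p.wom.t₂ := by
      unfold HashParams.t
      push_cast
      rfl
    have h6 := mul_le_mul_of_nonneg_left h3
      (by positivity : (0 : ℝ) ≤ p.q * (p.q * (2 * p.wom.n * p.wom.t₂)))
    rw [h2, h5, hd]
    nlinarith
  have hk : rmCapacity p.r / p.q - 2 * p.eps ≤ p.wom.k / p.wom.n := by
    have h1 := hp.wom.k_div_n_gt
    rw [capacity_wom] at h1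
    change _ - 2 * p.eps / 3 - _ < _ at h1
    have h2 : 1 / (p.wom.n : ℝ) ≤ p.eps := by
      have h3 := hp.wom.twenty_lt
      have h4 := hp.wom.one_le_logb
      change _ < (p.wom.n : ℝ) * p.eps at h3
      rw [div_le_iff₀ hn]
      linarith
    linarith
  have hkC : (p.wom.k : ℝ) / p.wom.n ≤ rmCapacity p.r / p.q := by
    have := hp.wom.k_div_n_le
    rwa [capacity_wom] at this
  set X : ℝ := p.u * (p.wom.k / p.wom.n) with hX
  have hX0 : 0 ≤ X := by positivity
  have hXC : X ≤ rmCapacity p.r := by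
    calc X ≤ p.q * (rmCapacity p.r / p.q) := mul_le_mul (by linarith) hkC (by positivity) hq.le
      _ = _ := mul_div_cancel₀ _ hq.ne'
  have hXge : rmCapacity p.r - ((p.r : ℝ) + 1) ^ 2 / p.q - 2 * p.q * p.eps ≤ X := by
    have h1 := mul_le_mul_of_nonneg_left hk hu0
    have h2 : (p.u : ℝ) * (rmCapacity p.r / p.q - 2 * p.eps) =
        rmCapacity p.r - (p.r + 1) * rmCapacity p.r / p.q - 2 * p.u * p.eps := by
      rw [show (p.u : ℝ) = p.q - (p.r + 1) by linarith]
      field_simp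
    have h3 : ((p.r : ℝ) + 1) * rmCapacity p.r / p.q ≤ ((p.r : ℝ) + 1) ^ 2 / p.q := by
      rw [sq]
      gcongr
    nlinarith
  have hR : X * (1 - d) ≤ p.rate := by
    have hKM : 0 ≤ Real.logb 2 (p.KM : ℝ) :=
      Real.logb_nonneg (by norm_num) (by exact_mod_cast hp.KM_pos)
    have hz : (0 : ℝ) < p.z := by exact_mod_cast hp.z_pos
    have ht' : (0 : ℝ) < p.wom.t := by exact_mod_cast hp.t_pos
    unfold rate rmRate
    rw [le_div_iff₀ (by positivity), hp.logb_KR]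
    -- For `d ≤ 1` the inequality `(1 - d) * (1 + d) ≤ 1` replaces a division; for `d ≥ 1` the bound
    -- is not positive and holds trivially.
    rcases le_total d 1 with h1 | h1
    · calc X * (1 - d) * (p.q * p.z) ≤ X * (1 - d) * (p.wom.n * p.wom.t * (1 + d)) :=
            mul_le_mul_of_nonneg_left hqz (mul_nonneg hX0 (by linarith))
        _ = X * p.wom.n * p.wom.t * (1 - d ^ 2) := by ring
        _ ≤ X * p.wom.n * p.wom.t * 1 :=
            mul_le_mul_of_nonneg_left (by nlinarith) (by positivity)
        _ = p.u * (p.wom.k * p.wom.t) := by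
            rw [hX]
            field_simp
        _ ≤ _ := by
            have : 0 ≤ (p.wom.t : ℝ) * Real.logb 2 (p.KM : ℝ) := by positivity
            linarith
    · have h2 : X * (1 - d) * (p.q * p.z) ≤ 0 :=
        mul_nonpos_of_nonpos_of_nonneg (mul_nonpos_of_nonneg_of_nonpos hX0 (by linarith)) (by positivity)
      have : 0 ≤ (p.wom.t : ℝ) * Real.logb 2 (p.KM : ℝ) + p.u * (p.wom.k * p.wom.t) := by positivity
      linarith
  have h1 : X * d ≤ ((p.r : ℝ) + 1) * d := mul_le_mul_of_nonneg_right (hXC.trans hC1) hd0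
  have h2 : 2 * p.q * p.eps ≤ 2 * (((p.r : ℝ) + 1) * p.q ^ 2) * p.eps := by
    refine mul_le_mul_of_nonneg_right ?_ he0.le
    nlinarith
  rw [hd] at h1
  nlinarith

/-- Each of the two losses is brought down to `η / 4`: the term `(r + 1) ^ 2 / q` by the choice of
`q`, and the term proportional to `q ^ 2 * eps` by an `ε₀` that depends on `q`. -/
theorem rate_bounds : ∀ r : ℕ, 0 < r → ∀ η : ℝ, 0 < η → ∃ Q : ℕ, ∀ q : ℕ, Q ≤ q →
      ∃ ε₀ : ℝ, 0 < ε₀ ∧ ∀ p : RankMod.RMParams, p.Valid → p.q = q → p.r = r → p.eps < ε₀ →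
        RankMod.rmCapacity r - η < p.rate ∧ p.rate ≤ RankMod.rmCapacity r := by
  intro r hr η hη
  have hr1 : (0 : ℝ) < (r : ℝ) + 1 := by positivity
  refine ⟨⌈4 * ((r : ℝ) + 1) ^ 2 / η⌉₊ + 1, fun q hq => ?_⟩
  have hq0 : (0 : ℝ) < q := by exact_mod_cast (by omega : 0 < q)
  have h1 : 4 * ((r : ℝ) + 1) ^ 2 / η ≤ q := by
    exact (Nat.le_ceil _).trans (Nat.cast_le.2 (by omega))
  refine ⟨min (1 / 4) (η / (24 * (((r : ℝ) + 1) * q ^ 2))), by positivity, ?_⟩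
  rintro p hp rfl rfl he
  have he1 := (he.trans_le (min_le_left _ _)).le
  have he2 := (he.trans_le (min_le_right _ _)).le
  refine ⟨?_, hp.rate_le⟩
  have h2 := hp.rate_ge he1
  have h3 : ((p.r : ℝ) + 1) ^ 2 / p.q ≤ η / 4 := by
    rw [div_le_iff₀ hη] at h1
    rw [div_le_iff₀ hq0]
    linarith
  have h4 : 6 * (((p.r : ℝ) + 1) * p.q ^ 2) * p.eps ≤ η / 4 := by
    rw [le_div_iff₀ (by positivity)] at he2
    linarith
  linarith

/-- The divisibility of the block length is arranged through `c`: with `eps = 2 ^ (-M)` and `c = q *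
j / (2 ^ M * M)` the expression for `n` is exactly `q * j`, before any rounding. The value of `j`
makes `c` exceed `20`. -/
theorem exists_valid {q r : ℕ} (hr : 0 < r) (hrq : r < q) {del ε₀ : ℝ} (hd : 0 < del)
    (hd' : del ≤ 1 / 2) (he : 0 < ε₀) :
    ∃ p : RMParams, p.Valid ∧ p.q = q ∧ p.r = r ∧ p.del = del ∧ p.eps < ε₀ := by
  obtain ⟨m, hm⟩ := exists_pow_lt_of_lt_one he (show (1 / 2 : ℝ) < 1 by norm_num)
  set M := m + 1
  have hM : (1 : ℝ) ≤ M := by exact_mod_cast (by omega : 1 ≤ M)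
  have hM2 : (1 : ℝ) ≤ 2 ^ M := one_le_pow₀ (by norm_num)
  have hq1 : (1 : ℝ) ≤ q := by exact_mod_cast (by omega : 1 ≤ q)
  set j : ℕ := 20 * 2 ^ M * M + 1 with hj
  have hj' : (j : ℝ) = 20 * 2 ^ M * M + 1 := by
    rw [hj]
    push_cast
    rfl
  set p : RMParams := ⟨q, r, hrq, (1 / 2) ^ M, del, q * j / (2 ^ M * M)⟩ with hp
  have hn : p.wom.n = q * j := by
    have : (q * j / (2 ^ M * M) : ℝ) / (1 / 2) ^ M * Real.logb 2 (1 / (1 / 2) ^ M) = (q * j : ℕ) := by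
      have e : (1 : ℝ) / (1 / 2) ^ M = 2 ^ M := by rw [one_div_pow, one_div_one_div]
      rw [div_eq_mul_one_div _ (((1 : ℝ) / 2) ^ M), e, Real.logb_pow,
        Real.logb_self_eq_one (by norm_num)]
      push_cast
      field_simp
    show ⌈(q * j / (2 ^ M * M) : ℝ) / (1 / 2) ^ M * Real.logb 2 (1 / (1 / 2) ^ M)⌉₊ = q * j
    rw [this, Nat.ceil_natCast]
  refine ⟨p, ⟨hr, ?_, ?_, hd, hd', ?_, ?_⟩, rfl, rfl, rfl, ?_⟩
  · show (0 : ℝ) < (1 / 2) ^ M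
    positivity
  · show ((1 : ℝ) / 2) ^ M ≤ 1 / 2
    exact pow_le_of_le_one (by norm_num) (by norm_num) (by omega)
  · show 20 < (q * j / (2 ^ M * M) : ℝ)
    rw [lt_div_iff₀ (by positivity), hj']
    nlinarith [mul_le_mul hM2 hM (by norm_num) (by positivity)]
  · rw [hn]
    exact dvd_mul_right q j
  · refine lt_of_le_of_lt ?_ hm
    show ((1 : ℝ) / 2) ^ M ≤ _
    exact pow_le_pow_of_le_one (by norm_num) (by norm_num) (by omega)

theorem exists_sequence : ∀ (r : ℕ) (del : ℝ), 0 < r → 0 < del → del ≤ 1 / 2 →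
      ∃ p : ℕ → RankMod.RMParams, (∀ i, (p i).Valid ∧ (p i).r = r ∧ (p i).del = del) ∧
        Tendsto (fun i => (p i).rate) atTop (𝓝 (RankMod.rmCapacity r)) := by
  intro r del hr hd hd'
  have h : ∀ i : ℕ, ∃ p : RMParams, (p.Valid ∧ p.r = r ∧ p.del = del) ∧
      rmCapacity r - 1 / ((i : ℝ) + 1) < p.rate ∧ p.rate ≤ rmCapacity r := by
    intro i
    obtain ⟨Q, hQ⟩ := rate_bounds r hr (1 / ((i : ℝ) + 1)) (by positivity)
    obtain ⟨ε₀, h0, h1⟩ := hQ (max Q (r + 1)) (le_max_left _ _)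
    obtain ⟨p, hp, h2, h3, h4, h5⟩ := exists_valid (q := max Q (r + 1)) hr
      ((Nat.lt_succ_self r).trans_le (le_max_right _ _)) hd hd' h0
    exact ⟨p, ⟨hp, h3, h4⟩, h1 p hp h2 h3 h5⟩
  choose p h1 h2 using h
  refine ⟨p, h1, ?_⟩
  have hlim : Tendsto (fun i : ℕ => rmCapacity r - 1 / ((i : ℝ) + 1)) atTop (𝓝 (rmCapacity r)) := by
    have := (tendsto_const_nhds (x := rmCapacity r)).sub (tendsto_one_div_add_atTop_nhds_zero_nat (𝕜 := ℝ))
    rwa [sub_zero] at this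
  exact tendsto_of_tendsto_of_tendsto_of_le_of_le hlim tendsto_const_nhds (fun i => (h2 i).1.le)
    fun i => (h2 i).2

end RMParams

end RankMod

namespace RAM

set_option synthInstance.maxHeartbeats 400000
set_option synthInstance.maxSize 4000

/-! ## Programs for the lexicographic index -/

theorem Sp.call6 {f a0 a1 a2 a3 a4 a5 : E} {L ρ : List ℕ} {v0 v1 v2 v3 v4 v5 c0 c1 c2 c3 c4 c5 w d : ℕ}
    (h0 : Sp a0 L ρ v0 c0) (h1 : Sp a1 L ρ v1 c1) (h2 : Sp a2 L ρ v2 c2) (h3 : Sp a3 L ρ v3 c3)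
    (h4 : Sp a4 L ρ v4 c4) (h5 : Sp a5 L ρ v5 c5) (hf : Sp f L [v0, v1, v2, v3, v4, v5] w d) :
    Sp (.call 6 ![a0, a1, a2, a3, a4, a5] f) L ρ w (c0 + c1 + c2 + c3 + c4 + c5 + d + 3) :=
  Sp.of_call (v := ![v0, v1, v2, v3, v4, v5]) (c := ![c0, c1, c2, c3, c4, c5]) (d := d)
    (by simp [Fin.forall_fin_succ, h0, h1, h2, h3, h4, h5]) (by simpa using hf)
    (by simp [Fin.sum_univ_succ]; omega)

def factE (n : E) : E := .call 1 ![n] (.fold (.var 0) (.lit 1) (mulE (.var 2) (.add (.var 1) (.lit 1))))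

theorem iter_factorial (n : ℕ) : iter (fun i acc => acc * (i + 1)) 1 n = n.factorial := by
  induction n with
  | zero => rfl
  | succ n ih => rw [iter_succ, ih, Nat.factorial_succ, mul_comm]

instance {L ρ : List ℕ} {n : E} {vn cn : ℕ} [Sp n L ρ vn cn] :
    Sp (factE n) L ρ vn.factorial (cn + 50 * (vn + 1) ^ 2) := by
  refine (Sp.call1 ‹_› inferInstance).mono (iter_factorial _) ?_
  generalize hS : Finset.sum (M := ℕ) (Finset.range _) _ = T
  have hT : T ≤ vn * (11 * vn + 40) := hS ▸ sum_range_le fun j hj => by omega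
  nlinarith

/-- Division by repeated doubling; the dividend has at most `B` bits. -/
def natDiv (a b B : ℕ) : ℕ := iter (fun i acc =>
  if (acc + acc + 1) * b - a / 2 ^ (B - 1 - i) ≠ 0 then acc + acc else acc + acc + 1) 0 B

/-- Binary long division: after `i` rounds the accumulator is the quotient of the number formed by
the top `i` of the `B` bits of `a`. -/
theorem natDiv_eq {a b B : ℕ} (ha : a < 2 ^ B) (hb : 0 < b) : natDiv a b B = a / b := by
  have h := iter_eq (a := 0) (f := fun i acc =>
    if (acc + acc + 1) * b - a / 2 ^ (B - 1 - i) ≠ 0 then acc + acc else acc + acc + 1)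
    (fun i => a / 2 ^ (B - i) / b) B (by
      rw [Nat.sub_zero, Nat.div_eq_of_lt ha, Nat.zero_div]) fun i hi => ?_
  · rw [natDiv, h]
    simp
  · rw [show B - i = B - 1 - i + 1 by omega, show B - (i + 1) = B - 1 - i by omega, pow_succ,
      ← Nat.div_div_eq_div_mul, Nat.div_right_comm]
    set A := a / 2 ^ (B - 1 - i)
    have h2 : (A / b / 2 + A / b / 2 + 1) * b - A = 0 ↔ A / b / 2 + A / b / 2 + 1 ≤ A / b := by
      rw [Nat.sub_eq_zero_iff_le, Nat.le_div_iff_mul_le hb]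
    split_ifs with h3
    · have : ¬ (A / b / 2 + A / b / 2 + 1 ≤ A / b) := fun h4 => h3 (h2.2 h4)
      omega
    · have := h2.1 (not_not.1 h3)
      omega

/-- The cost is polynomial in the bit length of the dividend and in the divisor itself. In the
counting of words the dividends are as large as factorials, while the divisors are small counters.
-/
def divE (a b B : E) : E := .call 3 ![a, b, B] (.fold (.var 2) (.lit 0)
  (.bind (.add (.add (.var 4) (.var 4)) (.lit 1))
    (.cond (.sub (mulE (.var 5) (.var 1)) (shrE (.var 0) (.sub (.sub (.var 2) (.lit 1)) (.var 3))))
      (.add (.var 4) (.var 4)) (.var 5))))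

instance {L ρ : List ℕ} {a b B : E} {va vb vB ca cb cB : ℕ} [Sp a L ρ va ca] [Sp b L ρ vb cb]
    [Sp B L ρ vB cB] :
    Sp (divE a b B) L ρ (natDiv va vb vB) (ca + cb + cB + 100 * (vB + vb + 1) ^ 2) := by
  refine (Sp.call3 ‹_› ‹_› ‹_› inferInstance).mono rfl ?_
  generalize hS : Finset.sum (M := ℕ) (Finset.range _) _ = T
  have hT : T ≤ vB * (9 * vB + 11 * vb + 80) := hS ▸ sum_range_le fun j hj => by omega
  nlinarith

/-- The number of cells among `ptr, …, ptr + p - 1` that contain `x`. -/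
def cnt (L : List ℕ) (ptr p x : ℕ) : ℕ :=
  ∑ b ∈ Finset.range p, if L.getD (ptr + b) 0 - x + (x - L.getD (ptr + b) 0) ≠ 0 then 0 else 1

def cntE (ptr p x : E) : E := .call 3 ![ptr, p, x] (.fold (.var 1) (.lit 0) (.add (.var 4)
  (.cond (neE (.ld (.add (.var 0) (.var 3))) (.var 2)) (.lit 0) (.lit 1))))

instance {L ρ : List ℕ} {ptr p x : E} {vptr vp vx cptr cp cx : ℕ} [Sp ptr L ρ vptr cptr]
    [Sp p L ρ vp cp] [Sp x L ρ vx cx] :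
    Sp (cntE ptr p x) L ρ (cnt L vptr vp vx) (cptr + cp + cx + 40 * vp + 20) := by
  refine (Sp.call3 ‹_› ‹_› ‹_› inferInstance).mono ?_ ?_
  · rw [iter_add_eq_sum, cnt]
  · simp
    omega

/-- The number of letters `x` that are left when `p` letters have been written from `ptr` on. -/
def left (L : List ℕ) (lo hi z ptr p x : ℕ) : ℕ :=
  (if x + 1 - lo ≠ 0 then (if hi + 1 - x ≠ 0 then z else 0) else 0) - cnt L ptr p x

def leftE (lo hi z ptr p x : E) : E := .call 6 ![lo, hi, z, ptr, p, x]
  (.sub (.cond (.sub (.add (.var 5) (.lit 1)) (.var 0))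
    (.cond (.sub (.add (.var 1) (.lit 1)) (.var 5)) (.var 2) (.lit 0)) (.lit 0))
    (cntE (.var 3) (.var 4) (.var 5)))

instance {L ρ : List ℕ} {lo hi z ptr p x : E} {vlo vhi vz vptr vp vx clo chi cz cptr cp cx : ℕ}
    [Sp lo L ρ vlo clo] [Sp hi L ρ vhi chi] [Sp z L ρ vz cz] [Sp ptr L ρ vptr cptr]
    [Sp p L ρ vp cp] [Sp x L ρ vx cx] :
    Sp (leftE lo hi z ptr p x) L ρ (left L vlo vhi vz vptr vp vx)
      (clo + chi + cz + cptr + cp + cx + 40 * vp + 100) := by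
  refine (Sp.call6 ‹_› ‹_› ‹_› ‹_› ‹_› ‹_› inferInstance).mono ?_ ?_
  · simp [left]
  · simp
    omega

theorem left_le (L : List ℕ) (lo hi z ptr p x : ℕ) : left L lo hi z ptr p x ≤ z := by
  unfold left
  split_ifs <;> omega

/-- The number of ways to complete a word of length `m` whose next letter is `w`. -/
def startNat (L : List ℕ) (lo hi z m ptr p w : ℕ) : ℕ :=
  -- Division by a product of factorials is done by the factors `1, 2, …` one at a time, which keeps
  -- every divisor small. Words of length `m` have counts of at most `m ^ 2` bits, so the width `m *
  -- m + m` suffices.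
  iter (fun x acc => iter (fun i acc => natDiv acc (i + 1) (m * m + m)) acc
    (left L lo hi z ptr p x)) ((m - p - 1).factorial * left L lo hi z ptr p w) (hi + 1)

def startE (lo hi z m ptr p w : E) : E := .call 7 ![lo, hi, z, m, ptr, p, w]
  (.bind (.add (mulE (.var 3) (.var 3)) (.var 3)) (.fold (.add (.var 1) (.lit 1))
    (mulE (factE (.sub (.sub (.var 3) (.var 5)) (.lit 1)))
      (leftE (.var 0) (.var 1) (.var 2) (.var 4) (.var 5) (.var 6)))
    (.fold (leftE (.var 0) (.var 1) (.var 2) (.var 4) (.var 5) (.var 8)) (.var 9)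
      (divE (.var 11) (.add (.var 10) (.lit 1)) (.var 7)))))

instance {L ρ : List ℕ} {lo hi z m ptr p w : E} {vlo vhi vz vm vptr vp vw : ℕ}
    {clo chi cz cm cptr cp cw : ℕ} [Sp lo L ρ vlo clo] [Sp hi L ρ vhi chi] [Sp z L ρ vz cz]
    [Sp m L ρ vm cm] [Sp ptr L ρ vptr cptr] [Sp p L ρ vp cp] [Sp w L ρ vw cw] :
    Sp (startE lo hi z m ptr p w) L ρ (startNat L vlo vhi vz vm vptr vp vw)
      (clo + chi + cz + cm + cptr + cp + cw + 2000 * (vm + vz + vhi + vp + 1) ^ 6) := by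
  refine (Sp.call7 ‹_› ‹_› ‹_› ‹_› ‹_› ‹_› ‹_› inferInstance).mono rfl ?_
  have hl := left_le L vlo vhi vz vptr vp
  set Y := vm + vz + vhi + vp + 1 with hY
  generalize hS : Finset.sum (M := ℕ) (Finset.range (vhi + 1)) _ = T
  have hT : T ≤ (vhi + 1) * (vz * (500 * Y ^ 4) + 40 * vp + 200) := hS ▸ sum_range_le fun x hx => by
    generalize hS : Finset.sum (M := ℕ) (Finset.range _) _ = T
    have hT : T ≤ left L vlo vhi vz vptr vp x * (500 * Y ^ 4) := hS ▸ sum_range_le fun j hj => by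
      have h1 : vm * vm + vm + (j + 1) + 1 ≤ 2 * Y ^ 2 := by
        have := hl x
        nlinarith
      have h2 := Nat.pow_le_pow_left h1 2
      have h3 : (2 * Y ^ 2) ^ 2 = 4 * Y ^ 4 := by ring
      have h4 : 1 ≤ Y ^ 4 := Nat.one_le_pow _ _ (by omega)
      omega
    have h5 := Nat.mul_le_mul_right (500 * Y ^ 4) (hl x)
    omega
  have h6 : (vhi + 1) * (vz * (500 * Y ^ 4) + 40 * vp + 200) ≤ Y * (Y * (500 * Y ^ 4) + 240 * Y) := by
    refine Nat.mul_le_mul (by omega) ?_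
    have := Nat.mul_le_mul_right (500 * Y ^ 4) (show vz ≤ Y by omega)
    omega
  have h7 : Y * (Y * (500 * Y ^ 4) + 240 * Y) = 500 * Y ^ 6 + 240 * Y ^ 2 := by ring
  have h8 : Y ^ 2 ≤ Y ^ 6 := Nat.pow_le_pow_right (by omega) (by norm_num)
  have h9 : Y ≤ Y ^ 6 := Nat.le_self_pow (by norm_num) _
  have h10 : (vm - vp - 1 + 1) ^ 2 ≤ Y ^ 2 := Nat.pow_le_pow_left (by omega) 2
  have h11 := hl vw
  omega

/-- The contribution of the first `p` letters to the lexicographic index. -/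
def rankNat (L : List ℕ) (lo hi z m ptr p : ℕ) : ℕ :=
  ∑ p' ∈ Finset.range p, ∑ w ∈ Finset.range (hi + 1),
    if L.getD (ptr + p') 0 - w ≠ 0 then startNat L lo hi z m ptr p' w else 0

def rankE (lo hi z m ptr p : E) : E := .call 6 ![lo, hi, z, m, ptr, p]
  (.fold (.var 5) (.lit 0) (.add (.var 7) (.fold (.add (.var 1) (.lit 1)) (.lit 0) (.add (.var 9)
    (.cond (.sub (.ld (.add (.var 4) (.var 6))) (.var 8))
      (startE (.var 0) (.var 1) (.var 2) (.var 3) (.var 4) (.var 6) (.var 8)) (.lit 0))))))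

instance {L ρ : List ℕ} {lo hi z m ptr p : E} {vlo vhi vz vm vptr vp : ℕ}
    {clo chi cz cm cptr cp : ℕ} [Sp lo L ρ vlo clo] [Sp hi L ρ vhi chi] [Sp z L ρ vz cz]
    [Sp m L ρ vm cm] [Sp ptr L ρ vptr cptr] [Sp p L ρ vp cp] :
    Sp (rankE lo hi z m ptr p) L ρ (rankNat L vlo vhi vz vm vptr vp)
      (clo + chi + cz + cm + cptr + cp + 3000 * (vm + vz + vhi + vp + 1) ^ 8) := by
  refine (Sp.call6 ‹_› ‹_› ‹_› ‹_› ‹_› ‹_› inferInstance).mono ?_ ?_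
  · simp only [iter_add_eq_sum, rankNat]
  set Y := vm + vz + vhi + vp + 1 with hY
  have h0 : 1 ≤ Y ^ 6 := Nat.one_le_pow _ _ (by omega)
  generalize hS : Finset.sum (M := ℕ) (Finset.range vp) _ = T
  have hT : T ≤ vp * (Y * (2200 * Y ^ 6) + 50) := hS ▸ sum_range_le fun x hx => by
    generalize hS : Finset.sum (M := ℕ) (Finset.range _) _ = T
    have hT : T ≤ (vhi + 1) * (2200 * Y ^ 6) := hS ▸ sum_range_le fun j hj => by
      have h1 : (vm + vz + vhi + x + 1) ^ 6 ≤ Y ^ 6 := Nat.pow_le_pow_left (by omega) 6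
      omega
    have h2 := Nat.mul_le_mul_right (2200 * Y ^ 6) (show vhi + 1 ≤ Y by omega)
    omega
  have h3 := Nat.mul_le_mul_right (Y * (2200 * Y ^ 6) + 50) (show vp ≤ Y by omega)
  have h4 : Y * (Y * (2200 * Y ^ 6) + 50) = 2200 * Y ^ 8 + 50 * Y := by ring
  have h5 : Y ≤ Y ^ 8 := Nat.le_self_pow (by norm_num) _
  omega

/-- The letter number `p` of the word with lexicographic index `y`. -/
def digitNat (L : List ℕ) (lo hi z m ptr p y : ℕ) : ℕ :=
  -- The next letter is the number of letters `w` for which all words starting with a letter up to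
  -- `w` precede the wanted word.
  ∑ w ∈ Finset.range (hi + 1), if ∑ x ∈ Finset.range (w + 1), startNat L lo hi z m ptr p x -
    (y - rankNat L lo hi z m ptr p) ≠ 0 then 0 else 1

def digitE (lo hi z m ptr p y : E) : E := .call 7 ![lo, hi, z, m, ptr, p, y]
  (.bind (.sub (.var 6) (rankE (.var 0) (.var 1) (.var 2) (.var 3) (.var 4) (.var 5)))
  (.fold (.add (.var 1) (.lit 1)) (.lit 0) (.add (.var 9) (.cond
    (.sub (.fold (.add (.var 8) (.lit 1)) (.lit 0) (.add (.var 11)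
      (startE (.var 0) (.var 1) (.var 2) (.var 3) (.var 4) (.var 5) (.var 10)))) (.var 7))
    (.lit 0) (.lit 1)))))

instance {L ρ : List ℕ} {lo hi z m ptr p y : E} {vlo vhi vz vm vptr vp vy : ℕ}
    {clo chi cz cm cptr cp cy : ℕ} [Sp lo L ρ vlo clo] [Sp hi L ρ vhi chi] [Sp z L ρ vz cz]
    [Sp m L ρ vm cm] [Sp ptr L ρ vptr cptr] [Sp p L ρ vp cp] [Sp y L ρ vy cy] :
    Sp (digitE lo hi z m ptr p y) L ρ (digitNat L vlo vhi vz vm vptr vp vy)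
      (clo + chi + cz + cm + cptr + cp + cy + 6000 * (vm + vz + vhi + vp + 1) ^ 8) := by
  refine (Sp.call7 ‹_› ‹_› ‹_› ‹_› ‹_› ‹_› ‹_› inferInstance).mono ?_ ?_
  · simp only [iter_add_eq_sum, digitNat]
  set Y := vm + vz + vhi + vp + 1 with hY
  have h0 : 1 ≤ Y ^ 6 := Nat.one_le_pow _ _ (by omega)
  generalize hS : Finset.sum (M := ℕ) (Finset.range (vhi + 1)) _ = T
  have hT : T ≤ (vhi + 1) * (Y * (2200 * Y ^ 6) + 50) := hS ▸ sum_range_le fun x hx => by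
    generalize hS : Finset.sum (M := ℕ) (Finset.range _) _ = T
    have hT : T ≤ (x + 1) * (2200 * Y ^ 6) := hS ▸ sum_range_le fun j hj => by omega
    have h2 := Nat.mul_le_mul_right (2200 * Y ^ 6) (show x + 1 ≤ Y by omega)
    omega
  have h3 := Nat.mul_le_mul_right (Y * (2200 * Y ^ 6) + 50) (show vhi + 1 ≤ Y by omega)
  have h4 : Y * (Y * (2200 * Y ^ 6) + 50) = 2200 * Y ^ 8 + 50 * Y := by ring
  have h5 : Y ≤ Y ^ 8 := Nat.le_self_pow (by norm_num) _
  omega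

/-- The word with lexicographic index `y`. -/
def unrankS (lo hi z m y : E) : S := .call 5 ![lo, hi, z, m, y] (.bindLen (.loop (.var 3)
  (.emit (digitE (.var 0) (.var 1) (.var 2) (.var 3) (.var 5) (.var 6) (.var 4)))))

end RAM

/-! ### Correctness of ranking and unranking -/

namespace RankMod
open RAM

section Rank
variable {L T : List ℕ} {lo hi z m ptr p : ℕ}

theorem cnt_eq (x : ℕ) (hp : p ≤ T.length) (h : ∀ b < p, L.getD (ptr + b) 0 = T.getD b 0) :
    cnt L ptr p x = (T.take p).count x := by
  induction p with
  | zero => rfl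
  | succ p ih =>
    have ih := ih (by omega) fun b hb => h b (by omega)
    rw [cnt] at ih ⊢
    rw [Finset.sum_range_succ, ih, h p (by omega), List.take_add_one, List.count_append,
      List.getD_eq_getElem?_getD, List.getElem?_eq_getElem (by omega : p < T.length)]
    congr 1
    simp only [Option.getD_some, Option.toList_some, List.count_singleton, beq_iff_eq]
    split_ifs <;> omega

theorem left_eq (hT : T ∈ permLists (Finset.Icc lo hi) z) (x : ℕ) (hp : p ≤ T.length)
    (h : ∀ b < p, L.getD (ptr + b) 0 = T.getD b 0) :
    left L lo hi z ptr p x = (T.drop p).count x := by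
  have h1 := hT x
  rw [← List.take_append_drop p T, List.count_append] at h1
  rw [left, cnt_eq x hp h]
  simp only [Finset.mem_Icc] at h1
  split_ifs at h1 ⊢ <;> omega

theorem iter_natDiv {a B : ℕ} (ha : a < 2 ^ B) (l : ℕ) :
    iter (fun i acc => natDiv acc (i + 1) B) a l = a / l.factorial := by
  induction l with
  | zero => simp [iter_zero]
  | succ l ih =>
    rw [iter_succ, ih, natDiv_eq ((Nat.div_le_self _ _).trans_lt ha) l.succ_pos,
      Nat.div_div_eq_div_mul, Nat.factorial_succ, mul_comm]

theorem iter_iter_natDiv {a B : ℕ} (ha : a < 2 ^ B) (c : ℕ → ℕ) (q : ℕ) :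
    iter (fun x acc => iter (fun i acc => natDiv acc (i + 1) B) acc (c x)) a q =
      a / ∏ x ∈ Finset.range q, (c x).factorial := by
  induction q with
  | zero => simp [iter_zero]
  | succ q ih =>
    rw [iter_succ, ih, iter_natDiv ((Nat.div_le_self _ _).trans_lt ha), Nat.div_div_eq_div_mul,
      Finset.prod_range_succ]

theorem startNat_eq (hT : T ∈ permLists (Finset.Icc lo hi) z) (hm : T.length = m) (w : ℕ)
    (hp : p < m) (h : ∀ b < p, L.getD (ptr + b) 0 = T.getD b 0) :
    startNat L lo hi z m ptr p w = startArr (T.drop p) w := by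
  subst hm
  have hc : ∀ x, left L lo hi z ptr p x = (T.drop p).count x := fun x => left_eq hT x hp.le h
  have hw : (T.drop p).count w ≤ T.length - p := List.length_drop (l := T) ▸ List.count_le_length
  -- The dividend is at most a factorial of the length, hence below the width given to the division.
  have hB : (T.length - p - 1).factorial * (T.drop p).count w <
      2 ^ (T.length * T.length + T.length) := by
    calc _ ≤ (T.length - p - 1).factorial * (T.length - p) := Nat.mul_le_mul_left _ hw
      _ = (T.length - p).factorial := by
          rw [mul_comm, Nat.mul_factorial_pred (by omega)]
      _ ≤ T.length.factorial := Nat.factorial_le (by omega)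
      _ ≤ T.length ^ T.length := Nat.factorial_le_pow _
      _ ≤ (2 ^ T.length) ^ T.length := Nat.pow_le_pow_left Nat.lt_two_pow_self.le _
      _ = 2 ^ (T.length * T.length) := (pow_mul _ _ _).symm
      _ < _ := Nat.pow_lt_pow_right one_lt_two (by omega)
  rw [startNat]
  simp only [hc]
  rw [iter_iter_natDiv hB, startArr_eq (q := hi + 1) fun x hx => ?_, List.length_drop, mul_comm]
  have := Finset.mem_Icc.1 (mem_permLists hT (List.mem_of_mem_drop hx))
  omega

theorem getD_le (hT : T ∈ permLists (Finset.Icc lo hi) z) (hp : p < T.length) : T.getD p 0 ≤ hi := by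
  rw [List.getD_eq_getElem _ _ hp]
  exact (Finset.mem_Icc.1 (mem_permLists hT (List.getElem_mem _))).2

theorem rankNat_eq (hT : T ∈ permLists (Finset.Icc lo hi) z) (hm : T.length = m) (hp : p ≤ m)
    (h : ∀ b < p, L.getD (ptr + b) 0 = T.getD b 0) :
    rankNat L lo hi z m ptr p =
      ∑ p' ∈ Finset.range p, ∑ w ∈ Finset.range (T.getD p' 0), startArr (T.drop p') w := by
  refine Finset.sum_congr rfl fun p' hp' => ?_
  have hp' := Finset.mem_range.1 hp'
  have hle := getD_le hT (by omega : p' < T.length)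
  rw [h p' hp', ← Finset.sum_filter]
  refine Finset.sum_congr ?_ fun w _ => startNat_eq hT hm w (by omega) fun b hb => h b (by omega)
  ext w
  simp only [Finset.mem_filter, Finset.mem_range]
  omega

theorem rankNat_eq_lexIndex (hT : T ∈ permLists (Finset.Icc lo hi) z) (hm : T.length = m)
    (h : ∀ b < m, L.getD (ptr + b) 0 = T.getD b 0) :
    rankNat L lo hi z m ptr m = lexIndex T := by
  rw [rankNat_eq hT hm le_rfl h, lexIndex_eq_sum, hm]

/-- Only the letters before position `p` need to be in memory. Unranking can therefore emit a letter
at a time and read back what it has written. -/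
theorem digitNat_eq (hT : T ∈ permLists (Finset.Icc lo hi) z) (hm : T.length = m) (hp : p < m)
    (h : ∀ b < p, L.getD (ptr + b) 0 = T.getD b 0) :
    digitNat L lo hi z m ptr p (lexIndex T) = T.getD p 0 := by
  have hp' : p < T.length := hm ▸ hp
  rw [digitNat, rankNat_eq hT hm hp.le h, lexIndex_drop_add T p hp'.le, Nat.add_sub_cancel_left]
  have hle := getD_le hT hp'
  have hd : T.drop p = T.getD p 0 :: T.drop (p + 1) := by
    rw [List.drop_eq_getElem_cons hp', List.getD_eq_getElem _ _ hp']
  rw [← card_filter_lexIndex (q := hi + 1) (v := T.getD p 0) (L := T.drop (p + 1)) (by omega), ← hd,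
    Finset.card_filter]
  refine Finset.sum_congr rfl fun w _ => ?_
  rw [Finset.sum_congr rfl fun x _ => startNat_eq hT hm x hp h]
  split_ifs <;> omega

theorem eq_flatMap_getD (T : List ℕ) : T = (List.range T.length).flatMap fun b => [T.getD b 0] := by
  rw [← List.map_eq_flatMap]
  refine List.ext_getElem (by simp) fun b h1 h2 => ?_
  rw [List.getElem_map, List.getElem_range, List.getD_eq_getElem _ _ h1]

end Rank

end RankMod

namespace RAM

set_option synthInstance.maxHeartbeats 400000
set_option synthInstance.maxSize 4000

theorem SpS.call5 {s : S} {a0 a1 a2 a3 a4 : E} {L ρ o : List ℕ}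
    {v0 v1 v2 v3 v4 c0 c1 c2 c3 c4 d : ℕ}
    (h0 : Sp a0 L ρ v0 c0) (h1 : Sp a1 L ρ v1 c1) (h2 : Sp a2 L ρ v2 c2) (h3 : Sp a3 L ρ v3 c3)
    (h4 : Sp a4 L ρ v4 c4) (hs : SpS s L [v0, v1, v2, v3, v4] o d) :
    SpS (.call 5 ![a0, a1, a2, a3, a4] s) L ρ o (c0 + c1 + c2 + c3 + c4 + d + 1) :=
  SpS.of_call (v := ![v0, v1, v2, v3, v4]) (c := ![c0, c1, c2, c3, c4])
    (d := d) (by simp [Fin.forall_fin_succ, h0, h1, h2, h3, h4]) (by simpa using hs)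
    (by simp [Fin.sum_univ_succ]; omega)

theorem SpS.unrank {L ρ T : List ℕ} {lo hi z m y : E} {vlo vhi vz vm vy clo chi cz cm cy : ℕ}
    (hlo : Sp lo L ρ vlo clo) (hhi : Sp hi L ρ vhi chi) (hz : Sp z L ρ vz cz) (hm : Sp m L ρ vm cm)
    (hy : Sp y L ρ vy cy) (hT : T ∈ RankMod.permLists (Finset.Icc vlo vhi) vz)
    (hl : T.length = vm) (hTy : RankMod.lexIndex T = vy) :
    SpS (unrankS lo hi z m y) L ρ T
      (clo + chi + cz + cm + cy + 7000 * (2 * vm + vz + vhi + 1) ^ 9) := by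
  set Y := 2 * vm + vz + vhi + 1 with hY
  have h0 : 1 ≤ Y ^ 8 := Nat.one_le_pow _ _ (by omega)
  have h1 : T = (List.range vm).flatMap fun b => [T.getD b 0] := hl ▸ RankMod.eq_flatMap_getD T
  rw [h1]
  refine SpS.mono (SpS.call5 hlo hhi hz hm hy <| SpS.bindLen rfl <| SpS.loop _ (6500 * Y ^ 8)
    inferInstance rfl fun p hp => (SpS.emit inferInstance ?_).mono ?_) ?_
  · rw [← hTy]
    refine RankMod.digitNat_eq hT hl hp fun b hb => ?_
    rw [getD_append_add]
    simpa using getD_flatMap_range (g := fun b => [T.getD b 0]) (l := 1) (r := 0)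
      (fun _ _ => rfl) hb one_pos
  · have := Nat.pow_le_pow_left (show vm + vz + vhi + p + 1 ≤ Y by omega) 8
    omega
  · have h2 : vm * (6500 * Y ^ 8 + 4) ≤ Y * (6600 * Y ^ 8) := Nat.mul_le_mul (by omega) (by omega)
    have h3 : Y * (6600 * Y ^ 8) = 6600 * Y ^ 9 := by ring
    have h4 : 1 ≤ Y ^ 9 := Nat.one_le_pow _ _ (by omega)
    omega

end RAM

namespace RAM

set_option synthInstance.maxHeartbeats 400000
set_option synthInstance.maxSize 4000

/-! ## Procedures for the rank-modulation encoder -/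

/-- A loop whose output is described by an invariant. -/
theorem SpS.loop_exists {L ρ : List ℕ} {e : E} {s : S} {v v' d : ℕ} {R : ℕ → List ℕ}
    (Inv : ℕ → List ℕ → Prop) (C : ℕ) (he : Sp e L ρ v d) (hv : v = v')
    [∀ i, Concat ρ [i] (R i)] (h0 : Inv 0 [])
    (hs : ∀ i < v', ∀ o, Inv i o → ∃ o', SpS s (L ++ o) (R i) o' C ∧ Inv (i + 1) (o ++ o')) :
    ∃ o, SpS (.loop e s) L ρ o (d + 2 + v' * (C + 4)) ∧ Inv v' o := by
  have key : ∀ n ≤ v', ∃ g : ℕ → List ℕ,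
      (∀ i < n, SpS s (L ++ (List.range i).flatMap g) (R i) (g i) C) ∧
      Inv n ((List.range n).flatMap g) := by
    intro n
    induction n with
    | zero => exact fun _ => ⟨fun _ => [], by simp, by simpa using h0⟩
    | succ n ih =>
      intro hn
      obtain ⟨g, hg, hI⟩ := ih (by omega)
      obtain ⟨o', ho', hI'⟩ := hs n hn _ hI
      have hne : ∀ i ≤ n, (List.range i).flatMap (Function.update g n o') =
          (List.range i).flatMap g := fun i hi => flatMap_range_congr fun j hj =>
        Function.update_of_ne (by omega) _ _
      -- The output of a round is known only to exist, so the sequence of outputs is extended round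
      -- by round; changing it at `n` does not affect the memory of earlier rounds.
      refine ⟨Function.update g n o', fun i hi => ?_, ?_⟩
      · rw [hne i (by omega)]
        rcases Nat.lt_succ_iff_lt_or_eq.1 hi with h | rfl
        · rw [Function.update_of_ne (by omega)]
          exact hg i h
        · rwa [Function.update_self]
      · rw [List.range_succ, List.flatMap_append, hne n le_rfl]
        simpa using hI'
  obtain ⟨g, hg, hI⟩ := key v' le_rfl
  exact ⟨_, SpS.loop g C he hv hg, hI⟩

/-- One rank of the encoder: the state, the keys, and the ranks of the cells up to this rank. -/
def stepS (n k f w t₁ t₂ pm px pc th i₁ : E) : S :=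
  .call 11 ![n, k, f, w, t₁, t₂, pm, px, pc, th, i₁] (.bindLen (.bind (mulE (.var 4) (.var 0))
  (.bind (mulE (.var 4) (.var 1))
  -- A cell is available if it has no new rank yet and its old rank is at most `th`. The output of
  -- one round consists of this state, of the keys, and of a fresh copy of all ranks with the new
  -- one included.
  (.seq (.loop (mulE (.var 12) (.var 5)) (.emit (.cond (.ld (.add (.var 8) (.var 14))) (.lit 0)
    (.cond (.sub (.ld (.add (.var 7) (.var 14))) (.var 9)) (.lit 0) (.lit 1)))))
  (.seq (keysS (.var 0) (.var 1) (.var 2) (.var 3) (.var 4) (.var 5) (.var 6) (.var 11))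
  (.loop (.var 5) (.loop (.var 4) (.bind (.sub (findXE (.var 0) (.var 1) (.var 2) (.var 3)
      (.ld (.add (.add (.var 11) (mulE (.var 12) (.var 5))) (.var 14)))
      (.add (.add (.var 6) (mulE (.var 13) (.var 14))) (mulE (.var 1) (.var 15)))
      (.add (.add (.var 11) (mulE (.var 12) (.var 14))) (mulE (.var 0) (.var 15)))) (.lit 1))
    (.bind (.add (.add (.var 8) (mulE (.var 12) (.var 14))) (mulE (.var 0) (.var 15)))
    (.loop (.var 0) (.emit (.cond (.ld (.add (.var 17) (.var 18)))
      (.ld (.add (.var 17) (.var 18))) (.cond (bitE (.var 16) (.var 18)) (.var 10) (.lit 0))))))))))))))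

/-- The state that `stepS` computes. -/
def stepState (L : List ℕ) (px pc th tn : ℕ) : List ℕ := (List.range tn).flatMap fun x =>
  [if L.getD (pc + x) 0 ≠ 0 then 0 else if L.getD (px + x) 0 - th ≠ 0 then 0 else 1]

/-- The new rank of a cell. -/
def stepRank (v i₁ : ℕ) (b : Bool) : ℕ := if v ≠ 0 then v else if b.toNat ≠ 0 then i₁ else 0

theorem length_stepState (L : List ℕ) (px pc th tn : ℕ) :
    (stepState L px pc th tn).length = tn := by
  rw [stepState, length_flatMap_range (l := 1) fun _ _ => rfl, mul_one]

/-- Only polynomial time is needed here, so a single `Z` dominates all parameters and also `2 ^ n`,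
and the cost is a power of `Z`. -/
theorem SpS.step {L ρ : List ℕ} {n k f w t₁ t₂ pm px pc th i₁ : E}
    {vn vk vf vw vt vt₂ vpm vpx vpc vth vi cn ck cf cw ct ct₂ cpm cpx cpc cth ci Z : ℕ}
    (hn : Sp n L ρ vn cn) (hk : Sp k L ρ vk ck) (hf : Sp f L ρ vf cf) (hw : Sp w L ρ vw cw)
    (ht : Sp t₁ L ρ vt ct) (ht₂ : Sp t₂ L ρ vt₂ ct₂) (hpm : Sp pm L ρ vpm cpm)
    (hpx : Sp px L ρ vpx cpx) (hpc : Sp pc L ρ vpc cpc) (hth : Sp th L ρ vth cth)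
    (hi : Sp i₁ L ρ vi ci) (hlm : vpm + vt₂ * (vt * vk) ≤ L.length)
    (hlx : vpx + vt₂ * (vt * vn) ≤ L.length) (hlc : vpc + vt₂ * (vt * vn) ≤ L.length) (hZn : vn ≤ Z) (hZk : vk ≤ Z) (hZt : vt ≤ Z)
    (hZt₂ : vt₂ ≤ Z) (hZ2 : 2 ^ vn ≤ Z) (hZ : vt₂ * (vt * vn) ≤ Z) {S K L' : List ℕ}
    (hS : S = stepState L vpx vpc vth (vt₂ * (vt * vn))) (hL' : L' = L ++ S)
    (hK : K = (List.range vt₂).flatMap fun j => [keyNum L' vn vk vf vw vt vpm L.length j]) :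
    SpS (stepS n k f w t₁ t₂ pm px pc th i₁) L ρ (S ++ (K ++
      (List.range vt₂).flatMap fun j => (List.range vt).flatMap fun i =>
        (List.range vn).flatMap fun b =>
        [stepRank (L.getD (vpc + vt * vn * j + vn * i + b) 0) vi
          ((xNum L' vn vk vf vw vt vpm L.length j i).testBit b)]))
      (cn + ck + cf + cw + ct + ct₂ + cpm + cpx + cpc + cth + ci + 1000000 * Z ^ 8) := by
  have hZ1 : 1 ≤ Z := Nat.one_le_two_pow.trans hZ2
  set tn := vt₂ * (vt * vn) with htn
  have hSl : S.length = tn := hS ▸ length_stepState _ _ _ _ _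
  have hKl : K.length = vt₂ := by rw [hK, length_flatMap_range (l := 1) fun _ _ => rfl, mul_one]
  have hL'l : L'.length = L.length + tn := by rw [hL', List.length_append, hSl]
  have hKj : ∀ j < vt₂, ∀ o o', (L' ++ K ++ o ++ o').getD (L.length + vt * vn * vt₂ + j) 0 =
      keyNum L' vn vk vf vw vt vpm L.length j := by
    intro j hj o o'
    rw [mul_comm _ vt₂, ← htn, ← hL'l, List.append_assoc, List.append_assoc, getD_append_add,
      getD_append_of_lt _ (by omega), hK]
    have := getD_flatMap_range (g := fun j => [keyNum L' vn vk vf vw vt vpm L.length j]) (l := 1)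
      (r := 0) (fun _ _ => rfl) hj one_pos
    simpa using this
  have e1 : (vn + vk + 1) ^ 3 ≤ 27 * Z ^ 3 := by
    calc (vn + vk + 1) ^ 3 ≤ (3 * Z) ^ 3 := Nat.pow_le_pow_left (by omega) 3
      _ = _ := by ring
  have e2 : 2 ^ vn * (2600 * (vn + vk + 1) ^ 3) ≤ 70200 * Z ^ 4 := by
    calc _ ≤ Z * (2600 * (27 * Z ^ 3)) := Nat.mul_le_mul hZ2 (by omega)
      _ = _ := by ring
  have e3 : (vt₂ + 1) * (2 ^ (vn + vn) * ((vt + 1) * (2 ^ vn * (4000 * (vn + vk + 1) ^ 3)))) ≤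
      432000 * Z ^ 8 := by
    calc _ ≤ (2 * Z) * ((Z * Z) * ((2 * Z) * (Z * (4000 * (27 * Z ^ 3))))) := by
          rw [pow_add]
          gcongr <;> omega
      _ = _ := by ring
  have p12 : Z ≤ Z ^ 2 := Nat.le_self_pow (by norm_num) _
  have p24 : Z ^ 2 ≤ Z ^ 4 := Nat.pow_le_pow_right hZ1 (by norm_num)
  have p45 : Z ^ 4 ≤ Z ^ 5 := Nat.pow_le_pow_right hZ1 (by norm_num)
  have p56 : Z ^ 5 ≤ Z ^ 6 := Nat.pow_le_pow_right hZ1 (by norm_num)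
  have p68 : Z ^ 6 ≤ Z ^ 8 := Nat.pow_le_pow_right hZ1 (by norm_num)
  refine SpS.mono (SpS.of_call (v := ![vn, vk, vf, vw, vt, vt₂, vpm, vpx, vpc, vth, vi])
    (c := ![cn, ck, cf, cw, ct, ct₂, cpm, cpx, cpc, cth, ci]) (d := 999999 * Z ^ 8)
    (by simp [Fin.forall_fin_succ, hn, hk, hf, hw, ht, ht₂, hpm, hpx, hpc, hth, hi])
    (o := S ++ (K ++ (List.range vt₂).flatMap fun j => (List.range vt).flatMap fun i =>
        (List.range vn).flatMap fun b =>
        [stepRank (L.getD (vpc + vt * vn * j + vn * i + b) 0) vi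
          ((xNum L' vn vk vf vw vt vpm L.length j i).testBit b)]))
    ?_ le_rfl) (by simp [Fin.sum_univ_succ]; omega)
  simp only [List.ofFn_succ, List.ofFn_zero, Matrix.cons_val_zero, Matrix.cons_val_succ]
  refine SpS.mono (SpS.bindLen rfl <| SpS.bind inferInstance rfl <| SpS.bind inferInstance rfl <|
    SpS.seq (o := S) ((SpS.loop' _ 40 inferInstance (v' := tn) (by rw [htn]; ring)
      fun x hx o => (SpS.emit inferInstance ?_).mono ?_).congr hS.symm) <|
    SpS.seq (o := K) (SpS.congr (o' := K) (SpS.keys (vpm := vpm) (vps := L.length) inferInstance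
      inferInstance inferInstance inferInstance inferInstance inferInstance inferInstance inferInstance
      ?_ ?_) ?_) <|
    SpS.loop' _ (73000 * Z ^ 5) inferInstance rfl fun j hj o => (SpS.loop' _ (72000 * Z ^ 4)
      inferInstance rfl fun i hi' o' => (SpS.bind (v' := xNum L' vn vk vf vw vt vpm L.length j i)
        (hρ := inferInstance) inferInstance ?_ <| SpS.bind inferInstance rfl <|
        SpS.loop' _ (9 * Z + 100) inferInstance rfl fun b hb o'' =>
          (SpS.emit inferInstance ?_).mono ?_).mono ?_).mono ?_) ?_
  · rw [getD_append_of_lt _ (by omega), getD_append_of_lt _ (by omega)]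
  · norm_num
  · rw [← hL', hL'l]
    omega
  · rw [← hL', hL'l]
  · rw [hK, hL']
  · rw [← hL', hKj j hj, xNum]
    congr 1
    rw [mul_comm _ j, mul_comm _ i, mul_comm _ j, mul_comm _ i]
    refine findX_congr (A := L'.length) (fun a ha => ?_) ?_ ?_ _
    · rw [List.append_assoc, List.append_assoc, getD_append_of_lt _ ha]
    · have := succ_mul_le (vt * vk) hj
      have := succ_mul_le vk hi'
      omega
    · have := succ_mul_le (vt * vn) hj
      have := succ_mul_le vn hi'
      omega
  · have h1 := succ_mul_le (vt * vn) hj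
    have h2 := succ_mul_le vn hi'
    rw [mul_comm j] at h1
    rw [mul_comm i] at h2
    rw [List.append_assoc, List.append_assoc, List.append_assoc, List.append_assoc,
      getD_append_of_lt _ (by omega), stepRank]
  · omega
  · have h1 : vn * (9 * Z + 100 + 4) ≤ Z * (113 * Z) := Nat.mul_le_mul hZn (by omega)
    have h2 : Z * (113 * Z) = 113 * Z ^ 2 := by ring
    omega
  · have h1 : vt * (72000 * Z ^ 4 + 4) ≤ Z * (72004 * Z ^ 4) := Nat.mul_le_mul hZt (by omega)
    have h2 : Z * (72004 * Z ^ 4) = 72004 * Z ^ 5 := by ring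
    omega
  · have h1 : vt₂ * (73000 * Z ^ 5 + 4) ≤ Z * (73004 * Z ^ 5) := Nat.mul_le_mul hZt₂ (by omega)
    have h2 : Z * (73004 * Z ^ 5) = 73004 * Z ^ 6 := by ring
    omega

/-- The number with the digits in the cells `p, …, p + m - 1`, in base `2 ^ w`. -/
def packKeys (L : List ℕ) (p w m : ℕ) : ℕ :=
  iter (fun j acc => acc * 2 ^ w + L.getD (p + (m - 1 - j)) 0) 0 m

def packKeysE (p w m : E) : E := .call 3 ![p, w, m] (.fold (.var 2) (.lit 0)
  (.add (shlE (.var 4) (.var 1)) (.ld (.add (.var 0) (.sub (.sub (.var 2) (.lit 1)) (.var 3))))))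

instance {L ρ : List ℕ} {p w m : E} {vp vw vm cp cw cm : ℕ} [Sp p L ρ vp cp] [Sp w L ρ vw cw]
    [Sp m L ρ vm cm] :
    Sp (packKeysE p w m) L ρ (packKeys L vp vw vm) (cp + cw + cm + vm * (11 * vw + 50) + 20) := by
  refine (Sp.call3 ‹_› ‹_› ‹_› inferInstance).mono rfl ?_
  rw [Finset.sum_const, Finset.card_range, smul_eq_mul]
  have : vm * (2 + 2 + 11 * vw + 12 + (2 + (2 + 1 + 1 + 2 + 1) + 1 + 1) + 1 + 6) ≤
    vm * (11 * vw + 50) := Nat.mul_le_mul_left _ (by omega)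
  omega

/-- Horner's rule starts with the last key, so key `j` occupies the binary digits from position `j *
w` on, as `keysOfNat` expects. -/
theorem packKeys_spec {L : List ℕ} {p w m : ℕ} (h : ∀ j < m, L.getD (p + j) 0 < 2 ^ w) :
    packKeys L p w m < (2 ^ w) ^ m ∧ ∀ j < m, ∀ b < w,
      (packKeys L p w m).testBit (j * w + b) = (L.getD (p + j) 0).testBit b := by
  have key : ∀ s ≤ m, iter (fun j acc => acc * 2 ^ w + L.getD (p + (m - 1 - j)) 0) 0 s < (2 ^ w) ^ s ∧
      ∀ j < s, ∀ b < w,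
        (iter (fun j acc => acc * 2 ^ w + L.getD (p + (m - 1 - j)) 0) 0 s).testBit (j * w + b) =
          (L.getD (p + (m - s + j)) 0).testBit b := by
    intro s
    induction s with
    | zero => simp [iter_zero]
    | succ s ih =>
      intro hs
      obtain ⟨h1, h2⟩ := ih (by omega)
      have h3 := h (m - 1 - s) (by omega)
      rw [iter_succ]
      generalize iter (fun j acc => acc * 2 ^ w + L.getD (p + (m - 1 - j)) 0) 0 s = V at *
      refine ⟨?_, fun j hj b hb => ?_⟩
      · rw [pow_succ]
        nlinarith
      · rw [mul_comm V, Nat.testBit_two_pow_mul_add _ h3]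
        rcases j with _ | j
        · rw [zero_mul, zero_add, if_pos hb, show m - (s + 1) + 0 = m - 1 - s by omega]
        · rw [if_neg (by rw [add_one_mul]; omega), show (j + 1) * w + b - w = j * w + b by
            rw [add_one_mul]; omega, h2 j (by omega) b hb,
            show m - (s + 1) + (j + 1) = m - s + j by omega]
  have h3 := key m le_rfl
  rw [← packKeys] at h3
  simpa only [Nat.sub_self, zero_add] using h3

/-- Words with given lexicographic indices. -/
def topsS (lo hi z m t p : E) : S := .call 6 ![lo, hi, z, m, t, p] (.loop (.var 4)
  (unrankS (.var 0) (.var 1) (.var 2) (.var 3) (.ld (.add (.var 5) (.var 6)))))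

theorem SpS.call6 {s : S} {a0 a1 a2 a3 a4 a5 : E} {L ρ o : List ℕ}
    {v0 v1 v2 v3 v4 v5 c0 c1 c2 c3 c4 c5 d : ℕ}
    (h0 : Sp a0 L ρ v0 c0) (h1 : Sp a1 L ρ v1 c1) (h2 : Sp a2 L ρ v2 c2) (h3 : Sp a3 L ρ v3 c3)
    (h4 : Sp a4 L ρ v4 c4) (h5 : Sp a5 L ρ v5 c5) (hs : SpS s L [v0, v1, v2, v3, v4, v5] o d) :
    SpS (.call 6 ![a0, a1, a2, a3, a4, a5] s) L ρ o (c0 + c1 + c2 + c3 + c4 + c5 + d + 1) :=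
  SpS.of_call (v := ![v0, v1, v2, v3, v4, v5]) (c := ![c0, c1, c2, c3, c4, c5])
    (d := d) (by simp [Fin.forall_fin_succ, h0, h1, h2, h3, h4, h5]) (by simpa using hs)
    (by simp [Fin.sum_univ_succ]; omega)

theorem SpS.tops {L ρ : List ℕ} {lo hi z m t p : E}
    {vlo vhi vz vm vt vp clo chi cz cm ct cp Z : ℕ}
    (hlo : Sp lo L ρ vlo clo) (hhi : Sp hi L ρ vhi chi) (hz : Sp z L ρ vz cz) (hm : Sp m L ρ vm cm)
    (ht : Sp t L ρ vt ct) (hp : Sp p L ρ vp cp) (hpt : vp + vt ≤ L.length) {T : ℕ → List ℕ}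
    (hT : ∀ l < vt, T l ∈ RankMod.permLists (Finset.Icc vlo vhi) vz ∧ (T l).length = vm ∧
      RankMod.lexIndex (T l) = L.getD (vp + l) 0)
    (hZ1 : 1 ≤ Z) (hZ : 2 * vm + vz + vhi + 1 ≤ Z) (hZt : vt ≤ Z) :
    SpS (topsS lo hi z m t p) L ρ ((List.range vt).flatMap T)
      (clo + chi + cz + cm + ct + cp + 8000 * Z ^ 10) := by
  refine SpS.mono (SpS.call6 hlo hhi hz hm ht hp <| SpS.loop' _ (7020 * Z ^ 9) inferInstance rfl
    fun l hl o => (SpS.unrank inferInstance inferInstance inferInstance inferInstance inferInstance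
      (hT l hl).1 (hT l hl).2.1 ?_).mono ?_) ?_
  · rw [getD_append_of_lt _ (by omega), (hT l hl).2.2]
  · have := Nat.pow_le_pow_left hZ 9
    have : 1 ≤ Z ^ 9 := Nat.one_le_pow _ _ hZ1
    omega
  · have h1 : vt * (7020 * Z ^ 9 + 4) ≤ Z * (7024 * Z ^ 9) := by
      have : 1 ≤ Z ^ 9 := Nat.one_le_pow _ _ hZ1
      exact Nat.mul_le_mul hZt (by omega)
    have h2 : Z * (7024 * Z ^ 9) = 7024 * Z ^ 10 := by ring
    have : 1 ≤ Z ^ 10 := Nat.one_le_pow _ _ hZ1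
    omega

/-- Words whose lexicographic indices are composed of the keys in blocks of `B` cells. -/
def indexS (n t₂ r₁ a m u p B : E) : S := .call 8 ![n, t₂, r₁, a, m, u, p, B] (.loop (.var 5)
  (unrankS (.lit 1) (.var 2) (.var 3) (.var 4) (packKeysE
    (.add (.var 6) (mulE (.var 7) (.var 8))) (.add (.var 0) (.var 0)) (.var 1))))

theorem SpS.index {L ρ : List ℕ} {n t₂ r₁ a m u p B : E}
    {vn vt₂ vr va vm vu vp vB cn ct₂ cr ca cm cu cp cB Z : ℕ}
    (hn : Sp n L ρ vn cn) (ht₂ : Sp t₂ L ρ vt₂ ct₂) (hr : Sp r₁ L ρ vr cr) (ha : Sp a L ρ va ca)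
    (hm : Sp m L ρ vm cm) (hu : Sp u L ρ vu cu) (hp : Sp p L ρ vp cp) (hB : Sp B L ρ vB cB)
    {T : ℕ → List ℕ} (hpB : ∀ i < vu, vp + vB * i + vt₂ ≤ L.length)
    (hT : ∀ i < vu, T i ∈ RankMod.permLists (Finset.Icc 1 vr) va ∧ (T i).length = vm ∧
      RankMod.lexIndex (T i) = packKeys L (vp + vB * i) (vn + vn) vt₂)
    (hZ1 : 1 ≤ Z) (hZ : 2 * vm + va + vr + 1 ≤ Z) (hZu : vu ≤ Z) (hZn : vn ≤ Z) (hZt₂ : vt₂ ≤ Z) :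
    SpS (indexS n t₂ r₁ a m u p B) L ρ ((List.range vu).flatMap T)
      (cn + ct₂ + cr + ca + cm + cu + cp + cB + 8000 * Z ^ 10) := by
  have p29 : Z ^ 2 ≤ Z ^ 9 := Nat.pow_le_pow_right hZ1 (by norm_num)
  have p12 : Z ≤ Z ^ 2 := Nat.le_self_pow (by norm_num) _
  refine SpS.mono (SpS.call8 hn ht₂ hr ha hm hu hp hB <| SpS.loop' _ (7300 * Z ^ 9) inferInstance rfl
    fun i hi o => (SpS.unrank inferInstance inferInstance inferInstance inferInstance inferInstance
      (hT i hi).1 (hT i hi).2.1 ?_).mono ?_) ?_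
  · rw [(hT i hi).2.2, packKeys, packKeys]
    have := hpB i hi
    refine iter_congr _ fun j hj b => ?_
    rw [getD_append_of_lt _ (by omega)]
  · have h1 := Nat.pow_le_pow_left hZ 9
    have h2 : vt₂ * (11 * (vn + vn) + 50) ≤ Z * (72 * Z) := Nat.mul_le_mul hZt₂ (by omega)
    have h3 : Z * (72 * Z) = 72 * Z ^ 2 := by ring
    omega
  · have h1 : vu * (7300 * Z ^ 9 + 4) ≤ Z * (7304 * Z ^ 9) := Nat.mul_le_mul hZu (by omega)
    have h2 : Z * (7304 * Z ^ 9) = 7304 * Z ^ 10 := by ring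
    have : 1 ≤ Z ^ 10 := Nat.one_le_pow _ _ hZ1
    omega

/-- The zeros of blocks of `n` cells are filled with the entries of blocks of `m` cells. -/
def fillS (n t₁ t₂ m c p : E) : S := .call 6 ![n, t₁, t₂, m, c, p] (.loop (.var 2) (.loop (.var 1)
  (.bind (.add (mulE (.var 1) (.var 6)) (.var 7)) (.bind (.add (.var 4) (mulE (.var 0) (.var 8)))
  (.bind (.add (.var 5) (mulE (.var 3) (.var 8))) (.loop (.var 0) (.emit
    (.cond (.ld (.add (.var 9) (.var 11))) (.ld (.add (.var 9) (.var 11)))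
      (.ld (.add (.var 10) (cntE (.var 9) (.var 11) (.lit 0))))))))))))

theorem SpS.fill {L ρ : List ℕ} {n t₁ t₂ m c p : E}
    {vn vt vt₂ vm vc vp cn ct ct₂ cm cc cp Z : ℕ}
    (hn : Sp n L ρ vn cn) (ht : Sp t₁ L ρ vt ct) (ht₂ : Sp t₂ L ρ vt₂ ct₂) (hm : Sp m L ρ vm cm)
    (hc : Sp c L ρ vc cc) (hp : Sp p L ρ vp cp) {f T : ℕ → List ℕ}
    (hf : ∀ l < vt₂ * vt, (f l).length = vn ∧ (f l).count 0 = (T l).length ∧ (T l).length = vm ∧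
      (∀ b < vn, L.getD (vc + vn * l + b) 0 = (f l).getD b 0) ∧
      ∀ b < vm, L.getD (vp + vm * l + b) 0 = (T l).getD b 0)
    (hlc : vc + vn * (vt₂ * vt) ≤ L.length) (hlp : vp + vm * (vt₂ * vt) ≤ L.length)
    (hZ1 : 1 ≤ Z) (hZn : vn ≤ Z) (hZt₂ : vt₂ ≤ Z) (hZt : vt ≤ Z) (hZ : vt₂ * vt ≤ Z) :
    SpS (fillS n t₁ t₂ m c p) L ρ ((List.range vt₂).flatMap fun j => (List.range vt).flatMap fun i =>
        RankMod.fill (f (vt * j + i)) (T (vt * j + i)))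
      (cn + ct + ct₂ + cm + cc + cp + 1000 * Z ^ 4) := by
  have p12 : Z ≤ Z ^ 2 := Nat.le_self_pow (by norm_num) _
  have p23 : Z ^ 2 ≤ Z ^ 3 := Nat.pow_le_pow_right hZ1 (by norm_num)
  have p34 : Z ^ 3 ≤ Z ^ 4 := Nat.pow_le_pow_right hZ1 (by norm_num)
  refine SpS.mono (SpS.call6 hn ht ht₂ hm hc hp <| SpS.loop' _ (800 * Z ^ 3) inferInstance rfl
    fun j hj o => (SpS.loop' (fun i => RankMod.fill (f (vt * j + i)) (T (vt * j + i))) (700 * Z ^ 2)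
      inferInstance rfl fun i hi o' => (SpS.bind inferInstance rfl <| SpS.bind inferInstance rfl <|
        SpS.bind inferInstance rfl <| (SpS.loop' (fun b =>
          [(RankMod.fill (f (vt * j + i)) (T (vt * j + i))).getD b 0]) (40 * Z + 100) inferInstance rfl
          fun b hb o'' => (SpS.emit inferInstance ?_).mono ?_).congr ?_).mono ?_).mono ?_) ?_
  · have hl : vt * j + i < vt₂ * vt := by
      have := succ_mul_le vt hj
      rw [mul_comm vt]
      omega
    set l := vt * j + i
    obtain ⟨h1, h2, h3, h4, h5⟩ := hf l hl
    have h6 := succ_mul_le vn hl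
    have h7 := succ_mul_le vm hl
    rw [mul_comm l, mul_comm (vt₂ * vt)] at h6 h7
    have hg : ∀ a < L.length, (L ++ o ++ o' ++ o'').getD a 0 = L.getD a 0 := fun a ha => by
      rw [List.append_assoc, List.append_assoc, getD_append_of_lt _ ha]
    rw [hg _ (by omega), RankMod.getD_fill _ _ _ (by omega), h4 b hb]
    by_cases h0 : (f l).getD b 0 = 0
    · rw [if_neg (not_not.2 h0), if_neg (not_not.2 h0), RankMod.cnt_eq (T := f l) 0 (by omega)
        fun b' hb' => by rw [hg _ (by omega), h4 b' (by omega)]]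
      have h8 : ((f l).take b).count 0 < vm := by
        rw [← h3, ← h2]
        conv_rhs => rw [← List.take_append_drop b (f l), List.count_append]
        have : 0 < ((f l).drop b).count 0 := by
          rw [List.count_pos_iff, List.drop_eq_getElem_cons (by omega),
            ← List.getD_eq_getElem (f l) 0 (by omega), h0]
          exact List.mem_cons_self
        omega
      rw [hg _ (by omega), h5 _ h8]
    · rw [if_pos h0, if_pos h0]
  · omega
  · have hl : vt * j + i < vt₂ * vt := by
      have := succ_mul_le vt hj
      rw [mul_comm vt]
      omega
    have := RankMod.eq_flatMap_getD (RankMod.fill (f (vt * j + i)) (T (vt * j + i)))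
    rw [RankMod.length_fill, (hf _ hl).1] at this
    exact this.symm
  · have hl : vt * j + i < vt₂ * vt := by
      have := succ_mul_le vt hj
      rw [mul_comm vt]
      omega
    have h1 : vn * (40 * Z + 100 + 4) ≤ Z * (144 * Z) := Nat.mul_le_mul hZn (by omega)
    have h2 : Z * (144 * Z) = 144 * Z ^ 2 := by ring
    omega
  · have h1 : vt * (700 * Z ^ 2 + 4) ≤ Z * (704 * Z ^ 2) := Nat.mul_le_mul hZt (by omega)
    have h2 : Z * (704 * Z ^ 2) = 704 * Z ^ 3 := by ring
    omega
  · have h1 : vt₂ * (800 * Z ^ 3 + 4) ≤ Z * (804 * Z ^ 3) := Nat.mul_le_mul hZt₂ (by omega)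
    have h2 : Z * (804 * Z ^ 3) = 804 * Z ^ 4 := by ring
    omega

end RAM

namespace RankMod
open RAM

theorem getD_append_length {A : List ℕ} (o : List ℕ) {s : ℕ} (h : A.length = s) (a : ℕ) :
    (A ++ o).getD (s + a) 0 = o.getD a 0 := h ▸ getD_append_add A o a

/-- Writing rank `i + 1` does not change which cells are free with respect to earlier ranks, so
earlier encodings stay valid. -/
theorem stepRank_imp_iff {v i i' : ℕ} {b : Bool} (hi : i' ≤ i) :
    (stepRank v (i + 1) b ≤ i' → stepRank v (i + 1) b = 0) ↔ (v ≤ i' → v = 0) := by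
  unfold stepRank
  split_ifs <;> omega

theorem stepRank_eq_iff {v i i' : ℕ} {b : Bool} (hi : i' < i) :
    stepRank v (i + 1) b = i' + 1 ↔ v = i' + 1 := by
  by_cases h0 : v = 0 <;> cases b <;> simp [stepRank, h0]
  omega

theorem stepRank_le {v i : ℕ} {b : Bool} (hv : v ≤ i) : stepRank v (i + 1) b ≤ i + 1 := by
  unfold stepRank
  split_ifs <;> omega

theorem HashParams.length_messageList (p : HashParams) (m : p.Message) :
    (p.messageList m).length = p.t₂ * (p.t₁ * p.k) := length_bitColumns _

namespace RMParams

variable {p : RMParams}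

/-- The induction step over the ranks. The free cells have the right weight, so the WOM encoder
applies. The new rank leaves the states and vectors of the earlier ranks as they are, and its own
characteristic vector is `x`, because `x` selects only cells that were free. -/
theorem Valid.encoding_step (hp : p.Valid) {σ : p.Cells → ℕ} (hσ : σ ∈ p.codebook) (m : p.Message)
    {f : p.wom.Blocks → Fin p.wom.n → ℕ} {i : ℕ} (hi : i < p.u) (hf : ∀ l b, f l b ≤ i)
    {key : ℕ → p.wom.Index}
    (h : ∀ i' : Fin p.u, (i' : ℕ) < i → IsHashEncoding p.wom.wx (m.1 i') (p.freeVec σ f i')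
      (fun l b => decide (f l b = i' + 1)) (key i')) :
    (∀ l, p.freeVec σ f i l ∈ J p.wom.ws p.wom.n) ∧ ∀ x : p.wom.Blocks → Fin p.wom.n → Bool,
      IsHashEncoding p.wom.wx (m.1 ⟨i, hi⟩) (p.freeVec σ f i) x (key i) →
      ∀ i' : Fin p.u, (i' : ℕ) < i + 1 → IsHashEncoding p.wom.wx (m.1 i')
        (p.freeVec σ (fun l b => stepRank (f l b) (i + 1) (x l b)) i')
        (fun l b => decide (stepRank (f l b) (i + 1) (x l b) = i' + 1)) (key i') := by
  refine ⟨fun l => hp.weight_freeVec hσ hi l fun i' hi' => ?_, fun x hx i' hi' => ?_⟩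
  · have := h ⟨i', hi'.trans hi⟩ hi' l.2 l.1
    exact ⟨this.2.1, this.1⟩
  · have e1 : p.freeVec σ (fun l b => stepRank (f l b) (i + 1) (x l b)) i' = p.freeVec σ f i' := by
      funext l b
      refine decide_eq_decide.2 (and_congr_right fun _ =>
        stepRank_imp_iff (by omega))
    rw [e1]
    rcases Nat.lt_succ_iff_lt_or_eq.1 hi' with hlt | heq
    · have e2 : (fun l b => decide (stepRank (f l b) (i + 1) (x l b) = i' + 1)) =
          fun l b => decide (f l b = i' + 1) := by
        funext l b
        exact decide_eq_decide.2 (stepRank_eq_iff hlt)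
      rw [e2]
      exact h i' hlt
    · have e3 : i' = ⟨i, hi⟩ := Fin.ext heq
      subst e3
      have e2 : (fun l b => decide (stepRank (f l b) (i + 1) (x l b) = i + 1)) = x := by
        funext l b
        have h1 := (hx l.2 l.1).1 b
        have h2 := hf l b
        cases hxb : x l b
        · refine decide_eq_false ?_
          by_cases h0 : f l b = 0 <;> simp [stepRank, h0]
          omega
        · rw [hxb] at h1
          have h3 := of_decide_eq_true (Bool.eq_true_of_true_le h1)
          simp [stepRank, h3.2 h2]
      simp only [e2]
      exact hx

theorem keysOfNat_eq {y : ℕ} {c : ℕ → ℕ} (h : ∀ j < p.wom.t₂, ∀ b < p.wom.n + p.wom.n,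
    y.testBit (j * (p.wom.n + p.wom.n) + b) = (c j).testBit b) :
    p.keysOfNat y = fun j : Fin p.wom.t₂ => keyOf p.wom.n (c j) := by
  funext j
  refine Prod.ext (funext fun b => ?_) (funext fun b => ?_)
  · have := h j j.2 b (by omega)
    simpa [keysOfNat, keyOf, vecOf, two_mul] using this
  · have := h j j.2 (p.wom.n + b) (by omega)
    simpa [keysOfNat, keyOf, vecOf, two_mul, add_assoc] using this

/-! ## Positions in the inputs -/

theorem length_messageList (p : RMParams) (m : p.Message) : (p.messageList m).length =
    p.u * (p.wom.t₂ * (p.wom.t₁ * p.wom.k)) + p.wom.t₂ * p.wom.t₁ := by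
  rw [messageList, List.length_append, length_flat fun i => HashParams.length_messageList _ _,
    length_columns (l := 1) fun _ => rfl, mul_one]

theorem getD_messageList_bits (p : RMParams) (m : p.Message) (i : Fin p.u) (i₁ : Fin p.wom.t₁)
    (j : Fin p.wom.t₂) (b : Fin p.wom.k) : (p.messageList m).getD
      (i * (p.wom.t₂ * (p.wom.t₁ * p.wom.k)) + (j * (p.wom.t₁ * p.wom.k) + i₁ * p.wom.k + b)) 0 =
      (m.1 i (i₁, j) b).toNat := by
  have h := HashParams.bitColumn_lt i₁ j b
  have h2 := succ_mul_le (p.wom.t₂ * (p.wom.t₁ * p.wom.k)) i.2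
  have hl : (flat fun i => p.wom.messageList (m.1 i)).length =
    p.u * (p.wom.t₂ * (p.wom.t₁ * p.wom.k)) := length_flat fun i => HashParams.length_messageList _ _
  rw [messageList, getD_append_of_lt _ (by omega), getD_flat (fun i => HashParams.length_messageList _ _)
    i h]
  exact HashParams.getD_bitColumns (m.1 i) i₁ j b

theorem getD_messageList_top (p : RMParams) (m : p.Message) (i₁ : Fin p.wom.t₁)
    (j : Fin p.wom.t₂) : (p.messageList m).getD
      (p.u * (p.wom.t₂ * (p.wom.t₁ * p.wom.k)) + (p.wom.t₁ * j + i₁)) 0 = m.2 (i₁, j) := by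
  rw [messageList, getD_append_length _ (length_flat fun i => HashParams.length_messageList _ _)]
  have := getD_columns (f := fun l => [(m.2 l : ℕ)]) (l := 1) (fun _ => rfl) i₁ j one_pos
  simpa [mul_comm] using this

theorem length_partsA (p : RMParams) (π : p.Cells → ℕ) :
    (flat fun i => List.ofFn (p.partA π i)).length = p.u * ((p.r + 1) * p.a) :=
  length_flat fun _ => List.length_ofFn

theorem length_permList (p : RMParams) (π : p.Cells → ℕ) : (p.permList π).length =
    p.u * ((p.r + 1) * p.a) + p.u * (p.u * p.a) + p.wom.t₂ * (p.wom.t₁ * p.wom.n) := by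
  rw [permList, List.length_append, List.length_append, length_partsA, List.length_ofFn,
    length_columns fun _ => List.length_ofFn]

theorem getD_permList_A (p : RMParams) (π : p.Cells → ℕ) (i : Fin p.u) {b : ℕ}
    (hb : b < (p.r + 1) * p.a) : (p.permList π).getD (i * ((p.r + 1) * p.a) + b) 0 =
      (List.ofFn (p.partA π i)).getD b 0 := by
  have h := succ_mul_le ((p.r + 1) * p.a) i.2
  rw [permList, List.append_assoc, getD_append_of_lt _ (by rw [length_partsA]; omega),
    getD_flat (fun _ => List.length_ofFn) i hb]

theorem getD_permList_B (p : RMParams) (π : p.Cells → ℕ) {b : ℕ} (hb : b < p.u * (p.u * p.a)) :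
    (p.permList π).getD (p.u * ((p.r + 1) * p.a) + b) 0 = (List.ofFn (p.partB π)).getD b 0 := by
  rw [permList, List.append_assoc, getD_append_length _ (p.length_partsA π),
    getD_append_of_lt _ (by rwa [List.length_ofFn])]

theorem getD_permList_X (p : RMParams) (π : p.Cells → ℕ) (i : Fin p.wom.t₁) (j : Fin p.wom.t₂)
    (b : Fin p.wom.n) : (p.permList π).getD (p.u * ((p.r + 1) * p.a) + p.u * (p.u * p.a) +
      (j * (p.wom.t₁ * p.wom.n) + i * p.wom.n + b)) 0 = p.partX π (i, j) b := by
  rw [permList, getD_append_length _ (by rw [List.length_append, length_partsA, List.length_ofFn]),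
    add_assoc, getD_columns (fun _ => List.length_ofFn) i j b.2, getD_ofFn]

theorem length_header (p : RMParams) : p.header.length = 7 := rfl

/-! ## The size of the code -/

theorem Valid.cells_eq (hp : p.Valid) : p.q * p.z = p.u * ((p.r + 1) * p.a) + p.u * (p.u * p.a) +
    p.wom.t₂ * (p.wom.t₁ * p.wom.n) := by
  rw [hp.q_mul_z, ← p.u_add, HashParams.t]
  ring

/-- The number of cells dominates every parameter, even `2 ^ n`, because `t₂` is exponential in `n`;
exhaustive search over blocks is polynomial in the size of the code. The bound for `a` comes from `2
* n * t₂`, since the index parts are empty when `u = 0`. -/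
theorem Valid.bounds (hp : p.Valid) : p.q ≤ p.q * p.z ∧ p.wom.n ≤ p.q * p.z ∧
    p.wom.k ≤ p.q * p.z ∧ p.wom.t₁ ≤ p.q * p.z ∧ p.wom.t₂ ≤ p.q * p.z ∧ p.a ≤ 2 * (p.q * p.z) ∧
    2 ^ p.wom.n ≤ p.q * p.z ∧ p.wom.t₂ * (p.wom.t₁ * p.wom.n) ≤ p.q * p.z ∧
    p.u * (p.u * p.a) ≤ p.q * p.z ∧ 41 ≤ p.q * p.z := by
  have h := hp.cells_eq
  have hn := hp.wom.n_ge
  have ht := hp.wom.t₁_pos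
  have ht₂ := p.wom.t₂_pos
  have hk := hp.wom.k_le_n
  have hqn : p.q ≤ p.wom.n := Nat.le_of_dvd (by omega) hp.dvd
  have h1 : p.wom.n ≤ p.wom.t₂ * (p.wom.t₁ * p.wom.n) :=
    (Nat.le_mul_of_pos_left _ ht).trans (Nat.le_mul_of_pos_left _ ht₂)
  have h2 : p.wom.t₁ ≤ p.wom.t₂ * (p.wom.t₁ * p.wom.n) :=
    (Nat.le_mul_of_pos_right _ (by omega)).trans (Nat.le_mul_of_pos_left _ ht₂)
  have h3 : p.wom.t₂ ≤ p.wom.t₂ * (p.wom.t₁ * p.wom.n) :=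
    Nat.le_mul_of_pos_right _ (Nat.mul_pos ht (by omega))
  have h4 := hp.a_spec.2
  have h5 : p.wom.n * p.wom.t₂ ≤ p.wom.t₂ * (p.wom.t₁ * p.wom.n) := by
    rw [mul_comm]
    exact Nat.mul_le_mul_left _ (Nat.le_mul_of_pos_left _ ht)
  have h6 : 2 ^ p.wom.n ≤ p.wom.t₂ := (Nat.le_self_pow (by norm_num) _).trans hp.wom.t₂_ge
  have h7 : 2 * p.wom.n * p.wom.t₂ = 2 * (p.wom.n * p.wom.t₂) := by ring
  refine ⟨?_, ?_, ?_, ?_, ?_, ?_, ?_, ?_, ?_, ?_⟩ <;> omega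

end RMParams

end RankMod

namespace RAM

theorem length_flatMap_range₃ (F : ℕ → ℕ → ℕ → ℕ) (t₂ t₁ n : ℕ) :
    ((List.range t₂).flatMap fun j => (List.range t₁).flatMap fun i =>
      (List.range n).flatMap fun b => [F j i b]).length = t₂ * (t₁ * n) :=
  length_flatMap_range fun _ _ => length_flatMap_range fun _ _ => by
    rw [length_flatMap_range (l := 1) fun _ _ => rfl, mul_one]

theorem getD_flatMap_range₁ (F : ℕ → ℕ) {n b : ℕ} (hb : b < n) :
    ((List.range n).flatMap fun b => [F b]).getD b 0 = F b := by
  simpa using getD_flatMap_range (g := fun b => [F b]) (l := 1) (r := 0) (fun _ _ => rfl) hb one_pos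

theorem getD_flatMap_range₃ (F : ℕ → ℕ → ℕ → ℕ) {t₂ t₁ n i j b : ℕ} (hj : j < t₂) (hi : i < t₁)
    (hb : b < n) : ((List.range t₂).flatMap fun j => (List.range t₁).flatMap fun i =>
      (List.range n).flatMap fun b => [F j i b]).getD (j * (t₁ * n) + i * n + b) 0 = F j i b := by
  have h1 : ∀ j i, ((List.range n).flatMap fun b => [F j i b]).length = n := fun j i => by
    rw [length_flatMap_range (l := 1) fun _ _ => rfl, mul_one]
  have h2 := succ_mul_le n hi
  rw [add_assoc, getD_flatMap_range (fun _ _ => length_flatMap_range fun _ _ => h1 _ _) hj (by omega),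
    getD_flatMap_range (fun _ _ => h1 _ _) hi hb, getD_flatMap_range₁ _ hb]

end RAM

/-! ### The loop over the ranks and its invariant -/

namespace RankMod
open RAM

namespace RMParams

variable {p : RMParams}

set_option synthInstance.maxHeartbeats 400000
set_option synthInstance.maxSize 4000

/-- What the encoder knows after the first `i` ranks have been written. -/
structure RanksInv (p : RMParams) (σ : p.Cells → ℕ) (m : p.Message) (L : List ℕ) (base i : ℕ)
    (o : List ℕ) (f : p.wom.Blocks → Fin p.wom.n → ℕ) : Prop where
  length : o.length = (p.wom.t₂ * (p.wom.t₁ * p.wom.n) + p.wom.t₂ * (p.wom.t₁ * p.wom.n) + p.wom.t₂) * i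
  le : ∀ l b, f l b ≤ i
  -- The ranks before the first round are an array of zeros at `base`. A round appends a state, the
  -- keys and the new ranks, so all positions repeat with this period, and the current ranks always
  -- start at `base` plus `i` periods.
  rank : ∀ (i₁ : Fin p.wom.t₁) (j : Fin p.wom.t₂) (b : Fin p.wom.n), (L ++ o).getD (base +
    (p.wom.t₂ * (p.wom.t₁ * p.wom.n) + p.wom.t₂ * (p.wom.t₁ * p.wom.n) + p.wom.t₂) * i +
    (j * (p.wom.t₁ * p.wom.n) + i₁ * p.wom.n + b)) 0 = f (i₁, j) b
  key_lt : ∀ i' : Fin p.u, (i' : ℕ) < i → ∀ j < p.wom.t₂, (L ++ o).getD (base +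
    p.wom.t₂ * (p.wom.t₁ * p.wom.n) + p.wom.t₂ * (p.wom.t₁ * p.wom.n) + (p.wom.t₂ *
    (p.wom.t₁ * p.wom.n) + p.wom.t₂ * (p.wom.t₁ * p.wom.n) + p.wom.t₂) * i' + j) 0 <
    2 ^ (p.wom.n + p.wom.n)
  enc : ∀ i' : Fin p.u, (i' : ℕ) < i → IsHashEncoding p.wom.wx (m.1 i') (p.freeVec σ f i')
    (fun l b => decide (f l b = i' + 1)) fun j => keyOf p.wom.n ((L ++ o).getD (base +
      p.wom.t₂ * (p.wom.t₁ * p.wom.n) + p.wom.t₂ * (p.wom.t₁ * p.wom.n) + (p.wom.t₂ *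
      (p.wom.t₁ * p.wom.n) + p.wom.t₂ * (p.wom.t₁ * p.wom.n) + p.wom.t₂) * i' + j) 0)

/-- The loop over the ranks that are written with the WOM code. -/
def ranksS : S := .loop (.var 8) (stepS (.var 2) (.var 3) (.var 9) (.var 7) (.var 4) (.var 5)
  (.add (.lit 7) (mulE (.var 11) (.var 20))) (.var 15) (.add (.var 16) (mulE (.var 17) (.var 20)))
  (.add (.add (.var 20) (.lit 1)) (.var 1)) (.add (.var 20) (.lit 1)))

theorem Valid.ranks (hp : p.Valid) {σ : p.Cells → ℕ} (hσ : σ ∈ p.codebook) (m : p.Message)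
    {L : List ℕ} {px base pt m₁ pb m₂ pc Z : ℕ}
    (hlen : L.length = base + p.wom.t₂ * (p.wom.t₁ * p.wom.n))
    (h0 : ∀ x < p.wom.t₂ * (p.wom.t₁ * p.wom.n), L.getD (base + x) 0 = 0)
    (hm : ∀ (i : Fin p.u) (i₁ : Fin p.wom.t₁) (j : Fin p.wom.t₂) (b : Fin p.wom.k),
      L.getD (7 + p.wom.t₂ * (p.wom.t₁ * p.wom.k) * i + j * (p.wom.t₁ * p.wom.k) + i₁ * p.wom.k + b) 0 =
        (m.1 i (i₁, j) b).toNat)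
    (hx : ∀ (i₁ : Fin p.wom.t₁) (j : Fin p.wom.t₂) (b : Fin p.wom.n),
      L.getD (px + (j * (p.wom.t₁ * p.wom.n) + i₁ * p.wom.n + b)) 0 = p.partX σ (i₁, j) b)
    (hlm : 7 + p.wom.t₂ * (p.wom.t₁ * p.wom.k) * p.u ≤ L.length)
    (hlx : px + p.wom.t₂ * (p.wom.t₁ * p.wom.n) ≤ L.length) (hZ : p.q * p.z ≤ Z) :
    ∃ o f, SpS ranksS L [p.q, p.r, p.wom.n, p.wom.k, p.wom.t₁, p.wom.t₂, p.a, p.zW, p.u,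
      leastPoly p.wom.n, p.wom.t₂ * (p.wom.t₁ * p.wom.n), p.wom.t₂ * (p.wom.t₁ * p.wom.k), pt, m₁, pb,
      px, base, p.wom.t₂ * (p.wom.t₁ * p.wom.n) + p.wom.t₂ * (p.wom.t₁ * p.wom.n) + p.wom.t₂, m₂, pc]
      o (2000000 * Z ^ 9) ∧ p.RanksInv σ m L base p.u o f := by
  obtain ⟨b1, b2, b3, b4, b5, b6, b7, b8, b9, b10⟩ := hp.bounds
  have hu := p.u_add
  set tn := p.wom.t₂ * (p.wom.t₁ * p.wom.n) with htn
  set tk := p.wom.t₂ * (p.wom.t₁ * p.wom.k) with htk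
  set B := tn + tn + p.wom.t₂ with hB
  have key := SpS.loop_exists (L := L) (R := fun i => [p.q, p.r, p.wom.n, p.wom.k,
      p.wom.t₁, p.wom.t₂, p.a, p.zW, p.u, leastPoly p.wom.n, tn, tk, pt, m₁, pb, px, base, B, m₂, pc,
      i]) (e := .var 8) (v' := p.u)
    (ρ := [p.q, p.r, p.wom.n, p.wom.k, p.wom.t₁, p.wom.t₂, p.a, p.zW, p.u, leastPoly p.wom.n, tn, tk,
      pt, m₁, pb, px, base, B, m₂, pc])
    (s := stepS (.var 2) (.var 3) (.var 9) (.var 7) (.var 4) (.var 5)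
      (.add (.lit 7) (mulE (.var 11) (.var 20))) (.var 15) (.add (.var 16) (mulE (.var 17) (.var 20)))
      (.add (.add (.var 20) (.lit 1)) (.var 1)) (.add (.var 20) (.lit 1)))
    (fun i o => ∃ f, p.RanksInv σ m L base i o f) (1001000 * Z ^ 8)
    inferInstance rfl ⟨fun _ _ => 0, by simp, by simp, fun i₁ j b => by
      rw [List.append_nil, mul_zero, add_zero, h0 _ (HashParams.bitColumn_lt i₁ j b)],
      by simp, by simp⟩ fun i hi o hI => ?_
  · obtain ⟨o, hs, f, hf⟩ := key
    refine ⟨o, f, hs.mono ?_, hf⟩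
    have h1 : p.u * (1001000 * Z ^ 8 + 4) ≤ Z * (1001004 * Z ^ 8) :=
      Nat.mul_le_mul (by omega) (by have := Nat.one_le_pow 8 Z (by omega); omega)
    have h2 : Z * (1001004 * Z ^ 8) = 1001004 * Z ^ 9 := by ring
    have := Nat.one_le_pow 9 Z (by omega)
    omega
  · obtain ⟨f, hI⟩ := hI
    have ho := hI.length
    rw [← htn, ← hB] at ho
    set M := L ++ o with hM
    have hMl : M.length = base + tn + B * i := by rw [hM, List.length_append, hlen, ho]
    have hML : ∀ a < L.length, M.getD a 0 = L.getD a 0 := fun a ha => getD_append_of_lt _ ha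
    set S := stepState M px (base + B * i) (i + 1 + p.r) tn with hS
    have hSl : S.length = tn := length_stepState _ _ _ _ _
    set L' := M ++ S with hL'
    have hL'M : ∀ a < M.length, L'.getD a 0 = M.getD a 0 := fun a ha => getD_append_of_lt _ ha
    have hkm : 7 + tk * i + tk ≤ L.length := by
      have := succ_mul_le tk hi
      rw [mul_comm i, mul_comm p.u] at this
      omega
    have hstate : ∀ (i₁ : Fin p.wom.t₁) (j : Fin p.wom.t₂) (b : Fin p.wom.n),
        L'.getD (M.length + j * (p.wom.t₁ * p.wom.n) + i₁ * p.wom.n + b) 0 =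
          -- The state computed by the program is the combinatorial state, so the weight condition
          -- of the WOM encoder is available.
          (p.freeVec σ f i (i₁, j) b).toNat := by
      intro i₁ j b
      have hlt := HashParams.bitColumn_lt i₁ j b
      rw [add_assoc, add_assoc, getD_append_length _ rfl, ← add_assoc, hS, stepState,
        getD_flatMap_range₁ _ hlt, hI.rank i₁ j b, hML _ (by omega), hx]
      have := hI.le (i₁, j) b
      unfold freeVec
      by_cases hf0 : f (i₁, j) b = 0
      · by_cases hs0 : p.partX σ (i₁, j) b ≤ i + 1 + p.r
        · simp [hf0, hs0]
        · simp [hf0, hs0]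
          omega
      · simp [hf0, this]
    have hmsg : ∀ (i₁ : Fin p.wom.t₁) (j : Fin p.wom.t₂) (b : Fin p.wom.k),
        L'.getD (7 + tk * i + j * (p.wom.t₁ * p.wom.k) + i₁ * p.wom.k + b) 0 =
          (m.1 ⟨i, hi⟩ (i₁, j) b).toNat := by
      intro i₁ j b
      have hlt := HashParams.bitColumn_lt i₁ j b
      rw [hL'M _ (by omega), hML _ (by omega), ← hm ⟨i, hi⟩]
    set K := (List.range p.wom.t₂).flatMap fun j => [keyNum L' p.wom.n p.wom.k (leastPoly p.wom.n)
      p.zW p.wom.t₁ (7 + tk * i) M.length j] with hK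
    have hKl : K.length = p.wom.t₂ := by
      rw [hK, length_flatMap_range (l := 1) fun _ _ => rfl, mul_one]
    set X := (List.range p.wom.t₂).flatMap fun j => (List.range p.wom.t₁).flatMap fun i₁ =>
      (List.range p.wom.n).flatMap fun b =>
        [stepRank (M.getD (base + B * i + p.wom.t₁ * p.wom.n * j + p.wom.n * i₁ + b) 0) (i + 1)
          ((xNum L' p.wom.n p.wom.k (leastPoly p.wom.n) p.zW p.wom.t₁ (7 + tk * i) M.length j
            i₁).testBit b)] with hX
    have hXl : X.length = tn := length_flatMap_range₃ _ _ _ _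
    have hstep : SpS (stepS (.var 2) (.var 3) (.var 9) (.var 7) (.var 4) (.var 5)
        (.add (.lit 7) (mulE (.var 11) (.var 20))) (.var 15) (.add (.var 16) (mulE (.var 17) (.var 20)))
        (.add (.add (.var 20) (.lit 1)) (.var 1)) (.add (.var 20) (.lit 1))) M
        [p.q, p.r, p.wom.n, p.wom.k, p.wom.t₁, p.wom.t₂, p.a, p.zW, p.u, leastPoly p.wom.n, tn, tk,
          pt, m₁, pb, px, base, B, m₂, pc, i] (S ++ (K ++ X)) (1001000 * Z ^ 8) := by
      refine (SpS.step (Z := Z) inferInstance inferInstance inferInstance inferInstance inferInstance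
        inferInstance inferInstance inferInstance inferInstance inferInstance inferInstance
        (by omega) (by omega) (by omega) (by omega) (by omega) (by omega) (by omega) (by omega)
        (by omega) rfl rfl rfl).mono ?_
      have : Z ≤ Z ^ 8 := Nat.le_self_pow (by norm_num) _
      omega
    have hnew : ∀ a, (L ++ (o ++ (S ++ (K ++ X)))).getD (M.length + a) 0 = (S ++ (K ++ X)).getD a 0 :=
      fun a => by rw [← List.append_assoc, ← hM, getD_append_length _ rfl]
    have hold : ∀ a < M.length, (L ++ (o ++ (S ++ (K ++ X)))).getD a 0 = M.getD a 0 :=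
      fun a ha => by rw [← List.append_assoc, ← hM, getD_append_of_lt _ ha]
    have hkey : ∀ j < p.wom.t₂, (L ++ (o ++ (S ++ (K ++ X)))).getD (base + tn + tn + B * i + j) 0 =
        keyNum L' p.wom.n p.wom.k (leastPoly p.wom.n) p.zW p.wom.t₁ (7 + tk * i) M.length j := by
      intro j hj
      rw [show base + tn + tn + B * i + j = M.length + (tn + j) by omega, hnew,
        getD_append_length _ hSl, getD_append_of_lt _ (by omega), hK, getD_flatMap_range₁ _ hj]
    -- Keys of earlier rounds stay where they are, so the earlier clauses of the invariant carry
    -- over.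
    have hkeyold : ∀ i' < i, ∀ j < p.wom.t₂,
        (L ++ (o ++ (S ++ (K ++ X)))).getD (base + tn + tn + B * i' + j) 0 =
        M.getD (base + tn + tn + B * i' + j) 0 := by
      intro i' hi' j hj
      have := succ_mul_le B hi'
      rw [mul_comm i', mul_comm i] at this
      exact hold _ (by omega)
    obtain ⟨hJ, hE⟩ := hp.encoding_step hσ m hi hI.le (key := fun i' j => keyOf p.wom.n
      ((L ++ (o ++ (S ++ (K ++ X)))).getD (base + tn + tn + B * i' + j) 0)) fun i' hi' => by
        have := hI.enc i' hi'
        simp only [← htn, ← hB, ← hM] at this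
        refine Eq.mp (congrArg (IsHashEncoding _ _ _ _) (funext fun j : Fin p.wom.t₂ => ?_)) this
        rw [hkeyold i' hi' j j.2]
    obtain ⟨hS1, hS2⟩ := hp.wom.search_spec (pm := 7 + tk * i) (ps := M.length) hmsg hstate hJ
    rw [hp.floor_wx] at hS1 hS2
    have hE := hE _ (by
      refine Eq.mp (congrArg (IsHashEncoding _ _ _ _) (funext fun j : Fin p.wom.t₂ => ?_)) hS1
      rw [hkey j j.2])
    refine ⟨_, hstep, _, ?_, fun l b => stepRank_le (hI.le l b), fun i₁ j b => ?_, fun i' hi' j hj => ?_,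
      hE⟩
    · rw [List.length_append, List.length_append, List.length_append, ho, hSl, hKl, hXl, ← htn, ← hB]
      rw [Nat.mul_succ]
      omega
    · have hlt := HashParams.bitColumn_lt i₁ j b
      rw [← htn, ← hB, Nat.mul_succ, show base + (B * i + B) + (j * (p.wom.t₁ * p.wom.n) +
        i₁ * p.wom.n + b) = M.length + (tn + (p.wom.t₂ + (j * (p.wom.t₁ * p.wom.n) +
        i₁ * p.wom.n + b))) by omega, hnew, getD_append_length _ hSl, getD_append_length _ hKl, hX,
        getD_flatMap_range₃ _ j.2 i₁.2 b.2, mul_comm _ (j : ℕ), mul_comm _ (i₁ : ℕ), add_assoc,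
        add_assoc, ← add_assoc ((j : ℕ) * _), hI.rank i₁ j b]
      rfl
    · rw [← htn, ← hB]
      rcases Nat.lt_succ_iff_lt_or_eq.1 hi' with h | h
      · rw [hkeyold i' h j hj]
        exact hI.key_lt i' h j hj
      · rw [h, hkey j hj]
        exact hS2 ⟨j, hj⟩

end RMParams

end RankMod

/-! ### The rank-modulation encoder as a program -/

namespace RankMod
open RAM

/-- A matrix of blocks as a sequence. -/
theorem exists_sequence_of_blocks {α : Type} {t₁ t₂ : ℕ} (F : Fin t₁ × Fin t₂ → α) (d : α) :
    ∃ G : ℕ → α, ∀ (i : Fin t₁) (j : Fin t₂), G (t₁ * j + i) = F (i, j) := by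
  refine ⟨fun l => if h : l % t₁ < t₁ ∧ l / t₁ < t₂ then F (⟨l % t₁, h.1⟩, ⟨l / t₁, h.2⟩) else d,
    fun i j => ?_⟩
  have h1 : (t₁ * j + i) % t₁ = i := by rw [Nat.mul_add_mod, Nat.mod_eq_of_lt i.2]
  have h2 : (t₁ * j + i) / t₁ = j := by
    rw [Nat.mul_add_div i.pos, Nat.div_eq_of_lt i.2, add_zero]
  simp only [h1, h2]
  rw [dif_pos ⟨i.2, j.2⟩]

theorem exists_block_of_lt {t₁ t₂ l : ℕ} (h : l < t₂ * t₁) :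
    ∃ (i : Fin t₁) (j : Fin t₂), l = t₁ * j + i := by
  have ht : 0 < t₁ := Nat.pos_of_ne_zero fun h0 => by simp [h0] at h
  exact ⟨⟨l % t₁, Nat.mod_lt _ ht⟩, ⟨l / t₁, Nat.div_lt_of_lt_mul (by rwa [mul_comm])⟩,
    (Nat.div_add_mod l t₁).symm⟩

theorem exists_sequence_of_fin {α : Type} {n : ℕ} (F : Fin n → α) (d : α) :
    ∃ G : ℕ → α, ∀ i : Fin n, G i = F i :=
  ⟨fun i => if h : i < n then F ⟨i, h⟩ else d, fun i => by simp⟩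

namespace RMParams

variable {p : RMParams}

set_option synthInstance.maxHeartbeats 400000
set_option synthInstance.maxSize 4000

/-- The encoder. -/
def encS : S := .bind (.ld (.lit 0)) (.bind (.ld (.lit 1)) (.bind (.ld (.lit 2))
  (.bind (.ld (.lit 3)) (.bind (.ld (.lit 4)) (.bind (.ld (.lit 5)) (.bind (.ld (.lit 6))
  (.bind (divE (.var 2) (.var 0) (.var 2)) (.bind (.sub (.sub (.var 0) (.var 1)) (.lit 1))
  (.bind (leastPolyE (.var 2)) (.bind (mulE (mulE (.var 2) (.var 4)) (.var 5))
  (.bind (mulE (mulE (.var 3) (.var 4)) (.var 5)) (.bind (.add (.lit 7) (mulE (.var 11) (.var 8)))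
  (.bind (mulE (.var 6) (.add (.var 1) (.lit 1)))
  (.bind (.add (.add (.var 12) (mulE (.var 4) (.var 5))) (mulE (.var 13) (.var 8)))
  (.bind (.add (.var 14) (mulE (mulE (.var 6) (.var 8)) (.var 8)))
  (.bindLen (.bind (.add (.add (.var 10) (.var 10)) (.var 5))
  (.bind (mulE (.var 7) (.add (.var 1) (.lit 1))) (.bind (.add (.var 16) (mulE (.var 17) (.var 8)))
  -- Variables: `0`–`6` header, `7` multiplicity, `8` number of written ranks, `9` modulus, `10` and
  -- `11` sizes of state and message part, `12` address of the top indices, `13` length of an index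
  -- word, `14` and `15` addresses of `π_b` and of the blocks in `σ`, `16` start of the output, `17`
  -- period of the rank loop, `18` length of a top word, `19` address of the final ranks. Zeros,
  -- rounds and top words are scratch data; the codeword comes last.
  (.seq (.loop (.var 10) (.emit (.lit 0))) (.seq ranksS
  (.seq (topsS (.sub (.var 0) (.var 1)) (.var 0) (.var 7) (.var 18) (mulE (.var 4) (.var 5)) (.var 12))
  (.seq (indexS (.var 2) (.var 5) (.add (.var 1) (.lit 1)) (.var 6) (.var 13) (.var 8)
    (.add (.add (.var 16) (.var 10)) (.var 10)) (.var 17))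
  (.seq (.loop (mulE (mulE (.var 6) (.var 8)) (.var 8)) (.emit (.ld (.add (.var 14) (.var 20)))))
  (fillS (.var 2) (.var 4) (.var 5) (.var 18) (.var 19) (.add (.var 19) (.var 10)))))))))))))))))))))))))))

-- The length `(r + 1) * a` of an index word is bounded only through the product of the bounds of
-- its factors, so `Z` is quadratic in the number of cells.
set_option maxHeartbeats 1000000 in
theorem Valid.encS_spec (hp : p.Valid) (σ : p.codebook) (m : p.Message) {Z : ℕ}
    (hZ : 8 * (p.q * p.z) ^ 2 ≤ Z) :
    ∃ (π : p.codebook) (A : List ℕ), p.decode π = m ∧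
      cost (σ : p.Cells → ℕ) (π : p.Cells → ℕ) ≤ p.r ∧ p.IsRMEncoding m σ π ∧
      SpS encS (p.header ++ p.messageList m ++ p.permList σ) [] (A ++ p.permList π)
        (3000000 * Z ^ 10) := by
  obtain ⟨b1, b2, b3, b4, b5, b6, b7, b8, b9, b10⟩ := hp.bounds
  have hu := p.u_add
  have hRZ : p.q * p.z ≤ Z := by nlinarith
  set tn := p.wom.t₂ * (p.wom.t₁ * p.wom.n) with htn
  set tk := p.wom.t₂ * (p.wom.t₁ * p.wom.k) with htk
  set L := p.header ++ p.messageList m ++ p.permList σ with hL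
  have hlm := p.length_messageList m
  have hlp := p.length_permList σ
  rw [← htk] at hlm
  rw [← htn] at hlp
  set pt := 7 + tk * p.u with hpt
  set m₁ := (p.r + 1) * p.a with hm₁
  set pb := pt + p.wom.t₂ * p.wom.t₁ + p.u * m₁ with hpb
  set px := pb + p.u * (p.u * p.a) with hpx
  have hhm : (p.header ++ p.messageList m).length = pt + p.wom.t₂ * p.wom.t₁ := by
    rw [List.length_append, length_header, hlm, hpt, mul_comm tk]
    omega
  set base := L.length with hbase
  have hLl : base = px + tn := by
    rw [hbase, hL, List.length_append, hhm, hlp]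
    omega
  have g0 : L.getD 0 0 = p.q ∧ L.getD 1 0 = p.r ∧ L.getD 2 0 = p.wom.n ∧ L.getD 3 0 = p.wom.k ∧
    L.getD 4 0 = p.wom.t₁ ∧ L.getD 5 0 = p.wom.t₂ ∧ L.getD 6 0 = p.a := ⟨rfl, rfl, rfl, rfl, rfl, rfl, rfl⟩
  have hLm : ∀ a < tk * p.u + p.wom.t₂ * p.wom.t₁, L.getD (7 + a) 0 = (p.messageList m).getD a 0 := by
    intro a ha
    rw [mul_comm tk] at ha
    rw [hL, List.append_assoc, getD_append_length _ p.length_header, getD_append_of_lt _ (by omega)]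
  have hLp : ∀ a, L.getD (pt + p.wom.t₂ * p.wom.t₁ + a) 0 = (p.permList σ).getD a 0 := fun a => by
    rw [hL, getD_append_length _ hhm]
  -- the ranks below `q - r`
  set zeros := (List.range tn).flatMap fun _ => [0] with hzeros
  have hzl : zeros.length = tn := by rw [hzeros, length_flatMap_range (l := 1) fun _ _ => rfl, mul_one]
  set m₂ := (p.r + 1) * p.zW with hm₂
  have hn := hp.wom.n_ge
  have hmt : p.wom.t₂ * p.wom.t₁ ≤ tn := by
    rw [htn, ← mul_assoc]
    exact Nat.le_mul_of_pos_right _ (by omega)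
  have hm₂n : m₂ ≤ p.wom.n := hp.n_eq ▸ Nat.mul_le_mul_right _ p.r_lt_q
  have hzn : p.zW ≤ p.wom.n := hp.n_eq ▸ Nat.le_mul_of_pos_left _ p.q_pos
  have hm₁R : m₁ ≤ 2 * (p.q * p.z) ^ 2 := by
    calc m₁ ≤ (p.q * p.z) * (2 * (p.q * p.z)) := Nat.mul_le_mul (p.r_lt_q.trans_le b1) b6
      _ = _ := by ring
  have hRR : p.q * p.z ≤ (p.q * p.z) ^ 2 := Nat.le_self_pow (by norm_num) _
  have ht₂ := p.wom.t₂_pos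
  set B := tn + tn + p.wom.t₂ with hB
  set pc := base + B * p.u with hpc
  set L₀ := L ++ zeros with hL₀
  have hL₀l : L₀.length = base + tn := by rw [hL₀, List.length_append, hzl]
  have hL₀L : ∀ a < base, L₀.getD a 0 = L.getD a 0 := fun a ha => getD_append_of_lt _ ha
  obtain ⟨o, f, hranks, hI⟩ := hp.ranks (L := L₀) (px := px) (base := base) (pt := pt) (m₁ := m₁)
    (pb := pb) (m₂ := m₂) (pc := pc) σ.2 m hL₀l
    (fun x hx => by rw [hL₀, getD_append_length _ hbase.symm, hzeros, getD_flatMap_range₁ _ hx])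
    (fun i i₁ j b => by
      have h1 := HashParams.bitColumn_lt i₁ j b
      have h2 := succ_mul_le tk i.2
      rw [← htk] at h1
      rw [mul_comm (i : ℕ), mul_comm p.u] at h2
      rw [← htk, add_assoc, add_assoc, add_assoc, hL₀L _ (by omega), hLm _ (by omega),
        ← p.getD_messageList_bits, ← htk, mul_comm (i : ℕ), add_assoc ((j : ℕ) * _)])
    (fun i₁ j b => by
      have h1 := HashParams.bitColumn_lt i₁ j b
      rw [← htn] at h1
      rw [hL₀L _ (by omega), ← p.getD_permList_X, ← hLp]
      congr 1
      simp only [hpx, hpb, hm₁]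
      ring) (show 7 + tk * p.u ≤ L₀.length by omega) (show px + tn ≤ L₀.length by omega) hRZ
  have hol : o.length = B * p.u := hI.length
  set M := L₀ ++ o with hM
  have hMl : M.length = pc + tn := by
    rw [hM, List.length_append, hL₀l, hol]
    omega
  have hML : ∀ a < base, M.getD a 0 = L.getD a 0 := fun a ha => by
    rw [hM, getD_append_of_lt _ (by omega), hL₀L a ha]
  -- the arrangements of the ranks from `q - r` on
  have hTex := fun l : p.wom.Blocks => exists_lexIndex_eq (S := Finset.Icc (p.q - p.r) p.q)
    (z := p.zW) (m.2 l).2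
  choose T hT hTm using hTex
  obtain ⟨Tn, hTn⟩ := exists_sequence_of_blocks T []
  have hTl : ∀ l, (T l).length = m₂ := fun l => by
    rw [length_permLists (hT l), Nat.card_Icc]
    congr 1
    omega
  set Ts := (List.range (p.wom.t₁ * p.wom.t₂)).flatMap Tn with hTs
  have hTnl : ∀ l < p.wom.t₂ * p.wom.t₁, (Tn l).length = m₂ := fun l hl => by
    obtain ⟨i, j, rfl⟩ := exists_block_of_lt hl
    rw [hTn, hTl]
  have hTnl' : ∀ l < p.wom.t₁ * p.wom.t₂, (Tn l).length = m₂ := fun l hl =>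
    hTnl l (by rwa [mul_comm])
  have hTsl : Ts.length = p.wom.t₂ * p.wom.t₁ * m₂ := by
    rw [hTs, length_flatMap_range hTnl', mul_comm p.wom.t₁]
  set M' := M ++ Ts with hM'
  have hM'l : M'.length = M.length + Ts.length := List.length_append
  have hM'M : ∀ a < M.length, M'.getD a 0 = M.getD a 0 := fun a ha => getD_append_of_lt _ ha
  -- the keys
  have hkeypos : ∀ i : Fin p.u, ∀ j < p.wom.t₂, base + tn + tn + B * i + j < M.length := by
    intro i j hj
    have := succ_mul_le B i.2
    rw [mul_comm (i : ℕ), mul_comm p.u] at this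
    omega
  set y : ℕ → ℕ := fun i => packKeys M' (base + tn + tn + B * i) (p.wom.n + p.wom.n) p.wom.t₂ with hy
  have hyspec := fun i : Fin p.u => packKeys_spec (L := M') (p := base + tn + tn + B * i)
    (w := p.wom.n + p.wom.n) (m := p.wom.t₂) fun j hj => by
      rw [hM'M _ (hkeypos i j hj)]
      exact hI.key_lt i i.2 j hj
  have hylt : ∀ i : Fin p.u, y i < p.wom.Ka := fun i => by
    rw [HashParams.Ka, two_mul]
    exact (hyspec i).1
  -- The packed keys form a number below `Ka`, and `a` was chosen so that this is the index of some
  -- word.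
  have hAex := fun i : Fin p.u => exists_lexIndex_eq ((hylt i).trans_le hp.a_spec.1)
  choose A hA hAy using hAex
  obtain ⟨An, hAn⟩ := exists_sequence_of_fin A []
  have hAl : ∀ i, (A i).length = m₁ := fun i => by
    rw [length_permLists (hA i), Nat.card_Icc, Nat.add_sub_cancel]
  obtain ⟨π, h1, h2, h3, h4, h5, h6⟩ := hp.encoding_spec σ m f hI.le A hA
    (fun i => by rw [hAy]; exact hylt i) (fun i => by
      rw [hAy, keysOfNat_eq (c := fun j => M'.getD (base + tn + tn + B * i + j) 0) (hyspec i).2]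
      refine Eq.mp (congrArg (IsHashEncoding _ _ _ _) (funext fun j : Fin p.wom.t₂ => ?_))
        (hI.enc i i.2)
      rw [hM'M _ (hkeypos i j j.2)]) T hT hTm
  set As := (List.range p.u).flatMap An with hAs
  have hAsl : As.length = p.u * m₁ := length_flatMap_range fun i hi => by
    rw [show An i = A ⟨i, hi⟩ from hAn ⟨i, hi⟩, hAl]
  set Bs := List.ofFn (p.partB σ) with hBs
  have hBl : Bs.length = p.u * (p.u * p.a) := List.length_ofFn
  obtain ⟨fn, hfn⟩ := exists_sequence_of_blocks (fun l => List.ofFn (f l)) []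
  set Xs := (List.range p.wom.t₂).flatMap fun j => (List.range p.wom.t₁).flatMap fun i =>
    fill (fn (p.wom.t₁ * j + i)) (Tn (p.wom.t₁ * j + i)) with hXs
  have hπ : p.permList π = As ++ Bs ++ Xs := by
    rw [permList, h5, flat_eq _ An fun i => by rw [h4, hAn],
      columns_eq _ (fun j i => fill (fn (p.wom.t₁ * j + i)) (Tn (p.wom.t₁ * j + i))) fun b => by
        rw [h6, hfn, hTn]]
  refine ⟨π, zeros ++ (o ++ Ts), h1, h2, h3, ?_⟩
  have hrun : SpS encS L [] (zeros ++ (o ++ (Ts ++ (As ++ (Bs ++ Xs))))) (3000000 * Z ^ 10) := by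
    refine SpS.mono (SpS.bind inferInstance g0.1 <| SpS.bind inferInstance g0.2.1 <|
      SpS.bind inferInstance g0.2.2.1 <| SpS.bind inferInstance g0.2.2.2.1 <|
      SpS.bind inferInstance g0.2.2.2.2.1 <| SpS.bind inferInstance g0.2.2.2.2.2.1 <|
      SpS.bind inferInstance g0.2.2.2.2.2.2 <|
      SpS.bind (v' := p.zW) inferInstance (natDiv_eq Nat.lt_two_pow_self p.q_pos) <|
      SpS.bind (v' := p.u) inferInstance rfl <| SpS.bind inferInstance rfl <|
      SpS.bind (v' := tn) inferInstance (by rw [htn]; ring) <|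
      SpS.bind (v' := tk) inferInstance (by rw [htk]; ring) <|
      SpS.bind (v' := pt) inferInstance rfl <|
      SpS.bind (v' := m₁) inferInstance (mul_comm _ _) <|
      SpS.bind (v' := pb) inferInstance (by rw [hpb]; ring) <|
      SpS.bind (v' := px) inferInstance (by rw [hpx]; ring) <| SpS.bindLen rfl <|
      SpS.bind (v' := B) inferInstance rfl <| SpS.bind (v' := m₂) inferInstance (mul_comm _ _) <|
      SpS.bind (v' := pc) inferInstance rfl <|
      SpS.seq (SpS.loop' (fun _ => [0]) 10 inferInstance rfl fun i hi o =>
        (SpS.emit inferInstance rfl).mono (by norm_num)) <|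
      SpS.seq hranks <|
      SpS.seq (SpS.tops (Z := Z) (T := Tn) inferInstance inferInstance inferInstance inferInstance
        inferInstance inferInstance ?_ ?_ ?_ ?_ ?_) <|
      SpS.seq (SpS.index (Z := Z) (T := An) inferInstance inferInstance inferInstance inferInstance
        inferInstance inferInstance inferInstance inferInstance ?_ ?_ ?_ ?_ ?_ ?_ ?_) <|
      SpS.seq ((SpS.loop' (fun b => [Bs.getD b 0]) 20 (v' := p.u * (p.u * p.a)) inferInstance
        (by ring) fun b hb o' => (SpS.emit inferInstance ?_).mono (by norm_num)).congr ?_) <|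
      SpS.fill (f := fn) (T := Tn) (Z := Z) inferInstance inferInstance inferInstance inferInstance
        inferInstance inferInstance ?_ ?_ ?_ ?_ ?_ ?_ ?_ ?_) ?_
    all_goals try simp only [← hL₀, ← hM, ← hM', ← htn, ← hB]
    · rw [mul_comm p.wom.t₁]
      omega
    · intro l hl
      rw [mul_comm] at hl
      obtain ⟨i, j, rfl⟩ := exists_block_of_lt hl
      rw [hML _ (by omega), hTn, hTm, ← p.getD_messageList_top, ← htk, mul_comm p.u, ← hLm _ (by omega),
        hpt, add_assoc]
      exact ⟨hT _, hTl _, rfl⟩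
    · omega
    · have := p.r_lt_q
      omega
    · rw [mul_comm]
      omega
    · intro i hi
      have h := hkeypos ⟨i, hi⟩ (p.wom.t₂ - 1) (by omega)
      simp only at h
      omega
    · intro i hi
      rw [show An i = A ⟨i, hi⟩ from hAn ⟨i, hi⟩]
      exact ⟨hA _, hAl _, hAy _⟩
    · omega
    · have := p.r_lt_q
      omega
    · omega
    · omega
    · omega
    · rw [List.append_assoc, getD_append_of_lt _ (by omega),
        hM'M _ (by omega), hML _ (by omega)]
      rw [← p.getD_permList_B σ hb, ← hLp, hpb, add_assoc]
    · exact (hBl ▸ eq_flatMap_getD Bs).symm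
    · intro l hl
      obtain ⟨i, j, rfl⟩ := exists_block_of_lt hl
      have e : p.wom.n * (p.wom.t₁ * j + i) = j * (p.wom.t₁ * p.wom.n) + i * p.wom.n := by ring
      have h := succ_mul_le m₂ hl
      rw [hfn, hTn, hTl, hp.count_zero (hI.le _) fun v hv =>
        hp.count_ranks (hI.enc ⟨v, hv⟩ hv j i).2.1]
      refine ⟨List.length_ofFn, rfl, rfl, fun b hb => ?_, fun b hb => ?_⟩
      · have hlt := HashParams.bitColumn_lt i j ⟨b, hb⟩
        rw [← htn] at hlt
        simp only at hlt
        have h1 := hI.rank i j ⟨b, hb⟩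
        have h2 := getD_ofFn (f (i, j)) ⟨b, hb⟩
        simp only at h1 h2
        rw [e, List.append_assoc, getD_append_of_lt _ (by omega),
          hM'M _ (by omega), h2, ← h1, ← htn, ← hB]
        congr 1
        omega
      · rw [List.append_assoc, hM', List.append_assoc, add_assoc, ← hMl, getD_append_length _ rfl,
          mul_comm m₂, getD_append_of_lt _ (by omega), hTs,
          getD_flatMap_range hTnl' (by rwa [mul_comm p.wom.t₁ p.wom.t₂]) hb, hTn]
    · have e : p.wom.n * (p.wom.t₂ * p.wom.t₁) = tn := by rw [htn]; ring
      rw [List.length_append, List.length_append]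
      omega
    · rw [mul_comm m₂, ← hTsl, List.length_append, List.length_append]
      omega
    · omega
    · omega
    · omega
    · omega
    · omega
    · have p1 : Z ≤ Z ^ 10 := Nat.le_self_pow (by norm_num) _
      have p2 : Z ^ 2 ≤ Z ^ 10 := Nat.pow_le_pow_right (by omega) (by norm_num)
      have p4 : Z ^ 4 ≤ Z ^ 10 := Nat.pow_le_pow_right (by omega) (by norm_num)
      have p6 : Z ^ 6 ≤ Z ^ 10 := Nat.pow_le_pow_right (by omega) (by norm_num)
      have p9 : Z ^ 9 ≤ Z ^ 10 := Nat.pow_le_pow_right (by omega) (by norm_num)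
      have c1 : (p.wom.n + p.q + 1) ^ 2 ≤ 9 * Z ^ 2 := by
        calc (p.wom.n + p.q + 1) ^ 2 ≤ (3 * Z) ^ 2 := Nat.pow_le_pow_left (by omega) 2
          _ = _ := by ring
      have c2 : (2 ^ p.wom.n) ^ 3 * (3000 * (p.wom.n + 1) ^ 3) ≤ 24000 * Z ^ 6 := by
        calc _ ≤ Z ^ 3 * (3000 * (2 * Z) ^ 3) := by gcongr <;> omega
          _ = _ := by ring
      have hr := p.r_lt_q
      have f1 : p.wom.t₁ ≤ Z ^ 10 := by omega
      have f2 : p.wom.t₂ ≤ Z ^ 10 := by omega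
      have f3 : p.u ≤ Z ^ 10 := by omega
      have f4 : p.r + 1 ≤ Z ^ 10 := by omega
      have f5 : tn ≤ Z ^ 10 := by omega
      have f6 : p.u * (p.u * p.a) ≤ Z ^ 10 := by omega
      have f7 : (p.wom.n + p.q + 1) ^ 2 ≤ 9 * Z ^ 10 := by omega
      have f8 : (2 ^ p.wom.n) ^ 3 * (3000 * (p.wom.n + 1) ^ 3) ≤ 24000 * Z ^ 10 := by omega
      have f9 : 1 ≤ Z ^ 10 := by omega
      clear * - f1 f2 f3 f4 f5 f6 f7 f8 f9 p9 p4
      linarith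
  rw [hπ]
  simpa using hrun

end RMParams

end RankMod

/-! ### Polynomial time of the encoder, and the rewriting code -/

namespace RankMod
open RAM

namespace RMParams

variable {p : RMParams}

set_option synthInstance.maxHeartbeats 400000
set_option synthInstance.maxSize 4000

/-- The length of a permutation. -/
def cellsE : E := .bind (.sub (.sub (.ld (.lit 0)) (.ld (.lit 1))) (.lit 1))
  (.add (.add (mulE (mulE (.ld (.lit 6)) (.add (.ld (.lit 1)) (.lit 1))) (.var 0))
    (mulE (mulE (.ld (.lit 6)) (.var 0)) (.var 0)))
    (mulE (mulE (.ld (.lit 2)) (.ld (.lit 4))) (.ld (.lit 5))))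

/-- The length of a message. -/
def messageE : E := .bind (.sub (.sub (.ld (.lit 0)) (.ld (.lit 1))) (.lit 1))
  (.add (mulE (mulE (mulE (.ld (.lit 3)) (.ld (.lit 4))) (.ld (.lit 5))) (.var 0))
    (mulE (.ld (.lit 4)) (.ld (.lit 5))))

theorem Valid.sp_cells (hp : p.Valid) (l : List ℕ) :
    Sp cellsE (p.header ++ l) [] (p.q * p.z) (100 * (p.q * p.z) + 300) := by
  obtain ⟨b1, b2, b3, b4, b5, b6, b7, b8, b9, b10⟩ := hp.bounds
  have hu : p.u = p.q - p.r - 1 := rfl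
  have hr := p.r_lt_q
  have g : (p.header ++ l).getD 0 0 = p.q ∧ (p.header ++ l).getD 1 0 = p.r ∧
    (p.header ++ l).getD 2 0 = p.wom.n ∧ (p.header ++ l).getD 4 0 = p.wom.t₁ ∧
    (p.header ++ l).getD 5 0 = p.wom.t₂ ∧ (p.header ++ l).getD 6 0 = p.a :=
    ⟨rfl, rfl, rfl, rfl, rfl, rfl⟩
  unfold cellsE
  refine Sp.mono inferInstance ?_ ?_
  · rw [g.1, g.2.1, g.2.2.1, g.2.2.2.1, g.2.2.2.2.1, g.2.2.2.2.2, ← hu, hp.cells_eq]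
    ring
  · rw [g.1, g.2.1, g.2.2.2.1, g.2.2.2.2.1, ← hu]
    omega

theorem Valid.sp_message (hp : p.Valid) (l : List ℕ) (m : p.Message) :
    Sp messageE (p.header ++ l) [] (p.messageList m).length (100 * (p.q * p.z) + 300) := by
  obtain ⟨b1, b2, b3, b4, b5, b6, b7, b8, b9, b10⟩ := hp.bounds
  have hu : p.u = p.q - p.r - 1 := rfl
  have hr := p.r_lt_q
  have g : (p.header ++ l).getD 0 0 = p.q ∧ (p.header ++ l).getD 1 0 = p.r ∧
    (p.header ++ l).getD 3 0 = p.wom.k ∧ (p.header ++ l).getD 4 0 = p.wom.t₁ ∧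
    (p.header ++ l).getD 5 0 = p.wom.t₂ := ⟨rfl, rfl, rfl, rfl, rfl⟩
  unfold messageE
  refine Sp.mono inferInstance ?_ ?_
  · rw [g.1, g.2.1, g.2.2.1, g.2.2.2.1, g.2.2.2.2, ← hu, length_messageList]
    ring
  · rw [g.1, g.2.1, g.2.2.2.1, g.2.2.2.2, ← hu]
    omega

/-- Constants are absorbed by powers of the number of cells. -/
theorem cost_le_pow {R : ℕ} (hR : 41 ≤ R) : 4000000 * (8 * R ^ 2) ^ 20 ≤ R ^ 120 := by
  have h : 4000000 * 8 ^ 20 ≤ R ^ 80 := by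
    calc 4000000 * 8 ^ 20 ≤ 41 ^ 80 := by norm_num
      _ ≤ R ^ 80 := Nat.pow_le_pow_left hR _
  calc 4000000 * (8 * R ^ 2) ^ 20 = 4000000 * 8 ^ 20 * R ^ 40 := by ring
    _ ≤ R ^ 80 * R ^ 40 := Nat.mul_le_mul_right _ h
    _ = R ^ 120 := by ring

theorem exists_encoder : ∃ (P : RAM.Prog) (B : ℕ), ∀ p : RankMod.RMParams, p.Valid →
      ∀ (m : p.Message) (σ : p.codebook), ∃ (π : p.codebook) (T : ℕ),
        p.decode π = m ∧
        RankMod.cost (σ : p.Cells → ℕ) (π : p.Cells → ℕ) ≤ p.r ∧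
        p.IsRMEncoding m σ π ∧
        RAM.Computes P (p.header ++ p.messageList m ++ p.permList σ) (p.permList π) T ∧
        T ≤ (p.q * p.z) ^ B := by
  refine ⟨S.prog (.add (.add (.lit 7) messageE) cellsE) encS cellsE, 120, fun p hp m σ => ?_⟩
  obtain ⟨π, A, h1, h2, h3, hs⟩ := hp.encS_spec σ m le_rfl
  have hl : ∀ σ, (p.permList σ).length = p.q * p.z := fun σ => by rw [length_permList, hp.cells_eq]
  have hc : Sp cellsE (p.header ++ p.messageList m ++ p.permList σ) [] (p.q * p.z)
    (100 * (p.q * p.z) + 300) := by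
    rw [List.append_assoc]
    exact hp.sp_cells _
  have hm : Sp messageE (p.header ++ p.messageList m ++ p.permList σ) [] (p.messageList m).length
    (100 * (p.q * p.z) + 300) := by
    rw [List.append_assoc]
    exact hp.sp_message _ m
  obtain ⟨T, hT, hT'⟩ := SpS.computes (len := .add (.add (.lit 7) messageE) cellsE) (res := cellsE)
    (C := (p.q * p.z) ^ 120) (c := 200 * (p.q * p.z) + 1000) (c'' := 100 * (p.q * p.z) + 300)
    (Sp.mono inferInstance (by
      rw [List.length_append, List.length_append, hl, length_header]) (by omega)) hs (by
      rw [hl, List.append_assoc, List.append_assoc]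
      exact hp.sp_cells _) (by
    obtain ⟨b1, b2, b3, b4, b5, b6, b7, b8, b9, b10⟩ := hp.bounds
    refine le_trans ?_ (cost_le_pow b10)
    rw [hl]
    have e1 : p.q * p.z ≤ 8 * (p.q * p.z) ^ 2 := by nlinarith
    generalize 8 * (p.q * p.z) ^ 2 = Z at *
    have e2 : Z ^ 10 ≤ Z ^ 20 := Nat.pow_le_pow_right (by omega) (by norm_num)
    have e3 : Z ≤ Z ^ 10 := Nat.le_self_pow (by norm_num) _
    have e4 : 1 ≤ Z ^ 10 := Nat.one_le_pow _ _ (by omega)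
    generalize p.q * p.z = R at *
    linarith)
  exact ⟨π, T, h1, h2, h3, hT, hT'⟩

/-! ## The code -/

theorem exists_isMultisetPerm {S : Finset ℕ} {z n : ℕ} (hn : n = S.card * z) :
    ∃ f : Fin n → ℕ, IsMultisetPerm S z f := by
  obtain ⟨L, hL⟩ := exists_mem_permLists S z
  have hl := (length_permLists hL).trans hn.symm
  subst hl
  exact ⟨L.get, isMultisetPerm_iff.2 (by rwa [List.ofFn_get])⟩

/-- Surjectivity of the decoder is obtained by rewriting an arbitrary codeword, so one has to exist.
-/
theorem Valid.codebook_nonempty (hp : p.Valid) : p.codebook.Nonempty := by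
  have hu := p.u_add
  obtain ⟨fA, hA⟩ := exists_isMultisetPerm (S := Finset.Icc 1 (p.r + 1)) (z := p.a)
    (n := (p.r + 1) * p.a) (by rw [Nat.card_Icc, Nat.add_sub_cancel])
  obtain ⟨fB, hB⟩ := exists_isMultisetPerm (S := Finset.Icc (p.r + 2) p.q) (z := p.u * p.a)
    (n := p.u * (p.u * p.a)) (by rw [Nat.card_Icc, show p.q + 1 - (p.r + 2) = p.u by omega])
  obtain ⟨fX, hX⟩ := exists_isMultisetPerm (S := Finset.Icc 1 p.q) (z := p.zW)
    (n := p.wom.n) (by rw [Nat.card_Icc, Nat.add_sub_cancel, hp.n_eq])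
  exact ⟨Sum.elim (fun x => fA x.2) (Sum.elim fB fun x => fX x.2), fun _ => hA, hB, fun _ => hX⟩

/-- Ranks up to `r + 1` occur `u * a` times in the index parts, and `π_b` supplies the larger ranks
equally often. Together with `zW` in each of the `t` blocks every rank occurs `z` times. -/
theorem isMultisetPerm_of_mem {π : p.Cells → ℕ} (h : π ∈ p.codebook) :
    IsMultisetPerm (Finset.Icc 1 p.q) p.z π := by
  intro v
  have hu := p.u_add
  have hA := fun i => h.1 i v
  have hB := h.2.1 v
  have hX := fun l => h.2.2 l v
  simp only [Finset.card_filter, Finset.mem_Icc] at hA hB hX ⊢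
  have hA' : ∀ i, ∑ j, (if π (Sum.inl (i, j)) = v then 1 else 0) = _ := hA
  have hB' : ∑ j, (if π (Sum.inr (Sum.inl j)) = v then 1 else 0) = _ := hB
  have hX' : ∀ l, ∑ j, (if π (Sum.inr (Sum.inr (l, j))) = v then 1 else 0) = _ := hX
  simp only [Fintype.sum_sum_type, Fintype.sum_prod_type, hA', hB', hX', Finset.sum_const,
    Finset.card_univ, Fintype.card_fin, smul_eq_mul, z, HashParams.t, mul_assoc]
  split_ifs <;> first | omega | (simp; done) | (simp; ring)

theorem Valid.isRMCode (hp : p.Valid) : IsRMCode p.q p.z p.KR p.r p.codebook p.decode := by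
  -- That every message can be written over every state is taken from the specification of the
  -- encoder program.
  obtain ⟨P, B, hP⟩ := exists_encoder
  obtain ⟨σ, hσ⟩ := hp.codebook_nonempty
  refine ⟨p.q_pos, hp.z_pos, hp.KR_pos, hp.r_pos, ?_, ?_, fun π h => isMultisetPerm_of_mem h,
    fun m => ?_, fun m σ => ?_⟩
  · simp only [Fintype.card_sum, Fintype.card_prod, Fintype.card_fin]
    rw [hp.cells_eq]
    ring
  · simp [KR, HashParams.KW, HashParams.t, mul_comm]
  · obtain ⟨π, T, h, -⟩ := hP p hp m ⟨σ, hσ⟩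
    exact ⟨π, h⟩
  · obtain ⟨π, T, h, h', -⟩ := hP p hp m σ
    exact ⟨π, h, h'⟩

end RMParams

end RankMod

/-! ### The rank-modulation decoder as a program -/

namespace RAM
open RankMod

theorem SpS.skip {L ρ : List ℕ} {c : ℕ} (hc : 1 ≤ c) : SpS .skip L ρ [] c := ⟨rfl, hc⟩

theorem map_eq_flatMap_getD (T : List ℕ) (g : ℕ → ℕ) :
    T.map g = (List.range T.length).flatMap fun b => [g (T.getD b 0)] := by
  conv_lhs => rw [eq_flatMap_getD T, List.map_flatMap]
  rfl

theorem filter_eq_flatMap_getD (T : List ℕ) (P : ℕ → Bool) :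
    T.filter P = (List.range T.length).flatMap fun b => if P (T.getD b 0) then [T.getD b 0] else [] := by
  conv_lhs => rw [eq_flatMap_getD T, List.filter_flatMap]
  refine flatMap_range_congr fun b _ => ?_
  simp only [List.filter_singleton]
  cases P (T.getD b 0) <;> rfl

theorem flatMap_range_split (g : ℕ → List ℕ) {i n : ℕ} (hi : i < n) :
    ∃ R, (List.range n).flatMap g = (List.range i).flatMap g ++ g i ++ R := by
  obtain ⟨d, rfl⟩ := Nat.exists_eq_add_of_lt hi
  refine ⟨((List.range d).map (i + 1 + ·)).flatMap g, ?_⟩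
  rw [show i + d + 1 = i + 1 + d by omega, List.range_add, List.flatMap_append, List.range_succ,
    List.flatMap_append]
  simp

end RAM

namespace RankMod
open RAM

theorem flat_map {m : ℕ} (f : Fin m → List ℕ) (g : ℕ → ℕ) :
    (flat f).map g = flat fun i => (f i).map g := by
  simp [flat, List.map_flatten, List.map_ofFn, Function.comp_def]

theorem flat_filter {m : ℕ} (f : Fin m → List ℕ) (P : ℕ → Bool) :
    (flat f).filter P = flat fun i => (f i).filter P := by
  simp [flat, List.filter_flatten, List.map_ofFn, Function.comp_def]

namespace RMParams

variable {p : RMParams}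

set_option synthInstance.maxHeartbeats 400000
set_option synthInstance.maxSize 4000

theorem columns_rankVec (p : RMParams) (π : p.Cells → ℕ) (i : Fin p.u) :
    columns (fun l => bits (p.rankVec π i l)) =
      (columns fun l => List.ofFn (p.partX π l)).map fun v => (decide (v = (i : ℕ) + 1)).toNat := by
  simp only [columns, flat_map, bits, rankVec, List.map_ofFn, Function.comp_def]

theorem columns_topRanks (p : RMParams) (π : p.Cells → ℕ) : columns (p.topRanks π) =
      (columns fun l => List.ofFn (p.partX π l)).filter fun v => decide (p.q - p.r ≤ v) := by
  simp only [columns, flat_filter]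
  rfl

/-- The bits of all keys in order are the lowest binary digits of the index, so the decoder can emit
them in one loop without forming keys. -/
theorem flat_keysOfNat (p : RMParams) (y : ℕ) :
    (flat fun j => bits (p.keysOfNat y j).1 ++ bits (p.keysOfNat y j).2) =
      natBits (p.wom.t₂ * (p.wom.n + p.wom.n)) y := by
  have hl : ∀ j, (bits (p.keysOfNat y j).1 ++ bits (p.keysOfNat y j).2).length = p.wom.n + p.wom.n :=
    fun j => by rw [List.length_append, length_bits, length_bits]
  rw [eq_flatMap_getD (flat _), length_flat hl, natBits]
  refine flatMap_range_congr fun x hx => ?_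
  obtain ⟨b, j, rfl⟩ := exists_block_of_lt hx
  rw [mul_comm, getD_flat hl j b.2]
  congr 1
  by_cases hb : (b : ℕ) < p.wom.n
  · rw [getD_append_of_lt _ (by rwa [length_bits]), getD_bits _ ⟨b, hb⟩, keysOfNat, two_mul]
  · obtain ⟨d, hd⟩ := Nat.exists_eq_add_of_le (not_lt.1 hb)
    have hd' : d < p.wom.n := by have := b.2; omega
    rw [hd, getD_append_length _ (length_bits _), getD_bits _ ⟨d, hd'⟩, keysOfNat, two_mul, ← add_assoc]

/-- The word that is read off for one of the ranks `1, …, q-r-1`. -/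
theorem wordList_rankVec (p : RMParams) (π : p.Cells → ℕ) (i : Fin p.u) (y : ℕ) :
    p.wom.wordList (p.rankVec π i) (p.keysOfNat y) =
      ((columns fun l => List.ofFn (p.partX π l)).map fun v => (decide (v = (i : ℕ) + 1)).toNat) ++
        natBits (p.wom.t₂ * (p.wom.n + p.wom.n)) y := by
  rw [HashParams.wordList, columns_rankVec, flat_keysOfNat]

theorem getD_permList_columns (p : RMParams) (π : p.Cells → ℕ) (x : ℕ) : (p.permList π).getD
    (p.u * ((p.r + 1) * p.a) + p.u * (p.u * p.a) + x) 0 =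
      (columns fun l => List.ofFn (p.partX π l)).getD x 0 := by
  rw [permList, getD_append_length _ (by rw [List.length_append, length_partsA, List.length_ofFn])]

/-- The decoder. -/
def decRMS : S := .bind (.ld (.lit 0)) (.bind (.ld (.lit 1)) (.bind (.ld (.lit 2))
  (.bind (.ld (.lit 3)) (.bind (.ld (.lit 4)) (.bind (.ld (.lit 5)) (.bind (.ld (.lit 6))
  (.bind (divE (.var 2) (.var 0) (.var 2)) (.bind (.sub (.sub (.var 0) (.var 1)) (.lit 1))
  (.bind (leastPolyE (.var 2)) (.bind (mulE (mulE (.var 2) (.var 4)) (.var 5))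
  (.bind (mulE (.var 6) (.add (.var 1) (.lit 1)))
  (.bind (.add (.add (.lit 7) (mulE (.var 11) (.var 8))) (mulE (mulE (.var 6) (.var 8)) (.var 8)))
  (.bind (mulE (.add (.var 2) (.var 2)) (.var 5)) (.bind (.add (.var 10) (.var 13))
  (.bind (mulE (.var 7) (.add (.var 1) (.lit 1)))
  (.bindLen (.bind (.add (.var 16) (mulE (.var 14) (.var 8)))
  -- For each written rank a complete word of the hash code is built: the characteristic vectors of
  -- the rank, then the digits of the index word. The filtered top ranks follow. From this scratch
  -- data the two kinds of message parts are computed.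
  (.seq (.loop (.var 8) (.seq (.loop (.var 10) (.emit (.cond
      (neE (.ld (.add (.var 12) (.var 19))) (.add (.var 18) (.lit 1))) (.lit 0) (.lit 1))))
    (.bind (rankE (.lit 1) (.add (.var 1) (.lit 1)) (.var 6) (.var 11)
        (.add (.lit 7) (mulE (.var 11) (.var 18))) (.var 11))
      (.loop (.var 13) (.emit (bitE (.var 19) (.var 20)))))))
  (.seq (.loop (.var 10) (.cond (.sub (.sub (.var 0) (.var 1)) (.ld (.add (.var 12) (.var 18))))
    .skip (.emit (.ld (.add (.var 12) (.var 18))))))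
  (.seq (.loop (.var 8) (decS (.var 2) (.var 3) (.var 9) (.var 4) (.var 5)
    (.add (.var 16) (mulE (.var 14) (.var 18)))
    (.add (.add (.var 16) (mulE (.var 14) (.var 18))) (.var 10))))
  (.loop (mulE (.var 4) (.var 5)) (.emit (rankE (.sub (.var 0) (.var 1)) (.var 0) (.var 7) (.var 15)
    (.add (.var 17) (mulE (.var 15) (.var 18))) (.var 15))))))))))))))))))))))))

-- Since the words of the hash code are laid out in memory as its own decoder expects them, that
-- decoder is reused unchanged.
set_option maxHeartbeats 1000000 in
theorem Valid.decRMS_spec (hp : p.Valid) (π : p.codebook) {Z : ℕ} (hZ : 8 * (p.q * p.z) ^ 2 ≤ Z) :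
    ∃ A : List ℕ, SpS decRMS (p.header ++ p.permList π) [] (A ++ p.messageList (p.decode π))
      (100000 * Z ^ 12) := by
  obtain ⟨b1, b2, b3, b4, b5, b6, b7, b8, b9, b10⟩ := hp.bounds
  have hu := p.u_add
  have hRZ : p.q * p.z ≤ Z := by nlinarith
  set tn := p.wom.t₂ * (p.wom.t₁ * p.wom.n) with htn
  set L := p.header ++ p.permList π with hL
  have hlp := p.length_permList π
  rw [← htn] at hlp
  set m₁ := (p.r + 1) * p.a with hm₁
  set m₂ := (p.r + 1) * p.zW with hm₂
  set px := 7 + p.u * m₁ + p.u * (p.u * p.a) with hpx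
  set kb := p.wom.t₂ * (p.wom.n + p.wom.n) with hkb
  set B := tn + kb with hB
  set base := L.length with hbase
  have hLl : base = px + tn := by
    rw [hbase, hL, List.length_append, length_header, hlp]
    omega
  set pt := base + B * p.u with hpt
  have g0 : L.getD 0 0 = p.q ∧ L.getD 1 0 = p.r ∧ L.getD 2 0 = p.wom.n ∧ L.getD 3 0 = p.wom.k ∧
    L.getD 4 0 = p.wom.t₁ ∧ L.getD 5 0 = p.wom.t₂ ∧ L.getD 6 0 = p.a := ⟨rfl, rfl, rfl, rfl, rfl, rfl, rfl⟩
  set X := columns fun l => List.ofFn (p.partX π l) with hX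
  have hXl : X.length = tn := length_columns fun _ => List.length_ofFn
  have hLX : ∀ x < tn, ∀ o, (L ++ o).getD (px + x) 0 = X.getD x 0 := fun x hx o => by
    rw [getD_append_of_lt _ (by omega), hL, hpx, hm₁, add_assoc 7, add_assoc 7,
      getD_append_length _ p.length_header, getD_permList_columns]
  obtain ⟨y, hy⟩ := exists_sequence_of_fin (fun i => lexIndex (List.ofFn (p.partA π i))) 0
  have hrank : ∀ i < p.u, ∀ o, rankNat (L ++ o) 1 (p.r + 1) p.a m₁ (7 + m₁ * i) m₁ = y i := by
    intro i hi o
    rw [show y i = _ from hy ⟨i, hi⟩]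
    have h1 := succ_mul_le m₁ hi
    refine rankNat_eq_lexIndex (isMultisetPerm_iff.1 (π.2.1 _)) List.length_ofFn fun b hb => ?_
    rw [mul_comm i] at h1
    rw [getD_append_of_lt _ (by omega), hL, add_assoc, getD_append_length _ p.length_header,
      ← getD_permList_A _ _ ⟨i, hi⟩ hb, mul_comm m₁]
  set W : ℕ → List ℕ := fun i => (X.map fun v => (decide (v = i + 1)).toNat) ++ natBits kb (y i) with hW
  have hWl : ∀ i, (W i).length = B := fun i => by
    rw [hW, List.length_append, List.length_map, hXl, length_natBits]
  have hWi : ∀ i : Fin p.u, W i = p.wom.wordList (p.rankVec π i)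
      (p.keysOfNat (lexIndex (List.ofFn (p.partA π i)))) := fun i => by
    rw [wordList_rankVec, hW, ← hy i]
  set Ws := (List.range p.u).flatMap W with hWs
  have hWsl : Ws.length = p.u * B := length_flatMap_range fun i _ => hWl i
  set Ts := X.filter fun v => decide (p.q - p.r ≤ v) with hTs
  have hTs' : Ts = columns (p.topRanks π) := (p.columns_topRanks π).symm
  have htl : ∀ l, (p.topRanks π l).length = m₂ := fun l => by
    rw [length_permLists (p.topRanks_mem π.2 l), Nat.card_Icc]
    congr 1
    have := p.r_lt_q
    omega
  set M := L ++ Ws ++ Ts with hM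
  have hm₁R : m₁ ≤ 2 * (p.q * p.z) ^ 2 := by
    calc m₁ ≤ (p.q * p.z) * (2 * (p.q * p.z)) := Nat.mul_le_mul (p.r_lt_q.trans_le b1) b6
      _ = _ := by ring
  have hm₂n : m₂ ≤ p.wom.n := hp.n_eq ▸ Nat.mul_le_mul_right _ p.r_lt_q
  have hzn : p.zW ≤ p.wom.n := hp.n_eq ▸ Nat.le_mul_of_pos_left _ p.q_pos
  have hRR : p.q * p.z ≤ (p.q * p.z) ^ 2 := Nat.le_self_pow (by norm_num) _
  have hZ1 : 1 ≤ Z := by omega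
  have ht : p.wom.t₂ * p.wom.t₁ ≤ Z := by
    have hn := hp.wom.n_ge
    refine le_trans ?_ (b8.trans hRZ)
    rw [htn, ← mul_assoc]
    exact Nat.le_mul_of_pos_right _ (by omega)
  have p12 : Z ≤ Z ^ 2 := Nat.le_self_pow (by norm_num) _
  have p24 : Z ^ 2 ≤ Z ^ 4 := Nat.pow_le_pow_right hZ1 (by norm_num)
  have p45 : Z ^ 4 ≤ Z ^ 5 := Nat.pow_le_pow_right hZ1 (by norm_num)
  have p56 : Z ^ 5 ≤ Z ^ 6 := Nat.pow_le_pow_right hZ1 (by norm_num)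
  have p68 : Z ^ 6 ≤ Z ^ 8 := Nat.pow_le_pow_right hZ1 (by norm_num)
  have hkZ : kb ≤ 2 * Z ^ 2 := by
    calc kb ≤ Z * (Z + Z) := Nat.mul_le_mul (by omega) (by omega)
      _ = _ := by ring
  set Ms := columns fun l => [((p.decode π).2 l : ℕ)] with hMs
  have hMsl : Ms.length = p.wom.t₂ * p.wom.t₁ := by
    rw [hMs, length_columns (l := 1) fun _ => rfl, mul_one]
  obtain ⟨D, hD⟩ := exists_sequence_of_fin (fun i => p.wom.messageList ((p.decode π).1 i)) []
  have hmsg : p.messageList (p.decode π) = (List.range p.u).flatMap D ++ Ms := by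
    rw [messageList, flat_eq _ D fun i => (hD i).symm]
  refine ⟨Ws ++ Ts, ?_⟩
  have hrun : SpS decRMS L [] (Ws ++ (Ts ++ ((List.range p.u).flatMap D ++ Ms))) (100000 * Z ^ 12) := by
    refine SpS.mono (SpS.bind inferInstance g0.1 <| SpS.bind inferInstance g0.2.1 <|
      SpS.bind inferInstance g0.2.2.1 <| SpS.bind inferInstance g0.2.2.2.1 <|
      SpS.bind inferInstance g0.2.2.2.2.1 <| SpS.bind inferInstance g0.2.2.2.2.2.1 <|
      SpS.bind inferInstance g0.2.2.2.2.2.2 <|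
      SpS.bind (v' := p.zW) inferInstance (natDiv_eq Nat.lt_two_pow_self p.q_pos) <|
      SpS.bind (v' := p.u) inferInstance rfl <| SpS.bind inferInstance rfl <|
      SpS.bind (v' := tn) inferInstance (by rw [htn]; ring) <|
      SpS.bind (v' := m₁) inferInstance (mul_comm _ _) <|
      SpS.bind (v' := px) inferInstance (by rw [hpx]; ring) <|
      SpS.bind (v' := kb) inferInstance (mul_comm _ _) <|
      SpS.bind (v' := B) inferInstance rfl <| SpS.bind (v' := m₂) inferInstance (mul_comm _ _) <|
      SpS.bindLen rfl <| SpS.bind (v' := pt) inferInstance rfl <|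
      SpS.seq (SpS.loop' W (10000 * Z ^ 8) inferInstance rfl fun i hi o =>
        (SpS.seq ((SpS.loop' _ 50 inferInstance rfl fun x hx o' =>
            (SpS.emit (v' := (decide (X.getD x 0 = i + 1)).toNat) inferInstance ?_).mono ?_).congr
              (o' := X.map fun v => (decide (v = i + 1)).toNat) ?_)
          (SpS.bind (v' := y i) inferInstance ?_ <|
            SpS.loop' (fun b => [((y i).testBit b).toNat]) (60 * Z ^ 2) inferInstance rfl
              fun b hb o' => (SpS.emit inferInstance rfl).mono ?_)).mono ?_) <|
      SpS.seq ((SpS.loop' (fun x => if p.q - p.r ≤ X.getD x 0 then [X.getD x 0] else []) 50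
        inferInstance rfl fun x hx o' => (SpS.cond (c := 20) inferInstance (fun h => ?_)
          (fun h => ?_)).mono ?_).congr ?_) <|
      SpS.seq (SpS.loop' D (50000 * Z ^ 6) inferInstance rfl fun i hi o' => ?_) <|
      ((SpS.loop' (v' := p.wom.t₂ * p.wom.t₁) (fun l => [Ms.getD l 0]) (4000 * Z ^ 8) inferInstance
        (mul_comm _ _) fun l hl o' => (SpS.emit inferInstance ?_).mono ?_).congr ?_)) ?_
    all_goals try simp only [← hM]
    · rw [List.append_assoc, hLX x hx]
      by_cases h : X.getD x 0 = i + 1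
      · rw [if_neg (by omega), decide_eq_true h]
        rfl
      · rw [if_pos (by omega), decide_eq_false h]
        rfl
    · norm_num
    · rw [map_eq_flatMap_getD, hXl]
    · rw [List.append_assoc, hrank i hi]
    · have h1 : b ≤ 2 * Z ^ 2 := hb.le.trans hkZ
      omega
    · have c1 : (m₁ + p.a + (p.r + 1) + m₁ + 1) ^ 8 ≤ Z ^ 8 := Nat.pow_le_pow_left (by omega) 8
      have c2 : kb * (60 * Z ^ 2 + 4) ≤ 128 * Z ^ 4 := by
        calc _ ≤ 2 * Z ^ 2 * (64 * Z ^ 2) := Nat.mul_le_mul hkZ (by omega)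
          _ = _ := by ring
      omega
    · rw [List.append_assoc, hLX x hx] at h
      rw [if_neg (by omega)]
      exact SpS.skip (by norm_num)
    · rw [List.append_assoc, hLX x hx] at h
      rw [if_pos (by omega)]
      refine (SpS.emit inferInstance ?_).mono (by norm_num)
      rw [List.append_assoc, hLX x hx]
    · norm_num
    · rw [hTs, filter_eq_flatMap_getD, hXl]
      simp only [decide_eq_true_eq]
    -- Word number `i` is isolated from the words before and after it, which become the surroundings
    -- permitted by `SpS.decode`.
    · obtain ⟨R, hR⟩ := flatMap_range_split W hi
      have e : B * i = ((List.range i).flatMap W).length := by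
        rw [length_flatMap_range fun j _ => hWl j, mul_comm]
      rw [show D i = _ from hD ⟨i, hi⟩]
      refine (SpS.decode (A := L ++ (List.range i).flatMap W) (B := R ++ Ts ++ o')
        (key := p.keysOfNat (lexIndex (List.ofFn (p.partA π ⟨i, hi⟩)))) (x := p.rankVec π ⟨i, hi⟩)
        (by have := hp.wom.n_ge; omega) inferInstance inferInstance inferInstance inferInstance
        inferInstance inferInstance inferInstance ?_ ?_ ?_).mono ?_
      · rw [← hWi ⟨i, hi⟩, hM, hWs, hR]
        simp only [List.append_assoc]
      · rw [List.length_append (as := L), ← e]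
      · rw [List.length_append (as := L), ← e]
      · have c1 : (p.wom.t₂ + 1) * ((p.wom.t₁ + 1) * (3000 * (p.wom.n + p.wom.k + 1) ^ 3)) ≤
            3000 * Z ^ 5 := by
          calc _ ≤ Z * (Z * (3000 * Z ^ 3)) := by gcongr <;> omega
            _ = _ := by ring
        omega
    · obtain ⟨i, j, rfl⟩ := exists_block_of_lt hl
      have h1 : Ms.getD (p.wom.t₁ * j + i) 0 = lexIndex (p.topRanks π (i, j)) := by
        have := getD_columns (f := fun l => [((p.decode π).2 l : ℕ)]) (l := 1) (fun _ => rfl) i j one_pos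
        simpa [hMs, mul_comm, decode] using this
      have hMl : (L ++ Ws).length = pt := by rw [List.length_append, hWsl, hpt, mul_comm B]
      have h2 := succ_mul_le m₂ hl
      rw [h1]
      refine rankNat_eq_lexIndex (p.topRanks_mem π.2 _) (htl _) fun b hb => ?_
      rw [hM, List.append_assoc, List.append_assoc, add_assoc,
        getD_append_length _ hMl, getD_append_of_lt, hTs', ← getD_columns htl i j hb]
      · congr 1
        ring
      · rw [hTs', length_columns htl, ← mul_assoc, mul_comm m₂]
        omega
    · have c1 : (m₂ + p.zW + p.q + m₂ + 1) ^ 8 ≤ Z ^ 8 := Nat.pow_le_pow_left (by omega) 8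
      omega
    · rw [← hMsl]
      exact (eq_flatMap_getD Ms).symm
    · have p812 : Z ^ 8 * Z ≤ Z ^ 12 := by
        rw [← pow_succ]
        exact Nat.pow_le_pow_right hZ1 (by norm_num)
      have c1 : (p.wom.n + p.q + 1) ^ 2 ≤ Z ^ 2 := Nat.pow_le_pow_left (by omega) 2
      have c2 : (2 ^ p.wom.n) ^ 3 * (3000 * (p.wom.n + 1) ^ 3) ≤ 3000 * Z ^ 6 := by
        calc _ ≤ Z ^ 3 * (3000 * Z ^ 3) := by gcongr <;> omega
          _ = _ := by ring
      have hr := p.r_lt_q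
      have d1 := Nat.mul_le_mul_right (10000 * Z ^ 8 + 4) (show p.u ≤ Z by omega)
      have d2 := Nat.mul_le_mul_right (50000 * Z ^ 6 + 4) (show p.u ≤ Z by omega)
      have d3 := Nat.mul_le_mul_right (4000 * Z ^ 8 + 4) ht
      have e1 : Z * Z ^ 6 ≤ Z * Z ^ 8 := Nat.mul_le_mul_left _ p68
      have e2 : Z ^ 8 ≤ Z * Z ^ 8 := Nat.le_mul_of_pos_left _ hZ1
      have f1 : p.wom.t₁ ≤ Z := by omega
      have f2 : p.wom.t₂ ≤ Z := by omega
      have f3 : p.u ≤ Z := by omega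
      have f4 : p.r + 1 ≤ Z := by omega
      have f5 : tn ≤ Z := by omega
      clear * - f1 f2 f3 f4 f5 c1 c2 d1 d2 d3 e1 e2 p812 p12 p24 p45 p56 p68 hZ1
      linarith
  rw [hmsg]
  simpa using hrun

theorem exists_decoder : ∃ (P : RAM.Prog) (B : ℕ), ∀ p : RankMod.RMParams, p.Valid →
      ∀ π : p.codebook, ∃ T : ℕ,
        RAM.Computes P (p.header ++ p.permList π) (p.messageList (p.decode π)) T ∧
        T ≤ (p.q * p.z) ^ B := by
  refine ⟨S.prog (.add (.lit 7) cellsE) decRMS messageE, 120, fun p hp π => ?_⟩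
  obtain ⟨A, hs⟩ := hp.decRMS_spec π le_rfl
  have hl : (p.permList π).length = p.q * p.z := by rw [length_permList, hp.cells_eq]
  refine SpS.computes (c := 200 * (p.q * p.z) + 1000) (c'' := 100 * (p.q * p.z) + 300) ?_ hs ?_ ?_
  · have := hp.sp_cells (p.permList π)
    exact Sp.mono inferInstance (by rw [List.length_append, hl, length_header]) (by omega)
  · rw [List.append_assoc]
    exact hp.sp_message _ _
  · obtain ⟨b1, b2, b3, b4, b5, b6, b7, b8, b9, b10⟩ := hp.bounds
    refine le_trans ?_ (cost_le_pow b10)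
    have hn := hp.wom.n_ge
    have h1 : (p.messageList (p.decode π)).length ≤ 8 * (p.q * p.z) ^ 2 := by
      have hk : p.wom.t₂ * (p.wom.t₁ * p.wom.k) ≤ p.q * p.z := le_trans (by
        gcongr
        exact hp.wom.k_le_n) b8
      have ht : p.wom.t₂ * p.wom.t₁ ≤ p.q * p.z := by
        refine le_trans ?_ b8
        rw [← mul_assoc]
        exact Nat.le_mul_of_pos_right _ (by omega)
      have hu : p.u ≤ p.q * p.z := by
        have := p.u_add
        omega
      rw [length_messageList]
      have := Nat.mul_le_mul hu hk
      nlinarith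
    have e1 : p.q * p.z ≤ 8 * (p.q * p.z) ^ 2 := by nlinarith
    generalize 8 * (p.q * p.z) ^ 2 = Z at *
    have e2 : Z ^ 12 ≤ Z ^ 20 := Nat.pow_le_pow_right (by omega) (by norm_num)
    have e3 : Z ≤ Z ^ 12 := Nat.le_self_pow (by norm_num) _
    have e4 : 1 ≤ Z ^ 12 := Nat.one_le_pow _ _ (by omega)
    clear * - h1 e1 e2 e3 e4
    linarith

end RMParams

end RankMod

theorem mainTheorem1 :
    -- the hash construction is a constant-weight concatenated WOM code
    (∀ p : RankMod.HashParams, p.Valid →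
      RankMod.IsConcatWOMCode p.n p.t p.KW p.Ka p.ws p.wx p.decode) ∧
    -- its rate
    (∀ p : RankMod.HashParams, p.Valid → p.eps ≤ 1 / 20 →
      p.capacity - p.eps < p.rate ∧
      p.rate ≤ Real.logb 2 (p.KW : ℝ) / (p.N : ℝ) ∧
      Real.logb 2 (p.KW : ℝ) / (p.N : ℝ) ≤ p.capacity) ∧
    (∀ del c ws wx : ℝ, 0 < del → del ≤ 1 / 2 → 20 < c → ws ∈ Set.Icc (0 : ℝ) 1 →
      wx ∈ Set.Icc (0 : ℝ) ws →
      Tendsto (fun eps : ℝ => (RankMod.HashParams.mk eps del c ws wx).rate) (𝓝[>] 0)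
        (𝓝 (RankMod.womCapacity ws wx))) ∧
    -- its encoder
    (∃ P : RAM.Prog, ∀ p : RankMod.HashParams, p.Valid →
      ∀ (m : p.Message) (s : p.Blocks → RankMod.J p.ws p.n),
        ∃ (x : p.Blocks → Fin p.n → Bool) (key : p.Index) (T : ℕ),
          RankMod.IsHashEncoding p.wx m (fun b => (s b : Fin p.n → Bool)) x key ∧
          RAM.Computes P (p.encInput m fun b => (s b : Fin p.n → Bool)) (p.wordList x key) T ∧
          (T : ℝ) < (p.N : ℝ) ^ (1 + p.del)) ∧
    -- its decoder
    (∃ (P : RAM.Prog) (A : ℝ), ∀ p : RankMod.HashParams, p.Valid →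
      ∀ (x : p.Blocks → RankMod.J p.wx p.n) (key : p.Index),
        ∃ T : ℕ,
          RAM.Computes P (p.header ++ p.wordList (fun b => (x b : Fin p.n → Bool)) key)
            (p.messageList (p.decode (x, key))) T ∧
          (T : ℝ) ≤ (p.N : ℝ) ^ (1 + A * (p.del * p.eps))) ∧
    -- the rank-modulation construction gives a rank-modulation rewriting code
    (∀ p : RankMod.RMParams, p.Valid →
      RankMod.IsRMCode p.q p.z p.KR p.r p.codebook p.decode) ∧
    -- its encoder
    (∃ (P : RAM.Prog) (B : ℕ), ∀ p : RankMod.RMParams, p.Valid →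
      ∀ (m : p.Message) (σ : p.codebook), ∃ (π : p.codebook) (T : ℕ),
        p.decode π = m ∧
        RankMod.cost (σ : p.Cells → ℕ) (π : p.Cells → ℕ) ≤ p.r ∧
        p.IsRMEncoding m σ π ∧
        RAM.Computes P (p.header ++ p.messageList m ++ p.permList σ) (p.permList π) T ∧
        T ≤ (p.q * p.z) ^ B) ∧
    -- its decoder
    (∃ (P : RAM.Prog) (B : ℕ), ∀ p : RankMod.RMParams, p.Valid →
      ∀ π : p.codebook, ∃ T : ℕ,
        RAM.Computes P (p.header ++ p.permList π) (p.messageList (p.decode π)) T ∧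
        T ≤ (p.q * p.z) ^ B) ∧
    -- its rate
    (∀ r : ℕ, 0 < r → ∀ η : ℝ, 0 < η → ∃ Q : ℕ, ∀ q : ℕ, Q ≤ q →
      ∃ ε₀ : ℝ, 0 < ε₀ ∧ ∀ p : RankMod.RMParams, p.Valid → p.q = q → p.r = r → p.eps < ε₀ →
        RankMod.rmCapacity r - η < p.rate ∧ p.rate ≤ RankMod.rmCapacity r) ∧
    (∀ (r : ℕ) (del : ℝ), 0 < r → 0 < del → del ≤ 1 / 2 →
      ∃ p : ℕ → RankMod.RMParams, (∀ i, (p i).Valid ∧ (p i).r = r ∧ (p i).del = del) ∧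
        Tendsto (fun i => (p i).rate) atTop (𝓝 (RankMod.rmCapacity r))) := by
  exact ⟨fun p hp => hp.isConcatWOMCode, fun p hp he => hp.rate_bounds he,
    fun del c ws wx h1 h2 h3 h4 h5 => RankMod.tendsto_rate h1 h2 h3 h4 h5,
    RankMod.HashParams.exists_encoder, RankMod.HashParams.exists_decoder, fun p hp => hp.isRMCode,
    RankMod.RMParams.exists_encoder, RankMod.RMParams.exists_decoder, RankMod.RMParams.rate_bounds,
    RankMod.RMParams.exists_sequence⟩
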